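/- **Setting.** Let $q_0>0$, $T,\alpha,\theta_\pm\in\mathbb R$, $q_\pm=q_0e^{i\theta_\pm}$ and $\Upsilon(x,t)=\alpha x+2(-q_0^2+2T^2q_0^4-\tfrac{\alpha^2}{2})t$. Let $u\in C^2(\mathbb R^2;\mathbb C)$ be a solution of the defocusing Kundu–Eckhaus equation $$iu_t+u_{xx}-2|u|^2u+4T^2|u|^4u+4iT(|u|^2)_xu=0 ,$$ such that $q:=ue^{-i\Upsilon}$ satisfies $q\to q_\pm$ and $q_x\to0$ as $x\to\pm\infty$, locally uniformly in $t$, and $(1+|x|)^2(u-e^{i\Upsilon}q_\pm)\in L^1(\mathbb R^\pm)$ for each $t$. For $\zeta\in\mathbb C\setminus\{0\}$ put $\kappa=\frac12(\zeta+q_0^2\zeta^{-1})$, $\lambda=\frac12(\zeta-q_0^2\zeta^{-1})$, $z=\kappa-Tq_0^2-\frac\alpha2$, $\Theta(x,t,\zeta)=\lambda\,(x+2(z-Tq_0^2-\frac\alpha2)t)$. For the profile $q(x)=q(x,0)$, let $\psi_\pm=(\psi_{\pm,1},\psi_{\pm,2})$ be the Jost solutions: the columns solve $$\psi_x=\begin{pmatrix}-i(z+T|q|^2+\frac\alpha2)&q\\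 \bar q&i(z+T|q|^2+\frac\alpha2)\end{pmatrix}\psi,$$ and as $x\to\pm\infty$, $e^{i\lambda x}\psi_{\pm,1}\to(1,\,i\bar q_\pm/\zeta)^{\mathsf T}$ and $e^{-i\lambda x}\psi_{\pm,2}\to(-iq_\pm/\zeta,\,1)^{\mathsf T}$ (for those $\zeta$ at which the column in question is determined by this). Define $$a=\frac{\det(\psi_{-,1},\psi_{+,2})}{1-q_0^2/\zeta^2},\qquad b=\frac{\det(\psi_{+,1},\psi_{-,1})}{1-q_0^2/\zeta^2},\qquad \tilde a=\frac{\det(\psi_{+,1},\psi_{-,2})}{1-q_0^2/\zeta^2}.$$ Assume that the data are reflectionless, i.e. $r=b/a=0$ on $\mathbb R\setminus\{0,\pm q_0\}$, and that the zeros of $a$ in the upper half-plane are exactly the $N\ge 0$ points $\zeta_j=q_0e^{i\beta_j}$ with distinct $\beta_j\in(0,\pi)$. Let $\tilde c_j=\tilde b_j/\tilde a'(\bar\zeta_j)$, where $\psi_{-,2}(\cdot,\bar\zeta_j)=\tilde b_j\psi_{+,1}(\cdot,\bar\zeta_j)$. Put $f_j=\sqrt{\tilde c_j}\,e^{-i\Theta(x,t,\bar\zeta_j)}$,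 $$B_{jk}=\frac{f_j\,(i\zeta_jq_+^{-1})\,f_k}{\bar\zeta_j-\zeta_k},\qquad B'_{jk}=\frac{f_j\,(i\bar\zeta_jq_+^{-1})\,f_k}{\bar\zeta_j-\zeta_k},\qquad \omega_+(x,t)=T\int_x^{\infty}(q_0^2-|u(y,t)|^2)\,dy .$$ **Claim.** For all $x,t\in\mathbb R$: 1. The integral defining $\omega_+$ converges absolutely, $\det(I+B)\ne0$, and $$u=e^{i(\Upsilon-2\omega_+)}\,q_+\,\frac{\det(I+B')}{\det(I+B)} .$$ 2. $\det(I+B)=1+\sum_{r=1}^{N}\sum_{n_1<\dots<n_r}B(n_1,\dots,n_r)$ with $B(n_1,\dots,n_r)$ the principal minors of $B$, and likewise for $B'$. With all products and sums over $j,k\in\{n_1,\dots,n_r\}$, $$B(n_1,\dots,n_r)=i^r\prod_j\frac{f_j^2\zeta_jq_+^{-1}}{\bar\zeta_j-\zeta_j}\prod_{j<k}\Big|\frac{\zeta_k-\zeta_j}{\zeta_k-\bar\zeta_j}\Big|^2 =(-1)^rq_0^{-r}e^{-ir\theta_+}e^{i\sum_j\beta_j}e^{-2i\sum_j\Theta(\bar\zeta_j)}\prod_j\frac{\tilde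 c_j}{2\sin\beta_j}\prod_{j<k}\frac{\sin^2\frac{\beta_j-\beta_k}2}{\sin^2\frac{\beta_j+\beta_k}2},$$ and $B'(n_1,\dots,n_r)$ is given by the same two expressions with $\prod_j\bar\zeta_j$ in place of $\prod_j\zeta_j$ in the numerator of the first, and $e^{-i\sum_j\beta_j}$ in place of $e^{i\sum_j\beta_j}$ in the second. 3. If $N=1$, then with $\Delta_1=-2q_0\sin\beta_1\,(x+(2q_0\cos\beta_1-4Tq_0^2-2\alpha)t)$, $$u=e^{i(\Upsilon-2\omega_+)}\,q_0e^{i\theta_+}\,\frac{\tilde c_1-2q_0\sin\beta_1\,e^{-\Delta_1}e^{i(\beta_1+\theta_+)}}{\tilde c_1e^{2i\beta_1}-2q_0\sin\beta_1\,e^{-\Delta_1}e^{i(\beta_1+\theta_+)}},$$ where the denominator does not vanish. 4. If moreover $\tilde c_1=-(\zeta_1-\bar\zeta_1)/(i\zeta_1q_+^{-1})$, then with $\kappa_1=\kappa(\zeta_1)$, $\lambda_1=\lambda(\zeta_1)=iq_0\sin\beta_1$, $$u=e^{i(\Upsilon-2\omega_+)}e^{i(\theta_+-\beta_1)}\{\kappa_1+\lambda_1\tanh(-\tfrac{\Delta_1}2)\},\qquad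 \omega_+=-Tq_0\sin\beta_1\,(-1+\tanh(-\tfrac{\Delta_1}2)),$$ $$|u|^2=q_0^2-|\lambda_1|^2\operatorname{sech}^2(\tfrac{\Delta_1}2).$$ -/

import Mathlib

open Filter Topology MeasureTheory
open scoped ComplexConjugate

noncomputable section

namespace KunduEckhaus

/-! ### The equation and its boundary conditions -/

/-- The phase `Υ(x,t)` of the plane-wave background. -/
def Upsilon (q₀ T α x t : ℝ) : ℝ :=
  α * x + 2 * (-q₀ ^ 2 + 2 * T ^ 2 * q₀ ^ 4 - α ^ 2 / 2) * t

/-- The boundary constant `q_± = q₀ e^{iθ_±}`. -/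
def bdry (q₀ θ : ℝ) : ℂ := (q₀ : ℂ) * Complex.exp (Complex.I * θ)

/-- The field with the background phase removed: `q(x,t) = u(x,t) e^{-iΥ(x,t)}`. -/
def gaugeField (q₀ T α : ℝ) (u : ℝ → ℝ → ℂ) (x t : ℝ) : ℂ :=
  u x t * Complex.exp (-(Complex.I * (Upsilon q₀ T α x t : ℂ)))

/-- The defocusing Kundu-Eckhaus equation
`i u_t + u_xx - 2|u|²u + 4T²|u|⁴u + 4iT(|u|²)_x u = 0` at every point of the plane. -/
def SolvesKE (T : ℝ) (u : ℝ → ℝ → ℂ) : Prop :=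
  ∀ x t : ℝ,
    Complex.I * deriv (fun s => u x s) t
      + deriv (fun y => deriv (fun w => u w t) y) x
      - 2 * (‖u x t‖ : ℂ) ^ 2 * u x t
      + 4 * (T : ℂ) ^ 2 * (‖u x t‖ : ℂ) ^ 4 * u x t
      + 4 * Complex.I * T * ((deriv (fun y => ‖u y t‖ ^ 2) x : ℝ) : ℂ) * u x t = 0

/-- Classical solutions of the defocusing Kundu-Eckhaus equation with nonzero boundary
conditions `u → u_± = e^{iΥ} q_±` as `x → ±∞`. The limits in the filter
`atTop ×ˢ 𝓝 t₀` are limits in `x` that are locally uniform in `t`. -/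
structure IsKESolution (q₀ T α θp θm : ℝ) (u : ℝ → ℝ → ℂ) : Prop where
  smooth : ContDiff ℝ 2 (fun p : ℝ × ℝ => u p.1 p.2)
  equation : SolvesKE T u
  right_limit : ∀ t₀ : ℝ, Tendsto (fun p : ℝ × ℝ => gaugeField q₀ T α u p.1 p.2)
    (atTop ×ˢ 𝓝 t₀) (𝓝 (bdry q₀ θp))
  left_limit : ∀ t₀ : ℝ, Tendsto (fun p : ℝ × ℝ => gaugeField q₀ T α u p.1 p.2)
    (atBot ×ˢ 𝓝 t₀) (𝓝 (bdry q₀ θm))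
  right_deriv : ∀ t₀ : ℝ,
    Tendsto (fun p : ℝ × ℝ => deriv (fun y => gaugeField q₀ T α u y p.2) p.1)
      (atTop ×ˢ 𝓝 t₀) (𝓝 0)
  left_deriv : ∀ t₀ : ℝ,
    Tendsto (fun p : ℝ × ℝ => deriv (fun y => gaugeField q₀ T α u y p.2) p.1)
      (atBot ×ˢ 𝓝 t₀) (𝓝 0)
  right_integrable : ∀ t : ℝ, IntegrableOn
    (fun x : ℝ => (((1 + |x|) ^ 2 : ℝ) : ℂ) *
      (u x t - Complex.exp (Complex.I * (Upsilon q₀ T α x t : ℂ)) * bdry q₀ θp)) (Set.Ici 0)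
  left_integrable : ∀ t : ℝ, IntegrableOn
    (fun x : ℝ => (((1 + |x|) ^ 2 : ℝ) : ℂ) *
      (u x t - Complex.exp (Complex.I * (Upsilon q₀ T α x t : ℂ)) * bdry q₀ θm)) (Set.Iic 0)

/-! ### Uniformization -/

/-- `κ(ζ) = (ζ + q₀²/ζ)/2`. -/
def kappa (q₀ : ℝ) (ζ : ℂ) : ℂ := (ζ + (q₀ : ℂ) ^ 2 / ζ) / 2

/-- `λ(ζ) = (ζ - q₀²/ζ)/2`. -/
def lam (q₀ : ℝ) (ζ : ℂ) : ℂ := (ζ - (q₀ : ℂ) ^ 2 / ζ) / 2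

/-- The spectral parameter `z = κ - T q₀² - α/2`. -/
def specZ (q₀ T α : ℝ) (ζ : ℂ) : ℂ := kappa q₀ ζ - T * q₀ ^ 2 - α / 2

/-- `Θ(x,t,ζ) = λ (x + 2 (z - T q₀² - α/2) t)`. -/
def Theta (q₀ T α x t : ℝ) (ζ : ℂ) : ℂ :=
  lam q₀ ζ * (x + 2 * (specZ q₀ T α ζ - T * q₀ ^ 2 - α / 2) * t)

/-! ### Direct scattering for a profile `q : ℝ → ℂ` (a fixed time) -/

/-- The matrix `X = Q - i (z + T|q|² + α/2) σ₃` of the `x`-part of the Lax pair. -/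
def laxX (q₀ T α : ℝ) (q : ℝ → ℂ) (ζ : ℂ) (x : ℝ) : Matrix (Fin 2) (Fin 2) ℂ :=
  !![-Complex.I * (specZ q₀ T α ζ + T * (‖q x‖ : ℂ) ^ 2 + α / 2), q x;
     conj (q x), Complex.I * (specZ q₀ T α ζ + T * (‖q x‖ : ℂ) ^ 2 + α / 2)]

/-- The matrix `E_±(ζ)` of asymptotic eigenvectors. -/
def asymE (qinf ζ : ℂ) : Matrix (Fin 2) (Fin 2) ℂ :=
  !![1, -Complex.I * qinf / ζ; Complex.I * conj qinf / ζ, 1]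

/-- The diagonal entries `1, -1` of `σ₃`. -/
def sgn3 (k : Fin 2) : ℂ := if k = 0 then 1 else -1

/-- `ψ` is the `k`-th column of a Jost solution: `ψ_x = X ψ`, and
`ψ e^{iλx(σ₃)_{kk}}` tends to the `k`-th column of `E_±` at the end `l` (`atTop` or `atBot`). -/
def IsJost (q₀ T α : ℝ) (q : ℝ → ℂ) (l : Filter ℝ) (qinf : ℂ) (k : Fin 2) (ζ : ℂ)
    (ψ : ℝ → Fin 2 → ℂ) : Prop :=
  (∀ x : ℝ, HasDerivAt ψ (Matrix.mulVec (laxX q₀ T α q ζ x) (ψ x)) x) ∧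
    Tendsto (fun x : ℝ => Complex.exp (Complex.I * sgn3 k * lam q₀ ζ * x) • ψ x) l
      (𝓝 (fun i => asymE qinf ζ i k))

/-- The `k`-th column of the Jost solution normalized at the end `l`. It is used only at those `ζ`
at which it is unique: `ζ` real, or `ζ` in the half-plane where the column decays at that end. -/
def jost (q₀ T α : ℝ) (q : ℝ → ℂ) (l : Filter ℝ) (qinf : ℂ) (k : Fin 2) (ζ : ℂ) :
    ℝ → Fin 2 → ℂ :=
  Classical.epsilon (IsJost q₀ T α q l qinf k ζ)

/-- The Wronskian `W[v,w] = det (v, w)`. -/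
def wronskian (v w : Fin 2 → ℂ) : ℂ := v 0 * w 1 - v 1 * w 0

section Scattering

variable (q₀ T α : ℝ) (qp qm : ℂ) (q : ℝ → ℂ) (ζ : ℂ)

/-- `a(ζ) = W[ψ_{-,1}, ψ_{+,2}] / det E_±`, for `Im ζ ≥ 0`. The Wronskian is independent of `x`. -/
def scatA : ℂ :=
  wronskian (jost q₀ T α q atBot qm 0 ζ 0) (jost q₀ T α q atTop qp 1 ζ 0)
    / (1 - (q₀ : ℂ) ^ 2 / ζ ^ 2)

/-- `b(ζ) = W[ψ_{+,1}, ψ_{-,1}] / det E_±`, for real `ζ`. -/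
def scatB : ℂ :=
  wronskian (jost q₀ T α q atTop qp 0 ζ 0) (jost q₀ T α q atBot qm 0 ζ 0)
    / (1 - (q₀ : ℂ) ^ 2 / ζ ^ 2)

/-- `ã(ζ) = W[ψ_{+,1}, ψ_{-,2}] / det E_±`, for `Im ζ ≤ 0`. -/
def scatATilde : ℂ :=
  wronskian (jost q₀ T α q atTop qp 0 ζ 0) (jost q₀ T α q atBot qm 1 ζ 0)
    / (1 - (q₀ : ℂ) ^ 2 / ζ ^ 2)

/-- The reflection coefficient `r = b / a`. -/
def reflection : ℂ := scatB q₀ T α qp qm q ζ / scatA q₀ T α qp qm q ζ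

end Scattering

/-- The discrete eigenvalue `ζ = q₀ e^{iβ}`. -/
def eigen (q₀ β : ℝ) : ℂ := (q₀ : ℂ) * Complex.exp (Complex.I * β)

/-- The profile `q` is reflectionless, the zeros of `a` in the upper half-plane are
exactly the `N` distinct points `ζ_j = q₀ e^{iβ_j}` with `0 < β_j < π`, and the norming constants are
`c̃_j = b̃_j / ã'(ζ̄_j)`, where `ψ_{-,2}(·,ζ̄_j) = b̃_j ψ_{+,1}(·,ζ̄_j)`. -/
structure IsReflectionlessData (q₀ T α : ℝ) (qp qm : ℂ) (q : ℝ → ℂ) {N : ℕ}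
    (β : Fin N → ℝ) (ct : Fin N → ℂ) : Prop where
  reflectionless : ∀ s : ℝ, s ≠ 0 → s ≠ q₀ → s ≠ -q₀ →
    reflection q₀ T α qp qm q (s : ℂ) = 0
  angle_mem : ∀ j, β j ∈ Set.Ioo 0 Real.pi
  angle_inj : Function.Injective β
  zeros : {ζ : ℂ | 0 < ζ.im ∧ scatA q₀ T α qp qm q ζ = 0} =
    Set.range (fun j => eigen q₀ (β j))
  norming : ∀ j, ∃ bt : ℂ,
    (∀ x : ℝ, jost q₀ T α q atBot qm 1 (conj (eigen q₀ (β j))) x =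
      bt • jost q₀ T α q atTop qp 0 (conj (eigen q₀ (β j))) x) ∧
    ct j = bt / deriv (scatATilde q₀ T α qp qm q) (conj (eigen q₀ (β j)))

/-! ### The ingredients of the soliton formula -/

/-- `ω_+(x,t) = T ∫_x^∞ (q₀² - |u(y,t)|²) dy`. -/
def omegaPlus (q₀ T : ℝ) (u : ℝ → ℝ → ℂ) (x t : ℝ) : ℝ :=
  T * ∫ y in Set.Ioi x, (q₀ ^ 2 - ‖u y t‖ ^ 2)

section Soliton

variable (q₀ T α θp : ℝ) {N : ℕ} (β : Fin N → ℝ) (ct : Fin N → ℂ) (x t : ℝ)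

/-- `f_j = √c̃_j e^{-iΘ(ζ̄_j)}` (principal square root). -/
def fcoef (j : Fin N) : ℂ :=
  ct j ^ (1 / 2 : ℂ) * Complex.exp (-Complex.I * Theta q₀ T α x t (conj (eigen q₀ (β j))))

/-- `B_{jk} = f_j (i ζ_j q_+⁻¹) f_k / (ζ̄_j - ζ_k)`. -/
def matB : Matrix (Fin N) (Fin N) ℂ := fun j k =>
  fcoef q₀ T α β ct x t j * (Complex.I * eigen q₀ (β j) * (bdry q₀ θp)⁻¹)
    * fcoef q₀ T α β ct x t k / (conj (eigen q₀ (β j)) - eigen q₀ (β k))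

/-- `B'_{jk} = f_j (i ζ̄_j q_+⁻¹) f_k / (ζ̄_j - ζ_k)`. -/
def matB' : Matrix (Fin N) (Fin N) ℂ := fun j k =>
  fcoef q₀ T α β ct x t j * (Complex.I * conj (eigen q₀ (β j)) * (bdry q₀ θp)⁻¹)
    * fcoef q₀ T α β ct x t k / (conj (eigen q₀ (β j)) - eigen q₀ (β k))

end Soliton

/-- The principal minor of `A` with rows and columns in `S`. -/
def principalMinor {N : ℕ} (A : Matrix (Fin N) (Fin N) ℂ) (S : Finset (Fin N)) : ℂ :=
  (A.submatrix (Subtype.val : {j // j ∈ S} → Fin N) Subtype.val).det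

/-- `Δ_1(x,t) = -2 q₀ sin β (x + (2 q₀ cos β - 4 T q₀² - 2α) t)`. -/
def Delta (q₀ T α β x t : ℝ) : ℝ :=
  -2 * q₀ * Real.sin β * (x + (2 * q₀ * Real.cos β - 4 * T * q₀ ^ 2 - 2 * α) * t)

end KunduEckhaus

end

open KunduEckhaus

open Filter Topology MeasureTheory
open scoped ComplexConjugate

namespace KunduEckhaus

/-! The proof is the inverse scattering transform with nonzero boundary values. At a fixed time the
profile is the potential of a Zakharov-Shabat system with spectral parameter κ(ζ) and real diagonal
perturbation d = T(|q|² − q₀²); the shifts by α and T q₀² disappear into κ (`laxX_eq`).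

Direct scattering. Only the column φ_{+,1} in the closed lower half-plane is constructed; the other
columns come from swapping and conjugating the components (`sconj`) and from the reflection x ↦ −x.
It is the sum of a Neumann series (`vsol`) whose kernel stays regular at λ = 0, so that a finite
first moment suffices and the branch points ζ = ±q₀ are included. A third symmetry, ζ ↦ q₀²/conj ζ
(`sconj_rjost_inv`), exchanges small and large ζ. On the circle |ζ| = q₀, where the eigenvalues lie,
it becomes a pointwise relation: the second component is a unimodular constant times the conjugate
of the first. The integral of φ₁φ₂ that governs the derivative of ã at a zero is therefore that
constant times the positive integral of |φ₁|² (`exists_pos_hasDerivAt_atil`). So the zeros are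
simple and c̃_j = −m_j q₊/ζ_j with m_j > 0.

Inverse scattering. Let Y (`rhY`) be the first component of e^{iλx}φ_{+,1} below the real axis and,
above it, the conjugate of the second component of e^{−iλx}φ_{-,2}/ã at the conjugate point. Absence
of reflection says precisely that the two boundary values agree, so Y is holomorphic off 0, ±q₀ and
the ζ_j. At 0 and ±q₀ the product of Y with the distance tends to zero; at ζ_j there is at most a
simple pole whose residue is a multiple of Y(conj ζ_j); at infinity Y tends to exp(i∫_x^∞ d) =
e^{−iω₊}. Liouville's theorem writes Y in partial fractions (`jcore_eq_sum`): its values at conj ζ_k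
give a linear system, and the limit ζ → 0 returns the potential (`potential_eq`). A rank one update
(`det_soliton`) solves the system as a quotient of determinants; the phase enters twice, which
explains e^{−2iω₊}. Since the m_j are positive, Cauchy's determinant shows that all principal minors
of B are nonnegative, so det(I + B) ≥ 1.

Time. The equation makes the x-part X and the t-part V of the Lax pair compatible (`zeroCurvature`),
and V tends to (2κ − C) X at both ends. Hence the Jost solutions at time t are scalar exponentials
times joint solutions: ã and the absence of reflection are conserved, and c̃_j acquires exactly the
time factor contained in f_j² (`KEFlow.pureSoliton`). The fixed-time reconstruction then applies at
every t.

For one soliton the determinants are scalars, and q₀² − |u|² is the derivative of a hyperbolic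
tangent, which makes ω₊ explicit. -/

open Set in
/-- Two-sided Grönwall inequality centred at `0`. -/
lemma norm_le_gronwallBound_abs {E : Type*} [NormedAddCommGroup E] [NormedSpace ℝ E]
    {h h' : ℝ → E} {δ K ε R : ℝ}
    (hd : ∀ x, |x| ≤ R → HasDerivAt h (h' x) x) (h0 : ‖h 0‖ ≤ δ)
    (hb : ∀ x, |x| ≤ R → ‖h' x‖ ≤ K * ‖h x‖ + ε) (x : ℝ) (hx : |x| ≤ R) :
    ‖h x‖ ≤ gronwallBound δ K ε |x| := by
  have hR : 0 ≤ R := (abs_nonneg x).trans hx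
  rcases le_total 0 x with h0x | h0x
  · have := norm_le_gronwallBound_of_norm_deriv_right_le (f := h) (f' := h') (δ := δ) (K := K)
      (ε := ε) (a := 0) (b := R)
      (fun y hy => (hd y (by rw [abs_of_nonneg hy.1]; exact hy.2)).continuousAt.continuousWithinAt)
      (fun y hy => (hd y (by rw [abs_of_nonneg hy.1]; exact hy.2.le)).hasDerivWithinAt) h0
      (fun y hy => hb y (by rw [abs_of_nonneg hy.1]; exact hy.2.le)) x
      ⟨h0x, by rwa [abs_of_nonneg h0x] at hx⟩
    simpa [abs_of_nonneg h0x] using this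
  · have hd' : ∀ y, |y| ≤ R → HasDerivAt (fun y => h (-y)) (-h' (-y)) y := fun y hy => by
      have := (hd (-y) (by simpa using hy)).scomp y (hasDerivAt_neg y)
      simpa [Function.comp_def] using this
    have := norm_le_gronwallBound_of_norm_deriv_right_le (f := fun y => h (-y))
      (f' := fun y => -h' (-y)) (δ := δ) (K := K) (ε := ε) (a := 0) (b := R)
      (fun y hy => (hd' y (by rw [abs_of_nonneg hy.1]; exact hy.2)).continuousAt.continuousWithinAt)
      (fun y hy => (hd' y (by rw [abs_of_nonneg hy.1]; exact hy.2.le)).hasDerivWithinAt)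
      (by simpa using h0)
      (fun y hy => by
        simpa using hb (-y) (by rw [abs_neg, abs_of_nonneg hy.1]; exact hy.2.le)) (-x)
      ⟨by linarith, by rwa [abs_of_nonpos h0x] at hx⟩
    simpa [abs_of_nonpos h0x] using this

lemma exists_norm_le_of_continuous {F : Type*} [NormedAddCommGroup F] {A : ℝ → F}
    (hA : Continuous A) (R : ℝ) : ∃ C, 0 ≤ C ∧ ∀ x, |x| ≤ R → ‖A x‖ ≤ C := by
  obtain ⟨C, hC⟩ := (isCompact_Icc (a := -R) (b := R)).exists_bound_of_continuousOn hA.continuousOn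
  exact ⟨max C 0, le_max_right _ _, fun x hx => (hC x (abs_le.mp hx)).trans (le_max_left _ _)⟩

/-! ### Linear differential equations: uniqueness and global existence -/

section LinearODE

variable {E : Type*} [NormedAddCommGroup E] [NormedSpace ℝ E]

lemma linear_ode_eq_zero {A : ℝ → E →L[ℝ] E} (hA : Continuous A) {φ : ℝ → E}
    (hφ : ∀ x, HasDerivAt φ (A x (φ x)) x) {x₀ : ℝ} (h0 : φ x₀ = 0) : φ = 0 := by
  funext x
  obtain ⟨C, hC0, hC⟩ := exists_norm_le_of_continuous (hA.comp (continuous_const.add continuous_id :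
    Continuous fun y : ℝ => x₀ + y)) |x - x₀|
  have := norm_le_gronwallBound_abs (h := fun y => φ (x₀ + y)) (h' := fun y => A (x₀ + y) (φ (x₀ + y)))
    (δ := 0) (K := C) (ε := 0) (R := |x - x₀|)
    (fun y _ => by simpa using (hφ (x₀ + y)).comp_const_add x₀ y) (by simp [h0])
    (fun y hy => by
      rw [add_zero]
      exact ((A (x₀ + y)).le_opNorm _).trans (by gcongr; exact hC y hy)) (x - x₀) le_rfl
  rw [gronwallBound_ε0_δ0] at this
  simpa using this

lemma linear_ode_unique {A : ℝ → E →L[ℝ] E} (hA : Continuous A) {φ ψ : ℝ → E}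
    (hφ : ∀ x, HasDerivAt φ (A x (φ x)) x) (hψ : ∀ x, HasDerivAt ψ (A x (ψ x)) x) {x₀ : ℝ}
    (h0 : φ x₀ = ψ x₀) : φ = ψ := by
  have := linear_ode_eq_zero hA (φ := fun x => φ x - ψ x) (x₀ := x₀)
    (fun x => by rw [map_sub]; exact (hφ x).sub (hψ x)) (by simp [h0])
  funext x
  exact sub_eq_zero.mp (congrFun this x)

/-- The iterated integrals of Picard's method for a linear equation. -/
noncomputable def picardTerm (A : ℝ → E →L[ℝ] E) (v : E) : ℕ → ℝ → E
  | 0 => fun _ => v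
  | n + 1 => fun t => ∫ s in (0:ℝ)..t, A s (picardTerm A v n s)

lemma continuous_picardTerm {A : ℝ → E →L[ℝ] E} (hA : Continuous A) (v : E) (n : ℕ) :
    Continuous (picardTerm A v n) := by
  induction n with
  | zero => exact continuous_const
  | succ n ih =>
    exact intervalIntegral.continuous_primitive
      (fun a b => ((hA.clm_apply ih).intervalIntegrable a b)) 0

lemma hasDerivAt_picardTerm [CompleteSpace E] {A : ℝ → E →L[ℝ] E} (hA : Continuous A) (v : E) (n : ℕ) (t : ℝ) :
    HasDerivAt (picardTerm A v (n + 1)) (A t (picardTerm A v n t)) t :=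
  intervalIntegral.integral_hasDerivAt_right
    ((hA.clm_apply (continuous_picardTerm hA v n)).intervalIntegrable _ _)
    ((hA.clm_apply (continuous_picardTerm hA v n)).stronglyMeasurableAtFilter _ _)
    (hA.clm_apply (continuous_picardTerm hA v n)).continuousAt

/-- The n-fold iterated integral runs over a simplex of volume |t|ⁿ/n!. The factorial makes the
Picard series converge on every bounded interval, so no continuation of local solutions is needed.
-/
lemma norm_picardTerm_le {A : ℝ → E →L[ℝ] E} (v : E) {C R : ℝ}
    (hC0 : 0 ≤ C) (hC : ∀ x, |x| ≤ R → ‖A x‖ ≤ C) (n : ℕ) (t : ℝ) (ht : |t| ≤ R) :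
    ‖picardTerm A v n t‖ ≤ ‖v‖ * ((C * |t|) ^ n / n.factorial) := by
  induction n generalizing t with
  | zero => simp [picardTerm]
  | succ n ih =>
    have key : ∀ s ∈ Set.uIoc 0 t, ‖A s (picardTerm A v n s)‖ ≤
        C * (‖v‖ * ((C * |s|) ^ n / n.factorial)) := fun s hs => by
      have hs' : |s| ≤ R := by
        rcases Set.mem_uIoc.mp hs with h | h
        · rw [abs_of_pos h.1]; exact h.2.trans ((le_abs_self t).trans ht)
        · rw [abs_of_nonpos h.2]; exact (neg_le_neg h.1.le).trans ((neg_le_abs t).trans ht)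
      refine ((A s).le_opNorm _).trans ?_
      gcongr
      exacts [hC s hs', ih s hs']
    have hint : |∫ s in (0:ℝ)..t, C * (‖v‖ * ((C * |s|) ^ n / n.factorial))| =
        ‖v‖ * ((C * |t|) ^ (n + 1) / (n + 1).factorial) := by
      have h1 : ∀ s : ℝ, C * (‖v‖ * ((C * |s|) ^ n / n.factorial)) =
          (C ^ (n + 1) * ‖v‖ / n.factorial) * |s| ^ n := fun s => by
        rw [mul_pow]; ring
      simp_rw [h1]
      rw [intervalIntegral.integral_const_mul]
      have h2 : |∫ s in (0:ℝ)..t, |s| ^ n| = |t| ^ (n + 1) / (n + 1) := by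
        rcases le_total 0 t with h | h
        · rw [intervalIntegral.integral_congr (g := fun s => s ^ n) (fun s hs => by
            rw [Set.uIcc_of_le h] at hs; simp [abs_of_nonneg hs.1]), integral_pow, abs_of_nonneg h]
          simp [abs_of_nonneg (by positivity : 0 ≤ t ^ (n + 1) / ((n:ℝ) + 1))]
        · rw [intervalIntegral.integral_congr (g := fun s => (-1) ^ n * s ^ n) (fun s hs => by
            rw [Set.uIcc_of_ge h] at hs; simp [abs_of_nonpos hs.2, ← mul_pow]),
            intervalIntegral.integral_const_mul, integral_pow]
          simp [abs_mul, abs_div, abs_pow, abs_of_nonneg (by positivity : 0 ≤ (n:ℝ) + 1)]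
      rw [abs_mul, h2, abs_of_nonneg (by positivity), Nat.factorial_succ, mul_pow]
      push_cast
      field_simp
    rw [← hint]
    have := intervalIntegral.norm_integral_le_abs_of_norm_le (μ := volume) (a := 0) (b := t)
      (f := fun s => A s (picardTerm A v n s))
      (g := fun s => C * (‖v‖ * ((C * |s|) ^ n / n.factorial)))
      ((ae_restrict_iff' measurableSet_uIoc).mpr (ae_of_all _ key)) (by apply Continuous.intervalIntegrable; fun_prop)
    exact this

/-- Global existence for linear differential equations with continuous coefficients. -/
lemma exists_linear_ode [CompleteSpace E] {A : ℝ → E →L[ℝ] E} (hA : Continuous A) (v : E) :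
    ∃ φ : ℝ → E, φ 0 = v ∧ ∀ t, HasDerivAt φ (A t (φ t)) t := by
  have hsum : ∀ t, Summable fun n => picardTerm A v n t := fun t => by
    obtain ⟨C, hC0, hC⟩ := exists_norm_le_of_continuous hA |t|
    exact Summable.of_norm_bounded ((Real.summable_pow_div_factorial (C * |t|)).mul_left ‖v‖)
      (fun n => norm_picardTerm_le v hC0 hC n t le_rfl)
  refine ⟨fun t => ∑' n, picardTerm A v n t, ?_, fun t => ?_⟩
  · refine (tsum_eq_single 0 (fun n hn => ?_)).trans ?_
    · obtain ⟨m, rfl⟩ := Nat.exists_eq_succ_of_ne_zero hn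
      simp [picardTerm]
    · rfl
  · obtain ⟨C, hC0, hC⟩ := exists_norm_le_of_continuous hA (|t| + 1)
    -- The recursion shifts the index: term n + 1 has derivative A applied to term n.
    -- Differentiating the series without its constant term 0 therefore reproduces A applied to the
    -- full sum.
    have hsplit : (fun t => ∑' n, picardTerm A v n t) =
        fun t => v + ∑' n, picardTerm A v (n + 1) t := by
      funext s
      rw [(hsum s).tsum_eq_zero_add]; rfl
    rw [hsplit]
    have hu : Summable fun n : ℕ => C * (‖v‖ * ((C * (|t| + 1)) ^ n / n.factorial)) :=
      ((Real.summable_pow_div_factorial _).mul_left _).mul_left _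
    have hmem : ∀ s ∈ Metric.ball (0:ℝ) (|t| + 1), |s| ≤ |t| + 1 := fun s hs => by
      rw [mem_ball_zero_iff, Real.norm_eq_abs] at hs; exact hs.le
    have := hasDerivAt_tsum_of_isPreconnected (𝕜 := ℝ) hu (t := Metric.ball (0:ℝ) (|t| + 1))
      Metric.isOpen_ball (convex_ball (0:ℝ) (|t| + 1)).isPreconnected
      (g := fun n => picardTerm A v (n + 1)) (g' := fun n s => A s (picardTerm A v n s))
      (fun n s _ => hasDerivAt_picardTerm hA v n s)
      (fun n s hs => by
        refine ((A s).le_opNorm _).trans ?_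
        refine mul_le_mul (hC s (hmem s hs)) ((norm_picardTerm_le v hC0 hC n s (hmem s hs)).trans ?_)
          (norm_nonneg _) hC0
        gcongr
        exact hmem s hs) (y₀ := t) (by simp) ((summable_nat_add_iff 1).mpr (hsum t)) (y := t)
      (by simp)
    rw [← ContinuousLinearMap.map_tsum _ (hsum t)] at this
    have h2 := this.const_add v
    convert h2 using 2
    exact (congrFun hsplit t).symm

end LinearODE

/-! ### Holomorphic functions -/

-- Morera's theorem: a rectangle that meets the real axis is cut along it, and Cauchy's theorem on
-- each half needs differentiability only in the open interior, with continuity up to the boundary.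
open Complex in
lemma differentiableOn_of_continuousOn_off_real {f : ℂ → ℂ} {c : ℂ} {r : ℝ}
    (hc : ContinuousOn f (Metric.ball c r))
    (hd : ∀ z ∈ Metric.ball c r, z.im ≠ 0 → DifferentiableAt ℂ f z) :
    DifferentiableOn ℂ f (Metric.ball c r) := by
  rw [← isConservativeOn_and_continuousOn_iff_isDifferentiableOn Metric.isOpen_ball]
  refine ⟨fun z w hzw => ?_, hc⟩
  rw [← add_eq_zero_iff_eq_neg, wedgeIntegral_add_wedgeIntegral_eq]
  have hzw' : (Set.uIcc z.re w.re ×ℂ Set.uIcc z.im w.im) ⊆ Metric.ball c r := hzw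
  have hsub : ∀ s t : ℝ, s ∈ Set.uIcc z.im w.im → t ∈ Set.uIcc z.im w.im →
      (0:ℝ) ∉ Set.Ioo (min s t) (max s t) →
      (∫ x : ℝ in z.re..w.re, f (x + s * I)) - (∫ x : ℝ in z.re..w.re, f (x + t * I)) +
      I • (∫ y : ℝ in s..t, f (w.re + y * I)) - I • (∫ y : ℝ in s..t, f (z.re + y * I)) = 0 := by
    intro s t hs ht h0
    have hst : Set.uIcc s t ⊆ Set.uIcc z.im w.im := Set.uIcc_subset_uIcc hs ht
    have := integral_boundary_rect_eq_zero_of_continuousOn_of_differentiableOn f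
      (⟨z.re, s⟩ : ℂ) (⟨w.re, t⟩ : ℂ) (hc.mono fun x hx => hzw' ⟨hx.1, hst hx.2⟩)
      (fun x hx => (hd x (hzw' ⟨Set.Ioo_subset_Icc_self hx.1,
        hst (Set.Ioo_subset_Icc_self hx.2)⟩) (fun h => h0 (h ▸ hx.2))).differentiableWithinAt)
    simpa using this
  by_cases h0 : (0:ℝ) ∈ Set.uIcc z.im w.im
  · have e1 := hsub z.im 0 Set.left_mem_uIcc h0 (by
      rintro ⟨h1, h2⟩
      rcases lt_max_iff.mp h2 with h | h <;> rcases min_lt_iff.mp h1 with h' | h' <;> linarith)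
    have e2 := hsub 0 w.im h0 Set.right_mem_uIcc (by
      rintro ⟨h1, h2⟩
      rcases lt_max_iff.mp h2 with h | h <;> rcases min_lt_iff.mp h1 with h' | h' <;> linarith)
    have hint : ∀ a ∈ Set.uIcc z.re w.re, ∀ s t : ℝ, s ∈ Set.uIcc z.im w.im →
        t ∈ Set.uIcc z.im w.im → IntervalIntegrable (fun y : ℝ => f (a + y * I)) volume s t := by
      intro a ha s t hs ht
      refine ContinuousOn.intervalIntegrable (hc.comp (by fun_prop) fun y hy => hzw' ?_)
      refine ⟨by simpa using ha, ?_⟩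
      have := Set.uIcc_subset_uIcc hs ht hy
      simpa using this
    rw [← intervalIntegral.integral_add_adjacent_intervals
        (hint w.re Set.right_mem_uIcc z.im 0 Set.left_mem_uIcc h0)
        (hint w.re Set.right_mem_uIcc 0 w.im h0 Set.right_mem_uIcc),
      ← intervalIntegral.integral_add_adjacent_intervals
        (hint z.re Set.left_mem_uIcc z.im 0 Set.left_mem_uIcc h0)
        (hint z.re Set.left_mem_uIcc 0 w.im h0 Set.right_mem_uIcc)]
    simp only [smul_eq_mul] at e1 e2 ⊢
    linear_combination e1 + e2
  · exact hsub z.im w.im Set.left_mem_uIcc Set.right_mem_uIcc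
      fun h => h0 (Set.Ioo_subset_Icc_self h)

/-- Differentiation of an integral depending holomorphically on a parameter. -/
lemma differentiableOn_integral_of_dominated {E : Type*} [NormedAddCommGroup E] [NormedSpace ℂ E]
    [CompleteSpace E] {μ : Measure ℝ} {F : ℂ → ℝ → E} {U : Set ℂ} (hU : IsOpen U) {bound : ℝ → ℝ}
    (hmeas : ∀ z ∈ U, AEStronglyMeasurable (F z) μ) (hbi : Integrable bound μ)
    (hb : ∀ z ∈ U, ∀ᵐ y ∂μ, ‖F z y‖ ≤ bound y)
    (hb' : ∀ᵐ y ∂μ, ∀ z ∈ U, ‖F z y‖ ≤ bound y)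
    (hd : ∀ᵐ y ∂μ, DifferentiableOn ℂ (fun z => F z y) U) :
    DifferentiableOn ℂ (fun z => ∫ y, F z y ∂μ) U := by
  intro z₀ hz₀
  obtain ⟨r, hr, hrU⟩ := Metric.isOpen_iff.mp hU z₀ hz₀
  have hs : ∀ z ∈ Metric.ball z₀ (r / 2), Metric.closedBall z (r / 4) ⊆ U := fun z hz x hx => by
    apply hrU
    rw [Metric.mem_ball] at hz ⊢
    rw [Metric.mem_closedBall] at hx
    linarith [dist_triangle x z z₀]
  have hsU : Metric.ball z₀ (r / 2) ⊆ U := fun z hz =>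
    hs z hz (Metric.mem_closedBall_self (by positivity))
  -- The difference quotients along this sequence exhibit the z-derivative of the integrand as an
  -- a.e. limit of measurable functions; its measurability comes from there.
  have hseq : Tendsto (fun n : ℕ => z₀ + ((r / 4 / (n + 1) : ℝ) : ℂ)) atTop (𝓝[≠] z₀) := by
    rw [tendsto_nhdsWithin_iff]
    constructor
    · have h1 : Tendsto (fun n : ℕ => (r / 4) / ((n:ℝ) + 1)) atTop (𝓝 0) :=
        tendsto_const_div_atTop_nhds_zero_nat (r/4) |>.comp (tendsto_add_atTop_nat 1) |>.congr
          (fun n => by simp)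
      have h2 := (Complex.continuous_ofReal.tendsto 0).comp h1
      simpa [Function.comp_def] using tendsto_const_nhds (x := z₀) |>.add h2
    · exact Eventually.of_forall fun n => by
        simp only [Set.mem_compl_iff, Set.mem_singleton_iff, add_eq_left]
        have : (0:ℝ) < r / 4 / (n + 1) := by positivity
        exact_mod_cast this.ne'
  have key := hasDerivAt_integral_of_dominated_loc_of_deriv_le (μ := μ) (𝕜 := ℂ) (x₀ := z₀)
    (F := F) (F' := fun z y => deriv (fun z => F z y) z) (bound := fun y => bound y / (r / 4))
    (s := Metric.ball z₀ (r / 2)) (Metric.ball_mem_nhds _ (by positivity))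
    (by filter_upwards [hU.mem_nhds hz₀] with z hz using hmeas z hz)
    (hbi.mono' (hmeas z₀ hz₀) (hb z₀ hz₀))
    (by
      refine aestronglyMeasurable_of_tendsto_ae (u := (atTop : Filter ℕ))
        (f := fun n y => ((z₀ + ((r / 4 / (n + 1) : ℝ) : ℂ)) - z₀)⁻¹ •
          (F (z₀ + ((r / 4 / (n + 1) : ℝ) : ℂ)) y - F z₀ y)) (fun n => ?_) ?_
      · refine AEStronglyMeasurable.const_smul ((hmeas _ (hrU ?_)).sub (hmeas z₀ hz₀)) _
        rw [Metric.mem_ball, dist_eq_norm, add_sub_cancel_left, Complex.norm_real,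
          Real.norm_of_nonneg (by positivity)]
        have : r / 4 / (n + 1) ≤ r / 4 := div_le_self (by positivity) (by linarith [n.cast_nonneg (α := ℝ)])
        linarith
      · filter_upwards [hd] with y hy
        have := ((hy.differentiableAt (hU.mem_nhds hz₀)).hasDerivAt.tendsto_slope).comp hseq
        exact this)
    (by
      filter_upwards [hb', hd] with y hy hdy z hz
      -- Cauchy's estimate on a circle of radius r/4 turns the bound on F into one on its
      -- derivative, so no hypothesis on the derivative is needed.
      refine Complex.norm_deriv_le_of_forall_mem_sphere_norm_le (by positivity)
        (DifferentiableOn.diffContOnCl ?_) (fun x hx => hy x (hs z hz (Metric.sphere_subset_closedBall hx)))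
      refine hdy.mono ?_
      rw [closure_ball _ (by positivity)]
      exact hs z hz)
    (hbi.div_const _)
    (by
      filter_upwards [hd] with y hdy z hz
      exact (hdy.differentiableAt (hU.mem_nhds (hsU hz))).hasDerivAt)
  exact key.2.differentiableAt.differentiableWithinAt

/-- A function with finitely many simple poles that has a limit at infinity is the sum of the limit
and its principal parts. -/
lemma eq_add_sum_principal_parts {f : ℂ → ℂ} {s : Finset ℂ} {R : ℂ → ℂ} {L : ℂ}
    (hd : ∀ z ∉ s, DifferentiableAt ℂ f z)
    (hR : ∀ p ∈ s, Tendsto (fun z => (z - p) * f z) (𝓝[≠] p) (𝓝 (R p)))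
    (hL : Tendsto f (cocompact ℂ) (𝓝 L)) {z : ℂ} (hz : z ∉ s) :
    f z = L + ∑ p ∈ s, R p / (z - p) := by
  induction s using Finset.induction_on generalizing f z with
  | empty =>
    have hdiff : Differentiable ℂ f := fun z => hd z (by simp)
    simpa using hdiff.apply_eq_of_tendsto_cocompact z hL
  | insert p s hp ih =>
    set g : ℂ → ℂ := fun z => f z - R p / (z - p) with hg
    have hopen : ∀ᶠ z in 𝓝[≠] p, z ∉ insert p s := by
      have h1 : ∀ᶠ z in 𝓝 p, z ∉ s := (s.finite_toSet.isClosed.isOpen_compl).mem_nhds (by simpa using hp)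
      filter_upwards [h1.filter_mono nhdsWithin_le_nhds, self_mem_nhdsWithin] with z h1 h2
      simp only [Finset.mem_insert, not_or]
      exact ⟨h2, h1⟩
    have hgd : ∀ z, z ≠ p → DifferentiableAt ℂ f z → DifferentiableAt ℂ g z := fun z hz hf =>
      hf.sub ((differentiableAt_const _).div (differentiableAt_id.sub_const p) (sub_ne_zero.mpr hz))
    have hlim0 : Tendsto (fun z => (z - p) * g z) (𝓝[≠] p) (𝓝 0) := by
      have h1 := (hR p (Finset.mem_insert_self p s)).sub_const (R p)
      rw [sub_self] at h1
      refine h1.congr' ?_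
      filter_upwards [self_mem_nhdsWithin] with z hz
      have : z - p ≠ 0 := sub_ne_zero.mpr hz
      simp only [hg]; field_simp
    -- After subtraction of the principal part at p the function is o(1/(z − p)), hence has a
    -- removable singularity there, and the induction continues with one pole less.
    have hlo : (fun z => g z - g p) =o[𝓝[≠] p] fun z => (z - p)⁻¹ := by
      rw [Asymptotics.isLittleO_iff_tendsto']
      · have h2 : Tendsto (fun z : ℂ => (z - p) * g p) (𝓝[≠] p) (𝓝 0) := by
          have : Tendsto (fun z : ℂ => (z - p) * g p) (𝓝 p) (𝓝 ((p - p) * g p)) :=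
            (Continuous.tendsto (by fun_prop) p)
          simpa using this.mono_left nhdsWithin_le_nhds
        have h3 := hlim0.sub h2
        rw [sub_zero] at h3
        refine h3.congr fun z => ?_
        rw [div_inv_eq_mul]; ring
      · filter_upwards [self_mem_nhdsWithin] with z hz h
        exact absurd (inv_eq_zero.mp h) (sub_ne_zero.mpr hz)
    set U : Set ℂ := {z | z ∉ s} with hUdef
    have hU : U ∈ 𝓝 p := (s.finite_toSet.isClosed.isOpen_compl).mem_nhds (by simpa using hp)
    have hUo : IsOpen U := s.finite_toSet.isClosed.isOpen_compl
    have hrem := Complex.differentiableOn_update_limUnder_of_isLittleO (f := g) hU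
      (fun z hz => (hgd z hz.2 (hd z (by
        simp only [Finset.mem_insert, not_or]; exact ⟨hz.2, hz.1⟩))).differentiableWithinAt) hlo
    set G := Function.update g p (limUnder (𝓝[≠] p) g) with hG
    have hGg : ∀ z, z ≠ p → G z = g z := fun z hz => Function.update_of_ne hz _ _
    have hGev : ∀ q : ℂ, ∀ᶠ z in 𝓝[≠] q, z ≠ p := fun q => by
      by_cases h : q = p
      · rw [h]; exact self_mem_nhdsWithin
      · exact (eventually_ne_nhds h).filter_mono nhdsWithin_le_nhds
    have hfin := ih (f := G)
      (fun z hz => hrem.differentiableAt (hUo.mem_nhds hz))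
      (fun q hq => by
        have hqp : q ≠ p := fun h => hp (h ▸ hq)
        have h1 := hR q (Finset.mem_insert_of_mem hq)
        have h2 : Tendsto (fun z : ℂ => (z - q) * (R p / (z - p))) (𝓝[≠] q) (𝓝 0) := by
          have : ContinuousAt (fun z : ℂ => (z - q) * (R p / (z - p))) q := by
            have := sub_ne_zero.mpr hqp
            fun_prop (disch := assumption)
          have := this.tendsto
          rw [sub_self, zero_mul] at this
          exact this.mono_left nhdsWithin_le_nhds
        have h3 := h1.sub h2
        rw [sub_zero] at h3
        refine h3.congr' ?_
        filter_upwards [hGev q] with z hz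
        rw [hGg z hz, hg]; ring)
      (by
        have h2 : Tendsto (fun z : ℂ => R p / (z - p)) (cocompact ℂ) (𝓝 0) := by
          have h4 : Tendsto (fun z : ℂ => z - p) (cocompact ℂ) (cocompact ℂ) :=
            (Homeomorph.subRight p).isClosedEmbedding.tendsto_cocompact
          have h3 : Tendsto (fun z : ℂ => (z - p)⁻¹) (cocompact ℂ) (𝓝 0) :=
            (tendsto_inv₀_cobounded (α := ℂ)).comp (by rwa [Metric.cobounded_eq_cocompact])
          simpa [div_eq_mul_inv] using h3.const_mul (R p)
        have h3 := hL.sub h2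
        rw [sub_zero] at h3
        refine h3.congr' ?_
        have : ∀ᶠ z in cocompact ℂ, z ≠ p := by
          exact (isCompact_singleton (x := p)).compl_mem_cocompact
        filter_upwards [this] with z hz
        rw [hGg z hz])
      (z := z) (fun h => hz (Finset.mem_insert_of_mem h))
    have hzp : z ≠ p := fun h => hz (h ▸ Finset.mem_insert_self p s)
    rw [hGg z hzp] at hfin
    rw [Finset.sum_insert hp]
    have : f z = g z + R p / (z - p) := by rw [hg]; ring
    rw [this, hfin]; ring

/-! ### The exponential kernel -/

/-- `ek λ s = (e^{2iλs} - 1) / (2iλ)`, continued by `s` to `λ = 0`. -/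
noncomputable def ek (lam : ℂ) (s : ℝ) : ℂ := s * dslope Complex.exp 0 (2 * Complex.I * lam * s)

lemma two_I_mul_ek (lam : ℂ) (s : ℝ) :
    2 * Complex.I * lam * ek lam s = Complex.exp (2 * Complex.I * lam * s) - 1 := by
  have := sub_smul_dslope Complex.exp 0 (2 * Complex.I * lam * s)
  rw [sub_zero, smul_eq_mul, Complex.exp_zero] at this
  rw [← this, ek]; ring

lemma ek_zero_left (s : ℝ) : ek 0 s = s := by simp [ek]

lemma ek_of_ne {lam : ℂ} (h : lam ≠ 0) (s : ℝ) :
    ek lam s = (Complex.exp (2 * Complex.I * lam * s) - 1) / (2 * Complex.I * lam) := by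
  rw [← two_I_mul_ek, mul_div_cancel_left₀]
  simp [h]

lemma differentiable_dslope_exp : Differentiable ℂ (dslope Complex.exp 0) := by
  rw [← differentiableOn_univ, Complex.differentiableOn_dslope univ_mem]
  exact Complex.differentiable_exp.differentiableOn

lemma continuous_ek : Continuous fun p : ℂ × ℝ => ek p.1 p.2 := by
  have := differentiable_dslope_exp.continuous
  unfold ek
  fun_prop

lemma differentiable_ek (s : ℝ) : Differentiable ℂ fun lam => ek lam s := by
  have := differentiable_dslope_exp
  unfold ek
  fun_prop

lemma norm_exp_sub_one_le_of_re_nonpos {z : ℂ} (hz : z.re ≤ 0) : ‖Complex.exp z - 1‖ ≤ ‖z‖ := by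
  have := Convex.norm_image_sub_le_of_norm_deriv_le (𝕜 := ℂ) (f := Complex.exp) (C := 1)
    (s := {w : ℂ | w.re ≤ 0}) (x := 0) (y := z) (fun w _ => Complex.differentiableAt_exp)
    (fun w hw => by
      rw [Complex.deriv_exp, Complex.norm_exp]
      exact Real.exp_le_one_iff.mpr hw) (convex_halfSpace_re_le 0) (by simp) hz
  simpa using this

lemma re_two_I_mul_mul (lam : ℂ) (s : ℝ) : (2 * Complex.I * lam * s).re = -2 * lam.im * s := by
  simp

lemma norm_exp_two_I_le_one {lam : ℂ} {s : ℝ} (hl : lam.im ≤ 0) (hs : s ≤ 0) :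
    ‖Complex.exp (2 * Complex.I * lam * s)‖ ≤ 1 := by
  rw [Complex.norm_exp, re_two_I_mul_mul]
  exact Real.exp_le_one_iff.mpr (by nlinarith [mul_nonneg_of_nonpos_of_nonpos hl hs])

/-- Uniform in λ, including λ = 0, that is ζ = ±q₀. The price is the factor |s|, which is why a
first moment of the potential is required. -/
lemma norm_ek_le {lam : ℂ} {s : ℝ} (hl : lam.im ≤ 0) (hs : s ≤ 0) : ‖ek lam s‖ ≤ |s| := by
  by_cases h : lam = 0
  · simp [h, ek_zero_left]
  · rw [ek_of_ne h, norm_div, div_le_iff₀ (by simpa using h)]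
    refine (norm_exp_sub_one_le_of_re_nonpos ?_).trans (le_of_eq ?_)
    · rw [re_two_I_mul_mul]; nlinarith [mul_nonneg_of_nonpos_of_nonpos hl hs]
    · simp; ring

/-- Complements `norm_ek_le` for large λ: it compensates the linear growth in λ of the constant part
of the system. -/
lemma norm_mul_ek_le {lam : ℂ} {s : ℝ} (hl : lam.im ≤ 0) (hs : s ≤ 0) : ‖lam‖ * ‖ek lam s‖ ≤ 1 := by
  have h1 : ‖2 * Complex.I * lam * ek lam s‖ ≤ 2 := by
    rw [two_I_mul_ek]
    exact (norm_sub_le _ _).trans (by simpa using (add_le_add_left (norm_exp_two_I_le_one hl hs) 1).trans (by norm_num))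
  simp only [norm_mul, Complex.norm_ofNat, Complex.norm_I, mul_one] at h1
  linarith

/-! ### Integrals over half-lines -/

section HalfLine

variable {E : Type*} [NormedAddCommGroup E] [NormedSpace ℝ E]

lemma hasDerivAt_integral_Ioi [CompleteSpace E] {F : ℝ → E} (hF : Continuous F)
    (hi : ∀ x, IntegrableOn F (Set.Ioi x)) (x : ℝ) :
    HasDerivAt (fun x => ∫ y in Set.Ioi x, F y) (-F x) x := by
  have h : (fun x => ∫ y in Set.Ioi x, F y) =
      fun x => (∫ y in Set.Ioi 0, F y) - ∫ y in (0:ℝ)..x, F y := by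
    funext a
    rw [eq_sub_iff_add_eq, add_comm]
    exact intervalIntegral.integral_interval_add_Ioi (hi 0) (hi a)
  rw [h]
  exact (intervalIntegral.integral_hasDerivAt_right (hF.intervalIntegrable _ _)
    (hF.stronglyMeasurableAtFilter _ _) hF.continuousAt).const_sub _

lemma tendsto_integral_Ioi_atTop {F : ℝ → E} (hi : ∀ x, IntegrableOn F (Set.Ioi x)) :
    Tendsto (fun x => ∫ y in Set.Ioi x, F y) atTop (𝓝 0) := by
  have h1 := intervalIntegral_tendsto_integral_Ioi 0 (hi 0) tendsto_id
  have h2 := h1.const_sub (∫ y in Set.Ioi 0, F y)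
  rw [sub_self] at h2
  refine h2.congr fun a => ?_
  rw [id, sub_eq_iff_eq_add, add_comm]
  exact (intervalIntegral.integral_interval_add_Ioi (hi 0) (hi a)).symm

lemma integrableOn_Ioi_of_weighted {F : ℝ → E} (hF : Continuous F)
    (hi : IntegrableOn (fun y => (1 + |y|) * ‖F y‖) (Set.Ioi 0)) {c : ℝ → ℝ} (hc : Continuous c)
    {A : ℝ} (hA : ∀ y, |c y| ≤ A * (1 + |y|)) (x : ℝ) :
    IntegrableOn (fun y => c y • F y) (Set.Ioi x) := by
  have h0 : IntegrableOn (fun y => c y • F y) (Set.Ioi 0) := by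
    refine (hi.const_mul A).mono' (hc.smul hF).aestronglyMeasurable (ae_of_all _ fun y => ?_)
    rw [norm_smul, Real.norm_eq_abs, ← mul_assoc]
    exact mul_le_mul_of_nonneg_right (hA y) (norm_nonneg _)
  rcases le_total 0 x with h | h
  · exact h0.mono_set (Set.Ioi_subset_Ioi h)
  · rw [← Set.Ioc_union_Ioi_eq_Ioi h]
    exact ((hc.smul hF).integrableOn_Ioc).union h0

end HalfLine

/-! ### Volterra equations -/

section Volterra

variable {E : Type*} [NormedAddCommGroup E] [NormedSpace ℂ E]

/-- Continuous functions whose first moment on the positive half-line is finite. -/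
structure FirstMoment {V : Type*} [NormedAddCommGroup V] (F : ℝ → V) : Prop where
  cont : Continuous F
  int : IntegrableOn (fun y => (1 + |y|) * ‖F y‖) (Set.Ioi 0)

lemma FirstMoment.of_bound {V W : Type*} [NormedAddCommGroup V] [NormedAddCommGroup W]
    {F : ℝ → V} {G : ℝ → W} (hF : FirstMoment F) (hG : Continuous G) {C : ℝ}
    (h : ∀ y, 0 < y → ‖G y‖ ≤ C * ‖F y‖) : FirstMoment G := by
  refine ⟨hG, (hF.int.const_mul C).mono' (by have := hG; fun_prop) ?_⟩
  refine (ae_restrict_iff' measurableSet_Ioi).mpr (ae_of_all _ fun y hy => ?_)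
  rw [Real.norm_of_nonneg (by positivity)]
  calc (1 + |y|) * ‖G y‖ ≤ (1 + |y|) * (C * ‖F y‖) := by gcongr; exact h y hy
    _ = C * ((1 + |y|) * ‖F y‖) := by ring

lemma FirstMoment.integrableOn {V : Type*} [NormedAddCommGroup V] {F : ℝ → V}
    (hF : FirstMoment F) (x₀ x : ℝ) : IntegrableOn (fun y => (1 + |y - x₀|) * ‖F y‖) (Set.Ioi x) := by
  have := integrableOn_Ioi_of_weighted (F := fun y => ‖F y‖) hF.cont.norm (by simpa using hF.int)
    (c := fun y => 1 + |y - x₀|) (by fun_prop) (A := 1 + |x₀|) (fun y => by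
      rw [abs_of_nonneg (by positivity)]
      nlinarith [abs_sub y x₀, abs_nonneg x₀, abs_nonneg y]) x
  simpa using this

lemma FirstMoment.integrableOn' {V : Type*} [NormedAddCommGroup V] {F : ℝ → V}
    (hF : FirstMoment F) (x : ℝ) : IntegrableOn F (Set.Ioi x) := by
  refine (hF.integrableOn 0 x).mono' hF.cont.aestronglyMeasurable (ae_of_all _ fun y => ?_)
  nlinarith [norm_nonneg (F y), abs_nonneg (y - 0)]

/-- The tail `∫_x^∞ C (1 + |y - x₀|) ‖F(y)‖ dy`. -/
noncomputable def momentTail {V : Type*} [NormedAddCommGroup V] (F : ℝ → V) (C x₀ x : ℝ) : ℝ :=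
  ∫ y in Set.Ioi x, C * ((1 + |y - x₀|) * ‖F y‖)

section
variable {V : Type*} [NormedAddCommGroup V] {F : ℝ → V}

lemma hasDerivAt_momentTail (hF : FirstMoment F) (C x₀ x : ℝ) :
    HasDerivAt (momentTail F C x₀) (-(C * ((1 + |x - x₀|) * ‖F x‖))) x :=
  hasDerivAt_integral_Ioi (F := fun y => C * ((1 + |y - x₀|) * ‖F y‖))
    (by have := hF.cont; fun_prop) (fun x => (hF.integrableOn x₀ x).const_mul C) x

lemma momentTail_nonneg {C : ℝ} (hC : 0 ≤ C) (x₀ x : ℝ) : 0 ≤ momentTail F C x₀ x :=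
  integral_nonneg fun y => by positivity

lemma momentTail_anti (hF : FirstMoment F) {C : ℝ} (hC : 0 ≤ C) (x₀ : ℝ) {x y : ℝ} (h : x ≤ y) :
    momentTail F C x₀ y ≤ momentTail F C x₀ x :=
  setIntegral_mono_set ((hF.integrableOn x₀ x).const_mul C) (ae_of_all _ fun y => by positivity)
    (Set.Ioi_subset_Ioi h).eventuallyLE

lemma tendsto_momentTail (hF : FirstMoment F) (C x₀ : ℝ) :
    Tendsto (momentTail F C x₀) atTop (𝓝 0) :=
  tendsto_integral_Ioi_atTop fun x => (hF.integrableOn x₀ x).const_mul C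

/-- The weight is centred at the moving endpoint x, but |y − x| ≤ |y| for 0 ≤ x ≤ y, so the tail
centred at 0 dominates it. -/
lemma tendsto_momentTail_diag (hF : FirstMoment F) {C : ℝ} (hC : 0 ≤ C) :
    Tendsto (fun x => momentTail F C x x) atTop (𝓝 0) := by
  refine squeeze_zero' (Eventually.of_forall fun x => momentTail_nonneg hC x x) ?_
    (tendsto_momentTail hF C 0)
  filter_upwards [eventually_ge_atTop 0] with x hx
  refine setIntegral_mono_on ((hF.integrableOn x x).const_mul C)
    ((hF.integrableOn 0 x).const_mul C) measurableSet_Ioi fun y hy => ?_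
  have hy' : x < y := hy
  gcongr 2
  rw [abs_of_nonneg (by linarith), abs_of_nonneg (by linarith)]
  linarith

/-- The derivative of the tail is minus the weight, so the integrand is exact. This turns the
iterated Volterra estimates into the terms of an exponential series. -/
lemma integral_momentTail_pow (hF : FirstMoment F) {C : ℝ} (hC : 0 ≤ C) (x₀ x : ℝ) (n : ℕ) :
    IntegrableOn (fun y => C * ((1 + |y - x₀|) * ‖F y‖) * (momentTail F C x₀ y ^ n / n.factorial))
      (Set.Ioi x) ∧
    ∫ y in Set.Ioi x, C * ((1 + |y - x₀|) * ‖F y‖) * (momentTail F C x₀ y ^ n / n.factorial) =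
      momentTail F C x₀ x ^ (n + 1) / (n + 1).factorial := by
  have hd : ∀ y ∈ Set.Ici x, HasDerivAt
      (fun y => -(momentTail F C x₀ y ^ (n + 1) / (n + 1).factorial))
      (C * ((1 + |y - x₀|) * ‖F y‖) * (momentTail F C x₀ y ^ n / n.factorial)) y := fun y _ => by
    have := (((hasDerivAt_momentTail hF C x₀ y).pow (n + 1)).div_const ((n + 1).factorial : ℝ)).neg
    refine this.congr_deriv ?_
    rw [Nat.factorial_succ]
    push_cast
    field_simp
  have hpos : ∀ y ∈ Set.Ioi x, 0 ≤ C * ((1 + |y - x₀|) * ‖F y‖) *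
      (momentTail F C x₀ y ^ n / n.factorial) := fun y _ => by
    have := momentTail_nonneg (F := F) hC x₀ y
    positivity
  have hlim : Tendsto (fun y => -(momentTail F C x₀ y ^ (n + 1) / (n + 1).factorial)) atTop (𝓝 0) := by
    have := (((tendsto_momentTail hF C x₀).pow (n + 1)).div_const ((n + 1).factorial : ℝ)).neg
    simpa using this
  refine ⟨integrableOn_Ioi_deriv_of_nonneg' hd hpos hlim, ?_⟩
  rw [integral_Ioi_of_hasDerivAt_of_nonneg' hd hpos hlim]
  ring

end

/-- The standing assumptions on the constant part `(λ, M)` of the system. -/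
structure ConstPart (C : ℝ) (lam : ℂ) (M : E →L[ℂ] E) : Prop where
  im_le : lam.im ≤ 0
  sq : ∀ v, M (M v) = (2 * Complex.I * lam) • M v
  bound : ∀ s : ℝ, s ≤ 0 → 1 + ‖ek lam s‖ * ‖M‖ ≤ C * (1 + |s|)

lemma ConstPart.nonneg {C : ℝ} {lam : ℂ} {M : E →L[ℂ] E} (h : ConstPart C lam M) : 0 ≤ C := by
  have := h.bound 0 le_rfl
  simp only [abs_zero, add_zero, mul_one] at this
  exact le_trans (by positivity) this

lemma continuous_kernel {lam : ℂ} {M : E →L[ℂ] E} {F : ℝ → E} (hF : Continuous F) (x : ℝ) :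
    Continuous fun y => F y + ek lam (x - y) • M (F y) := by
  have h1 : Continuous fun y : ℝ => ek lam (x - y) :=
    continuous_ek.comp (Continuous.prodMk continuous_const (continuous_const.sub continuous_id))
  exact hF.add (h1.smul (M.continuous.comp hF))

variable [CompleteSpace E]

/-- The Volterra integral `-∫_x^∞ (F(y) + ek λ (x-y) M F(y)) dy` solves `G' = M G + F`. -/
lemma hasDerivAt_volterra_integral {F : ℝ → E} (hF : FirstMoment F) {lam : ℂ} (hl : lam.im ≤ 0)
    {M : E →L[ℂ] E} (hM : ∀ v, M (M v) = (2 * Complex.I * lam) • M v) (x : ℝ) :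
    HasDerivAt (fun x => -∫ y in Set.Ioi x, (F y + ek lam (x - y) • M (F y)))
      (F x + M (-∫ y in Set.Ioi x, (F y + ek lam (x - y) • M (F y)))) x := by
  have ha := hasDerivAt_integral_Ioi hF.cont hF.integrableOn'
  set a := fun x => ∫ y in Set.Ioi x, F y with ha_def
  -- Since M² = 2iλM, exp(sM) = 1 + ek λ s · M, and the integral is variation of constants from
  -- infinity. To differentiate it the kernel is separated: for λ ≠ 0 into integrals of F and
  -- e^{−2iλy}F, for λ = 0 into integrals of F and yF.
  by_cases h0 : lam = 0
  · subst h0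
    have hci : ∀ x, IntegrableOn (fun y : ℝ => y • F y) (Set.Ioi x) := fun x =>
      integrableOn_Ioi_of_weighted hF.cont hF.int continuous_id (A := 1)
        (fun y => by rw [id]; linarith [abs_nonneg y]) x
    have hc := hasDerivAt_integral_Ioi (F := fun y : ℝ => y • F y)
      (continuous_id.smul hF.cont) hci
    set c := fun x => ∫ y in Set.Ioi x, y • F y with hc_def
    have hG : ∀ x, -∫ y in Set.Ioi x, (F y + ek 0 (x - y) • M (F y)) =
        -(a x) - M (x • a x - c x) := fun x => by
      have h1 : ∀ y, F y + ek 0 (x - y) • M (F y) = F y + M (x • F y - y • F y) := fun y => by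
        rw [ek_zero_left, map_sub, M.map_smul_of_tower, M.map_smul_of_tower, ← sub_smul,
          Complex.coe_smul]
      simp_rw [h1]
      have hx : IntegrableOn (fun y => x • F y) (Set.Ioi x) := (hF.integrableOn' x).smul x
      have hi : IntegrableOn (fun y => x • F y - y • F y) (Set.Ioi x) := hx.sub (hci x)
      have hMi : IntegrableOn (fun y => M (x • F y - y • F y)) (Set.Ioi x) := M.integrable_comp hi
      rw [integral_add (hF.integrableOn' x) hMi, M.integral_comp_comm hi,
        integral_sub hx (hci x), integral_smul]
      abel
    simp_rw [hG]
    have hM0 : ∀ v, M (M v) = 0 := fun v => by simpa using hM v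
    have hd := ((ha x).neg).sub ((M.restrictScalars ℝ).hasFDerivAt.comp_hasDerivAt x
      (((hasDerivAt_id x).smul (ha x)).sub (hc x)))
    refine hd.congr_deriv ?_
    simp only [id, smul_neg, one_smul, neg_neg, ContinuousLinearMap.coe_restrictScalars', map_sub,
      map_neg, hM0, map_add]
    have e1 : ∀ v : E, M (x • v) = x • M v := fun v => M.map_smul_of_tower x v
    simp only [e1]
    abel
  · have hexp : ∀ x, IntegrableOn (fun y : ℝ => Complex.exp (-(2 * Complex.I * lam * y)) • F y)
        (Set.Ioi x) := fun x => by
      refine ((hF.integrableOn' x).norm.const_mul (Real.exp (2 * lam.im * x))).mono'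
        (by have := hF.cont; fun_prop) ((ae_restrict_iff' measurableSet_Ioi).mpr
          (ae_of_all _ fun y hy => ?_))
      rw [norm_smul, Complex.norm_exp]
      refine mul_le_mul_of_nonneg_right (Real.exp_le_exp.mpr ?_) (norm_nonneg _)
      rw [Complex.neg_re, re_two_I_mul_mul]
      have : x < y := hy
      nlinarith
    have hb := hasDerivAt_integral_Ioi
      (F := fun y : ℝ => Complex.exp (-(2 * Complex.I * lam * y)) • F y)
      (by have := hF.cont; fun_prop) hexp
    set b := fun x : ℝ => ∫ y : ℝ in Set.Ioi x, Complex.exp (-(2 * Complex.I * lam * y)) • F y with hb_def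
    have h2 : 2 * Complex.I * lam ≠ 0 := by simp [h0]
    have hG : ∀ x : ℝ, -∫ y in Set.Ioi x, (F y + ek lam (x - y) • M (F y)) =
        -(a x) - (2 * Complex.I * lam)⁻¹ •
          M (Complex.exp (2 * Complex.I * lam * x) • b x - a x) := fun x => by
      have h1 : ∀ y : ℝ, F y + ek lam (x - y) • M (F y) = F y + (2 * Complex.I * lam)⁻¹ •
          M (Complex.exp (2 * Complex.I * lam * x) •
            (Complex.exp (-(2 * Complex.I * lam * y)) • F y) - F y) := fun y => by
        rw [ek_of_ne h0, map_sub, map_smul, map_smul, smul_smul, ← Complex.exp_add,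
          div_eq_inv_mul, mul_smul, sub_smul, one_smul]
        congr 5
        push_cast; ring
      simp_rw [h1]
      have hx : IntegrableOn (fun y : ℝ => Complex.exp (2 * Complex.I * lam * x) •
            (Complex.exp (-(2 * Complex.I * lam * y)) • F y)) (Set.Ioi x) :=
        (hexp x).smul (Complex.exp (2 * Complex.I * lam * x))
      have hi : IntegrableOn (fun y : ℝ => Complex.exp (2 * Complex.I * lam * x) •
            (Complex.exp (-(2 * Complex.I * lam * y)) • F y) - F y) (Set.Ioi x) :=
        hx.sub (hF.integrableOn' x)
      have hMi : IntegrableOn (fun y : ℝ => (2 * Complex.I * lam)⁻¹ •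
          M (Complex.exp (2 * Complex.I * lam * x) •
            (Complex.exp (-(2 * Complex.I * lam * y)) • F y) - F y)) (Set.Ioi x) :=
        (M.integrable_comp hi).smul _
      rw [integral_add (hF.integrableOn' x) hMi, integral_smul, M.integral_comp_comm hi,
        integral_sub hx (hF.integrableOn' x), integral_smul]
      abel
    simp_rw [hG]
    have he : HasDerivAt (fun x : ℝ => Complex.exp (2 * Complex.I * lam * x))
        (Complex.exp (2 * Complex.I * lam * x) * (2 * Complex.I * lam)) x := by
      have := ((Complex.ofRealCLM.hasDerivAt (x := x)).const_mul (2 * Complex.I * lam)).cexp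
      simpa using this
    have hd := ((ha x).neg).sub (((M.restrictScalars ℝ).hasFDerivAt.comp_hasDerivAt x
      ((he.smul (hb x)).sub (ha x))).const_smul (2 * Complex.I * lam)⁻¹)
    refine hd.congr_deriv ?_
    have e1 : Complex.exp (2 * Complex.I * lam * x) • -(Complex.exp (-(2 * Complex.I * lam * x)) • F x)
        = -F x := by
      rw [smul_neg, smul_smul, ← Complex.exp_add, add_neg_cancel, Complex.exp_zero, one_smul]
    rw [e1]
    simp only [ContinuousLinearMap.coe_restrictScalars', map_sub, map_neg, map_smul, hM, map_add,
      smul_sub, smul_add, smul_neg, mul_smul, neg_neg]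
    simp only [smul_smul, ← mul_assoc]
    have e3 : (2 * Complex.I * lam)⁻¹ * Complex.exp (2 * Complex.I * lam * x) * 2 * Complex.I * lam =
        Complex.exp (2 * Complex.I * lam * x) := by field_simp
    have e4 : (2 * Complex.I * lam)⁻¹ * 2 * Complex.I * lam = 1 := by field_simp
    simp only [e3, e4, one_smul]
    abel

/-- The terms of the Neumann series of the Volterra equation for `m' = (M + P) m`. -/
noncomputable def vterm (lam : ℂ) (M : E →L[ℂ] E) (P : ℝ → E →L[ℂ] E) (g : E) : ℕ → ℝ → E
  | 0 => fun _ => g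
  | n + 1 => fun x => -∫ y in Set.Ioi x,
      (P y (vterm lam M P g n y) + ek lam (x - y) • M (P y (vterm lam M P g n y)))

/-- The solution of the Volterra equation for `m' = (M + P) m`, `m(∞) = g`. -/
noncomputable def vsol (lam : ℂ) (M : E →L[ℂ] E) (P : ℝ → E →L[ℂ] E) (g : E) (x : ℝ) : E :=
  ∑' n, vterm lam M P g n x

variable {C : ℝ} {lam : ℂ} {M : E →L[ℂ] E} {P : ℝ → E →L[ℂ] E}

/-- The weight is centred at a fixed x₀ ≤ x and not at x, so that successive kernels are all
measured by the same tail and the bounds can be iterated. -/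
lemma ConstPart.kernel_le (h : ConstPart C lam M) {x₀ x y : ℝ} (h0 : x₀ ≤ x) (hxy : x ≤ y) (v : E) :
    ‖P y v + ek lam (x - y) • M (P y v)‖ ≤ C * ((1 + |y - x₀|) * ‖P y‖) * ‖v‖ := by
  have h1 := h.bound (x - y) (by linarith)
  have h2 : |x - y| ≤ |y - x₀| := by
    rw [abs_of_nonpos (by linarith), abs_of_nonneg (by linarith)]; linarith
  calc ‖P y v + ek lam (x - y) • M (P y v)‖
      ≤ ‖P y v‖ + ‖ek lam (x - y)‖ * (‖M‖ * ‖P y v‖) := by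
        refine (norm_add_le _ _).trans ?_
        rw [norm_smul]
        gcongr
        exact M.le_opNorm _
    _ = (1 + ‖ek lam (x - y)‖ * ‖M‖) * ‖P y v‖ := by ring
    _ ≤ (C * (1 + |x - y|)) * (‖P y‖ * ‖v‖) := by
        have := h.nonneg
        gcongr
        exact (P y).le_opNorm v
    _ ≤ (C * (1 + |y - x₀|)) * (‖P y‖ * ‖v‖) := by
        have := h.nonneg
        gcongr
    _ = _ := by ring

/-- Continuity and bound are proved together because each term is continuous as a Volterra integral
only if the previous one, multiplied by P, has a finite first moment, and that uses its bound. -/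
lemma vterm_props (hP : FirstMoment P) (h : ConstPart C lam M) (g : E) (n : ℕ) :
    Continuous (vterm lam M P g n) ∧ ∀ x₀ x, x₀ ≤ x →
      ‖vterm lam M P g n x‖ ≤ ‖g‖ * (momentTail P C x₀ x ^ n / n.factorial) := by
  induction n with
  | zero => exact ⟨continuous_const, fun x₀ x _ => by simp [vterm]⟩
  | succ n ih =>
    have hC := h.nonneg
    constructor
    · have hF : FirstMoment fun y => P y (vterm lam M P g n y) :=
        hP.of_bound (hP.cont.clm_apply ih.1) (C := ‖g‖ * (momentTail P C 0 0 ^ n / n.factorial))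
          fun y hy => by
            refine ((P y).le_opNorm _).trans ?_
            rw [mul_comm]
            refine mul_le_mul_of_nonneg_right ((ih.2 0 y hy.le).trans ?_) (norm_nonneg _)
            have h1 := momentTail_nonneg (F := P) hC 0 y
            have h2 := momentTail_anti hP hC 0 hy.le
            gcongr
      exact continuous_iff_continuousAt.mpr fun x =>
        (hasDerivAt_volterra_integral hF h.im_le h.sq x).continuousAt
    · intro x₀ x hx
      obtain ⟨hi, hv⟩ := integral_momentTail_pow hP hC x₀ x n
      rw [vterm, norm_neg, ← hv, ← integral_const_mul]
      refine norm_integral_le_of_norm_le (hi.const_mul _)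
        ((ae_restrict_iff' measurableSet_Ioi).mpr (ae_of_all _ fun y hy => ?_))
      have hy' : x < y := hy
      refine (h.kernel_le hx hy'.le _).trans ?_
      rw [mul_left_comm ‖g‖]
      gcongr
      exact ih.2 x₀ y (hx.trans hy'.le)

lemma summable_vterm (hP : FirstMoment P) (h : ConstPart C lam M) (g : E) (x : ℝ) :
    Summable fun n => ‖vterm lam M P g n x‖ :=
  Summable.of_nonneg_of_le (fun _ => norm_nonneg _) (fun n => (vterm_props hP h g n).2 x x le_rfl)
    ((Real.summable_pow_div_factorial _).mul_left _)

/-- The base point x₀ is free: x₀ = x yields the limit at infinity, a fixed x₀ yields a bound on a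
whole half-line. -/
lemma norm_vsol_sub_le (hP : FirstMoment P) (h : ConstPart C lam M) (g : E) {x₀ x : ℝ} (hx : x₀ ≤ x) :
    ‖vsol lam M P g x - g‖ ≤ ‖g‖ * (Real.exp (momentTail P C x₀ x) - 1) := by
  rw [vsol, (summable_vterm hP h g x).of_norm.tsum_eq_zero_add]
  have h1 : HasSum (fun n : ℕ => ‖g‖ * (momentTail P C x₀ x ^ (n + 1) / (n + 1).factorial))
      (‖g‖ * (Real.exp (momentTail P C x₀ x) - 1)) := by
    have := NormedSpace.expSeries_div_hasSum_exp (momentTail P C x₀ x)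
    rw [← Real.exp_eq_exp_ℝ] at this
    have h2 := (hasSum_nat_add_iff' 1).mpr this
    simpa using h2.mul_left ‖g‖
  have h3 : vterm lam M P g 0 x = g := rfl
  rw [h3, add_sub_cancel_left]
  exact tsum_of_norm_bounded h1 fun n => (vterm_props hP h g (n + 1)).2 x₀ x hx

lemma norm_vsol_le (hP : FirstMoment P) (h : ConstPart C lam M) (g : E) {x₀ x : ℝ} (hx : x₀ ≤ x) :
    ‖vsol lam M P g x‖ ≤ ‖g‖ * Real.exp (momentTail P C x₀ x₀) := by
  have h1 := norm_vsol_sub_le hP h g hx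
  have h2 : ‖vsol lam M P g x‖ ≤ ‖vsol lam M P g x - g‖ + ‖g‖ := by
    simpa using norm_add_le (vsol lam M P g x - g) g
  have h3 := Real.exp_le_exp.mpr (momentTail_anti hP h.nonneg x₀ hx)
  nlinarith [norm_nonneg g]

lemma continuous_vsol (hP : FirstMoment P) (h : ConstPart C lam M) (g : E) :
    Continuous (vsol lam M P g) := by
  refine continuous_iff_continuousAt.mpr fun x => ?_
  have : ContinuousOn (vsol lam M P g) (Set.Ici (x - 1)) := by
    refine continuousOn_tsum (u := fun n : ℕ => ‖g‖ * (momentTail P C (x - 1) (x - 1) ^ n / n.factorial))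
      (fun n => (vterm_props hP h g n).1.continuousOn)
      ((Real.summable_pow_div_factorial _).mul_left _) fun n y hy => ?_
    refine ((vterm_props hP h g n).2 (x - 1) y hy).trans ?_
    have h1 := momentTail_nonneg (F := P) h.nonneg (x - 1) y
    have h2 := momentTail_anti hP h.nonneg (x - 1) hy
    gcongr
  exact this.continuousAt (Ici_mem_nhds (by linarith))

lemma firstMoment_clm_vsol (hP : FirstMoment P) (h : ConstPart C lam M) (g : E) :
    FirstMoment fun y => P y (vsol lam M P g y) :=
  hP.of_bound (hP.cont.clm_apply (continuous_vsol hP h g))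
    (C := ‖g‖ * Real.exp (momentTail P C 0 0)) fun y hy => by
      refine ((P y).le_opNorm _).trans ?_
      rw [mul_comm]
      exact mul_le_mul_of_nonneg_right (norm_vsol_le hP h g hy.le) (norm_nonneg _)

lemma vsol_eq (hP : FirstMoment P) (h : ConstPart C lam M) (g : E) (x : ℝ) :
    vsol lam M P g x = g + -∫ y in Set.Ioi x,
      (P y (vsol lam M P g y) + ek lam (x - y) • M (P y (vsol lam M P g y))) := by
  have hC := h.nonneg
  have hb : ∀ n, ∀ y ∈ Set.Ioi x, ‖P y (vterm lam M P g n y) +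
      ek lam (x - y) • M (P y (vterm lam M P g n y))‖ ≤
      ‖g‖ * (C * ((1 + |y - x|) * ‖P y‖) * (momentTail P C x y ^ n / n.factorial)) := fun n y hy => by
    have hy' : x < y := hy
    refine (h.kernel_le le_rfl hy'.le _).trans ?_
    rw [mul_left_comm ‖g‖]
    gcongr
    exact (vterm_props hP h g n).2 x y hy'.le
  have hint : ∀ n, IntegrableOn (fun y => P y (vterm lam M P g n y) +
      ek lam (x - y) • M (P y (vterm lam M P g n y))) (Set.Ioi x) := fun n =>
    ((integral_momentTail_pow hP hC x x n).1.const_mul ‖g‖).mono'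
      (continuous_kernel (hP.cont.clm_apply (vterm_props hP h g n).1) x).aestronglyMeasurable
      ((ae_restrict_iff' measurableSet_Ioi).mpr (ae_of_all _ (hb n)))
  have key := hasSum_integral_of_summable_integral_norm hint (by
    refine Summable.of_nonneg_of_le (fun n => integral_nonneg fun y => norm_nonneg _) (fun n => ?_)
      (((summable_nat_add_iff 1).mpr
        (Real.summable_pow_div_factorial (momentTail P C x x))).mul_left ‖g‖)
    rw [← (integral_momentTail_pow hP hC x x n).2, ← integral_const_mul]
    exact setIntegral_mono_on (hint n).norm ((integral_momentTail_pow hP hC x x n).1.const_mul ‖g‖)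
      measurableSet_Ioi (hb n))
  have hpt : ∀ y, ∑' n, (P y (vterm lam M P g n y) + ek lam (x - y) • M (P y (vterm lam M P g n y))) =
      P y (vsol lam M P g y) + ek lam (x - y) • M (P y (vsol lam M P g y)) := fun y => by
    have hs := (summable_vterm hP h g y).of_norm
    have h1 : HasSum (fun n => P y (vterm lam M P g n y)) (P y (vsol lam M P g y)) :=
      (P y).hasSum hs.hasSum
    exact (h1.add ((M.hasSum h1).const_smul (ek lam (x - y)))).tsum_eq
  simp_rw [hpt] at key
  rw [vsol, (summable_vterm hP h g x).of_norm.tsum_eq_zero_add]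
  congr 1
  exact key.neg.tsum_eq

/-- Differentiating the integral equation gives P m + M(m − g); the condition M g = 0 turns this
into the desired system. -/
lemma hasDerivAt_vsol (hP : FirstMoment P) (h : ConstPart C lam M) {g : E} (hg : M g = 0) (x : ℝ) :
    HasDerivAt (vsol lam M P g) (M (vsol lam M P g x) + P x (vsol lam M P g x)) x := by
  have h1 := (hasDerivAt_volterra_integral (firstMoment_clm_vsol hP h g) h.im_le h.sq x).const_add g
  rw [← funext (vsol_eq hP h g)] at h1
  refine h1.congr_deriv ?_
  have h2 : M (vsol lam M P g x) = M (-∫ y in Set.Ioi x,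
      (P y (vsol lam M P g y) + ek lam (x - y) • M (P y (vsol lam M P g y)))) := by
    conv_lhs => rw [vsol_eq hP h g x]
    rw [map_add, hg, zero_add]
  rw [h2, add_comm]

lemma tendsto_vsol (hP : FirstMoment P) (h : ConstPart C lam M) (g : E) :
    Tendsto (vsol lam M P g) atTop (𝓝 g) := by
  rw [tendsto_iff_norm_sub_tendsto_zero]
  refine squeeze_zero (fun _ => norm_nonneg _) (fun x => norm_vsol_sub_le hP h g (le_refl x)) ?_
  have := ((Real.continuous_exp.tendsto 0).comp (tendsto_momentTail_diag hP h.nonneg)).sub_const 1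
  simpa using this.const_mul ‖g‖

/-! ### Dependence on a parameter -/

section Parameter

variable {lam : ℂ → ℂ} {M : ℂ → E →L[ℂ] E} {g : ℂ → E} {Z : Set ℂ} {Gb : ℝ}

/-- The right side does not involve z, so it is a dominating function for the continuity and for the
holomorphy of every term. -/
lemma norm_kernel_vterm_le (hP : FirstMoment P) (h : ∀ z ∈ Z, ConstPart C (lam z) (M z))
    (hgb : ∀ z ∈ Z, ‖g z‖ ≤ Gb) (n : ℕ) {x y : ℝ} (hxy : x < y) {z : ℂ} (hz : z ∈ Z) :
    ‖P y (vterm (lam z) (M z) P (g z) n y) +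
      ek (lam z) (x - y) • M z (P y (vterm (lam z) (M z) P (g z) n y))‖ ≤
      Gb * (C * ((1 + |y - x|) * ‖P y‖) * (momentTail P C x y ^ n / n.factorial)) := by
  have hC := (h z hz).nonneg
  refine ((h z hz).kernel_le le_rfl hxy.le _).trans ?_
  rw [mul_left_comm Gb]
  have h1 := momentTail_nonneg (F := P) hC x y
  gcongr
  exact ((vterm_props hP (h z hz) (g z) n).2 x y hxy.le).trans (by gcongr; exact hgb z hz)

lemma continuousOn_vterm (hP : FirstMoment P) (h : ∀ z ∈ Z, ConstPart C (lam z) (M z))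
    (hlam : ContinuousOn lam Z) (hM : ContinuousOn M Z) (hg : ContinuousOn g Z)
    (hgb : ∀ z ∈ Z, ‖g z‖ ≤ Gb) (n : ℕ) (x : ℝ) :
    ContinuousOn (fun z => vterm (lam z) (M z) P (g z) n x) Z := by
  rcases Z.eq_empty_or_nonempty with rfl | ⟨z₀, hz₀⟩
  · exact continuousOn_empty _
  have hC := (h z₀ hz₀).nonneg
  induction n generalizing x with
  | zero => exact hg
  | succ n ih =>
    refine (continuousOn_of_dominated (fun z hz => (continuous_kernel (hP.cont.clm_apply
      (vterm_props hP (h z hz) (g z) n).1) x).aestronglyMeasurable)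
      (fun z hz => (ae_restrict_iff' measurableSet_Ioi).mpr
        (ae_of_all _ fun y hy => norm_kernel_vterm_le hP h hgb n hy hz))
      ((integral_momentTail_pow hP hC x x n).1.const_mul Gb) (ae_of_all _ fun y => ?_)).neg
    have h1 : ContinuousOn (fun z => P y (vterm (lam z) (M z) P (g z) n y)) Z :=
      (P y).continuous.comp_continuousOn (ih y)
    have h2 : ContinuousOn (fun z => ek (lam z) (x - y)) Z :=
      (differentiable_ek (x - y)).continuous.comp_continuousOn hlam
    exact h1.add (h2.smul (hM.clm_apply h1))

lemma continuousOn_vsol (hP : FirstMoment P) (h : ∀ z ∈ Z, ConstPart C (lam z) (M z))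
    (hlam : ContinuousOn lam Z) (hM : ContinuousOn M Z) (hg : ContinuousOn g Z)
    (hgb : ∀ z ∈ Z, ‖g z‖ ≤ Gb) (x : ℝ) :
    ContinuousOn (fun z => vsol (lam z) (M z) P (g z) x) Z :=
  continuousOn_tsum (u := fun n : ℕ => Gb * (momentTail P C x x ^ n / n.factorial))
    (fun n => continuousOn_vterm hP h hlam hM hg hgb n x)
    ((Real.summable_pow_div_factorial _).mul_left _) fun n z hz =>
      ((vterm_props hP (h z hz) (g z) n).2 x x le_rfl).trans (by
        have := momentTail_nonneg (F := P) (h z hz).nonneg x x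
        gcongr
        exact hgb z hz)

lemma differentiableOn_vsol (hZ : IsOpen Z) (hP : FirstMoment P)
    (h : ∀ z ∈ Z, ConstPart C (lam z) (M z))
    (hlam : DifferentiableOn ℂ lam Z) (hM : DifferentiableOn ℂ M Z) (hg : DifferentiableOn ℂ g Z)
    (hgb : ∀ z ∈ Z, ‖g z‖ ≤ Gb) (x : ℝ) :
    DifferentiableOn ℂ (fun z => vsol (lam z) (M z) P (g z) x) Z := by
  rcases Z.eq_empty_or_nonempty with rfl | ⟨z₀, hz₀⟩
  · exact differentiableOn_empty
  have hC := (h z₀ hz₀).nonneg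
  refine Complex.differentiableOn_tsum_of_summable_norm
    (u := fun n : ℕ => Gb * (momentTail P C x x ^ n / n.factorial))
    ((Real.summable_pow_div_factorial _).mul_left _) (fun n => ?_) hZ fun n z hz =>
      ((vterm_props hP (h z hz) (g z) n).2 x x le_rfl).trans (by
        have := momentTail_nonneg (F := P) (h z hz).nonneg x x
        gcongr
        exact hgb z hz)
  induction n generalizing x with
  | zero => exact hg
  | succ n ih =>
    refine (differentiableOn_integral_of_dominated hZ (fun z hz => (continuous_kernel (hP.cont.clm_apply
      (vterm_props hP (h z hz) (g z) n).1) x).aestronglyMeasurable)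
      ((integral_momentTail_pow hP hC x x n).1.const_mul Gb)
      (fun z hz => (ae_restrict_iff' measurableSet_Ioi).mpr
        (ae_of_all _ fun y hy => norm_kernel_vterm_le hP h hgb n hy hz))
      ((ae_restrict_iff' measurableSet_Ioi).mpr
        (ae_of_all _ fun y hy z hz => norm_kernel_vterm_le hP h hgb n hy hz))
      (ae_of_all _ fun y => ?_)).neg
    have h1 : DifferentiableOn ℂ (fun z => P y (vterm (lam z) (M z) P (g z) n y)) Z :=
      (P y).differentiable.comp_differentiableOn (ih y)
    have h2 : DifferentiableOn ℂ (fun z => ek (lam z) (x - y)) Z :=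
      (differentiable_ek (x - y)).comp_differentiableOn hlam
    exact h1.add (h2.smul (hM.clm_apply h1))

end Parameter

end Volterra

/-! ### The spectral functions -/

lemma kappa_sub_lam (q₀ : ℝ) (ζ : ℂ) : kappa q₀ ζ - lam q₀ ζ = (q₀ : ℂ) ^ 2 / ζ := by
  unfold kappa lam; ring

lemma kappa_add_lam (q₀ : ℝ) (ζ : ℂ) : kappa q₀ ζ + lam q₀ ζ = ζ := by
  unfold kappa lam; ring

lemma kappa_sq (q₀ : ℝ) {ζ : ℂ} (hζ : ζ ≠ 0) : kappa q₀ ζ ^ 2 = lam q₀ ζ ^ 2 + (q₀ : ℂ) ^ 2 := by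
  unfold kappa lam; field_simp; ring

lemma lam_im (q₀ : ℝ) (ζ : ℂ) :
    (lam q₀ ζ).im = ζ.im * (1 + q₀ ^ 2 / Complex.normSq ζ) / 2 := by
  have h : (lam q₀ ζ) = (ζ - ((q₀ ^ 2 : ℝ) : ℂ) * ζ⁻¹) / (2 : ℝ) := by
    unfold lam; push_cast; rw [div_eq_mul_inv ((q₀:ℂ) ^ 2)]
  rw [h, Complex.div_ofReal_im, Complex.sub_im, Complex.im_ofReal_mul,
    Complex.inv_im]
  ring

lemma lam_im_nonpos (q₀ : ℝ) {ζ : ℂ} (h : ζ.im ≤ 0) : (lam q₀ ζ).im ≤ 0 := by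
  rw [lam_im]
  have : 0 ≤ 1 + q₀ ^ 2 / Complex.normSq ζ := by have := Complex.normSq_nonneg ζ; positivity
  nlinarith

lemma lam_im_neg (q₀ : ℝ) {ζ : ℂ} (h : ζ.im < 0) : (lam q₀ ζ).im < 0 := by
  rw [lam_im]
  have : 0 < 1 + q₀ ^ 2 / Complex.normSq ζ := by have := Complex.normSq_nonneg ζ; positivity
  nlinarith

lemma norm_kappa_le {q₀ : ℝ} (hq : 0 < q₀) {ζ : ℂ} (hζ : ζ ≠ 0) :
    ‖kappa q₀ ζ‖ ≤ ‖lam q₀ ζ‖ + q₀ := by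
  refine abs_le_of_sq_le_sq' ?_ (by positivity) |>.2
  have h := congrArg norm (kappa_sq q₀ hζ)
  rw [norm_pow] at h
  rw [h]
  refine (norm_add_le _ _).trans ?_
  rw [norm_pow, norm_pow, Complex.norm_real, Real.norm_of_nonneg hq.le]
  nlinarith [norm_nonneg (lam q₀ ζ)]

lemma conj_kappa (q₀ : ℝ) (ζ : ℂ) : conj (kappa q₀ ζ) = kappa q₀ (conj ζ) := by
  simp [kappa, Complex.conj_ofNat]

lemma conj_lam (q₀ : ℝ) (ζ : ℂ) : conj (lam q₀ ζ) = lam q₀ (conj ζ) := by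
  simp [lam, Complex.conj_ofNat]

lemma kappa_inv {q₀ : ℝ} (hq : q₀ ≠ 0) (ζ : ℂ) : kappa q₀ ((q₀ : ℂ) ^ 2 / ζ) = kappa q₀ ζ := by
  unfold kappa
  rw [div_div_cancel₀ (by exact_mod_cast pow_ne_zero 2 hq)]; ring

lemma lam_inv {q₀ : ℝ} (hq : q₀ ≠ 0) (ζ : ℂ) : lam q₀ ((q₀ : ℂ) ^ 2 / ζ) = -lam q₀ ζ := by
  unfold lam
  rw [div_div_cancel₀ (by exact_mod_cast pow_ne_zero 2 hq)]; ring

/-! ### The Zakharov-Shabat system -/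

/-- The coefficient matrix of the Zakharov-Shabat system with potential `p`, real diagonal
perturbation `d` and spectral parameter `k`. -/
noncomputable def zsX (p : ℂ) (d : ℝ) (k : ℂ) : Matrix (Fin 2) (Fin 2) ℂ :=
  !![-Complex.I * (k + d), p; conj p, Complex.I * (k + d)]

/-- `φ` solves the Zakharov-Shabat system. -/
def IsZSSol (p : ℝ → ℂ) (d : ℝ → ℝ) (k : ℂ) (φ : ℝ → Fin 2 → ℂ) : Prop :=
  ∀ x, HasDerivAt φ ((zsX (p x) (d x) k).mulVec (φ x)) x

lemma isZSSol_iff {p : ℝ → ℂ} {d : ℝ → ℝ} {k : ℂ} {φ : ℝ → Fin 2 → ℂ} :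
    IsZSSol p d k φ ↔ ∀ x,
      HasDerivAt (fun y => φ y 0) (-Complex.I * (k + d x) * φ x 0 + p x * φ x 1) x ∧
      HasDerivAt (fun y => φ y 1) (conj (p x) * φ x 0 + Complex.I * (k + d x) * φ x 1) x := by
  unfold IsZSSol
  refine forall_congr' fun x => ?_
  rw [hasDerivAt_pi, Fin.forall_fin_two]
  simp [zsX, Matrix.mulVec, dotProduct, Fin.sum_univ_two]

/-- Multiplication by a matrix as a continuous linear map. -/
noncomputable def mulCLM (A : Matrix (Fin 2) (Fin 2) ℂ) : (Fin 2 → ℂ) →L[ℂ] (Fin 2 → ℂ) :=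
  LinearMap.toContinuousLinearMap (Matrix.mulVecLin A)

lemma mulCLM_apply (A : Matrix (Fin 2) (Fin 2) ℂ) (v : Fin 2 → ℂ) : mulCLM A v = A.mulVec v := rfl

lemma mulCLM_eq (a b c e : ℂ) : mulCLM !![a, b; c, e] =
    a • mulCLM !![1, 0; 0, 0] + b • mulCLM !![0, 1; 0, 0] + c • mulCLM !![0, 0; 1, 0] +
      e • mulCLM !![0, 0; 0, 1] := by
  ext v i
  fin_cases i <;> simp [mulCLM_apply, Matrix.mulVec, dotProduct, Fin.sum_univ_two]

lemma norm_mulCLM_le (a b c e : ℂ) : ‖mulCLM !![a, b; c, e]‖ ≤ ‖a‖ + ‖b‖ + ‖c‖ + ‖e‖ := by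
  refine ContinuousLinearMap.opNorm_le_bound _ (by positivity) fun v => ?_
  rw [pi_norm_le_iff_of_nonneg (by positivity)]
  have h0 := norm_le_pi_norm v 0
  have h1 := norm_le_pi_norm v 1
  intro i
  fin_cases i
  · simp only [mulCLM_apply, Matrix.mulVec, dotProduct, Fin.sum_univ_two]
    refine (norm_add_le _ _).trans ?_
    simp only [norm_mul]
    simp only [Fin.zero_eta, Matrix.of_apply, Matrix.cons_val', Matrix.cons_val_zero, Matrix.cons_val_one,
      Matrix.cons_val_fin_one]
    nlinarith [norm_nonneg a, norm_nonneg b, norm_nonneg c, norm_nonneg e, norm_nonneg v,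
      mul_le_mul_of_nonneg_left h0 (norm_nonneg a), mul_le_mul_of_nonneg_left h1 (norm_nonneg b),
      mul_nonneg (norm_nonneg c) (norm_nonneg v), mul_nonneg (norm_nonneg e) (norm_nonneg v)]
  · simp only [mulCLM_apply, Matrix.mulVec, dotProduct, Fin.sum_univ_two]
    refine (norm_add_le _ _).trans ?_
    simp only [norm_mul]
    simp only [Fin.mk_one, Matrix.of_apply, Matrix.cons_val', Matrix.cons_val_zero, Matrix.cons_val_one,
      Matrix.cons_val_fin_one]
    nlinarith [norm_nonneg a, norm_nonneg b, norm_nonneg c, norm_nonneg e, norm_nonneg v,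
      mul_le_mul_of_nonneg_left h0 (norm_nonneg c), mul_le_mul_of_nonneg_left h1 (norm_nonneg e),
      mul_nonneg (norm_nonneg a) (norm_nonneg v), mul_nonneg (norm_nonneg b) (norm_nonneg v)]

/-- The assumptions on the potential at the right end. -/
structure RightPotential (q₀ : ℝ) (p : ℝ → ℂ) (d : ℝ → ℝ) (pinf : ℂ) : Prop where
  pos : 0 < q₀
  norm_inf : ‖pinf‖ = q₀
  contDiff : ContDiff ℝ 1 p
  momp : FirstMoment fun y => p y - pinf
  momd : FirstMoment d

namespace RightPotential

variable {q₀ : ℝ} {p : ℝ → ℂ} {d : ℝ → ℝ} {pinf : ℂ}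

lemma cont_p (h : RightPotential q₀ p d pinf) : Continuous p := h.contDiff.continuous

lemma conj_mul_inf (h : RightPotential q₀ p d pinf) : conj pinf * pinf = (q₀ : ℂ) ^ 2 := by
  rw [Complex.conj_mul', h.norm_inf]

lemma inf_ne (h : RightPotential q₀ p d pinf) : pinf ≠ 0 := by
  rw [← norm_pos_iff, h.norm_inf]; exact h.pos

lemma q_ne (h : RightPotential q₀ p d pinf) : (q₀ : ℂ) ≠ 0 := by exact_mod_cast h.pos.ne'

end RightPotential

/-! ### Construction of the right Jost solution -/

section Core

/-- The perturbation of the constant coefficient system. -/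
noncomputable def pertP (p : ℝ → ℂ) (d : ℝ → ℝ) (pinf : ℂ) (y : ℝ) : (Fin 2 → ℂ) →L[ℂ] (Fin 2 → ℂ) :=
  mulCLM !![-Complex.I * d y, p y - pinf; conj (p y - pinf), Complex.I * d y]

/-- The constant part `X_∞ + iλ`. -/
noncomputable def constM (q₀ : ℝ) (pinf ζ : ℂ) : (Fin 2 → ℂ) →L[ℂ] (Fin 2 → ℂ) :=
  mulCLM !![-Complex.I * ((q₀ : ℂ) ^ 2 / ζ), pinf; conj pinf, Complex.I * ζ]

/-- The asymptotic vector `(1, i conj p_∞ / ζ)`. -/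
noncomputable def asymV (pinf ζ : ℂ) : Fin 2 → ℂ := ![1, Complex.I * conj pinf / ζ]

/-- The normalized Jost solution `e^{iλx} φ_{+,1}(x, ζ)`, for `Im ζ ≤ 0`. -/
noncomputable def jcore (q₀ : ℝ) (p : ℝ → ℂ) (d : ℝ → ℝ) (pinf ζ : ℂ) (x : ℝ) : Fin 2 → ℂ :=
  vsol (lam q₀ ζ) (constM q₀ pinf ζ) (pertP p d pinf) (asymV pinf ζ) x

/-- The Jost solution `φ_{+,1}(x, ζ)`, for `Im ζ ≤ 0`. -/
noncomputable def rjost (q₀ : ℝ) (p : ℝ → ℂ) (d : ℝ → ℝ) (pinf ζ : ℂ) (x : ℝ) : Fin 2 → ℂ :=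
  Complex.exp (-(Complex.I * lam q₀ ζ * x)) • jcore q₀ p d pinf ζ x

/-- The characterization of `φ_{+,1}`. -/
def IsRightJost (q₀ : ℝ) (p : ℝ → ℂ) (d : ℝ → ℝ) (pinf ζ : ℂ) (φ : ℝ → Fin 2 → ℂ) : Prop :=
  IsZSSol p d (kappa q₀ ζ) φ ∧
    Tendsto (fun x : ℝ => Complex.exp (Complex.I * lam q₀ ζ * x) • φ x) atTop (𝓝 (asymV pinf ζ))

variable {q₀ : ℝ} {p : ℝ → ℂ} {d : ℝ → ℝ} {pinf : ℂ}

lemma firstMoment_pertP (h : RightPotential q₀ p d pinf) : FirstMoment (pertP p d pinf) := by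
  have hc : Continuous (pertP p d pinf) := by
    unfold pertP
    simp_rw [mulCLM_eq (-Complex.I * _)]
    have := h.cont_p
    have := h.momd.cont
    have hcc : Continuous fun y => conj (p y - pinf) := Complex.continuous_conj.comp (by fun_prop)
    fun_prop
  refine ⟨hc, ((h.momp.int.const_mul 2).add (h.momd.int.const_mul 2)).mono'
    (by fun_prop) (ae_of_all _ fun y => ?_)⟩
  have h1 := norm_mulCLM_le (-Complex.I * d y) (p y - pinf) (conj (p y - pinf)) (Complex.I * d y)
  simp only [norm_mul, norm_neg, Complex.norm_I, one_mul, RCLike.norm_conj, Complex.norm_real] at h1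
  rw [Real.norm_of_nonneg (by positivity)]
  calc (1 + |y|) * ‖pertP p d pinf y‖ ≤ (1 + |y|) * (‖d y‖ + ‖p y - pinf‖ + ‖p y - pinf‖ + ‖d y‖) := by
        gcongr; exact h1
    _ = _ := by simp only [Pi.add_apply]; ring

/-- The matrix has trace 2iλ and determinant q₀² − |p_∞|² = 0, so Cayley-Hamilton gives M² = 2iλM.
Its norm is at most 4|λ| + 4q₀; the bound of λ·ek serves the first summand and the bound of ek the
second, so 5 + 4q₀ works for all ζ. -/
lemma constPart_constM (h : RightPotential q₀ p d pinf) {ζ : ℂ} (hζ : ζ ≠ 0) (him : ζ.im ≤ 0) :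
    ConstPart (5 + 4 * q₀) (lam q₀ ζ) (constM q₀ pinf ζ) := by
  refine ⟨lam_im_nonpos q₀ him, fun v => ?_, fun s hs => ?_⟩
  · have h1 := h.conj_mul_inf
    have h2 : 2 * Complex.I * lam q₀ ζ = Complex.I * ζ - Complex.I * ((q₀ : ℂ) ^ 2 / ζ) := by
      unfold lam; ring
    rw [h2]
    ext i
    fin_cases i
    · simp [constM, mulCLM_apply, Matrix.mulVec, dotProduct, Fin.sum_univ_two]
      field_simp
      linear_combination (v 0 * ζ ^ 2) * h1 + ((q₀:ℂ) ^ 2 * ζ ^ 2 * v 0) * Complex.I_sq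
    · simp [constM, mulCLM_apply, Matrix.mulVec, dotProduct, Fin.sum_univ_two]
      field_simp
      linear_combination (v 1 * ζ) * h1 + ((q₀:ℂ) ^ 2 * ζ * v 1) * Complex.I_sq
  · have hM : ‖constM q₀ pinf ζ‖ ≤ 4 * ‖lam q₀ ζ‖ + 4 * q₀ := by
      refine (norm_mulCLM_le _ _ _ _).trans ?_
      rw [← kappa_sub_lam q₀ ζ]
      have h1 : ‖Complex.I * ζ‖ ≤ ‖kappa q₀ ζ‖ + ‖lam q₀ ζ‖ := by
        rw [norm_mul, Complex.norm_I, one_mul]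
        conv_lhs => rw [← kappa_add_lam q₀ ζ]
        exact norm_add_le _ _
      have h2 : ‖-Complex.I * (kappa q₀ ζ - lam q₀ ζ)‖ ≤ ‖kappa q₀ ζ‖ + ‖lam q₀ ζ‖ := by
        rw [norm_mul, norm_neg, Complex.norm_I, one_mul]
        exact norm_sub_le _ _
      have h3 := norm_kappa_le h.pos hζ
      rw [RCLike.norm_conj, h.norm_inf]
      linarith
    have h1 := norm_ek_le (lam_im_nonpos q₀ him) hs
    have h2 := norm_mul_ek_le (lam_im_nonpos q₀ him) hs
    have h3 := h.pos
    calc 1 + ‖ek (lam q₀ ζ) s‖ * ‖constM q₀ pinf ζ‖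
        ≤ 1 + ‖ek (lam q₀ ζ) s‖ * (4 * ‖lam q₀ ζ‖ + 4 * q₀) := by gcongr
      _ = 1 + 4 * (‖lam q₀ ζ‖ * ‖ek (lam q₀ ζ) s‖) + 4 * q₀ * ‖ek (lam q₀ ζ) s‖ := by ring
      _ ≤ 1 + 4 * 1 + 4 * q₀ * |s| := by gcongr
      _ ≤ (5 + 4 * q₀) * (1 + |s|) := by nlinarith [abs_nonneg s]

lemma norm_asymV_le (h : RightPotential q₀ p d pinf) (ζ : ℂ) : ‖asymV pinf ζ‖ ≤ 1 + q₀ / ‖ζ‖ := by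
  have := h.pos
  rw [pi_norm_le_iff_of_nonneg (by positivity), Fin.forall_fin_two]
  simp only [asymV, Matrix.cons_val_zero, Matrix.cons_val_one, Matrix.cons_val_fin_one, norm_one, norm_div, norm_mul,
    Complex.norm_I, one_mul, RCLike.norm_conj, h.norm_inf]
  constructor
  · have : 0 ≤ q₀ / ‖ζ‖ := by positivity
    linarith
  · linarith

lemma constM_asymV (h : RightPotential q₀ p d pinf) {ζ : ℂ} (hζ : ζ ≠ 0) :
    constM q₀ pinf ζ (asymV pinf ζ) = 0 := by
  have h1 := h.conj_mul_inf
  ext i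
  fin_cases i
  · simp [constM, asymV, mulCLM_apply, Matrix.mulVec, dotProduct, Fin.sum_univ_two]
    field_simp
    linear_combination Complex.I * h1
  · simp [constM, asymV, mulCLM_apply, Matrix.mulVec, dotProduct, Fin.sum_univ_two]
    field_simp
    simp

lemma hasDerivAt_jcore (h : RightPotential q₀ p d pinf) {ζ : ℂ} (hζ : ζ ≠ 0) (him : ζ.im ≤ 0) (x : ℝ) :
    HasDerivAt (fun y => jcore q₀ p d pinf ζ y 0)
      (-Complex.I * ((q₀ : ℂ) ^ 2 / ζ + d x) * jcore q₀ p d pinf ζ x 0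
        + p x * jcore q₀ p d pinf ζ x 1) x ∧
    HasDerivAt (fun y => jcore q₀ p d pinf ζ y 1)
      (conj (p x) * jcore q₀ p d pinf ζ x 0
        + Complex.I * (ζ + d x) * jcore q₀ p d pinf ζ x 1) x := by
  have h1 := hasDerivAt_vsol (firstMoment_pertP h) (constPart_constM h hζ him) (constM_asymV h hζ) x
  rw [hasDerivAt_pi, Fin.forall_fin_two] at h1
  refine ⟨h1.1.congr_deriv ?_, h1.2.congr_deriv ?_⟩
  · simp [constM, pertP, jcore, mulCLM_apply, dotProduct, Fin.sum_univ_two]; ring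
  · simp [constM, pertP, jcore, mulCLM_apply, dotProduct, Fin.sum_univ_two]; ring

lemma hasDerivAt_exp_mul (c : ℂ) (x : ℝ) :
    HasDerivAt (fun x : ℝ => Complex.exp (c * x)) (c * Complex.exp (c * x)) x := by
  have := ((Complex.ofRealCLM.hasDerivAt (x := x)).const_mul c).cexp
  simpa [mul_comm] using this

lemma isRightJost_rjost (h : RightPotential q₀ p d pinf) {ζ : ℂ} (hζ : ζ ≠ 0) (him : ζ.im ≤ 0) :
    IsRightJost q₀ p d pinf ζ (rjost q₀ p d pinf ζ) := by
  constructor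
  · rw [isZSSol_iff]
    intro x
    obtain ⟨h0, h1⟩ := hasDerivAt_jcore h hζ him x
    have he := hasDerivAt_exp_mul (-(Complex.I * lam q₀ ζ)) x
    simp only [neg_mul] at he
    have e1 := kappa_sub_lam q₀ ζ
    have e2 := kappa_add_lam q₀ ζ
    rw [← e1] at h0
    have e3 : Complex.I * (ζ + d x) = Complex.I * (kappa q₀ ζ + lam q₀ ζ + d x) := by rw [e2]
    rw [e3] at h1
    constructor
    · refine (he.mul h0).congr_deriv ?_
      simp only [rjost, Pi.smul_apply, smul_eq_mul]; ring
    · refine (he.mul h1).congr_deriv ?_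
      simp only [rjost, Pi.smul_apply, smul_eq_mul]; ring
  · refine (tendsto_vsol (firstMoment_pertP h) (constPart_constM h hζ him) _).congr fun x => ?_
    rw [rjost, smul_smul, ← Complex.exp_add, add_neg_cancel, Complex.exp_zero, one_smul]; rfl

lemma exists_norm_jcore_le (h : RightPotential q₀ p d pinf) (x₀ : ℝ) :
    ∃ B, 0 ≤ B ∧ ∀ x, x₀ ≤ x → ∀ ζ : ℂ, ζ ≠ 0 → ζ.im ≤ 0 →
      ‖jcore q₀ p d pinf ζ x‖ ≤ B * (1 + q₀ / ‖ζ‖) := by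
  refine ⟨Real.exp (momentTail (pertP p d pinf) (5 + 4 * q₀) x₀ x₀), (Real.exp_pos _).le,
    fun x hx ζ hζ him => ?_⟩
  refine (norm_vsol_le (firstMoment_pertP h) (constPart_constM h hζ him) _ hx).trans ?_
  rw [mul_comm]
  gcongr
  exact norm_asymV_le h ζ

/-- The point R does not depend on ζ. The analysis for large ζ starts at such a point and works back
to x on a compact interval. -/
lemma jcore_sub_asymV_small (h : RightPotential q₀ p d pinf) {ε : ℝ} (hε : 0 < ε) (x₀ : ℝ) :
    ∃ R, x₀ ≤ R ∧ ∀ x, R ≤ x → ∀ ζ : ℂ, ζ ≠ 0 → ζ.im ≤ 0 →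
      ‖jcore q₀ p d pinf ζ x - asymV pinf ζ‖ ≤ ε * (1 + q₀ / ‖ζ‖) := by
  have hC : (0:ℝ) ≤ 5 + 4 * q₀ := by have := h.pos; positivity
  have h1 := ((Real.continuous_exp.tendsto 0).comp
    (tendsto_momentTail_diag (firstMoment_pertP h) hC)).sub_const 1
  rw [Real.exp_zero, sub_self] at h1
  obtain ⟨R, hR⟩ := eventually_atTop.mp (h1.eventually (ge_mem_nhds hε))
  refine ⟨max R x₀, le_max_right _ _, fun x hx ζ hζ him => ?_⟩
  refine (norm_vsol_sub_le (firstMoment_pertP h) (constPart_constM h hζ him) _ (le_refl x)).trans ?_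
  rw [mul_comm]
  have := h.pos
  exact mul_le_mul (hR x ((le_max_left _ _).trans hx)) (norm_asymV_le h ζ) (norm_nonneg _) hε.le

lemma continuousOn_lam (q₀ : ℝ) : ContinuousOn (lam q₀) {0}ᶜ := by
  unfold lam
  exact (continuousOn_id.sub (continuousOn_const.div continuousOn_id fun z hz => hz)).div_const _

lemma differentiableOn_lam (q₀ : ℝ) : DifferentiableOn ℂ (lam q₀) {0}ᶜ := by
  unfold lam
  exact (differentiableOn_id.sub ((differentiableOn_const _).div differentiableOn_id
    fun z hz => hz)).div_const _

lemma differentiableOn_constM (q₀ : ℝ) (pinf : ℂ) : DifferentiableOn ℂ (constM q₀ pinf) {0}ᶜ := by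
  unfold constM
  simp_rw [mulCLM_eq (-Complex.I * _)]
  have h1 : DifferentiableOn ℂ (fun ζ : ℂ => -Complex.I * ((q₀ : ℂ) ^ 2 / ζ)) {0}ᶜ :=
    ((differentiableOn_const _).div differentiableOn_id fun z hz => hz).const_mul _
  fun_prop

lemma differentiableOn_asymV (pinf : ℂ) : DifferentiableOn ℂ (asymV pinf) {0}ᶜ := by
  rw [differentiableOn_pi, Fin.forall_fin_two]
  constructor
  · simp only [asymV, Matrix.cons_val_zero]; exact differentiableOn_const _
  · simp only [asymV, Matrix.cons_val_one, Matrix.cons_val_fin_one]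
    exact (differentiableOn_const _).div differentiableOn_id fun z hz => hz

lemma continuousOn_jcore (h : RightPotential q₀ p d pinf) (x : ℝ) :
    ContinuousOn (fun ζ => jcore q₀ p d pinf ζ x) {ζ | ζ ≠ 0 ∧ ζ.im ≤ 0} := by
  intro ζ₀ hζ₀
  have hr : 0 < ‖ζ₀‖ / 2 := by have := norm_pos_iff.mpr hζ₀.1; positivity
  have hZ : ∀ z ∈ {ζ : ℂ | ‖ζ₀‖ / 2 < ‖ζ‖ ∧ ζ.im ≤ 0}, z ≠ 0 := fun z hz h0 => by
    have h1 : ‖ζ₀‖ / 2 < ‖z‖ := hz.1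
    rw [h0, norm_zero] at h1
    linarith
  have hq := h.pos
  -- The asymptotic vector has to be bounded uniformly in the parameter, which fails near 0; hence
  -- the localization to |ζ| > |ζ₀|/2.
  have key := continuousOn_vsol (Z := {ζ : ℂ | ‖ζ₀‖ / 2 < ‖ζ‖ ∧ ζ.im ≤ 0}) (firstMoment_pertP h)
    (fun z hz => constPart_constM h (hZ z hz) hz.2) ((continuousOn_lam q₀).mono hZ)
    ((differentiableOn_constM q₀ pinf).continuousOn.mono hZ)
    ((differentiableOn_asymV pinf).continuousOn.mono hZ) (Gb := 1 + q₀ / (‖ζ₀‖ / 2))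
    (fun z hz => (norm_asymV_le h z).trans (by gcongr; exact hz.1.le)) x ζ₀
    ⟨by linarith, hζ₀.2⟩
  refine key.mono_of_mem_nhdsWithin ?_
  have : {ζ : ℂ | ‖ζ₀‖ / 2 < ‖ζ‖} ∈ 𝓝 ζ₀ :=
    (isOpen_lt continuous_const continuous_norm).mem_nhds (by rw [Set.mem_ofPred_eq]; linarith)
  filter_upwards [mem_nhdsWithin_of_mem_nhds this, self_mem_nhdsWithin] with z h1 h2
  exact ⟨h1, h2.2⟩

lemma differentiableOn_jcore (h : RightPotential q₀ p d pinf) (x : ℝ) :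
    DifferentiableOn ℂ (fun ζ => jcore q₀ p d pinf ζ x) {ζ | ζ.im < 0} := by
  intro ζ₀ hζ₀
  have hζ₀' : ζ₀.im < 0 := hζ₀
  have hne : ζ₀ ≠ 0 := fun h0 => by rw [h0] at hζ₀'; simp at hζ₀'
  have hr : 0 < ‖ζ₀‖ / 2 := by have := norm_pos_iff.mpr hne; positivity
  have hZ : ∀ z ∈ {ζ : ℂ | ‖ζ₀‖ / 2 < ‖ζ‖ ∧ ζ.im < 0}, z ≠ 0 := fun z hz h0 => by
    have h1 : ‖ζ₀‖ / 2 < ‖z‖ := hz.1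
    rw [h0, norm_zero] at h1
    linarith
  have hq := h.pos
  have hopen : IsOpen {ζ : ℂ | ‖ζ₀‖ / 2 < ‖ζ‖ ∧ ζ.im < 0} :=
    (isOpen_lt continuous_const continuous_norm).inter
      (isOpen_lt Complex.continuous_im continuous_const)
  have key := differentiableOn_vsol (Z := {ζ : ℂ | ‖ζ₀‖ / 2 < ‖ζ‖ ∧ ζ.im < 0}) hopen
    (firstMoment_pertP h)
    (fun z hz => constPart_constM h (hZ z hz) hz.2.le) ((differentiableOn_lam q₀).mono hZ)
    ((differentiableOn_constM q₀ pinf).mono hZ)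
    ((differentiableOn_asymV pinf).mono hZ) (Gb := 1 + q₀ / (‖ζ₀‖ / 2))
    (fun z hz => (norm_asymV_le h z).trans (by gcongr; exact hz.1.le)) x
  have hmem : ζ₀ ∈ {ζ : ℂ | ‖ζ₀‖ / 2 < ‖ζ‖ ∧ ζ.im < 0} := ⟨by linarith, hζ₀⟩
  exact (key.differentiableAt (hopen.mem_nhds hmem)).differentiableWithinAt

end Core

/-! ### Wronskians, uniqueness, symmetries -/

section Wronskian

variable {p : ℝ → ℂ} {d : ℝ → ℝ}

lemma continuous_mulCLM_zsX (hp : Continuous p) (hd : Continuous d) (k : ℂ) :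
    Continuous fun x => (mulCLM (zsX (p x) (d x) k)).restrictScalars ℝ := by
  have h1 : Continuous fun x => mulCLM (zsX (p x) (d x) k) := by
    unfold zsX
    simp_rw [mulCLM_eq (-Complex.I * _)]
    have : Continuous fun y => conj (p y) := Complex.continuous_conj.comp hp
    fun_prop
  exact (ContinuousLinearMap.restrictScalarsL ℂ (Fin 2 → ℂ) (Fin 2 → ℂ) ℝ ℝ).continuous.comp h1

lemma IsZSSol.unique (hp : Continuous p) (hd : Continuous d) {k : ℂ} {φ ψ : ℝ → Fin 2 → ℂ}
    (hφ : IsZSSol p d k φ) (hψ : IsZSSol p d k ψ) {x₀ : ℝ} (h0 : φ x₀ = ψ x₀) : φ = ψ :=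
  linear_ode_unique (continuous_mulCLM_zsX hp hd k) (fun x => hφ x) (fun x => hψ x) h0

lemma isZSSol_zero (k : ℂ) : IsZSSol p d k fun _ => 0 := fun x => by
  rw [Matrix.mulVec_zero]; exact hasDerivAt_const _ _

lemma IsZSSol.smul {k : ℂ} {φ : ℝ → Fin 2 → ℂ} (hφ : IsZSSol p d k φ) (c : ℂ) :
    IsZSSol p d k fun x => c • φ x := fun x => by
  rw [Matrix.mulVec_smul]; exact (hφ x).const_smul c

lemma IsZSSol.continuous {k : ℂ} {φ : ℝ → Fin 2 → ℂ} (hφ : IsZSSol p d k φ) : Continuous φ :=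
  continuous_iff_continuousAt.mpr fun x => (hφ x).continuousAt

/-- Two spectral parameters are allowed: equal ones give constancy of the Wronskian, different ones
give, after integration, its derivative in the parameter. -/
lemma hasDerivAt_wronskian {k k' : ℂ} {φ ψ : ℝ → Fin 2 → ℂ} (hφ : IsZSSol p d k φ)
    (hψ : IsZSSol p d k' ψ) (x : ℝ) :
    HasDerivAt (fun x => wronskian (φ x) (ψ x))
      (-Complex.I * (k - k') * (φ x 0 * ψ x 1 + φ x 1 * ψ x 0)) x := by
  obtain ⟨h0, h1⟩ := isZSSol_iff.mp hφ x
  obtain ⟨h2, h3⟩ := isZSSol_iff.mp hψ x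
  refine ((h0.mul h3).sub (h1.mul h2)).congr_deriv ?_
  ring

lemma wronskian_const {k : ℂ} {φ ψ : ℝ → Fin 2 → ℂ} (hφ : IsZSSol p d k φ)
    (hψ : IsZSSol p d k ψ) (x y : ℝ) : wronskian (φ x) (ψ x) = wronskian (φ y) (ψ y) :=
  is_const_of_deriv_eq_zero (fun x => (hasDerivAt_wronskian hφ hψ x).differentiableAt)
    (fun x => by rw [(hasDerivAt_wronskian hφ hψ x).deriv]; ring) x y

lemma exists_eq_smul_of_wronskian_eq_zero {v w : Fin 2 → ℂ} (hv : v ≠ 0) (h : wronskian v w = 0) :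
    ∃ c : ℂ, w = c • v := by
  unfold wronskian at h
  by_cases h0 : v 0 = 0
  · have h1 : v 1 ≠ 0 := fun h1 => hv (by ext i; fin_cases i <;> simp [h0, h1])
    refine ⟨w 1 / v 1, ?_⟩
    have hw : w 0 = 0 := by
      rw [h0, zero_mul, zero_sub, neg_eq_zero] at h
      exact (mul_eq_zero.mp h).resolve_left h1
    ext i; fin_cases i
    · simp [h0, hw]
    · simp [h1]
  · refine ⟨w 0 / v 0, ?_⟩
    ext i; fin_cases i
    · simp [h0]
    · simp; field_simp; linear_combination h

lemma wronskian_smul_smul (a b : ℂ) (v w : Fin 2 → ℂ) :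
    wronskian (a • v) (b • w) = a * b * wronskian v w := by
  simp [wronskian]; ring

/-- Exchange of the components followed by complex conjugation. -/
noncomputable def sconj (v : Fin 2 → ℂ) : Fin 2 → ℂ := ![conj (v 1), conj (v 0)]

lemma continuous_sconj : Continuous sconj := by
  unfold sconj
  refine continuous_pi fun i => ?_
  fin_cases i
  · exact Complex.continuous_conj.comp (continuous_apply 1)
  · exact Complex.continuous_conj.comp (continuous_apply 0)

lemma sconj_smul (c : ℂ) (v : Fin 2 → ℂ) : sconj (c • v) = conj c • sconj v := by
  ext i; fin_cases i <;> simp [sconj]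

lemma sconj_sconj (v : Fin 2 → ℂ) : sconj (sconj v) = v := by
  ext i; fin_cases i <;> simp [sconj]

lemma hasDerivAt_conj {f : ℝ → ℂ} {f' : ℂ} {x : ℝ} (h : HasDerivAt f f' x) :
    HasDerivAt (fun x => conj (f x)) (conj f') x :=
  (Complex.conjCLE : ℂ →L[ℝ] ℂ).hasFDerivAt.comp_hasDerivAt x h

lemma IsZSSol.sconj {k : ℂ} {φ : ℝ → Fin 2 → ℂ} (hφ : IsZSSol p d k φ) :
    IsZSSol p d (conj k) fun x => sconj (φ x) := by
  rw [isZSSol_iff] at hφ ⊢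
  intro x
  obtain ⟨h0, h1⟩ := hφ x
  refine ⟨(hasDerivAt_conj h1).congr_deriv ?_, (hasDerivAt_conj h0).congr_deriv ?_⟩
  · simp [KunduEckhaus.sconj]; ring
  · simp [KunduEckhaus.sconj]; ring

/-- Conservation of `|φ₁|² - |φ₂|²` for real spectral parameter. -/
lemma IsZSSol.normSq_sub_const {k : ℝ} {φ : ℝ → Fin 2 → ℂ} (hφ : IsZSSol p d k φ) (x y : ℝ) :
    ‖φ x 0‖ ^ 2 - ‖φ x 1‖ ^ 2 = ‖φ y 0‖ ^ 2 - ‖φ y 1‖ ^ 2 := by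
  have h1 := hφ.sconj
  rw [Complex.conj_ofReal] at h1
  have h2 := wronskian_const hφ h1 x y
  have h3 : ∀ v : Fin 2 → ℂ, wronskian v (KunduEckhaus.sconj v) = ((‖v 0‖ ^ 2 - ‖v 1‖ ^ 2 : ℝ) : ℂ) := fun v => by
    simp [wronskian, KunduEckhaus.sconj, Complex.mul_conj']
  rw [h3, h3] at h2
  exact_mod_cast h2

end Wronskian

/-! ### Uniqueness of the Jost solution and the inversion symmetry -/

section Jost

variable {q₀ : ℝ} {p : ℝ → ℂ} {d : ℝ → ℝ} {pinf : ℂ}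

lemma asymV_ne_zero (pinf ζ : ℂ) : asymV pinf ζ ≠ 0 := fun h => by
  have := congrFun h 0
  simp [asymV] at this

lemma IsRightJost.ne_zero (h : RightPotential q₀ p d pinf) {ζ : ℂ} {φ : ℝ → Fin 2 → ℂ}
    (hφ : IsRightJost q₀ p d pinf ζ φ) (x : ℝ) : φ x ≠ 0 := fun h0 => by
  have h1 := hφ.1.unique h.cont_p h.momd.cont (isZSSol_zero _) (x₀ := x) h0
  have h2 := hφ.2
  rw [h1] at h2
  simp only [smul_zero] at h2
  exact asymV_ne_zero pinf ζ (tendsto_nhds_unique h2 tendsto_const_nhds)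

lemma continuous_wronskian : Continuous fun q : (Fin 2 → ℂ) × (Fin 2 → ℂ) => wronskian q.1 q.2 := by
  unfold wronskian; fun_prop

/-- The Wronskian W of two candidates is constant while e^{2iλx}W tends to W[g, g] = 0, and
|e^{iλx}| ≥ 1 for x ≥ 0 because Im λ ≤ 0. So W = 0, the candidates are proportional, and the first
component of the normalization makes the factor 1. -/
lemma IsRightJost.unique (h : RightPotential q₀ p d pinf) {ζ : ℂ} (him : ζ.im ≤ 0)
    {φ ψ : ℝ → Fin 2 → ℂ} (hφ : IsRightJost q₀ p d pinf ζ φ) (hψ : IsRightJost q₀ p d pinf ζ ψ) :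
    φ = ψ := by
  set e := fun x : ℝ => Complex.exp (Complex.I * lam q₀ ζ * x) with he
  have h1 : Tendsto (fun x => wronskian (e x • φ x) (e x • ψ x)) atTop (𝓝 0) := by
    have := (continuous_wronskian.tendsto (asymV pinf ζ, asymV pinf ζ)).comp
      (hφ.2.prodMk_nhds hψ.2)
    have h0 : wronskian (asymV pinf ζ) (asymV pinf ζ) = 0 := by simp [wronskian, mul_comm]
    rw [← h0]; exact this
  have hW : wronskian (φ 0) (ψ 0) = 0 := by
    rw [← norm_eq_zero]
    refine le_antisymm (ge_of_tendsto h1.norm ?_ |>.trans (by simp)) (norm_nonneg _)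
    filter_upwards [eventually_ge_atTop 0] with x hx
    rw [wronskian_smul_smul, wronskian_const hφ.1 hψ.1 x 0, norm_mul]
    refine le_mul_of_one_le_left (norm_nonneg _) ?_
    rw [norm_mul, he, Complex.norm_exp]
    have : 0 ≤ (Complex.I * lam q₀ ζ * x).re := by
      have := lam_im_nonpos q₀ him
      simp
      nlinarith
    nlinarith [Real.one_le_exp this]
  obtain ⟨c, hc⟩ := exists_eq_smul_of_wronskian_eq_zero (hφ.ne_zero h 0) hW
  have h2 : ψ = fun x => c • φ x :=
    hψ.1.unique h.cont_p h.momd.cont (hφ.1.smul c) (x₀ := 0) hc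
  have h3 : Tendsto (fun x => e x • ψ x) atTop (𝓝 (c • asymV pinf ζ)) := by
    rw [h2]
    refine (hφ.2.const_smul c).congr fun x => ?_
    rw [smul_comm]
  have h4 := congrFun (tendsto_nhds_unique hψ.2 h3) 0
  simp [asymV] at h4
  rw [h2, ← h4]
  simp

lemma IsRightJost.eq_rjost (h : RightPotential q₀ p d pinf) {ζ : ℂ} (hζ : ζ ≠ 0) (him : ζ.im ≤ 0)
    {φ : ℝ → Fin 2 → ℂ} (hφ : IsRightJost q₀ p d pinf ζ φ) : φ = rjost q₀ p d pinf ζ :=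
  hφ.unique h him (isRightJost_rjost h hζ him)

/-- The inversion symmetry `ζ ↦ q₀² / conj ζ`. -/
lemma sconj_rjost_inv (h : RightPotential q₀ p d pinf) {ζ : ℂ} (hζ : ζ ≠ 0) (him : ζ.im ≤ 0) (x : ℝ) :
    sconj (rjost q₀ p d pinf ((q₀ : ℂ) ^ 2 / conj ζ) x) =
      (-Complex.I * pinf * ζ / (q₀ : ℂ) ^ 2) • rjost q₀ p d pinf ζ x := by
  have hq := h.q_ne
  have hpi := h.inf_ne
  set ζ' := (q₀ : ℂ) ^ 2 / conj ζ with hζ'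
  have hcz : conj ζ ≠ 0 := by simpa using hζ
  have hζ'0 : ζ' ≠ 0 := div_ne_zero (pow_ne_zero 2 hq) hcz
  have him' : ζ'.im ≤ 0 := by
    have : ζ' = ((q₀ ^ 2 / Complex.normSq ζ : ℝ) : ℂ) * ζ := by
      rw [hζ']
      push_cast
      rw [div_mul_eq_mul_div, div_eq_div_iff hcz (by simpa using hζ), mul_assoc, Complex.mul_conj]
    rw [this, Complex.im_ofReal_mul]
    exact mul_nonpos_of_nonneg_of_nonpos (div_nonneg (sq_nonneg _) (Complex.normSq_nonneg _)) him
  have hJ := isRightJost_rjost h hζ'0 him'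
  -- The factor is forced by the first component of the asymptotic vectors: the conjugate of i conj
  -- p_∞/ζ' is −i p_∞ ζ/q₀².
  set c := -Complex.I * pinf * ζ / (q₀ : ℂ) ^ 2 with hc
  have hc0 : c ≠ 0 := by
    rw [hc]; simp [hpi, hζ, h.pos.ne']
  have hlam : lam q₀ ζ' = -conj (lam q₀ ζ) := by rw [hζ', lam_inv h.pos.ne', conj_lam]
  have hkap : conj (kappa q₀ ζ') = kappa q₀ ζ := by
    rw [hζ', kappa_inv h.pos.ne', conj_kappa, Complex.conj_conj]
  have hnew : IsRightJost q₀ p d pinf ζ fun x => c⁻¹ • sconj (rjost q₀ p d pinf ζ' x) := by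
    constructor
    · have := hJ.1.sconj
      rw [hkap] at this
      exact this.smul _
    · have h1 := ((continuous_sconj.tendsto _).comp hJ.2).const_smul c⁻¹
      have h2 : c⁻¹ • sconj (asymV pinf ζ') = asymV pinf ζ := by
        rw [inv_smul_eq_iff₀ hc0]
        have h3 := h.conj_mul_inf
        ext i; fin_cases i
        · simp [sconj, asymV, hζ', hc]; field_simp
        · simp [sconj, asymV, hc]; field_simp
          linear_combination (-1 : ℂ) * h3 + (conj pinf * pinf) * Complex.I_sq
      rw [h2] at h1
      refine h1.congr fun x => ?_
      simp only [Function.comp_apply, sconj_smul]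
      rw [smul_comm, ← Complex.exp_conj]
      congr 3
      simp [hlam]
  have := congrFun (hnew.eq_rjost h hζ him) x
  rw [← this, smul_smul, mul_inv_cancel₀ hc0, one_smul]

/-- On the circle `|ζ| = q₀` the inversion symmetry is local. -/
lemma sconj_rjost_circle (h : RightPotential q₀ p d pinf) {ζ : ℂ} (hn : ‖ζ‖ = q₀) (him : ζ.im ≤ 0)
    (x : ℝ) : sconj (rjost q₀ p d pinf ζ x) =
      (-Complex.I * pinf * ζ / (q₀ : ℂ) ^ 2) • rjost q₀ p d pinf ζ x := by
  have hζ : ζ ≠ 0 := by rw [← norm_pos_iff, hn]; exact h.pos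
  have := sconj_rjost_inv h hζ him x
  have h2 : (q₀ : ℂ) ^ 2 / conj ζ = ζ := by
    rw [div_eq_iff (by simpa using hζ), Complex.mul_conj', hn]
  rwa [h2] at this

end Jost

/-! ### Behaviour at infinity -/

section Infinity

variable {q₀ : ℝ} {p : ℝ → ℂ} {d : ℝ → ℝ} {pinf : ℂ}

/-- `∫_x^∞ d`. -/
noncomputable def tailD (d : ℝ → ℝ) (x : ℝ) : ℝ := ∫ y in Set.Ioi x, d y

lemma hasDerivAt_tailD (h : RightPotential q₀ p d pinf) (x : ℝ) :
    HasDerivAt (tailD d) (-d x) x :=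
  hasDerivAt_integral_Ioi h.momd.cont h.momd.integrableOn' x

lemma tendsto_tailD (h : RightPotential q₀ p d pinf) : Tendsto (tailD d) atTop (𝓝 0) :=
  tendsto_integral_Ioi_atTop h.momd.integrableOn'

/-- First-order integration by parts for the second component. -/
lemma exists_secondary_bound (h : RightPotential q₀ p d pinf) (x R : ℝ) :
    ∃ C, 0 ≤ C ∧ ∀ a b, x ≤ a → a ≤ b → b ≤ R → ∀ ζ : ℂ, q₀ ≤ ‖ζ‖ → ζ.im ≤ 0 →
      ‖jcore q₀ p d pinf ζ a 1 + conj (p a) * jcore q₀ p d pinf ζ a 0 / (Complex.I * ζ)‖ ≤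
      ‖jcore q₀ p d pinf ζ b 1 + conj (p b) * jcore q₀ p d pinf ζ b 0 / (Complex.I * ζ)‖ *
        Real.exp (ζ.im * (b - a)) + C / ‖ζ‖ * (b - a) := by
  obtain ⟨B, hB0, hB⟩ := exists_norm_jcore_le h x
  obtain ⟨Cp, hCp0, hCp⟩ := exists_norm_le_of_continuous h.cont_p (max |x| |R|)
  obtain ⟨Cd, hCd0, hCd⟩ := exists_norm_le_of_continuous h.momd.cont (max |x| |R|)
  obtain ⟨Cq, hCq0, hCq⟩ := exists_norm_le_of_continuous
    (h.contDiff.continuous_deriv (le_refl 1)) (max |x| |R|)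
  have hq := h.pos
  set C := Cd * Cp * (B * 2) + (Cq * (B * 2) + Cp * ((q₀ + Cd) * (B * 2) + Cp * (B * 2))) with hC
  refine ⟨C, by positivity, fun a b hxa hab hbR ζ hζn him => ?_⟩
  have hζ : ζ ≠ 0 := by rw [← norm_pos_iff]; linarith
  have hζp : 0 < ‖ζ‖ := norm_pos_iff.mpr hζ
  -- The correction cancels the source conj p · m₁ of the second equation. What remains is n' = i(ζ
  -- + d)n + r with r of order 1/ζ; this is where p is differentiated.
  set n := fun y : ℝ => jcore q₀ p d pinf ζ y 1 +
    conj (p y) * jcore q₀ p d pinf ζ y 0 / (Complex.I * ζ) with hn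
  -- A primitive of ζ + d. Because d is real, the modulus of the integrating factor e^{−iS} sees
  -- only Im ζ.
  set S := fun y : ℝ => ζ * y - tailD d y with hS
  set r := fun y : ℝ => (-(Complex.I * d y) * (conj (p y) * jcore q₀ p d pinf ζ y 0) +
    (conj (deriv p y) * jcore q₀ p d pinf ζ y 0 + conj (p y) *
      (-Complex.I * ((q₀ : ℂ) ^ 2 / ζ + d y) * jcore q₀ p d pinf ζ y 0
        + p y * jcore q₀ p d pinf ζ y 1))) / (Complex.I * ζ) with hr
  have hpd : ∀ y, HasDerivAt p (deriv p y) y := fun y =>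
    (h.contDiff.differentiable (by norm_num) y).hasDerivAt
  have hSd : ∀ y, HasDerivAt S (ζ + d y) y := fun y => by
    have h1 : HasDerivAt (fun y : ℝ => ζ * (y:ℂ)) ζ y := by
      simpa using (Complex.ofRealCLM.hasDerivAt (x := y)).const_mul ζ
    have h2 : HasDerivAt (fun y : ℝ => ((tailD d y : ℝ) : ℂ)) ((-d y : ℝ) : ℂ) y :=
      (hasDerivAt_tailD h y).ofReal_comp
    refine (h1.sub h2).congr_deriv ?_
    push_cast; ring
  have hnd : ∀ y, HasDerivAt n (Complex.I * (ζ + d y) * n y + r y) y := fun y => by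
    obtain ⟨h0, h1⟩ := hasDerivAt_jcore h hζ him y
    refine (h1.add (((hasDerivAt_conj (hpd y)).mul h0).div_const (Complex.I * ζ))).congr_deriv ?_
    simp only [hn, hr]
    have := Complex.I_ne_zero
    field_simp
    ring
  have hνd : ∀ y, HasDerivAt (fun y => Complex.exp (-(Complex.I * S y)) * n y)
      (Complex.exp (-(Complex.I * S y)) * r y) y := fun y => by
    have h1 : HasDerivAt (fun y => -(Complex.I * S y)) (-(Complex.I * (ζ + d y))) y :=
      ((hSd y).const_mul Complex.I).neg
    refine (h1.cexp.mul (hnd y)).congr_deriv ?_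
    ring
  have hexp : ∀ y, ‖Complex.exp (-(Complex.I * S y))‖ = Real.exp (ζ.im * y) := fun y => by
    rw [Complex.norm_exp]
    congr 1
    simp [hS]
  have hm : ∀ y, x ≤ y → ‖jcore q₀ p d pinf ζ y‖ ≤ B * 2 := fun y hy => by
    refine (hB y hy ζ hζ him).trans ?_
    have : q₀ / ‖ζ‖ ≤ 1 := (div_le_one hζp).mpr hζn
    gcongr
    linarith
  have hrb : ∀ y, x ≤ y → y ≤ R → ‖r y‖ ≤ C / ‖ζ‖ := fun y hy hyR => by
    have hyM : |y| ≤ max |x| |R| := abs_le_max_abs_abs hy hyR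
    have m0 : ‖jcore q₀ p d pinf ζ y 0‖ ≤ B * 2 := (norm_le_pi_norm _ 0).trans (hm y hy)
    have m1 : ‖jcore q₀ p d pinf ζ y 1‖ ≤ B * 2 := (norm_le_pi_norm _ 1).trans (hm y hy)
    have hpy := hCp y hyM
    have hdy := hCd y hyM
    have hqy := hCq y hyM
    have e1 : ‖(q₀ : ℂ) ^ 2 / ζ + d y‖ ≤ q₀ + Cd := by
      refine (norm_add_le _ _).trans (add_le_add ?_ (by simpa using hdy))
      rw [norm_div, norm_pow, Complex.norm_real, Real.norm_of_nonneg hq.le, div_le_iff₀ hζp]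
      nlinarith
    rw [hr]
    simp only
    rw [norm_div, norm_mul, Complex.norm_I, one_mul]
    gcongr
    refine (norm_add_le _ _).trans (add_le_add ?_ ((norm_add_le _ _).trans (add_le_add ?_ ?_)))
    · rw [norm_mul, norm_neg, norm_mul, norm_mul, Complex.norm_I, one_mul, RCLike.norm_conj,
        Complex.norm_real, mul_assoc]
      gcongr
    · rw [norm_mul, RCLike.norm_conj]
      gcongr
    · rw [norm_mul, RCLike.norm_conj]
      gcongr
      refine (norm_add_le _ _).trans (add_le_add ?_ ?_)
      · rw [norm_mul, norm_mul, norm_neg, Complex.norm_I, one_mul]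
        gcongr
      · rw [norm_mul]; gcongr
  have hC0 : 0 ≤ C := by positivity
  have key := norm_image_sub_le_of_norm_deriv_le_segment'
    (f := fun y => Complex.exp (-(Complex.I * S y)) * n y) (a := a) (b := b)
    (C := Real.exp (ζ.im * a) * (C / ‖ζ‖))
    (fun y _ => (hνd y).hasDerivWithinAt) (fun y hy => by
      rw [norm_mul, hexp]
      exact mul_le_mul (Real.exp_le_exp.mpr (by have := hy.1; nlinarith))
        (hrb y (hxa.trans hy.1) (hy.2.le.trans hbR)) (norm_nonneg _) (Real.exp_pos _).le) b ⟨hab, le_rfl⟩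
  have h3 : Real.exp (ζ.im * a) * ‖n a‖ ≤ Real.exp (ζ.im * b) * ‖n b‖ +
      Real.exp (ζ.im * a) * (C / ‖ζ‖) * (b - a) := by
    have h4 := norm_le_insert' (Complex.exp (-(Complex.I * S a)) * n a)
      (Complex.exp (-(Complex.I * S b)) * n b)
    rw [norm_sub_rev] at h4
    rw [norm_mul, norm_mul, hexp, hexp] at h4
    linarith
  have h5 : Real.exp (ζ.im * b) = Real.exp (ζ.im * a) * Real.exp (ζ.im * (b - a)) := by
    rw [← Real.exp_add]; ring_nf
  rw [h5] at h3
  have h6 := Real.exp_pos (ζ.im * a)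
  refine le_of_mul_le_mul_left ?_ h6
  calc Real.exp (ζ.im * a) * ‖n a‖ ≤ _ := h3
    _ = _ := by ring

/-- Far to the right the second component is close to its asymptotic value, of size q₀/|ζ|,
uniformly in ζ. The secondary bound carries this back to x with errors of order 1/|ζ|. Uniformity in
y is needed because the result is integrated in `tendsto_jcore_zero`. -/
lemma exists_jcore_one_small (h : RightPotential q₀ p d pinf) (x R₁ : ℝ) {ε : ℝ} (hε : 0 < ε) :
    ∃ M, ∀ ζ : ℂ, M ≤ ‖ζ‖ → ζ.im ≤ 0 → ∀ y, x ≤ y → y ≤ R₁ → ‖jcore q₀ p d pinf ζ y 1‖ ≤ ε := by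
  obtain ⟨R, hR1, hR⟩ := jcore_sub_asymV_small h (ε := ε / 8) (by positivity) (max x R₁)
  obtain ⟨C, hC0, hC⟩ := exists_secondary_bound h x R
  obtain ⟨B, hB0, hB⟩ := exists_norm_jcore_le h x
  obtain ⟨Cp, hCp0, hCp⟩ := exists_norm_le_of_continuous h.cont_p (max |x| |R|)
  have hq := h.pos
  have hxR : x ≤ R := (le_max_left _ _).trans hR1
  set K := q₀ + 2 * (Cp * (B * 2)) + C * (R - x) with hK
  have hK0 : 0 ≤ K := by have : 0 ≤ R - x := by linarith
                         positivity
  refine ⟨max q₀ (2 * K / ε), fun ζ hζM him y hy hy1 => ?_⟩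
  have hζn : q₀ ≤ ‖ζ‖ := (le_max_left _ _).trans hζM
  have hζp : 0 < ‖ζ‖ := by linarith
  have hζ : ζ ≠ 0 := norm_pos_iff.mp hζp
  have hq1 : q₀ / ‖ζ‖ ≤ 1 := (div_le_one hζp).mpr hζn
  have hKε : K / ‖ζ‖ ≤ ε / 2 := by
    have h1 : 2 * K / ε ≤ ‖ζ‖ := (le_max_right _ _).trans hζM
    rw [div_le_iff₀ hε] at h1
    rw [div_le_iff₀ hζp]; linarith
  have hyR : y ≤ R := hy1.trans ((le_max_right _ _).trans hR1)
  have hpm : ∀ y, x ≤ y → y ≤ R → ‖conj (p y) * jcore q₀ p d pinf ζ y 0 / (Complex.I * ζ)‖ ≤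
      Cp * (B * 2) / ‖ζ‖ := fun y hy hyR => by
    rw [norm_div, norm_mul, norm_mul, Complex.norm_I, one_mul, RCLike.norm_conj]
    gcongr
    · exact hCp y (abs_le_max_abs_abs hy hyR)
    · refine (norm_le_pi_norm _ 0).trans ((hB y hy ζ hζ him).trans ?_)
      gcongr; linarith
  have h1 := hC y R hy hyR le_rfl ζ hζn him
  have h2 : ‖jcore q₀ p d pinf ζ R 1‖ ≤ q₀ / ‖ζ‖ + ε / 4 := by
    have e1 := (norm_le_pi_norm (jcore q₀ p d pinf ζ R - asymV pinf ζ) 1).trans (hR R le_rfl ζ hζ him)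
    have e2 : ‖asymV pinf ζ 1‖ = q₀ / ‖ζ‖ := by simp [asymV, h.norm_inf]
    have e3 : ‖jcore q₀ p d pinf ζ R 1‖ ≤ ‖asymV pinf ζ 1‖ +
        ‖(jcore q₀ p d pinf ζ R - asymV pinf ζ) 1‖ := by
      rw [Pi.sub_apply]; exact norm_le_insert' _ _
    nlinarith
  have h3 : Real.exp (ζ.im * (R - y)) ≤ 1 := Real.exp_le_one_iff.mpr (by nlinarith)
  have h4 := norm_add_le (jcore q₀ p d pinf ζ R 1)
    (conj (p R) * jcore q₀ p d pinf ζ R 0 / (Complex.I * ζ))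
  have h5 := hpm R hxR le_rfl
  have h6 := hpm y hy hyR
  have h7 : ‖jcore q₀ p d pinf ζ y 1‖ ≤
      ‖jcore q₀ p d pinf ζ y 1 + conj (p y) * jcore q₀ p d pinf ζ y 0 / (Complex.I * ζ)‖ +
      ‖conj (p y) * jcore q₀ p d pinf ζ y 0 / (Complex.I * ζ)‖ := norm_le_add_norm_add _ _
  have h8 : C / ‖ζ‖ * (R - y) ≤ C * (R - x) / ‖ζ‖ := by
    rw [div_mul_eq_mul_div]; gcongr
  have h9 := mul_le_of_le_one_right (norm_nonneg (jcore q₀ p d pinf ζ R 1 +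
    conj (p R) * jcore q₀ p d pinf ζ R 0 / (Complex.I * ζ))) h3
  have h10 : K / ‖ζ‖ = q₀ / ‖ζ‖ + 2 * (Cp * (B * 2) / ‖ζ‖) + C * (R - x) / ‖ζ‖ := by rw [hK]; ring
  linarith

/-- The filter of large `ζ` in the closed lower half-plane. -/
noncomputable def lowerInf : Filter ℂ := cocompact ℂ ⊓ 𝓟 {ζ | ζ.im ≤ 0}

lemma eventually_lowerInf {P : ℂ → Prop} (h : ∃ M : ℝ, ∀ ζ : ℂ, M ≤ ‖ζ‖ → ζ.im ≤ 0 → P ζ) :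
    ∀ᶠ ζ in lowerInf, P ζ := by
  obtain ⟨M, hM⟩ := h
  have : ∀ᶠ ζ : ℂ in cocompact ℂ, M ≤ ‖ζ‖ := tendsto_norm_cocompact_atTop.eventually_ge_atTop M
  rw [lowerInf, eventually_inf_principal]
  filter_upwards [this] with ζ h1 h2 using hM ζ h1 h2

lemma tendsto_jcore_one (h : RightPotential q₀ p d pinf) (x : ℝ) :
    Tendsto (fun ζ => jcore q₀ p d pinf ζ x 1) lowerInf (𝓝 0) := by
  rw [Metric.tendsto_nhds]
  intro ε hε
  obtain ⟨M, hM⟩ := exists_jcore_one_small h x x (half_pos hε)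
  refine eventually_lowerInf ⟨M, fun ζ h1 h2 => ?_⟩
  rw [dist_zero_right]
  linarith [hM ζ h1 h2 x le_rfl le_rfl]

/-- The factor e^{−i tailD} removes d from the first equation; its remaining sources are q₀²m₁/ζ and
p m₂, both small for large ζ. Only the phase collected from d survives. -/
lemma tendsto_jcore_zero (h : RightPotential q₀ p d pinf) (x : ℝ) :
    Tendsto (fun ζ => jcore q₀ p d pinf ζ x 0) lowerInf
      (𝓝 (Complex.exp (Complex.I * tailD d x))) := by
  rw [Metric.tendsto_nhds]
  intro ε hε
  have hq := h.pos
  obtain ⟨B, hB0, hB⟩ := exists_norm_jcore_le h x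
  have hexpc : Tendsto (fun R => Complex.exp (-(Complex.I * tailD d R))) atTop (𝓝 1) := by
    have h1 : Tendsto (fun R => -(Complex.I * ((tailD d R : ℝ) : ℂ))) atTop (𝓝 (-(Complex.I * ((0:ℝ):ℂ)))) :=
      (((Complex.continuous_ofReal.tendsto 0).comp (tendsto_tailD h)).const_mul _).neg
    have := (Complex.continuous_exp.tendsto _).comp h1
    simpa [Function.comp_def] using this
  obtain ⟨R0, hR0⟩ := eventually_atTop.mp ((Metric.tendsto_nhds.mp hexpc) (ε / 5) (by positivity))
  obtain ⟨R, hR1, hR⟩ := jcore_sub_asymV_small h (ε := ε / 10) (by positivity) (max x R0)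
  have hxR : x ≤ R := (le_max_left _ _).trans hR1
  have hR0R : R0 ≤ R := (le_max_right _ _).trans hR1
  obtain ⟨Cp, hCp0, hCp⟩ := exists_norm_le_of_continuous h.cont_p (max |x| |R|)
  have hL : 0 ≤ R - x := by linarith
  obtain ⟨M, hM⟩ := exists_jcore_one_small h x R (ε := ε / (5 * (Cp * (R - x) + 1))) (by positivity)
  refine eventually_lowerInf ⟨max M (max q₀ (5 * (q₀ ^ 2 * (B * 2) * (R - x)) / ε)), fun ζ hζM him => ?_⟩
  have hζn : q₀ ≤ ‖ζ‖ := (le_max_left _ _).trans ((le_max_right _ _).trans hζM)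
  have hζp : 0 < ‖ζ‖ := by linarith
  have hζ : ζ ≠ 0 := norm_pos_iff.mp hζp
  have hq1 : q₀ / ‖ζ‖ ≤ 1 := (div_le_one hζp).mpr hζn
  have hsm := hM ζ ((le_max_left _ _).trans hζM) him
  set μ := fun y : ℝ => Complex.exp (-(Complex.I * tailD d y)) * jcore q₀ p d pinf ζ y 0 with hμ
  have hμd : ∀ y, HasDerivAt μ (Complex.exp (-(Complex.I * tailD d y)) *
      (-Complex.I * ((q₀ : ℂ) ^ 2 / ζ) * jcore q₀ p d pinf ζ y 0
        + p y * jcore q₀ p d pinf ζ y 1)) y := fun y => by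
    have h2 : HasDerivAt (fun y : ℝ => ((tailD d y : ℝ) : ℂ)) ((-d y : ℝ) : ℂ) y :=
      (hasDerivAt_tailD h y).ofReal_comp
    have h3 : HasDerivAt (fun y : ℝ => -(Complex.I * ((tailD d y : ℝ) : ℂ)))
        (-(Complex.I * ((-d y : ℝ) : ℂ))) y := (h2.const_mul Complex.I).neg
    refine (h3.cexp.mul (hasDerivAt_jcore h hζ him y).1).congr_deriv ?_
    push_cast; ring
  have hexp : ∀ y, ‖Complex.exp (-(Complex.I * tailD d y))‖ = 1 := fun y => by
    rw [Complex.norm_exp]; simp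
  have key := norm_image_sub_le_of_norm_deriv_le_segment' (f := μ) (a := x) (b := R)
    (C := q₀ ^ 2 / ‖ζ‖ * (B * 2) + Cp * (ε / (5 * (Cp * (R - x) + 1))))
    (fun y _ => (hμd y).hasDerivWithinAt) (fun y hy => by
      rw [norm_mul, hexp, one_mul]
      refine (norm_add_le _ _).trans (add_le_add ?_ ?_)
      · rw [norm_mul, norm_mul, norm_neg, Complex.norm_I, one_mul, norm_div, norm_pow,
          Complex.norm_real, Real.norm_of_nonneg hq.le]
        gcongr
        refine (norm_le_pi_norm _ 0).trans ((hB y hy.1 ζ hζ him).trans ?_)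
        gcongr; linarith
      · rw [norm_mul]
        gcongr
        · exact hCp y (abs_le_max_abs_abs hy.1 hy.2.le)
        · exact hsm y hy.1 hy.2.le) R ⟨hxR, le_rfl⟩
  have k1 : q₀ ^ 2 / ‖ζ‖ * (B * 2) * (R - x) ≤ ε / 5 := by
    have h1 : 5 * (q₀ ^ 2 * (B * 2) * (R - x)) / ε ≤ ‖ζ‖ :=
      (le_max_right _ _).trans ((le_max_right _ _).trans hζM)
    rw [div_le_iff₀ hε] at h1
    have : q₀ ^ 2 / ‖ζ‖ * (B * 2) * (R - x) = (q₀ ^ 2 * (B * 2) * (R - x)) / ‖ζ‖ := by ring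
    rw [this, div_le_iff₀ hζp]
    linarith
  have k2 : Cp * (ε / (5 * (Cp * (R - x) + 1))) * (R - x) ≤ ε / 5 := by
    have h1 : 0 ≤ Cp * (R - x) := by positivity
    have h2 : Cp * (ε / (5 * (Cp * (R - x) + 1))) * (R - x) =
      (ε / 5) * ((Cp * (R - x)) / (Cp * (R - x) + 1)) := by field_simp
    rw [h2]
    refine mul_le_of_le_one_right (by positivity) ((div_le_one (by positivity)).mpr (by linarith))
  have k3 : ‖jcore q₀ p d pinf ζ R 0 - 1‖ ≤ ε / 5 := by
    have e1 := (norm_le_pi_norm (jcore q₀ p d pinf ζ R - asymV pinf ζ) 0).trans (hR R le_rfl ζ hζ him)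
    have e2 : asymV pinf ζ 0 = 1 := by simp [asymV]
    rw [Pi.sub_apply, e2] at e1
    nlinarith
  have k4 : ‖μ R - 1‖ ≤ ε / 5 + ε / 5 := by
    have e1 : μ R - 1 = Complex.exp (-(Complex.I * tailD d R)) * (jcore q₀ p d pinf ζ R 0 - 1) +
        (Complex.exp (-(Complex.I * tailD d R)) - 1) := by rw [hμ]; ring
    rw [e1]
    refine (norm_add_le _ _).trans (add_le_add ?_ ?_)
    · rw [norm_mul, hexp, one_mul]; exact k3
    · rw [← dist_eq_norm]; exact (hR0 R hR0R).le
  have k5 : ‖μ x - 1‖ ≤ 4 * (ε / 5) := by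
    have e1 : μ x - 1 = (μ R - 1) - (μ R - μ x) := by ring
    rw [e1]
    refine (norm_sub_le _ _).trans ?_
    rw [add_mul] at key
    linarith
  have k6 : jcore q₀ p d pinf ζ x 0 - Complex.exp (Complex.I * tailD d x) =
      Complex.exp (Complex.I * tailD d x) * (μ x - 1) := by
    have e : Complex.exp (Complex.I * tailD d x) * Complex.exp (-(Complex.I * tailD d x)) = 1 := by
      rw [← Complex.exp_add, add_neg_cancel, Complex.exp_zero]
    rw [hμ]
    linear_combination (-(jcore q₀ p d pinf ζ x 0)) * e
  rw [dist_eq_norm, k6, norm_mul, mul_comm Complex.I, Complex.norm_exp_ofReal_mul_I, one_mul]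
  linarith

/-- The potential as the leading coefficient of the second component, along the negative
imaginary axis. -/
lemma tendsto_mul_jcore_one (h : RightPotential q₀ p d pinf) (x : ℝ) :
    Tendsto (fun η : ℝ => (-Complex.I * η) * jcore q₀ p d pinf (-Complex.I * η) x 1) atTop
      (𝓝 (Complex.I * conj (p x) * Complex.exp (Complex.I * tailD d x))) := by
  obtain ⟨C, hC0, hC⟩ := exists_secondary_bound h x (x + 1)
  obtain ⟨B, hB0, hB⟩ := exists_norm_jcore_le h x
  obtain ⟨Cp, hCp0, hCp⟩ := exists_norm_le_of_continuous h.cont_p (max |x| |x + 1|)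
  have hq := h.pos
  have hnorm : ∀ η : ℝ, 0 < η → ‖-Complex.I * (η : ℂ)‖ = η := fun η hη => by
    simp [abs_of_pos hη]
  have him : ∀ η : ℝ, (-Complex.I * (η : ℂ)).im = -η := fun η => by simp
  have htend : Tendsto (fun η : ℝ => -Complex.I * (η : ℂ)) atTop lowerInf := by
    rw [lowerInf, tendsto_inf, tendsto_principal]
    refine ⟨?_, ?_⟩
    · rw [← Metric.cobounded_eq_cocompact, ← tendsto_norm_atTop_iff_cobounded]
      refine tendsto_id.congr' ?_
      filter_upwards [eventually_gt_atTop 0] with η hη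
      rw [hnorm η hη, id]
    · filter_upwards [eventually_gt_atTop 0] with η hη
      rw [him]; linarith
  have h0 := (tendsto_jcore_zero h x).comp htend
  set n := fun η : ℝ => (-Complex.I * (η : ℂ)) * (jcore q₀ p d pinf (-Complex.I * η) x 1 +
    conj (p x) * jcore q₀ p d pinf (-Complex.I * η) x 0 / (Complex.I * (-Complex.I * η))) with hn
  have hn0 : Tendsto n atTop (𝓝 0) := by
    have hg : Tendsto (fun η : ℝ => (B * 2 + Cp * (B * 2)) * (η * Real.exp (-Real.sqrt η)) +
        C * (Real.sqrt η)⁻¹) atTop (𝓝 0) := by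
      have h1 : Tendsto (fun s : ℝ => s ^ 2 * Real.exp (-s)) atTop (𝓝 0) :=
        Real.tendsto_pow_mul_exp_neg_atTop_nhds_zero 2
      have h2 := h1.comp Real.tendsto_sqrt_atTop
      have h3 : Tendsto (fun η : ℝ => η * Real.exp (-Real.sqrt η)) atTop (𝓝 0) := by
        refine h2.congr' ?_
        filter_upwards [eventually_ge_atTop 0] with η hη
        simp [Real.sq_sqrt hη]
      have h4 := (tendsto_inv_atTop_zero.comp Real.tendsto_sqrt_atTop).const_mul C
      simpa using (h3.const_mul (B * 2 + Cp * (B * 2))).add h4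
    refine squeeze_zero_norm' ?_ hg
    filter_upwards [eventually_ge_atTop (max q₀ 1)] with η hη
    have hη1 : 1 ≤ η := (le_max_right _ _).trans hη
    have hηq : q₀ ≤ η := (le_max_left _ _).trans hη
    have hη0 : 0 < η := by linarith
    have hs0 : 0 < Real.sqrt η := Real.sqrt_pos.mpr hη0
    have hs1 : 1 ≤ Real.sqrt η := Real.one_le_sqrt.mpr hη1
    have hinv : (Real.sqrt η)⁻¹ ≤ 1 := inv_le_one_of_one_le₀ hs1
    have hinv0 : 0 ≤ (Real.sqrt η)⁻¹ := by positivity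
    have hne : -Complex.I * (η : ℂ) ≠ 0 := by rw [← norm_pos_iff, hnorm η hη0]; exact hη0
    -- The step length η^{−1/2} is a compromise: the damping e^{−√η} beats the prefactor η, while
    -- the accumulated error, of size C η^{−1/2}, still vanishes.
    have key := hC x (x + (Real.sqrt η)⁻¹) le_rfl (by linarith) (by linarith) (-Complex.I * η)
      (by rw [hnorm η hη0]; exact hηq) (by rw [him]; linarith)
    rw [hn]
    simp only
    rw [norm_mul, hnorm η hη0]
    rw [hnorm η hη0, him] at key
    have hb : ∀ y, x ≤ y → ‖jcore q₀ p d pinf (-Complex.I * η) y‖ ≤ B * 2 := fun y hy => by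
      refine (hB y hy _ hne (by rw [him]; linarith)).trans ?_
      rw [hnorm η hη0]
      have : q₀ / η ≤ 1 := (div_le_one hη0).mpr hηq
      gcongr; linarith
    have hb1 := hb (x + (Real.sqrt η)⁻¹) (by linarith)
    have k1 : ‖jcore q₀ p d pinf (-Complex.I * η) (x + (Real.sqrt η)⁻¹) 1 +
        conj (p (x + (Real.sqrt η)⁻¹)) * jcore q₀ p d pinf (-Complex.I * η) (x + (Real.sqrt η)⁻¹) 0 /
          (Complex.I * (-Complex.I * η))‖ ≤ B * 2 + Cp * (B * 2) := by
      refine (norm_add_le _ _).trans (add_le_add ((norm_le_pi_norm _ 1).trans hb1) ?_)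
      rw [norm_div, norm_mul, norm_mul, Complex.norm_I, one_mul, hnorm η hη0, RCLike.norm_conj]
      refine (div_le_self (by positivity) hη1).trans ?_
      gcongr
      · exact hCp _ (abs_le_max_abs_abs (by linarith) (by linarith))
      · exact (norm_le_pi_norm _ 0).trans hb1
    have k2 : -η * (x + (Real.sqrt η)⁻¹ - x) = -Real.sqrt η := by
      have : η * (Real.sqrt η)⁻¹ = Real.sqrt η := by
        nth_rewrite 1 [← Real.mul_self_sqrt hη0.le]; field_simp
      linear_combination (-1 : ℝ) * this
    rw [k2] at key
    calc _ ≤ η * ((B * 2 + Cp * (B * 2)) * Real.exp (-Real.sqrt η) +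
          C / η * (x + (Real.sqrt η)⁻¹ - x)) := by
          gcongr
          refine key.trans ?_
          gcongr
      _ = _ := by field_simp; ring
  have h1 := hn0.add (h0.const_mul (Complex.I * conj (p x)))
  rw [zero_add] at h1
  refine h1.congr' ?_
  filter_upwards [eventually_gt_atTop 0] with η hη
  have hηc : (η : ℂ) ≠ 0 := by exact_mod_cast hη.ne'
  have := Complex.I_ne_zero
  simp only [hn, Function.comp_apply]
  field_simp
  ring_nf
  simp

end Infinity

/-! ### Scattering on the line -/

/-- Exchange of the two components. -/
def swap2 (v : Fin 2 → ℂ) : Fin 2 → ℂ := ![v 1, v 0]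

lemma continuous_swap2 : Continuous swap2 := by
  unfold swap2
  refine continuous_pi fun i => ?_
  fin_cases i
  · simpa using continuous_apply 1
  · simpa using continuous_apply 0

lemma swap2_swap2 (v : Fin 2 → ℂ) : swap2 (swap2 v) = v := by
  ext i; fin_cases i <;> rfl

lemma swap2_smul (c : ℂ) (v : Fin 2 → ℂ) : swap2 (c • v) = c • swap2 v := by
  ext i; fin_cases i <;> rfl

lemma wronskian_sconj (v w : Fin 2 → ℂ) : wronskian (sconj v) (sconj w) = -conj (wronskian v w) := by
  simp [wronskian, sconj]

lemma wronskian_comm (v w : Fin 2 → ℂ) : wronskian v w = -wronskian w v := by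
  simp [wronskian]; ring

/-- The potential reflected at the origin. -/
def reflP (p : ℝ → ℂ) (x : ℝ) : ℂ := -conj (p (-x))

/-- The reflected diagonal perturbation. -/
def reflD (d : ℝ → ℝ) (x : ℝ) : ℝ := d (-x)

lemma reflP_reflP (p : ℝ → ℂ) : reflP (reflP p) = p := by
  ext x; simp [reflP]

lemma reflD_reflD (d : ℝ → ℝ) : reflD (reflD d) = d := by
  ext x; simp [reflD]

/-- Reversing x changes the sign of the coefficient matrix and swapping the components exchanges its
diagonal entries, so κ is preserved and only the off-diagonal entries change. Every statement about
the left end thus reduces to the right end. -/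
lemma IsZSSol.reflect {p : ℝ → ℂ} {d : ℝ → ℝ} {k : ℂ} {φ : ℝ → Fin 2 → ℂ} (hφ : IsZSSol p d k φ) :
    IsZSSol (reflP p) (reflD d) k fun x => swap2 (φ (-x)) := by
  rw [isZSSol_iff] at hφ ⊢
  intro x
  obtain ⟨h0, h1⟩ := hφ (-x)
  have hn : HasDerivAt (fun y : ℝ => -y) (-1) x := (hasDerivAt_id x).neg
  have h0' := h0.scomp x hn
  have h1' := h1.scomp x hn
  simp only [Function.comp_def] at h0' h1'
  constructor
  · refine h1'.congr_deriv ?_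
    simp [reflP, reflD, swap2]; ring
  · refine h0'.congr_deriv ?_
    simp [reflP, reflD, swap2]; ring

/-- The assumptions on a potential on the line. -/
structure LinePotential (q₀ : ℝ) (p : ℝ → ℂ) (d : ℝ → ℝ) (pp pm : ℂ) : Prop where
  right : RightPotential q₀ p d pp
  left : RightPotential q₀ (reflP p) (reflD d) (-conj pm)

/-- The Jost solution `φ_{-,2}(x, ζ)`, for `Im ζ ≤ 0`. -/
noncomputable def ljost (q₀ : ℝ) (p : ℝ → ℂ) (d : ℝ → ℝ) (pm ζ : ℂ) (x : ℝ) : Fin 2 → ℂ :=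
  swap2 (rjost q₀ (reflP p) (reflD d) (-conj pm) ζ (-x))

/-- The normalized Jost solution `e^{-iλx} φ_{-,2}(x, ζ)`, for `Im ζ ≤ 0`. -/
noncomputable def lcore (q₀ : ℝ) (p : ℝ → ℂ) (d : ℝ → ℝ) (pm ζ : ℂ) (x : ℝ) : Fin 2 → ℂ :=
  swap2 (jcore q₀ (reflP p) (reflD d) (-conj pm) ζ (-x))

lemma ljost_eq_smul_lcore (q₀ : ℝ) (p : ℝ → ℂ) (d : ℝ → ℝ) (pm ζ : ℂ) (x : ℝ) :
    ljost q₀ p d pm ζ x = Complex.exp (Complex.I * lam q₀ ζ * x) • lcore q₀ p d pm ζ x := by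
  simp [ljost, lcore, rjost, swap2_smul]

lemma lcore_eq_smul_ljost (q₀ : ℝ) (p : ℝ → ℂ) (d : ℝ → ℝ) (pm ζ : ℂ) (x : ℝ) :
    lcore q₀ p d pm ζ x = Complex.exp (-(Complex.I * lam q₀ ζ * x)) • ljost q₀ p d pm ζ x := by
  rw [ljost_eq_smul_lcore, smul_smul, ← Complex.exp_add]; simp

lemma jcore_eq_smul_rjost (q₀ : ℝ) (p : ℝ → ℂ) (d : ℝ → ℝ) (pp ζ : ℂ) (x : ℝ) :
    jcore q₀ p d pp ζ x = Complex.exp (Complex.I * lam q₀ ζ * x) • rjost q₀ p d pp ζ x := by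
  rw [rjost, smul_smul, ← Complex.exp_add]; simp

/-! ### Identification of the Jost columns of the statement -/

section Jost

variable {q₀ T α : ℝ} {q : ℝ → ℂ} {qinf ζ : ℂ}

/-- The diagonal perturbation of the Kundu-Eckhaus spectral problem. -/
noncomputable def kePert (q₀ T : ℝ) (q : ℝ → ℂ) (x : ℝ) : ℝ := T * (‖q x‖ ^ 2 - q₀ ^ 2)

/-- Since z = κ − Tq₀² − α/2, the diagonal z + T|q|² + α/2 equals κ + T(|q|² − q₀²): the
perturbation decays and α leaves the spectral problem. -/
lemma laxX_eq (q₀ T α : ℝ) (q : ℝ → ℂ) (ζ : ℂ) (x : ℝ) :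
    laxX q₀ T α q ζ x = zsX (q x) (kePert q₀ T q x) (kappa q₀ ζ) := by
  simp only [laxX, zsX, specZ, kePert]
  push_cast
  congr! 3 <;> ring_nf

lemma isJost_zero_atTop {ψ : ℝ → Fin 2 → ℂ} : IsJost q₀ T α q atTop qinf 0 ζ ψ ↔
    IsRightJost q₀ q (kePert q₀ T q) qinf ζ ψ := by
  have : (fun i => asymE qinf ζ i 0) = asymV qinf ζ := by
    ext i; fin_cases i <;> simp [asymE, asymV]
  simp only [IsJost, IsRightJost, IsZSSol, laxX_eq, this, sgn3, if_true, mul_one]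

lemma kePert_reflP (q₀ T : ℝ) (q : ℝ → ℂ) : kePert q₀ T (reflP q) = reflD (kePert q₀ T q) := by
  ext x; simp [kePert, reflP, reflD]

lemma IsJost.reflect {ψ : ℝ → Fin 2 → ℂ} (h : IsJost q₀ T α q atBot qinf 1 ζ ψ) :
    IsRightJost q₀ (reflP q) (reflD (kePert q₀ T q)) (-conj qinf) ζ fun x => swap2 (ψ (-x)) := by
  obtain ⟨h1, h2⟩ := h
  simp only [laxX_eq] at h1
  refine ⟨IsZSSol.reflect h1, ?_⟩
  have h3 := (continuous_swap2.tendsto _).comp (h2.comp tendsto_neg_atTop_atBot)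
  have h4 : swap2 (fun i => asymE qinf ζ i 1) = asymV (-conj qinf) ζ := by
    ext i; fin_cases i <;> simp [asymE, asymV, swap2]
  rw [h4] at h3
  refine h3.congr fun x => ?_
  simp [Function.comp_def, swap2_smul, sgn3]

lemma isJost_ljost (h : RightPotential q₀ (reflP q) (reflD (kePert q₀ T q)) (-conj qinf)) (hζ : ζ ≠ 0)
    (him : ζ.im ≤ 0) :
    IsJost q₀ T α q atBot qinf 1 ζ (ljost q₀ q (kePert q₀ T q) qinf ζ) := by
  obtain ⟨h1, h2⟩ := isRightJost_rjost h hζ him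
  constructor
  · simp only [laxX_eq]
    have := h1.reflect
    rw [reflP_reflP, reflD_reflD] at this
    exact this
  · have h3 := (continuous_swap2.tendsto _).comp (h2.comp tendsto_neg_atBot_atTop)
    have h4 : (fun i => asymE qinf ζ i 1) = swap2 (asymV (-conj qinf) ζ) := by
      ext i; fin_cases i <;> simp [asymE, asymV, swap2]
    rw [h4]
    refine h3.congr fun x => ?_
    simp [Function.comp_def, swap2_smul, sgn3, ljost]

/-- A column chosen by `Classical.epsilon` is known only once existence and uniqueness are; this is
the single place where the choice is unfolded. -/
lemma jost_eq {l : Filter ℝ} {k : Fin 2} {ψ : ℝ → Fin 2 → ℂ} (h : IsJost q₀ T α q l qinf k ζ ψ)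
    (hu : ∀ ψ', IsJost q₀ T α q l qinf k ζ ψ' → ψ' = ψ) : jost q₀ T α q l qinf k ζ = ψ :=
  hu _ (Classical.epsilon_spec ⟨ψ, h⟩)

lemma jost_zero_atTop (h : RightPotential q₀ q (kePert q₀ T q) qinf) (hζ : ζ ≠ 0) (him : ζ.im ≤ 0) :
    jost q₀ T α q atTop qinf 0 ζ = rjost q₀ q (kePert q₀ T q) qinf ζ :=
  jost_eq (isJost_zero_atTop.mpr (isRightJost_rjost h hζ him)) fun _ h' =>
    (isJost_zero_atTop.mp h').eq_rjost h hζ him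

lemma eq_ljost (h : RightPotential q₀ (reflP q) (reflD (kePert q₀ T q)) (-conj qinf)) (hζ : ζ ≠ 0)
    (him : ζ.im ≤ 0) {ψ : ℝ → Fin 2 → ℂ} (hψ : IsJost q₀ T α q atBot qinf 1 ζ ψ) :
    ψ = ljost q₀ q (kePert q₀ T q) qinf ζ := by
  have := hψ.reflect.eq_rjost h hζ him
  ext1 x
  rw [ljost, ← this]
  simp [swap2_swap2]

lemma jost_one_atBot (h : RightPotential q₀ (reflP q) (reflD (kePert q₀ T q)) (-conj qinf)) (hζ : ζ ≠ 0)
    (him : ζ.im ≤ 0) :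
    jost q₀ T α q atBot qinf 1 ζ = ljost q₀ q (kePert q₀ T q) qinf ζ :=
  jost_eq (isJost_ljost h hζ him) fun _ h' => eq_ljost h hζ him h'

/-- The symmetry between the two columns. -/
lemma IsJost.sconj {l : Filter ℝ} {j k : Fin 2} (hjk : j ≠ k) {ψ : ℝ → Fin 2 → ℂ}
    (h : IsJost q₀ T α q l qinf j ζ ψ) :
    IsJost q₀ T α q l qinf k (conj ζ) fun x => sconj (ψ x) := by
  obtain ⟨h1, h2⟩ := h
  simp only [laxX_eq] at h1
  constructor
  · have := IsZSSol.sconj h1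
    rw [conj_kappa] at this
    simp only [laxX_eq]; exact this
  · have h3 := (continuous_sconj.tendsto _).comp h2
    have h4 : (fun i => asymE qinf (conj ζ) i k) =
        KunduEckhaus.sconj (fun i => asymE qinf ζ i j) := by
      ext i
      fin_cases j <;> fin_cases k <;> fin_cases i <;> simp_all [asymE, KunduEckhaus.sconj]
    rw [h4]
    refine h3.congr fun x => ?_
    simp only [Function.comp_apply, sconj_smul]
    rw [← Complex.exp_conj]
    congr 2
    fin_cases j <;> fin_cases k <;> simp_all [sgn3, conj_lam]

lemma jost_one_atTop (h : RightPotential q₀ q (kePert q₀ T q) qinf) (hζ : ζ ≠ 0) (him : 0 ≤ ζ.im) :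
    jost q₀ T α q atTop qinf 1 ζ = fun x => sconj (rjost q₀ q (kePert q₀ T q) qinf (conj ζ) x) := by
  have hc : conj ζ ≠ 0 := by simpa using hζ
  have hi : (conj ζ).im ≤ 0 := by simpa using him
  refine jost_eq ?_ fun ψ hψ => ?_
  · have := (isJost_zero_atTop.mpr (isRightJost_rjost h hc hi)).sconj (T := T) (α := α)
      (show (0 : Fin 2) ≠ 1 by simp)
    rwa [Complex.conj_conj] at this
  · have := (isJost_zero_atTop.mp (hψ.sconj (show (1 : Fin 2) ≠ 0 by simp))).eq_rjost h hc hi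
    ext1 x
    rw [← this, sconj_sconj]

lemma jost_zero_atBot (h : RightPotential q₀ (reflP q) (reflD (kePert q₀ T q)) (-conj qinf))
    (hζ : ζ ≠ 0) (him : 0 ≤ ζ.im) :
    jost q₀ T α q atBot qinf 0 ζ = fun x => sconj (ljost q₀ q (kePert q₀ T q) qinf (conj ζ) x) := by
  have hc : conj ζ ≠ 0 := by simpa using hζ
  have hi : (conj ζ).im ≤ 0 := by simpa using him
  refine jost_eq ?_ fun ψ hψ => ?_
  · have := (isJost_ljost (α := α) h hc hi).sconj (show (1 : Fin 2) ≠ 0 by simp)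
    rwa [Complex.conj_conj] at this
  · have := eq_ljost h hc hi (hψ.sconj (show (0 : Fin 2) ≠ 1 by simp))
    ext1 x
    rw [← this, sconj_sconj]

end Jost

/-! ### The coefficient ã and the scattering relations on the real axis -/

section Scattering

variable {q₀ : ℝ} {p : ℝ → ℂ} {d : ℝ → ℝ} {pp pm : ℂ}

/-- The Wronskian `W[φ_{+,1}, φ_{-,2}]`, for `Im ζ ≤ 0`. -/
noncomputable def jostW (q₀ : ℝ) (p : ℝ → ℂ) (d : ℝ → ℝ) (pp pm ζ : ℂ) : ℂ :=
  wronskian (rjost q₀ p d pp ζ 0) (ljost q₀ p d pm ζ 0)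

/-- The coefficient `ã`, for `Im ζ ≤ 0`. -/
noncomputable def atil (q₀ : ℝ) (p : ℝ → ℂ) (d : ℝ → ℝ) (pp pm ζ : ℂ) : ℂ :=
  jostW q₀ p d pp pm ζ / (1 - (q₀ : ℂ) ^ 2 / ζ ^ 2)

lemma one_sub_ne_zero {q₀ : ℝ} {ζ : ℂ} (hζ : ζ ≠ 0) (h1 : ζ ≠ q₀) (h2 : ζ ≠ -q₀) :
    (1 - (q₀ : ℂ) ^ 2 / ζ ^ 2) ≠ 0 := fun h => by
  field_simp at h
  have : (ζ - q₀) * (ζ + q₀) = 0 := by linear_combination h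
  rcases mul_eq_zero.mp this with h' | h'
  · exact h1 (sub_eq_zero.mp h')
  · exact h2 (eq_neg_of_add_eq_zero_left h')

lemma one_sub_ne_zero_of_im {q₀ : ℝ} {ζ : ℂ} (h : ζ.im ≠ 0) : (1 - (q₀ : ℂ) ^ 2 / ζ ^ 2) ≠ 0 :=
  one_sub_ne_zero (fun h0 => h (by simp [h0])) (fun h0 => h (by simp [h0])) fun h0 => h (by simp [h0])

namespace LinePotential

lemma isZSSol_rjost (h : LinePotential q₀ p d pp pm) {ζ : ℂ} (hζ : ζ ≠ 0) (him : ζ.im ≤ 0) :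
    IsZSSol p d (kappa q₀ ζ) (rjost q₀ p d pp ζ) := (isRightJost_rjost h.right hζ him).1

lemma isZSSol_ljost (h : LinePotential q₀ p d pp pm) {ζ : ℂ} (hζ : ζ ≠ 0) (him : ζ.im ≤ 0) :
    IsZSSol p d (kappa q₀ ζ) (ljost q₀ p d pm ζ) := by
  have := (isRightJost_rjost h.left hζ him).1.reflect
  rwa [reflP_reflP, reflD_reflD] at this

lemma jostW_eq (h : LinePotential q₀ p d pp pm) {ζ : ℂ} (hζ : ζ ≠ 0) (him : ζ.im ≤ 0) (x : ℝ) :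
    jostW q₀ p d pp pm ζ = wronskian (rjost q₀ p d pp ζ x) (ljost q₀ p d pm ζ x) :=
  wronskian_const (h.isZSSol_rjost hζ him) (h.isZSSol_ljost hζ him) 0 x

lemma jostW_eq_core (h : LinePotential q₀ p d pp pm) {ζ : ℂ} (hζ : ζ ≠ 0) (him : ζ.im ≤ 0) (x : ℝ) :
    jostW q₀ p d pp pm ζ = wronskian (jcore q₀ p d pp ζ x) (lcore q₀ p d pm ζ x) := by
  rw [h.jostW_eq hζ him x, rjost, ljost_eq_smul_lcore, wronskian_smul_smul, ← Complex.exp_add]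
  simp

lemma rjost_ne_zero (h : LinePotential q₀ p d pp pm) {ζ : ℂ} (hζ : ζ ≠ 0) (him : ζ.im ≤ 0) (x : ℝ) :
    rjost q₀ p d pp ζ x ≠ 0 := (isRightJost_rjost h.right hζ him).ne_zero h.right x

lemma ljost_ne_zero (h : LinePotential q₀ p d pp pm) {ζ : ℂ} (hζ : ζ ≠ 0) (him : ζ.im ≤ 0) (x : ℝ) :
    ljost q₀ p d pm ζ x ≠ 0 := fun h0 => by
  refine (isRightJost_rjost h.left hζ him).ne_zero h.left (-x) ?_
  have := congrArg swap2 h0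
  rw [ljost, swap2_swap2] at this
  rw [this]; ext i; fin_cases i <;> rfl

end LinePotential

lemma norm_exp_lam_real (q₀ s x : ℝ) : ‖Complex.exp (Complex.I * lam q₀ (s : ℂ) * x)‖ = 1 := by
  rw [Complex.norm_exp]
  simp [lam_im]

/-- On the real axis the conserved quantity equals the asymptotic determinant. -/
lemma normSq_rjost_real (h : RightPotential q₀ p d pp) {s : ℝ} (hs : s ≠ 0) (x : ℝ) :
    ‖rjost q₀ p d pp (s : ℂ) x 0‖ ^ 2 - ‖rjost q₀ p d pp (s : ℂ) x 1‖ ^ 2 = 1 - q₀ ^ 2 / s ^ 2 := by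
  have hs' : (s : ℂ) ≠ 0 := by exact_mod_cast hs
  obtain ⟨h1, h2⟩ := isRightJost_rjost h hs' (by simp)
  have hk : kappa q₀ (s : ℂ) = (((s + q₀ ^ 2 / s) / 2 : ℝ) : ℂ) := by simp [kappa]
  rw [hk] at h1
  have h3 : Tendsto (fun y => ‖rjost q₀ p d pp (s : ℂ) y 0‖ ^ 2 - ‖rjost q₀ p d pp (s : ℂ) y 1‖ ^ 2)
      atTop (𝓝 (‖asymV pp s 0‖ ^ 2 - ‖asymV pp s 1‖ ^ 2)) := by
    rw [tendsto_pi_nhds] at h2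
    refine (((h2 0).norm.pow 2).sub ((h2 1).norm.pow 2)).congr fun y => ?_
    simp only [Pi.smul_apply, norm_smul, norm_exp_lam_real, one_mul]
  have h4 : ‖asymV pp s 0‖ ^ 2 - ‖asymV pp s 1‖ ^ 2 = 1 - q₀ ^ 2 / s ^ 2 := by
    simp [asymV, h.norm_inf, div_pow]
  rw [h4] at h3
  refine tendsto_nhds_unique (tendsto_const_nhds.congr fun y => ?_) h3
  exact h1.normSq_sub_const x y

lemma normSq_ljost_real (h : LinePotential q₀ p d pp pm) {s : ℝ} (hs : s ≠ 0) (x : ℝ) :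
    ‖ljost q₀ p d pm (s : ℂ) x 1‖ ^ 2 - ‖ljost q₀ p d pm (s : ℂ) x 0‖ ^ 2 = 1 - q₀ ^ 2 / s ^ 2 :=
  normSq_rjost_real h.left hs (-x)

/-- For v = φ_{+,1} and w = φ_{-,2} at real ζ this is the relation |a|² − |b|² = 1 before
normalization. It shows that ã has no real zeros away from 0 and ±q₀. -/
lemma normSq_wronskian_sub (v w : Fin 2 → ℂ) :
    ‖wronskian v w‖ ^ 2 - ‖wronskian v (sconj w)‖ ^ 2 =
      (‖v 0‖ ^ 2 - ‖v 1‖ ^ 2) * (‖w 1‖ ^ 2 - ‖w 0‖ ^ 2) := by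
  simp only [← Complex.normSq_eq_norm_sq, wronskian, sconj, Complex.normSq_apply]
  simp
  ring

lemma jostW_real_ne_zero (h : LinePotential q₀ p d pp pm) {s : ℝ} (hs : s ≠ 0) (h1 : s ≠ q₀)
    (h2 : s ≠ -q₀) : jostW q₀ p d pp pm (s : ℂ) ≠ 0 := fun h0 => by
  have h3 := normSq_wronskian_sub (rjost q₀ p d pp (s : ℂ) 0) (ljost q₀ p d pm (s : ℂ) 0)
  rw [normSq_rjost_real h.right hs, normSq_ljost_real h hs] at h3
  rw [jostW] at h0
  rw [h0, norm_zero] at h3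
  have h4 : (1 - q₀ ^ 2 / s ^ 2) ≠ 0 := by
    have := one_sub_ne_zero (q₀ := q₀) (ζ := s) (by exact_mod_cast hs) (by exact_mod_cast h1)
      (by exact_mod_cast h2)
    exact_mod_cast this
  nlinarith [sq_nonneg ‖wronskian (rjost q₀ p d pp (s : ℂ) 0) (sconj (ljost q₀ p d pm (s : ℂ) 0))‖,
    mul_self_pos.mpr h4]

lemma atil_real_ne_zero (h : LinePotential q₀ p d pp pm) {s : ℝ} (hs : s ≠ 0) (h1 : s ≠ q₀)
    (h2 : s ≠ -q₀) : atil q₀ p d pp pm (s : ℂ) ≠ 0 :=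
  div_ne_zero (jostW_real_ne_zero h hs h1 h2)
    (one_sub_ne_zero (by exact_mod_cast hs) (by exact_mod_cast h1) (by exact_mod_cast h2))

/-- Without reflection, `φ_{-,2}` is proportional to `φ_{+,2}` on the real axis. -/
lemma ljost_eq_smul_of_wronskian_eq_zero (h : LinePotential q₀ p d pp pm) {s : ℝ} (hs : s ≠ 0)
    (h1 : s ≠ q₀) (h2 : s ≠ -q₀)
    (hb : wronskian (rjost q₀ p d pp (s : ℂ) 0) (sconj (ljost q₀ p d pm (s : ℂ) 0)) = 0) (x : ℝ) :
    ljost q₀ p d pm (s : ℂ) x = atil q₀ p d pp pm (s : ℂ) • sconj (rjost q₀ p d pp (s : ℂ) x) := by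
  have hs' : (s : ℂ) ≠ 0 := by exact_mod_cast hs
  have him : (s : ℂ).im ≤ 0 := by simp
  have hr := h.isZSSol_rjost hs' him
  have hl := (h.isZSSol_ljost hs' him)
  have hls := hl.sconj
  rw [conj_kappa, Complex.conj_ofReal] at hls
  rw [wronskian_const hr hls 0 x] at hb
  obtain ⟨c, hc⟩ := exists_eq_smul_of_wronskian_eq_zero (h.rjost_ne_zero hs' him x) hb
  have hl2 : ljost q₀ p d pm (s : ℂ) x = conj c • sconj (rjost q₀ p d pp (s : ℂ) x) := by
    rw [← sconj_smul, ← hc, sconj_sconj]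
  have hD : wronskian (rjost q₀ p d pp (s : ℂ) x) (sconj (rjost q₀ p d pp (s : ℂ) x)) =
      1 - (q₀ : ℂ) ^ 2 / (s : ℂ) ^ 2 := by
    have := normSq_rjost_real h.right hs x
    have h5 : (((‖rjost q₀ p d pp (s : ℂ) x 0‖ ^ 2 - ‖rjost q₀ p d pp (s : ℂ) x 1‖ ^ 2 : ℝ)) : ℂ) =
      1 - (q₀ : ℂ) ^ 2 / (s : ℂ) ^ 2 := by rw [this]; push_cast; ring
    rw [← h5]
    push_cast
    rw [← Complex.mul_conj', ← Complex.mul_conj']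
    simp [wronskian, sconj]
  -- Pairing with φ_{+,1} identifies the factor of proportionality as ã.
  have hW := h.jostW_eq hs' him x
  rw [hl2, ← one_smul ℂ (rjost q₀ p d pp (s : ℂ) x), wronskian_smul_smul, one_smul, hD, one_mul] at hW
  rw [hl2, atil, hW, mul_div_cancel_right₀]
  exact one_sub_ne_zero hs' (by exact_mod_cast h1) (by exact_mod_cast h2)

end Scattering

/-! ### The derivative of `ã` at its zeros -/

section HalfLine

variable {q₀ : ℝ} {p : ℝ → ℂ} {d : ℝ → ℝ} {pinf : ℂ}

lemma norm_exp_neg_lam (q₀ : ℝ) (ζ : ℂ) (x : ℝ) :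
    ‖Complex.exp (-(Complex.I * lam q₀ ζ * x))‖ = Real.exp ((lam q₀ ζ).im * x) := by
  rw [Complex.norm_exp]; simp

lemma ne_zero_of_im_neg {ζ : ℂ} (h : ζ.im < 0) : ζ ≠ 0 := fun h0 => by simp [h0] at h

lemma exists_norm_rjost_le (h : RightPotential q₀ p d pinf) {ζ₀ : ℂ} (h0 : ζ₀.im < 0) :
    ∃ B, 0 ≤ B ∧ ∀ᶠ ζ in 𝓝 ζ₀, ζ.im < 0 ∧ ∀ x, 0 ≤ x →
      ‖rjost q₀ p d pinf ζ x‖ ≤ B * Real.exp ((lam q₀ ζ).im * x) := by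
  obtain ⟨B, hB0, hB⟩ := exists_norm_jcore_le h 0
  have hn : 0 < ‖ζ₀‖ := norm_pos_iff.mpr (ne_zero_of_im_neg h0)
  have hq := h.pos
  refine ⟨B * (1 + q₀ / (‖ζ₀‖ / 2)), by positivity, ?_⟩
  filter_upwards [(isOpen_lt Complex.continuous_im continuous_const).mem_nhds h0,
    (isOpen_lt continuous_const continuous_norm).mem_nhds (show ‖ζ₀‖ / 2 < ‖ζ₀‖ by linarith)]
    with ζ h1 h2
  have h1' : ζ.im < 0 := h1
  have h2' : ‖ζ₀‖ / 2 < ‖ζ‖ := h2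
  refine ⟨h1, fun x hx => ?_⟩
  rw [rjost, norm_smul, norm_exp_neg_lam, mul_comm]
  gcongr
  exact (hB x hx ζ (ne_zero_of_im_neg h1) h1'.le).trans (by gcongr)

lemma differentiableOn_rjost (h : RightPotential q₀ p d pinf) (x : ℝ) :
    DifferentiableOn ℂ (fun ζ => rjost q₀ p d pinf ζ x) {ζ | ζ.im < 0} := by
  unfold rjost
  have h1 : DifferentiableOn ℂ (fun ζ => Complex.exp (-(Complex.I * lam q₀ ζ * x))) {ζ | ζ.im < 0} :=
    ((((differentiableOn_lam q₀).mono fun ζ hζ => ne_zero_of_im_neg hζ).const_mul _).mul_const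
    _).neg.cexp
  exact h1.smul (differentiableOn_jcore h x)

lemma differentiableAt_rjost (h : RightPotential q₀ p d pinf) {ζ : ℂ} (him : ζ.im < 0) (x : ℝ) :
    DifferentiableAt ℂ (fun ζ => rjost q₀ p d pinf ζ x) ζ :=
  (differentiableOn_rjost h x).differentiableAt
    ((isOpen_lt Complex.continuous_im continuous_const).mem_nhds him)

lemma tendsto_rjost_atTop (h : RightPotential q₀ p d pinf) {ζ : ℂ} (him : ζ.im < 0) :
    Tendsto (rjost q₀ p d pinf ζ) atTop (𝓝 0) := by
  obtain ⟨B, -, hB⟩ := exists_norm_rjost_le h him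
  have hb := hB.self_of_nhds.2
  rw [tendsto_zero_iff_norm_tendsto_zero]
  have h1 : Tendsto (fun x : ℝ => B * Real.exp ((lam q₀ ζ).im * x)) atTop (𝓝 (B * 0)) :=
    ((Real.tendsto_exp_atBot.comp
      ((tendsto_const_mul_atBot_of_neg (lam_im_neg q₀ him)).mpr tendsto_id)).const_mul B)
  rw [mul_zero] at h1
  refine tendsto_of_tendsto_of_tendsto_of_le_of_le' tendsto_const_nhds h1
    (Eventually.of_forall fun x => norm_nonneg _) ?_
  filter_upwards [eventually_ge_atTop 0] with x hx using hb x hx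

/-- The first factor vanishes at a, so the second need only be continuous: its increment is
multiplied by something of first order. -/
lemma hasDerivAt_mul_of_continuousAt {f K : ℂ → ℂ} {f' a : ℂ} (hf : HasDerivAt f f' a) (h0 : f a = 0)
    (hK : ContinuousAt K a) : HasDerivAt (fun z => f z * K z) (f' * K a) a := by
  rw [hasDerivAt_iff_tendsto_slope] at hf ⊢
  refine (hf.mul (hK.tendsto.mono_left nhdsWithin_le_nhds)).congr fun z => ?_
  simp [slope_def_field, h0]; ring

lemma hasDerivAt_kappa (q₀ : ℝ) {ζ : ℂ} (hζ : ζ ≠ 0) :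
    HasDerivAt (kappa q₀) ((1 - (q₀ : ℂ) ^ 2 / ζ ^ 2) / 2) ζ := by
  unfold kappa
  refine (((hasDerivAt_id ζ).add (((hasDerivAt_id ζ).inv hζ).const_mul ((q₀ : ℂ) ^ 2))).div_const
    2).congr_deriv ?_
  simp; ring

/-- The derivative in the spectral parameter of the Wronskian of two decaying solutions. -/
lemma hasDerivAt_wronskian_rjost (h : RightPotential q₀ p d pinf) {ζ₀ : ℂ} (h0 : ζ₀.im < 0) :
    HasDerivAt (fun ζ => wronskian (rjost q₀ p d pinf ζ 0) (rjost q₀ p d pinf ζ₀ 0))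
      (Complex.I * (1 - (q₀ : ℂ) ^ 2 / ζ₀ ^ 2) *
        ∫ x in Set.Ioi 0, rjost q₀ p d pinf ζ₀ x 0 * rjost q₀ p d pinf ζ₀ x 1) ζ₀ := by
  obtain ⟨B, hB0, hB⟩ := exists_norm_rjost_le h h0
  have hζ₀ := ne_zero_of_im_neg h0
  set g := rjost q₀ p d pinf ζ₀ with hg
  have hgs := (isRightJost_rjost h hζ₀ h0.le).1
  -- Both solutions decay, so integrating the derivative of their Wronskian over (0, ∞) gives W(0) =
  -- i(κ(ζ) − κ(ζ₀))K(ζ). Only continuity of K at ζ₀ is needed.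
  set K := fun ζ => ∫ x in Set.Ioi (0:ℝ), (rjost q₀ p d pinf ζ x 0 * g x 1 +
    rjost q₀ p d pinf ζ x 1 * g x 0) with hK
  set bound := fun x : ℝ => 2 * (B * (B * Real.exp ((lam q₀ ζ₀).im * x))) with hbound
  have hbi : IntegrableOn bound (Set.Ioi 0) :=
    (((integrableOn_exp_mul_Ioi (lam_im_neg q₀ h0) 0).const_mul B).const_mul B).const_mul 2
  have hbd : ∀ᶠ ζ in 𝓝 ζ₀, ∀ x, 0 < x → ‖rjost q₀ p d pinf ζ x 0 * g x 1 +
      rjost q₀ p d pinf ζ x 1 * g x 0‖ ≤ bound x := by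
    filter_upwards [hB] with ζ hζ x hx
    have hgx := hB.self_of_nhds.2 x hx.le
    have hζx : ‖rjost q₀ p d pinf ζ x‖ ≤ B := by
      refine (hζ.2 x hx.le).trans (mul_le_of_le_one_right hB0 (Real.exp_le_one_iff.mpr ?_))
      exact mul_nonpos_of_nonpos_of_nonneg (lam_im_neg q₀ hζ.1).le hx.le
    have e : ∀ i j, ‖rjost q₀ p d pinf ζ x i * g x j‖ ≤ B * (B * Real.exp ((lam q₀ ζ₀).im * x)) :=
      fun i j => by
        rw [norm_mul]
        exact mul_le_mul ((norm_le_pi_norm _ i).trans hζx) ((norm_le_pi_norm _ j).trans hgx)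
          (norm_nonneg _) hB0
    refine (norm_add_le _ _).trans ?_
    have := e 0 1
    have := e 1 0
    simp only [hbound]
    linarith
  have hcg : Continuous g := hgs.continuous
  have hcont : ∀ᶠ ζ in 𝓝 ζ₀, Continuous fun x => rjost q₀ p d pinf ζ x 0 * g x 1 +
      rjost q₀ p d pinf ζ x 1 * g x 0 := by
    filter_upwards [hB] with ζ hζ
    have : Continuous (rjost q₀ p d pinf ζ) :=
      (isRightJost_rjost h (ne_zero_of_im_neg hζ.1) hζ.1.le).1.continuous
    fun_prop
  have hKc : ContinuousAt K ζ₀ := by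
    refine continuousAt_of_dominated (bound := bound)
      (hcont.mono fun ζ hζ => hζ.aestronglyMeasurable) ?_ hbi (ae_of_all _ fun x => ?_)
    · filter_upwards [hbd] with ζ hζ
      exact (ae_restrict_iff' measurableSet_Ioi).mpr (ae_of_all _ fun x hx => hζ x hx)
    · have := (differentiableAt_rjost h h0 x).continuousAt
      have c0 := (continuousAt_pi.mp this) 0
      have c1 := (continuousAt_pi.mp this) 1
      exact (c0.mul continuousAt_const).add (c1.mul continuousAt_const)
  have hkd : HasDerivAt (fun ζ => Complex.I * (kappa q₀ ζ - kappa q₀ ζ₀))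
      (Complex.I * ((1 - (q₀ : ℂ) ^ 2 / ζ₀ ^ 2) / 2)) ζ₀ :=
    ((hasDerivAt_kappa q₀ hζ₀).sub_const _).const_mul _
  have key := hasDerivAt_mul_of_continuousAt hkd (by simp) hKc
  have hK0 : K ζ₀ = 2 * ∫ x in Set.Ioi 0, g x 0 * g x 1 := by
    rw [← integral_const_mul]
    refine integral_congr_ae (ae_of_all _ fun x => ?_)
    simp only [← hg]; ring
  rw [hK0] at key
  refine (key.congr_of_eventuallyEq ?_).congr_deriv (by ring)
  filter_upwards [hB, hbd, hcont] with ζ hζ hζb hζc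
  have hr := (isRightJost_rjost h (ne_zero_of_im_neg hζ.1) hζ.1.le).1
  have hint : IntegrableOn (fun x => rjost q₀ p d pinf ζ x 0 * g x 1 +
      rjost q₀ p d pinf ζ x 1 * g x 0) (Set.Ioi 0) :=
    Integrable.mono' hbi hζc.aestronglyMeasurable
      ((ae_restrict_iff' measurableSet_Ioi).mpr (ae_of_all _ fun x hx => hζb x hx))
  have hlim : Tendsto (fun x => wronskian (rjost q₀ p d pinf ζ x) (g x)) atTop (𝓝 0) := by
    have := (continuous_wronskian.tendsto ((0 : Fin 2 → ℂ), (0 : Fin 2 → ℂ))).comp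
      ((tendsto_rjost_atTop h hζ.1).prodMk_nhds (tendsto_rjost_atTop h h0))
    rw [show wronskian ((0 : Fin 2 → ℂ), (0 : Fin 2 → ℂ)).1 ((0 : Fin 2 → ℂ), (0 : Fin 2 → ℂ)).2 = 0
      by simp [wronskian]] at this
    exact this
  have hI := integral_Ioi_of_hasDerivAt_of_tendsto' (a := 0)
    (fun x _ => hasDerivAt_wronskian hr hgs x) (hint.const_mul _) hlim
  rw [integral_const_mul] at hI
  simp only [hK]
  rw [← hg] at hI
  linear_combination hI

/-- The second component of the inversion symmetry on the circle. It makes φ₁φ₂ a constant multiple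
of |φ₁|², the source of positivity for the norming constants. -/
lemma circle_mul_eq (h : RightPotential q₀ p d pinf) {ζ : ℂ} (hn : ‖ζ‖ = q₀) (him : ζ.im ≤ 0) (x : ℝ) :
    rjost q₀ p d pinf ζ x 1 = Complex.I * conj pinf / ζ * conj (rjost q₀ p d pinf ζ x 0) := by
  have hζ : ζ ≠ 0 := by rw [← norm_pos_iff, hn]; exact h.pos
  have h1 := congrFun (sconj_rjost_circle h hn him x) 1
  simp only [sconj, Matrix.cons_val_one, Matrix.cons_val_fin_one, Pi.smul_apply, smul_eq_mul] at h1
  rw [h1]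
  have h2 := h.conj_mul_inf
  have h3 := h.q_ne
  field_simp
  linear_combination (-(rjost q₀ p d pinf ζ x 1)) * h2 +
    (-(conj pinf * pinf * rjost q₀ p d pinf ζ x 1)) * (-Complex.I_sq)

lemma circle_ne_zero (h : RightPotential q₀ p d pinf) {ζ : ℂ} (hn : ‖ζ‖ = q₀) (him : ζ.im ≤ 0) (x : ℝ) :
    rjost q₀ p d pinf ζ x 0 ≠ 0 := fun h0 => by
  have hζ : ζ ≠ 0 := by rw [← norm_pos_iff, hn]; exact h.pos
  refine (isRightJost_rjost h hζ him).ne_zero h x ?_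
  ext i; fin_cases i
  · exact h0
  · simp [circle_mul_eq h hn him x, h0]

lemma integral_circle (h : RightPotential q₀ p d pinf) {ζ : ℂ} (hn : ‖ζ‖ = q₀) (him : ζ.im < 0) :
    0 < ∫ x in Set.Ioi 0, ‖rjost q₀ p d pinf ζ x 0‖ ^ 2 ∧
    ∫ x in Set.Ioi 0, rjost q₀ p d pinf ζ x 0 * rjost q₀ p d pinf ζ x 1 =
      Complex.I * conj pinf / ζ *
        ((∫ x in Set.Ioi 0, ‖rjost q₀ p d pinf ζ x 0‖ ^ 2 : ℝ) : ℂ) := by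
  obtain ⟨B, hB0, hB⟩ := exists_norm_rjost_le h him
  have hb := hB.self_of_nhds.2
  have hζ := ne_zero_of_im_neg him
  have hc : Continuous (rjost q₀ p d pinf ζ) := (isRightJost_rjost h hζ him.le).1.continuous
  constructor
  · rw [setIntegral_pos_iff_support_of_nonneg_ae (ae_of_all _ fun x => by positivity)]
    · have : Function.support (fun x => ‖rjost q₀ p d pinf ζ x 0‖ ^ 2) = Set.univ := by
        ext x; simp [circle_ne_zero h hn him.le x]
      rw [this, Set.univ_inter]; simp
    · refine Integrable.mono' ((((integrableOn_exp_mul_Ioi (lam_im_neg q₀ him) 0).const_mul B).const_mul B))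
        (by fun_prop) ((ae_restrict_iff' measurableSet_Ioi).mpr (ae_of_all _ fun x hx => ?_))
      have hx0 : (0:ℝ) < x := hx
      have h1 := (norm_le_pi_norm _ 0).trans (hb x hx0.le)
      have h2 : Real.exp ((lam q₀ ζ).im * x) ≤ 1 := Real.exp_le_one_iff.mpr
        (mul_nonpos_of_nonpos_of_nonneg (lam_im_neg q₀ him).le hx0.le)
      rw [norm_pow, norm_norm, sq]
      exact mul_le_mul (h1.trans (mul_le_of_le_one_right hB0 h2)) h1 (norm_nonneg _) hB0
  · rw [← integral_complex_ofReal, ← integral_const_mul]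
    refine integral_congr_ae (ae_of_all _ fun x => ?_)
    simp only
    rw [circle_mul_eq h hn him.le x]
    push_cast
    rw [← Complex.mul_conj']
    ring

end HalfLine

section Line

variable {q₀ : ℝ} {p : ℝ → ℂ} {d : ℝ → ℝ} {pp pm : ℂ}

lemma differentiableOn_jostW (h : LinePotential q₀ p d pp pm) :
    DifferentiableOn ℂ (jostW q₀ p d pp pm) {ζ | ζ.im < 0} := by
  have h1 := differentiableOn_pi.mp (differentiableOn_rjost h.right 0)
  have h2 := differentiableOn_pi.mp (differentiableOn_rjost h.left (-0))
  exact ((h1 0).mul (h2 0)).sub ((h1 1).mul (h2 1))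

/-- By proportionality each of the two terms of the product rule is a Wronskian of a Jost solution
near ζ₀ with the same Jost solution at ζ₀. The half-line formula evaluates one over (0, ∞) and,
after reflection, the other over (−∞, 0). -/
lemma hasDerivAt_jostW (h : LinePotential q₀ p d pp pm) {ζ₀ : ℂ} (h0 : ζ₀.im < 0)
    {bt : ℂ} (hb : ∀ x, ljost q₀ p d pm ζ₀ x = bt • rjost q₀ p d pp ζ₀ x) :
    bt ≠ 0 ∧ HasDerivAt (jostW q₀ p d pp pm)
      (Complex.I * (1 - (q₀ : ℂ) ^ 2 / ζ₀ ^ 2) * bt *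
        ((∫ x in Set.Ioi 0, rjost q₀ p d pp ζ₀ x 0 * rjost q₀ p d pp ζ₀ x 1) +
        (∫ x in Set.Ioi 0, rjost q₀ p d pp ζ₀ (-x) 0 * rjost q₀ p d pp ζ₀ (-x) 1))) ζ₀ := by
  have hζ₀ := ne_zero_of_im_neg h0
  have hbt : bt ≠ 0 := fun hb0 => h.ljost_ne_zero hζ₀ h0.le 0 (by rw [hb 0, hb0, zero_smul])
  refine ⟨hbt, ?_⟩
  have d1 := hasDerivAt_wronskian_rjost h.right h0
  have d2 := hasDerivAt_wronskian_rjost h.left h0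
  set g := rjost q₀ p d pp ζ₀ with hg
  have hhat : ∀ x, rjost q₀ (reflP p) (reflD d) (-conj pm) ζ₀ x = bt • swap2 (g (-x)) := fun x => by
    rw [← swap2_smul, ← hb, ljost, neg_neg, swap2_swap2]
  have hint : ∫ x in Set.Ioi 0, rjost q₀ (reflP p) (reflD d) (-conj pm) ζ₀ x 0 *
      rjost q₀ (reflP p) (reflD d) (-conj pm) ζ₀ x 1 =
      bt ^ 2 * ∫ x in Set.Ioi 0, g (-x) 0 * g (-x) 1 := by
    rw [← integral_const_mul]
    refine integral_congr_ae (ae_of_all _ fun x => ?_)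
    simp only [hhat x, Pi.smul_apply, smul_eq_mul, swap2, Matrix.cons_val_zero, Matrix.cons_val_one,
      Matrix.cons_val_fin_one]
    ring
  rw [hint] at d2
  have r0 := differentiableAt_pi.mp (differentiableAt_rjost h.right h0 0)
  have l0 := differentiableAt_pi.mp (differentiableAt_rjost h.left h0 0)
  have hr0 := (r0 0).hasDerivAt
  have hr1 := (r0 1).hasDerivAt
  have hl0 := (l0 0).hasDerivAt
  have hl1 := (l0 1).hasDerivAt
  have e1 := d1.unique ((hr0.mul_const (g 0 1)).sub (hr1.mul_const (g 0 0)))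
  have e2 := d2.unique ((hl0.mul_const (rjost q₀ (reflP p) (reflD d) (-conj pm) ζ₀ 0 1)).sub
    (hl1.mul_const (rjost q₀ (reflP p) (reflD d) (-conj pm) ζ₀ 0 0)))
  have hW : jostW q₀ p d pp pm = fun ζ => rjost q₀ p d pp ζ 0 0 *
      rjost q₀ (reflP p) (reflD d) (-conj pm) ζ 0 0 - rjost q₀ p d pp ζ 0 1 *
      rjost q₀ (reflP p) (reflD d) (-conj pm) ζ 0 1 := by
    ext ζ; simp [jostW, wronskian, ljost, swap2]
  rw [hW]
  refine ((hr0.mul hl0).sub (hr1.mul hl1)).congr_deriv ?_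
  have h00 := hhat 0
  rw [neg_zero] at h00
  have a0 : rjost q₀ (reflP p) (reflD d) (-conj pm) ζ₀ 0 0 = bt * g 0 1 := by rw [h00]; rfl
  have a1 : rjost q₀ (reflP p) (reflD d) (-conj pm) ζ₀ 0 1 = bt * g 0 0 := by rw [h00]; rfl
  rw [a0, a1] at e2
  rw [a0, a1, ← hg]
  -- The left-end formula carries bt², one factor from each component of the reflected solution, so
  -- the identity is compared after multiplication by bt.
  apply mul_left_cancel₀ hbt
  linear_combination (-bt ^ 2) * e1 - e2

/-- The zeros of `ã` on the circle are simple, and the norming constants have a fixed phase. -/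
lemma exists_pos_hasDerivAt_atil (h : LinePotential q₀ p d pp pm) {ζ₀ : ℂ} (hn : ‖ζ₀‖ = q₀)
    (h0 : ζ₀.im < 0) {bt : ℂ} (hb : ∀ x, ljost q₀ p d pm ζ₀ x = bt • rjost q₀ p d pp ζ₀ x) :
    bt ≠ 0 ∧ ∃ J : ℝ, 0 < J ∧ HasDerivAt (atil q₀ p d pp pm) (-(bt * (conj pp / ζ₀) * J)) ζ₀ := by
  obtain ⟨hbt, hd⟩ := hasDerivAt_jostW h h0 hb
  have hζ₀ := ne_zero_of_im_neg h0
  obtain ⟨hpos, hi⟩ := integral_circle h.right hn h0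
  have hi2 : ∫ x in Set.Ioi 0, rjost q₀ p d pp ζ₀ (-x) 0 * rjost q₀ p d pp ζ₀ (-x) 1 =
      Complex.I * conj pp / ζ₀ *
        ((∫ x in Set.Ioi 0, ‖rjost q₀ p d pp ζ₀ (-x) 0‖ ^ 2 : ℝ) : ℂ) := by
    rw [← integral_complex_ofReal, ← integral_const_mul]
    refine integral_congr_ae (ae_of_all _ fun x => ?_)
    simp only
    rw [circle_mul_eq h.right hn h0.le (-x)]
    push_cast
    rw [← Complex.mul_conj']
    ring
  have hnn : 0 ≤ ∫ x in Set.Ioi 0, ‖rjost q₀ p d pp ζ₀ (-x) 0‖ ^ 2 :=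
    integral_nonneg fun x => by positivity
  refine ⟨hbt, _, add_pos_of_pos_of_nonneg hpos hnn, ?_⟩
  rw [hi, hi2] at hd
  have hD := one_sub_ne_zero_of_im (q₀ := q₀) h0.ne
  have hW0 : jostW q₀ p d pp pm ζ₀ = 0 := by
    simp [jostW, hb 0, wronskian]; ring
  have hc : ContinuousAt (fun ζ : ℂ => (1 - (q₀ : ℂ) ^ 2 / ζ ^ 2)⁻¹) ζ₀ :=
    (continuousAt_const.sub (continuousAt_const.div (continuousAt_id.pow 2)
      (pow_ne_zero 2 hζ₀))).inv₀ hD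
  -- As W vanishes at ζ₀, the denominator enters only through its value, which cancels the factor 1
  -- − q₀²/ζ₀² of the derivative of W.
  have := hasDerivAt_mul_of_continuousAt hd hW0 hc
  unfold atil
  simp only [div_eq_mul_inv (jostW _ _ _ _ _ _)]
  refine this.congr_deriv ?_
  push_cast
  have hb2 : ∀ D Z : ℂ, D ≠ 0 → Complex.I * D * bt * Z * D⁻¹ = Complex.I * bt * Z := fun D Z hD => by
    field_simp
  rw [hb2 _ _ hD]
  generalize ((∫ x in Set.Ioi 0, ‖rjost q₀ p d pp ζ₀ x 0‖ ^ 2 : ℝ) : ℂ) = A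
  generalize ((∫ x in Set.Ioi 0, ‖rjost q₀ p d pp ζ₀ (-x) 0‖ ^ 2 : ℝ) : ℂ) = A'
  linear_combination (bt * (conj pp / ζ₀) * (A + A')) * Complex.I_sq

end Line

/-! ### Gluing along the real axis -/

/-- The function equal to `A` in the closed lower half-plane, and to the conjugate of `g` reflected
in the real axis elsewhere. -/
noncomputable def glue (A g : ℂ → ℂ) (ζ : ℂ) : ℂ :=
  if ζ.im ≤ 0 then A ζ else conj (g (conj ζ))

lemma isOpen_im_neg : IsOpen {ζ : ℂ | ζ.im < 0} := isOpen_lt Complex.continuous_im continuous_const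

lemma isOpen_im_pos : IsOpen {ζ : ℂ | 0 < ζ.im} := isOpen_lt continuous_const Complex.continuous_im

lemma tendsto_conj_inf {l : Filter ℂ} (hl : Tendsto (conj : ℂ → ℂ) l l) :
    Tendsto (conj : ℂ → ℂ) (l ⊓ 𝓟 {ζ | ¬ζ.im ≤ 0}) (l ⊓ 𝓟 {ζ | ζ.im ≤ 0}) :=
  hl.inf (tendsto_principal_principal.mpr fun ζ hζ => by
    have : ¬ζ.im ≤ 0 := hζ
    simp only [Set.mem_ofPred_eq, Complex.conj_im]; linarith)

lemma tendsto_glue {A g : ℂ → ℂ} {l : Filter ℂ} {L : ℂ} (hl : Tendsto (conj : ℂ → ℂ) l l)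
    (hA : Tendsto A (l ⊓ 𝓟 {ζ | ζ.im ≤ 0}) (𝓝 L))
    (hg : Tendsto g (l ⊓ 𝓟 {ζ | ζ.im ≤ 0}) (𝓝 (conj L))) : Tendsto (glue A g) l (𝓝 L) := by
  refine Tendsto.if hA ?_
  have := (Complex.continuous_conj.tendsto _).comp (hg.comp (tendsto_conj_inf hl))
  rwa [Complex.conj_conj] at this

lemma eventually_glue {A g : ℂ → ℂ} {l : Filter ℂ} {P : ℂ → Prop} (hP : ∀ z, P z → P (conj z))
    (hl : Tendsto (conj : ℂ → ℂ) l l)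
    (hA : ∀ᶠ ζ in l ⊓ 𝓟 {ζ | ζ.im ≤ 0}, P (A ζ)) (hg : ∀ᶠ ζ in l ⊓ 𝓟 {ζ | ζ.im ≤ 0}, P (g ζ)) :
    ∀ᶠ ζ in l, P (glue A g ζ) := by
  have h2 := (tendsto_conj_inf hl).eventually hg
  rw [eventually_inf_principal] at hA h2
  filter_upwards [hA, h2] with ζ h3 h4
  unfold glue
  split_ifs with h5
  · exact h3 h5
  · exact hP _ (h4 h5)

lemma tendsto_conj_punctured {c : ℂ} (hc : conj c = c) :
    Tendsto (conj : ℂ → ℂ) (𝓝[≠] c) (𝓝[≠] c) := by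
  refine tendsto_nhdsWithin_iff.mpr ⟨?_, ?_⟩
  · have := Complex.continuous_conj.tendsto c
    rw [hc] at this
    exact this.mono_left nhdsWithin_le_nhds
  · filter_upwards [self_mem_nhdsWithin] with z hz h0
    refine hz ?_
    have h1 : conj z = c := h0
    rw [Set.mem_singleton_iff, ← Complex.conj_conj z, h1, hc]

lemma tendsto_conj_cocompact : Tendsto (conj : ℂ → ℂ) (cocompact ℂ) (cocompact ℂ) := by
  rw [← Metric.cobounded_eq_cocompact, ← tendsto_norm_atTop_iff_cobounded]
  simpa only [RCLike.norm_conj] using tendsto_norm_cobounded_atTop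

lemma mul_glue {A g : ℂ → ℂ} {c : ℂ} (hc : conj c = c) (ζ : ℂ) :
    (ζ - c) * glue A g ζ = glue (fun z => (z - c) * A z) (fun z => (z - c) * g z) ζ := by
  unfold glue
  split_ifs
  · rfl
  · simp [hc]

lemma inv_glue (A g : ℂ → ℂ) (ζ : ℂ) :
    (glue A g ζ)⁻¹ = glue (fun z => (A z)⁻¹) (fun z => (g z)⁻¹) ζ := by
  unfold glue
  split_ifs
  · rfl
  · simp

/-- Schwarz reflection: the two pieces are holomorphic off the axis and agree on it, so Morera's
theorem applies. The set U is symmetric because g is evaluated at the conjugate point. -/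
lemma differentiableAt_glue {A g : ℂ → ℂ} {U : Set ℂ} (hU : IsOpen U) (hUc : ∀ z ∈ U, conj z ∈ U)
    (hAc : ContinuousOn A (U ∩ {ζ | ζ.im ≤ 0})) (hgc : ContinuousOn g (U ∩ {ζ | ζ.im ≤ 0}))
    (hA : DifferentiableOn ℂ A (U ∩ {ζ | ζ.im < 0})) (hg : DifferentiableOn ℂ g (U ∩ {ζ | ζ.im < 0}))
    (hreal : ∀ s : ℝ, (s : ℂ) ∈ U → A s = conj (g s)) {z : ℂ} (hz : z ∈ U) :
    DifferentiableAt ℂ (glue A g) z := by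
  have hB : ∀ z ∈ U, z.im ≠ 0 → DifferentiableAt ℂ (glue A g) z := fun z hz h0 => by
    rcases lt_or_gt_of_ne h0 with h1 | h1
    · refine (hA.differentiableAt ((hU.inter isOpen_im_neg).mem_nhds ⟨hz, h1⟩)).congr_of_eventuallyEq ?_
      filter_upwards [isOpen_im_neg.mem_nhds h1] with w hw
      have hw' : w.im < 0 := hw
      simp [glue, hw'.le]
    · have h2 : (conj z).im < 0 := by simpa using h1
      have h3 := (hg.differentiableAt ((hU.inter isOpen_im_neg).mem_nhds ⟨hUc z hz, h2⟩)).conj_conj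
      rw [Complex.conj_conj] at h3
      refine h3.congr_of_eventuallyEq ?_
      filter_upwards [isOpen_im_pos.mem_nhds h1] with w hw
      have hw' : 0 < w.im := hw
      simp [glue, hw']
  have hC : ContinuousOn (glue A g) U := fun z hz => by
    by_cases h0 : z.im = 0
    · have hzc : conj z = z := Complex.conj_eq_iff_im.mpr h0
      have e1 : ContinuousWithinAt (glue A g) (U ∩ {ζ | ζ.im ≤ 0}) z :=
        (hAc z ⟨hz, h0.le⟩).congr (fun w hw => by
          have h' : w.im ≤ 0 := hw.2
          simp [glue, h']) (by simp [glue, h0])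
      have e2 : ContinuousWithinAt (glue A g) (U ∩ {ζ | 0 ≤ ζ.im}) z := by
        have h3 : ContinuousWithinAt (fun w => conj (g (conj w))) (U ∩ {ζ | 0 ≤ ζ.im}) z := by
          have h4 : ContinuousWithinAt g (U ∩ {ζ | ζ.im ≤ 0}) (conj z) := by
            rw [hzc]; exact hgc z ⟨hz, h0.le⟩
          refine Complex.continuous_conj.continuousAt.comp_continuousWithinAt
            (h4.comp Complex.continuous_conj.continuousWithinAt fun w hw => ⟨hUc w hw.1, ?_⟩)
          have : 0 ≤ w.im := hw.2
          simpa using this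
        have h5 : ∀ w ∈ U ∩ {ζ | 0 ≤ ζ.im}, glue A g w = conj (g (conj w)) := fun w hw => by
          have h6 : 0 ≤ w.im := hw.2
          unfold glue
          split_ifs with h7
          · have h8 : w.im = 0 := le_antisymm h7 h6
            have h9 : ((w.re : ℝ) : ℂ) = w := by apply Complex.ext <;> simp [h8]
            rw [Complex.conj_eq_iff_im.mpr h8, ← h9]
            exact hreal _ (by rw [h9]; exact hw.1)
          · rfl
        exact h3.congr h5 (h5 z ⟨hz, h0.ge⟩)
      refine (e1.union e2).mono fun w hw => ?_
      rcases le_total w.im 0 with h | h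
      · exact Or.inl ⟨hw, h⟩
      · exact Or.inr ⟨hw, h⟩
    · exact (hB z hz h0).continuousAt.continuousWithinAt
  obtain ⟨r, hr, hball⟩ := Metric.isOpen_iff.mp hU z hz
  exact (differentiableOn_of_continuousOn_off_real (hC.mono hball)
    fun w hw h0 => hB w (hball hw) h0).differentiableAt (Metric.ball_mem_nhds z hr)

/-- A singularity of order at most one with a limit along a nontrivial filter is removable. -/
lemma tendsto_punctured_of_bounded {H : ℂ → ℂ} {c L : ℂ} {l : Filter ℂ} [l.NeBot] (hl : l ≤ 𝓝[≠] c)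
    (hd : ∀ᶠ z in 𝓝[≠] c, DifferentiableAt ℂ H z) {C : ℝ}
    (hb : ∀ᶠ z in 𝓝[≠] c, ‖(z - c) * H z‖ ≤ C) (hL : Tendsto H l (𝓝 L)) :
    Tendsto H (𝓝[≠] c) (𝓝 L) := by
  have h0 : Tendsto (fun z : ℂ => z - c) (𝓝[≠] c) (𝓝 0) := by
    have : Tendsto (fun z : ℂ => z - c) (𝓝 c) (𝓝 (c - c)) := tendsto_id.sub_const c
    rw [sub_self] at this
    exact this.mono_left nhdsWithin_le_nhds
  -- The product (z − c)H extends holomorphically to c, and its value there may be computed along l,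
  -- where H converges; so it is 0, and H itself has a removable singularity.
  have h1 : Tendsto (fun z => (z - c) * H z) (𝓝[≠] c) (𝓝 0) := by
    have h2 := Complex.tendsto_limUnder_of_differentiable_on_punctured_nhds_of_bounded_under
      (f := fun z => (z - c) * H z) (c := c)
      (hd.mono fun z hz => by fun_prop)
      ⟨C, by simpa [eventually_map] using hb⟩
    have h3 : Tendsto (fun z => (z - c) * H z) l (𝓝 (0 * L)) := (h0.mono_left hl).mul hL
    rw [tendsto_nhds_unique (h2.mono_left hl) h3, zero_mul] at h2
    exact h2
  have h4 : (fun z => H z - H c) =o[𝓝[≠] c] fun z => (z - c)⁻¹ := by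
    refine (Asymptotics.isLittleO_iff_tendsto' ?_).mpr ?_
    · filter_upwards [self_mem_nhdsWithin] with z hz h5
      exact absurd (inv_eq_zero.mp h5) (sub_ne_zero.mpr hz)
    · have h6 := h1.sub (h0.mul_const (H c))
      rw [zero_mul, sub_zero] at h6
      refine h6.congr fun z => ?_
      rw [div_inv_eq_mul]; ring
  have h7 := Complex.tendsto_limUnder_of_differentiable_on_punctured_nhds_of_isLittleO hd h4
  rwa [tendsto_nhds_unique (h7.mono_left hl) hL] at h7

/-! ### Behaviour at ζ = 0 -/

section Inversion

variable {q₀ : ℝ} {p : ℝ → ℂ} {d : ℝ → ℝ} {pinf : ℂ}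

lemma jcore_inv (h : RightPotential q₀ p d pinf) {ζ : ℂ} (hζ : ζ ≠ 0) (him : ζ.im ≤ 0) (x : ℝ) :
    sconj (jcore q₀ p d pinf ((q₀ : ℂ) ^ 2 / conj ζ) x) =
      (-Complex.I * pinf * ζ / (q₀ : ℂ) ^ 2) • jcore q₀ p d pinf ζ x := by
  rw [jcore_eq_smul_rjost, jcore_eq_smul_rjost, sconj_smul, sconj_rjost_inv h hζ him, smul_comm]
  congr 1
  rw [← Complex.exp_conj]
  congr 2
  simp [lam_inv h.pos.ne', conj_lam]

lemma tendsto_inversion (hq : 0 < q₀) :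
    Tendsto (fun ζ : ℂ => (q₀ : ℂ) ^ 2 / conj ζ) (𝓝[≠] 0 ⊓ 𝓟 {ζ | ζ.im ≤ 0}) lowerInf := by
  refine Tendsto.inf ?_ (tendsto_principal_principal.mpr fun ζ hζ => ?_)
  · rw [← Metric.cobounded_eq_cocompact, ← tendsto_norm_atTop_iff_cobounded]
    have h1 : Tendsto (fun ζ : ℂ => ‖ζ‖⁻¹) (𝓝[≠] 0) atTop :=
      tendsto_inv_nhdsGT_zero.comp (tendsto_norm_nhdsNE_zero)
    have h2 := h1.const_mul_atTop (pow_pos hq 2)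
    refine h2.congr fun ζ => ?_
    simp [div_eq_mul_inv, abs_of_pos hq]
  · have h1 : ζ.im ≤ 0 := hζ
    have h2 : (q₀ : ℂ) ^ 2 / conj ζ = ((q₀ ^ 2 / Complex.normSq ζ : ℝ) : ℂ) * ζ := by
      rcases eq_or_ne ζ 0 with rfl | h0
      · simp
      · have h3 : conj ζ ≠ 0 := by simpa using h0
        rw [Complex.ofReal_div, Complex.normSq_eq_conj_mul_self]
        field_simp
        push_cast; ring
    simp only [Set.mem_ofPred_eq]
    rw [h2, Complex.im_ofReal_mul]
    have := Complex.normSq_nonneg ζ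
    exact mul_nonpos_of_nonneg_of_nonpos (by positivity) h1

/-- Inversion moves ζ → 0 to infinity: ζ m₁(ζ) is a constant times the conjugate of m₂ at the
inverse point, and the second component vanishes at infinity. -/
lemma tendsto_mul_jcore_zero (h : RightPotential q₀ p d pinf) (x : ℝ) :
    Tendsto (fun ζ => ζ * jcore q₀ p d pinf ζ x 0) (𝓝[≠] 0 ⊓ 𝓟 {ζ | ζ.im ≤ 0}) (𝓝 0) := by
  have h1 := (Complex.continuous_conj.tendsto _).comp
    ((tendsto_jcore_one h x).comp (tendsto_inversion h.pos))
  rw [map_zero] at h1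
  have h2 := h1.const_mul ((q₀ : ℂ) ^ 2 / (-Complex.I * pinf))
  rw [mul_zero] at h2
  refine h2.congr' ?_
  have h3 : ∀ᶠ ζ : ℂ in 𝓝[≠] 0 ⊓ 𝓟 {ζ | ζ.im ≤ 0}, ζ ≠ 0 ∧ ζ.im ≤ 0 := by
    rw [eventually_inf_principal]
    filter_upwards [self_mem_nhdsWithin] with ζ hζ him using ⟨hζ, him⟩
  filter_upwards [h3] with ζ hζ
  have h4 := congrFun (jcore_inv h hζ.1 hζ.2 x) 0
  simp only [sconj, Matrix.cons_val_zero, Pi.smul_apply, smul_eq_mul] at h4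
  simp only [Function.comp_apply]
  rw [h4]
  have := h.inf_ne
  have := h.q_ne
  have := Complex.I_ne_zero
  field_simp

/-- The normalized Jost solution recovers the potential at `ζ = 0`. -/
lemma tendsto_jcore_zero_at_zero (h : RightPotential q₀ p d pinf) (x : ℝ) :
    Tendsto (fun η : ℝ => jcore q₀ p d pinf (-Complex.I * ((q₀ ^ 2 / η : ℝ) : ℂ)) x 0) atTop
      (𝓝 (p x * conj (Complex.exp (Complex.I * tailD d x)) / pinf)) := by
  have h1 := (Complex.continuous_conj.tendsto _).comp (tendsto_mul_jcore_one h x)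
  have h2 := h1.const_mul (Complex.I / pinf)
  have e : Complex.I / pinf * conj (Complex.I * conj (p x) * Complex.exp (Complex.I * tailD d x)) =
      p x * conj (Complex.exp (Complex.I * tailD d x)) / pinf := by
    simp only [map_mul, Complex.conj_I, Complex.conj_conj]
    linear_combination (-(p x * conj (Complex.exp (Complex.I * tailD d x)) / pinf)) * Complex.I_sq
  rw [e] at h2
  refine h2.congr' ?_
  filter_upwards [eventually_gt_atTop 0] with η hη
  -- Chosen so that its inverse point q₀²/conj ζ is −iη, where the expansion of the second component
  -- is known.
  set ζ : ℂ := -Complex.I * ((q₀ ^ 2 / η : ℝ) : ℂ) with hζdef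
  have hq := h.pos
  have hqn := h.q_ne
  have hηn : (η : ℂ) ≠ 0 := by exact_mod_cast hη.ne'
  have hζ : ζ ≠ 0 := by
    rw [hζdef]
    refine mul_ne_zero (neg_ne_zero.mpr Complex.I_ne_zero) ?_
    exact_mod_cast (div_pos (pow_pos hq 2) hη).ne'
  have him : ζ.im ≤ 0 := by
    have : ζ.im = -(q₀ ^ 2 / η) := by simp only [hζdef, Complex.im_mul_ofReal]; simp
    rw [this]
    have := (div_pos (pow_pos hq 2) hη)
    linarith
  have hinv : (q₀ : ℂ) ^ 2 / conj ζ = -Complex.I * η := by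
    have : conj ζ = Complex.I * ((q₀ : ℂ) ^ 2 / η) := by simp [hζdef]
    rw [this]
    have := Complex.I_ne_zero
    field_simp
    simp
  have h4 := congrFun (jcore_inv h hζ him x) 0
  simp only [sconj, Matrix.cons_val_zero, Pi.smul_apply, smul_eq_mul, hinv] at h4
  simp only [Function.comp_apply, map_mul, map_neg, Complex.conj_I, Complex.conj_ofReal, neg_neg]
  rw [h4, hζdef]
  have := h.inf_ne
  push_cast
  field_simp
  simp [pow_succ]

end Inversion

/-! ### The reflectionless Riemann-Hilbert problem -/

lemma norm_eigen {q₀ : ℝ} (hq : 0 < q₀) (β : ℝ) : ‖eigen q₀ β‖ = q₀ := by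
  rw [eigen, norm_mul, mul_comm Complex.I, Complex.norm_exp_ofReal_mul_I, Complex.norm_real,
    Real.norm_of_nonneg hq.le, mul_one]

lemma eigen_im (q₀ β : ℝ) : (eigen q₀ β).im = q₀ * Real.sin β := by
  rw [eigen, mul_comm Complex.I, Complex.im_ofReal_mul, Complex.exp_ofReal_mul_I_im]

lemma eigen_re (q₀ β : ℝ) : (eigen q₀ β).re = q₀ * Real.cos β := by
  rw [eigen, mul_comm Complex.I, Complex.re_ofReal_mul, Complex.exp_ofReal_mul_I_re]

lemma eigen_ne_zero {q₀ : ℝ} (hq : 0 < q₀) (β : ℝ) : eigen q₀ β ≠ 0 := by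
  rw [← norm_pos_iff, norm_eigen hq]; exact hq

lemma eigen_mul_conj {q₀ : ℝ} (hq : 0 < q₀) (β : ℝ) :
    eigen q₀ β * conj (eigen q₀ β) = (q₀ : ℂ) ^ 2 := by
  rw [Complex.mul_conj', norm_eigen hq]

lemma eigen_im_pos {q₀ β : ℝ} (hq : 0 < q₀) (hβ : β ∈ Set.Ioo 0 Real.pi) : 0 < (eigen q₀ β).im := by
  rw [eigen_im]; exact mul_pos hq (Real.sin_pos_of_mem_Ioo hβ)

lemma eigen_injOn {q₀ β β' : ℝ} (hq : 0 < q₀) (hβ : β ∈ Set.Ioo 0 Real.pi)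
    (hβ' : β' ∈ Set.Ioo 0 Real.pi) (h : eigen q₀ β = eigen q₀ β') : β = β' := by
  have h1 := congrArg Complex.re h
  rw [eigen_re, eigen_re] at h1
  exact Real.injOn_cos (Set.Ioo_subset_Icc_self hβ) (Set.Ioo_subset_Icc_self hβ')
    (mul_left_cancel₀ hq.ne' h1)

lemma lam_conj_eigen {q₀ : ℝ} (hq : 0 < q₀) (β : ℝ) :
    lam q₀ (conj (eigen q₀ β)) = -(Complex.I * (q₀ * Real.sin β : ℝ)) := by
  have h1 : (q₀ : ℂ) ^ 2 / conj (eigen q₀ β) = eigen q₀ β := by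
    rw [← eigen_mul_conj hq β]
    field_simp [(map_ne_zero _).mpr (eigen_ne_zero hq β)]
  rw [lam, h1, ← eigen_im]
  have := Complex.sub_conj (eigen q₀ β)
  push_cast at this
  linear_combination (-1 / 2 : ℂ) * this

/-- A reflectionless potential with its zeros and norming constants. -/
structure PureSoliton (q₀ : ℝ) (p : ℝ → ℂ) (d : ℝ → ℝ) (pp pm : ℂ) {N : ℕ} (β : Fin N → ℝ)
    (ct : Fin N → ℂ) : Prop where
  line : LinePotential q₀ p d pp pm
  refl : ∀ s : ℝ, s ≠ 0 → s ≠ q₀ → s ≠ -q₀ →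
    wronskian (rjost q₀ p d pp (s : ℂ) 0) (sconj (ljost q₀ p d pm (s : ℂ) 0)) = 0
  mem : ∀ j, β j ∈ Set.Ioo 0 Real.pi
  inj : Function.Injective β
  zeros : ∀ ζ : ℂ, ζ.im < 0 → atil q₀ p d pp pm ζ = 0 → ∃ j, ζ = conj (eigen q₀ (β j))
  norming : ∀ j, ∃ bt : ℂ,
    (∀ x, ljost q₀ p d pm (conj (eigen q₀ (β j))) x =
      bt • rjost q₀ p d pp (conj (eigen q₀ (β j))) x) ∧
    ct j = bt / deriv (atil q₀ p d pp pm) (conj (eigen q₀ (β j)))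

section Line

variable {q₀ : ℝ} {p : ℝ → ℂ} {d : ℝ → ℝ} {pp pm : ℂ}

lemma continuousOn_lcore (h : LinePotential q₀ p d pp pm) (x : ℝ) :
    ContinuousOn (fun ζ => lcore q₀ p d pm ζ x) {ζ | ζ ≠ 0 ∧ ζ.im ≤ 0} :=
  continuous_swap2.comp_continuousOn (continuousOn_jcore h.left (-x))

lemma continuousOn_jostW (h : LinePotential q₀ p d pp pm) :
    ContinuousOn (jostW q₀ p d pp pm) {ζ | ζ ≠ 0 ∧ ζ.im ≤ 0} :=
  (continuous_wronskian.comp_continuousOn ((continuousOn_jcore h.right 0).prodMk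
    (continuousOn_lcore h 0))).congr fun _ hζ => h.jostW_eq_core hζ.1 hζ.2 0

lemma continuousOn_atil (h : LinePotential q₀ p d pp pm) :
    ContinuousOn (atil q₀ p d pp pm) {ζ | (ζ ≠ 0 ∧ ζ ≠ q₀ ∧ ζ ≠ -q₀) ∧ ζ.im ≤ 0} := by
  refine ((continuousOn_jostW h).mono fun ζ hζ => ⟨hζ.1.1, hζ.2⟩).div ?_
    fun ζ hζ => one_sub_ne_zero hζ.1.1 hζ.1.2.1 hζ.1.2.2
  exact continuousOn_const.sub (continuousOn_const.div (continuousOn_id.pow 2)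
    fun ζ hζ => pow_ne_zero 2 hζ.1.1)

lemma differentiableOn_atil (h : LinePotential q₀ p d pp pm) :
    DifferentiableOn ℂ (atil q₀ p d pp pm) {ζ | ζ.im < 0} := by
  refine (differentiableOn_jostW h).div ?_ fun ζ hζ => one_sub_ne_zero_of_im (ne_of_lt hζ)
  exact (differentiableOn_const _).sub ((differentiableOn_const _).div (differentiableOn_id.pow 2)
    fun ζ hζ => pow_ne_zero 2 (ne_zero_of_im_neg hζ))

lemma lcore_one (ζ : ℂ) (x : ℝ) : lcore q₀ p d pm ζ x 1 =
    jcore q₀ (reflP p) (reflD d) (-conj pm) ζ (-x) 0 := rfl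

lemma differentiableOn_lcore_one (h : LinePotential q₀ p d pp pm) (x : ℝ) :
    DifferentiableOn ℂ (fun ζ => lcore q₀ p d pm ζ x 1) {ζ | ζ.im < 0} := by
  simp only [lcore_one]
  exact differentiableOn_pi.mp (differentiableOn_jcore h.left (-x)) 0

lemma jostW_eq_mul (h : LinePotential q₀ p d pp pm) {ζ : ℂ} (hζ : ζ ≠ 0) (him : ζ.im ≤ 0) (x : ℝ) :
    jostW q₀ p d pp pm ζ = jcore q₀ p d pp ζ x 0 * jcore q₀ (reflP p) (reflD d) (-conj pm) ζ (-x) 0 -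
      jcore q₀ p d pp ζ x 1 * jcore q₀ (reflP p) (reflD d) (-conj pm) ζ (-x) 1 :=
  h.jostW_eq_core hζ him x

lemma norm_exp_tail (d : ℝ → ℝ) (x : ℝ) : ‖Complex.exp (Complex.I * tailD d x)‖ = 1 := by
  rw [mul_comm, Complex.norm_exp_ofReal_mul_I]

/-- The limit is exp(i∫d) over the whole line and does not depend on x. It is kept split at x
because the left factor then cancels in the quotient by ã, leaving the same phase as below the axis.
-/
lemma tendsto_jostW_lowerInf (h : LinePotential q₀ p d pp pm) (x : ℝ) :
    Tendsto (jostW q₀ p d pp pm) lowerInf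
      (𝓝 (Complex.exp (Complex.I * tailD d x) * Complex.exp (Complex.I * tailD (reflD d) (-x)))) := by
  have h1 := ((tendsto_jcore_zero h.right x).mul (tendsto_jcore_zero h.left (-x))).sub
    ((tendsto_jcore_one h.right x).mul (tendsto_jcore_one h.left (-x)))
  rw [mul_zero, sub_zero] at h1
  refine h1.congr' ?_
  refine eventually_lowerInf ⟨1, fun ζ hζ him => ?_⟩
  exact (jostW_eq_mul h (norm_pos_iff.mp (by linarith)) him x).symm

lemma tendsto_one_sub (q₀ : ℝ) :
    Tendsto (fun ζ : ℂ => 1 - (q₀ : ℂ) ^ 2 / ζ ^ 2) (cocompact ℂ) (𝓝 1) := by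
  have h1 : Tendsto (fun ζ : ℂ => ζ⁻¹) (cocompact ℂ) (𝓝 0) := by
    rw [← Metric.cobounded_eq_cocompact]; exact tendsto_inv₀_cobounded
  have h2 := ((h1.pow 2).const_mul ((q₀ : ℂ) ^ 2)).const_sub 1
  norm_num at h2
  refine h2.congr fun ζ => ?_
  rw [div_eq_mul_inv]

lemma tendsto_atil_lowerInf (h : LinePotential q₀ p d pp pm) (x : ℝ) :
    Tendsto (atil q₀ p d pp pm) lowerInf
      (𝓝 (Complex.exp (Complex.I * tailD d x) * Complex.exp (Complex.I * tailD (reflD d) (-x)))) := by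
  have := (tendsto_jostW_lowerInf h x).div ((tendsto_one_sub q₀).mono_left inf_le_left) one_ne_zero
  rwa [div_one] at this

lemma tendsto_lcore_div_lowerInf (h : LinePotential q₀ p d pp pm) (x : ℝ) :
    Tendsto (fun ζ => lcore q₀ p d pm ζ x 1 / atil q₀ p d pp pm ζ) lowerInf
      (𝓝 (conj (Complex.exp (Complex.I * tailD d x)))) := by
  have h1 := (tendsto_jcore_zero h.left (-x)).div (tendsto_atil_lowerInf h x)
    (mul_ne_zero (Complex.exp_ne_zero _) (Complex.exp_ne_zero _))
  rw [div_mul_cancel_right₀ (Complex.exp_ne_zero _), Complex.inv_def,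
    Complex.normSq_eq_norm_sq, norm_exp_tail] at h1
  simp only [Complex.ofReal_one, one_pow, inv_one, mul_one] at h1
  exact h1

lemma conj_jostW_inv (h : LinePotential q₀ p d pp pm) {ζ : ℂ} (hζ : ζ ≠ 0) (him : ζ.im ≤ 0)
    (hinv0 : (q₀ : ℂ) ^ 2 / conj ζ ≠ 0) (hinv : ((q₀ : ℂ) ^ 2 / conj ζ).im ≤ 0) :
    conj (jostW q₀ p d pp pm ((q₀ : ℂ) ^ 2 / conj ζ)) =
      -(pp * conj pm * ζ ^ 2 / (q₀ : ℂ) ^ 4) * jostW q₀ p d pp pm ζ := by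
  rw [jostW_eq_mul h hinv0 hinv 0, jostW_eq_mul h hζ him 0]
  have e1 := jcore_inv h.right hζ him 0
  have e2 := jcore_inv h.left hζ him (-0)
  have a1 := congrFun e1 0
  have a2 := congrFun e1 1
  have b1 := congrFun e2 0
  have b2 := congrFun e2 1
  simp only [sconj, Matrix.cons_val_zero, Matrix.cons_val_one, Matrix.cons_val_fin_one, Pi.smul_apply,
    smul_eq_mul] at a1 a2 b1 b2
  rw [map_sub, map_mul, map_mul, a1, a2, b1, b2]
  have := h.right.q_ne
  field_simp
  simp only [Complex.I_sq]
  ring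

/-- By inversion W behaves like a nonzero multiple of ζ⁻² at 0, and so does 1 − q₀²/ζ². Hence ã has
a nonzero finite limit there, and dividing by it preserves the limit 0. -/
lemma tendsto_mul_lcore_div_zero (h : LinePotential q₀ p d pp pm) (x : ℝ) :
    Tendsto (fun ζ => ζ * (lcore q₀ p d pm ζ x 1 / atil q₀ p d pp pm ζ))
      (𝓝[≠] 0 ⊓ 𝓟 {ζ | ζ.im ≤ 0}) (𝓝 0) := by
  have hq := h.right.pos
  have hqn := h.right.q_ne
  have hpp := h.right.inf_ne
  have hpm : conj pm ≠ 0 := neg_ne_zero.mp h.left.inf_ne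
  have h1 := tendsto_mul_jcore_zero h.left (-x)
  have h2 := (Complex.continuous_conj.tendsto _).comp
    ((tendsto_jostW_lowerInf h x).comp (tendsto_inversion hq))
  set E := Complex.exp (Complex.I * tailD d x) * Complex.exp (Complex.I * tailD (reflD d) (-x)) with hE
  have hE0 : conj E ≠ 0 := (map_ne_zero _).mpr (mul_ne_zero (Complex.exp_ne_zero _) (Complex.exp_ne_zero _))
  have h3 : Tendsto (fun ζ : ℂ => -((q₀ : ℂ) ^ 4 / (pp * conj pm)) / (ζ ^ 2 - (q₀ : ℂ) ^ 2))
      (𝓝[≠] 0 ⊓ 𝓟 {ζ | ζ.im ≤ 0}) (𝓝 (-((q₀ : ℂ) ^ 4 / (pp * conj pm)) / (0 ^ 2 - (q₀ : ℂ) ^ 2))) := by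
    have hc : ContinuousAt (fun ζ : ℂ => -((q₀ : ℂ) ^ 4 / (pp * conj pm)) / (ζ ^ 2 - (q₀ : ℂ) ^ 2)) 0 :=
      continuousAt_const.div (by fun_prop) (by simpa using hqn)
    exact hc.tendsto.mono_left (inf_le_left.trans nhdsWithin_le_nhds)
  have h4 := h1.div (h2.mul h3) (mul_ne_zero hE0 (div_ne_zero
    (neg_ne_zero.mpr (div_ne_zero (pow_ne_zero 4 hqn) (mul_ne_zero hpp hpm))) (by simpa using hqn)))
  rw [zero_div] at h4
  refine h4.congr' ?_
  have h5 : ∀ᶠ ζ : ℂ in 𝓝[≠] 0 ⊓ 𝓟 {ζ | ζ.im ≤ 0}, ζ ≠ 0 ∧ ζ.im ≤ 0 := by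
    rw [eventually_inf_principal]
    filter_upwards [self_mem_nhdsWithin] with ζ hζ him using ⟨hζ, him⟩
  have h6 : ∀ᶠ ζ : ℂ in 𝓝[≠] 0 ⊓ 𝓟 {ζ | ζ.im ≤ 0}, ((q₀ : ℂ) ^ 2 / conj ζ).im ≤ 0 :=
    (tendsto_inversion hq).eventually (by
      rw [lowerInf]; exact mem_inf_of_right (mem_principal_self _))
  filter_upwards [h5, h6] with ζ hζ hi
  have hi0 : (q₀ : ℂ) ^ 2 / conj ζ ≠ 0 := div_ne_zero (pow_ne_zero 2 hqn) ((map_ne_zero _).mpr hζ.1)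
  simp only [Pi.div_apply, Function.comp_apply, lcore_one, atil]
  rw [conj_jostW_inv h hζ.1 hζ.2 hi0 hi, mul_div_assoc]
  congr 2
  have hz := hζ.1
  field_simp

end Line

/-! ### The Riemann-Hilbert function and its partial fractions -/

section Soliton

variable {q₀ : ℝ} {p : ℝ → ℂ} {d : ℝ → ℝ} {pp pm : ℂ} {N : ℕ} {β : Fin N → ℝ} {ct : Fin N → ℂ}

/-- The sectionally analytic function of the Riemann-Hilbert problem. -/
noncomputable def rhY (q₀ : ℝ) (p : ℝ → ℂ) (d : ℝ → ℝ) (pp pm : ℂ) (x : ℝ) : ℂ → ℂ :=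
  glue (fun ζ => jcore q₀ p d pp ζ x 0) fun ζ => lcore q₀ p d pm ζ x 1 / atil q₀ p d pp pm ζ

/-- The exceptional points of the Riemann-Hilbert problem. -/
noncomputable def excSet (q₀ : ℝ) (β : Fin N → ℝ) : Finset ℂ :=
  {0, (q₀ : ℂ), -(q₀ : ℂ)} ∪ Finset.univ.image fun j => eigen q₀ (β j)

lemma mem_excSet {ζ : ℂ} : ζ ∈ excSet q₀ β ↔ (ζ = 0 ∨ ζ = q₀ ∨ ζ = -q₀) ∨ ∃ j, ζ = eigen q₀ (β j) := by
  simp [excSet, eq_comm, or_assoc]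

namespace PureSoliton

/-- The jump condition: without reflection φ_{-,2} is ã times the swapped conjugate of φ_{+,1}, so
the two halves of Y match on the real axis. -/
lemma jcore_real_eq (h : PureSoliton q₀ p d pp pm β ct) {s : ℝ} (hs : s ≠ 0) (h1 : s ≠ q₀)
    (h2 : s ≠ -q₀) (x : ℝ) :
    jcore q₀ p d pp s x 0 = conj (lcore q₀ p d pm s x 1 / atil q₀ p d pp pm s) := by
  have ha := atil_real_ne_zero h.line hs h1 h2
  have e := ljost_eq_smul_of_wronskian_eq_zero h.line hs h1 h2 (h.refl s hs h1 h2) x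
  rw [lcore_eq_smul_ljost, e, jcore_eq_smul_rjost]
  simp only [Pi.smul_apply, smul_eq_mul, sconj, Matrix.cons_val_one, Matrix.cons_val_fin_one]
  rw [mul_left_comm, mul_div_cancel_left₀ _ ha, map_mul, Complex.conj_conj, ← Complex.exp_conj]
  simp [conj_lam]

lemma atil_ne_zero (h : PureSoliton q₀ p d pp pm β ct) {ζ : ℂ} (him : ζ.im ≤ 0)
    (hs : conj ζ ∉ excSet q₀ β) : atil q₀ p d pp pm ζ ≠ 0 := by
  rw [mem_excSet] at hs
  push Not at hs
  rcases him.lt_or_eq with h1 | h1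
  · intro h0
    obtain ⟨j, hj⟩ := h.zeros ζ h1 h0
    exact hs.2 j (by rw [hj, Complex.conj_conj])
  · have hc : conj ζ = ζ := Complex.conj_eq_iff_im.mpr h1
    have h9 : ((ζ.re : ℝ) : ℂ) = ζ := by apply Complex.ext <;> simp [h1]
    rw [hc, ← h9] at hs
    rw [← h9]
    exact atil_real_ne_zero h.line (by exact_mod_cast hs.1.1) (by exact_mod_cast hs.1.2.1)
      (by exact_mod_cast hs.1.2.2)

lemma differentiableAt_rhY (h : PureSoliton q₀ p d pp pm β ct) (x : ℝ) {z : ℂ}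
    (hz : z ∉ excSet q₀ β) : DifferentiableAt ℂ (rhY q₀ p d pp pm x) z := by
  have hq := h.line.right.pos
  -- Gluing needs a set stable under conjugation, so the conjugate eigenvalues are omitted too,
  -- although Y is holomorphic there; they are recovered separately.
  set U : Set ℂ := {z | z ∉ excSet q₀ β ∧ conj z ∉ excSet q₀ β} with hU
  have hlow : ∀ {w : ℂ}, w.im ≤ 0 → ∀ j, w ≠ eigen q₀ (β j) := fun {w} hw j h0 => by
    have := eigen_im_pos hq (h.mem j)
    rw [← h0] at this; linarith
  have hopen : IsOpen U := by
    have h1 : IsOpen ((excSet q₀ β : Set ℂ))ᶜ := (excSet q₀ β).finite_toSet.isClosed.isOpen_compl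
    exact h1.inter (h1.preimage Complex.continuous_conj)
  have hsub : ∀ w ∈ U ∩ {ζ | ζ.im ≤ 0}, (w ≠ 0 ∧ w ≠ q₀ ∧ w ≠ -q₀) ∧ w.im ≤ 0 := fun w hw => by
    have h1 := hw.1.1
    rw [mem_excSet] at h1
    push Not at h1
    exact ⟨h1.1, hw.2⟩
  have hcj : ∀ i, ContinuousOn (fun ζ => jcore q₀ p d pp ζ x i) {ζ | ζ ≠ 0 ∧ ζ.im ≤ 0} :=
    continuousOn_pi.mp (continuousOn_jcore h.line.right x)
  have hcl : ∀ i, ContinuousOn (fun ζ => lcore q₀ p d pm ζ x i) {ζ | ζ ≠ 0 ∧ ζ.im ≤ 0} :=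
    continuousOn_pi.mp (continuousOn_lcore h.line x)
  have key : ∀ w ∈ U, DifferentiableAt ℂ (rhY q₀ p d pp pm x) w := fun w hw => by
    refine differentiableAt_glue hopen (fun w hw => ⟨hw.2, by rw [Complex.conj_conj]; exact hw.1⟩)
      ((hcj 0).mono fun w hw => ⟨(hsub w hw).1.1, hw.2⟩)
      (((hcl 1).mono fun w hw => ⟨(hsub w hw).1.1, hw.2⟩).div
        ((continuousOn_atil h.line).mono hsub) fun w hw => h.atil_ne_zero hw.2 hw.1.2)
      ((differentiableOn_pi.mp (differentiableOn_jcore h.line.right x) 0).mono fun w hw => hw.2)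
      (((differentiableOn_lcore_one h.line x).mono fun w hw => hw.2).div
        ((differentiableOn_atil h.line).mono fun w hw => hw.2) fun w hw =>
          h.atil_ne_zero (le_of_lt hw.2) hw.1.2) (fun s hs => ?_) hw
    have h1 := hs.1
    rw [mem_excSet] at h1
    push Not at h1
    exact h.jcore_real_eq (by exact_mod_cast h1.1.1) (by exact_mod_cast h1.1.2.1)
      (by exact_mod_cast h1.1.2.2) x
  by_cases hc : conj z ∈ excSet q₀ β
  · -- only the conjugates of the eigenvalues remain
    rw [mem_excSet] at hc hz
    push Not at hz
    have hc' : ∃ j, conj z = eigen q₀ (β j) := by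
      refine hc.resolve_left fun h0 => ?_
      have hr : ∀ c : ℂ, conj c = c → conj z = c → z = c := fun c hc h => by
        rw [← Complex.conj_conj z, h, hc]
      rcases h0 with h0 | h0 | h0
      · exact hz.1.1 (hr _ (by simp) h0)
      · exact hz.1.2.1 (hr _ (by simp) h0)
      · exact hz.1.2.2 (hr _ (by simp) h0)
    obtain ⟨j, hj⟩ := hc'
    have him : z.im < 0 := by
      have := eigen_im_pos hq (h.mem j)
      rw [← hj, Complex.conj_im] at this
      linarith
    refine ((differentiableOn_pi.mp (differentiableOn_jcore h.line.right x) 0).differentiableAt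
      (isOpen_im_neg.mem_nhds him)).congr_of_eventuallyEq ?_
    filter_upwards [isOpen_im_neg.mem_nhds him] with w hw
    have hw' : w.im < 0 := hw
    simp [rhY, glue, hw'.le]
  · exact key z ⟨hz, hc⟩

lemma tendsto_rhY (h : PureSoliton q₀ p d pp pm β ct) (x : ℝ) :
    Tendsto (rhY q₀ p d pp pm x) (cocompact ℂ) (𝓝 (Complex.exp (Complex.I * tailD d x))) :=
  tendsto_glue tendsto_conj_cocompact (tendsto_jcore_zero h.line.right x)
    (tendsto_lcore_div_lowerInf h.line x)

lemma tendsto_mul_rhY_zero (h : PureSoliton q₀ p d pp pm β ct) (x : ℝ) :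
    Tendsto (fun z => (z - 0) * rhY q₀ p d pp pm x z) (𝓝[≠] 0) (𝓝 0) := by
  unfold rhY
  simp only [mul_glue (map_zero _)]
  refine tendsto_glue (tendsto_conj_punctured (map_zero _)) ?_ ?_
  · simpa only [sub_zero] using tendsto_mul_jcore_zero h.line.right x
  · rw [map_zero]
    simpa only [sub_zero] using tendsto_mul_lcore_div_zero h.line x

/-- At `±q₀` the function stays bounded. -/
lemma tendsto_mul_rhY_branch (h : PureSoliton q₀ p d pp pm β ct) (x : ℝ) {s₀ : ℝ}
    (hs₀ : s₀ = q₀ ∨ s₀ = -q₀) :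
    Tendsto (fun z => (z - s₀) * rhY q₀ p d pp pm x z) (𝓝[≠] (s₀ : ℂ)) (𝓝 0) := by
  have hq := h.line.right.pos
  have hs0 : s₀ ≠ 0 := by rcases hs₀ with rfl | rfl <;> simp [hq.ne']
  have hsc : (s₀ : ℂ) ≠ 0 := by exact_mod_cast hs0
  have hsq : s₀ ^ 2 = q₀ ^ 2 := by rcases hs₀ with rfl | rfl <;> ring
  have hsqc : (s₀ : ℂ) ^ 2 = (q₀ : ℂ) ^ 2 := by exact_mod_cast hsq
  have hcs : conj (s₀ : ℂ) = s₀ := Complex.conj_ofReal s₀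
  have hmem : (s₀ : ℂ) ∈ {ζ : ℂ | ζ ≠ 0 ∧ ζ.im ≤ 0} := ⟨hsc, by simp⟩
  -- The branch points lie on the circle |ζ| = q₀, where the first component has no zeros. This
  -- makes 1/Y the right function to study.
  have hne : ∀ {p : ℝ → ℂ} {d : ℝ → ℝ} {pinf : ℂ}, RightPotential q₀ p d pinf → ∀ x,
      jcore q₀ p d pinf s₀ x 0 ≠ 0 := fun {p d pinf} hr x => by
    have hn : ‖(s₀ : ℂ)‖ = q₀ := by
      rw [Complex.norm_real, Real.norm_eq_abs, ← abs_of_pos hq]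
      exact (sq_eq_sq_iff_abs_eq_abs _ _).mp hsq
    rw [jcore_eq_smul_rjost]
    exact mul_ne_zero (Complex.exp_ne_zero _) (circle_ne_zero hr hn (by simp) x)
  set l : Filter ℂ := 𝓝[≠] (s₀ : ℂ) ⊓ 𝓟 {ζ | ζ.im ≤ 0} with hl
  have hlnb : l.NeBot := by
    rw [hl, ← nhdsWithin_inter', ← mem_closure_iff_nhdsWithin_neBot]
    have h1 : Tendsto (fun n : ℕ => (s₀ : ℂ) - Complex.I * (1 / ((n : ℝ) + 1) : ℝ)) atTop (𝓝 s₀) := by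
      have h2 := ((Complex.continuous_ofReal.tendsto 0).comp
        (tendsto_one_div_add_atTop_nhds_zero_nat (𝕜 := ℝ))).const_mul Complex.I
      have h3 := h2.const_sub (s₀ : ℂ)
      simpa only [Complex.ofReal_zero, mul_zero, sub_zero, Function.comp_apply] using h3
    refine mem_closure_of_tendsto h1 (Eventually.of_forall fun n => ?_)
    have hn : 0 < 1 / ((n : ℝ) + 1) := by positivity
    have him : ((s₀ : ℂ) - Complex.I * (1 / ((n : ℝ) + 1) : ℝ)).im = -(1 / ((n : ℝ) + 1)) := by
      rw [Complex.sub_im, Complex.im_mul_ofReal]; simp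
    refine ⟨fun h0 => ?_, ?_⟩
    · have h1 : (s₀ : ℂ) - Complex.I * (1 / ((n : ℝ) + 1) : ℝ) = s₀ := h0
      rw [h1, Complex.ofReal_im] at him
      linarith
    · rw [Set.mem_ofPred_eq, him]; linarith
  have hlle : l ≤ 𝓝[{ζ : ℂ | ζ ≠ 0 ∧ ζ.im ≤ 0}] (s₀ : ℂ) := by
    refine le_inf (inf_le_left.trans nhdsWithin_le_nhds) (le_principal_iff.mpr ?_)
    rw [hl, mem_inf_principal]
    filter_upwards [nhdsWithin_le_nhds (isOpen_ne.mem_nhds hsc)] with ζ h1 h2 using ⟨h1, h2⟩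
  have hF : Tendsto (fun ζ => jcore q₀ p d pp ζ x 0) l (𝓝 (jcore q₀ p d pp s₀ x 0)) :=
    ((continuousOn_pi.mp (continuousOn_jcore h.line.right x) 0) _ hmem).mono_left hlle
  have hN : Tendsto (fun ζ => lcore q₀ p d pm ζ x 1) l (𝓝 (lcore q₀ p d pm s₀ x 1)) :=
    ((continuousOn_pi.mp (continuousOn_lcore h.line x) 1) _ hmem).mono_left hlle
  have hF0 := hne h.line.right x
  have hN0 : lcore q₀ p d pm s₀ x 1 ≠ 0 := hne h.line.left (-x)
  have hW : Tendsto (jostW q₀ p d pp pm) l (𝓝 (jostW q₀ p d pp pm s₀)) :=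
    ((continuousOn_jostW h.line) _ hmem).mono_left hlle
  have hid : Tendsto (fun z : ℂ => z) l (𝓝 s₀) := inf_le_left.trans nhdsWithin_le_nhds
  have hlow : ∀ᶠ z : ℂ in l, z.im ≤ 0 := mem_inf_of_right (mem_principal_self _)
  -- the reciprocal
  have hH : Tendsto (fun z => (rhY q₀ p d pp pm x z)⁻¹) l (𝓝 (jcore q₀ p d pp s₀ x 0)⁻¹) := by
    refine (hF.inv₀ hF0).congr' ?_
    filter_upwards [hlow] with z hz
    simp [rhY, glue, hz]
  have hexc : ∀ᶠ z in 𝓝[≠] (s₀ : ℂ), z ∉ excSet q₀ β := by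
    have h1 : ((excSet q₀ β : Set ℂ) \ {(s₀ : ℂ)})ᶜ ∈ 𝓝 (s₀ : ℂ) :=
      (((excSet q₀ β).finite_toSet.sdiff).isClosed.isOpen_compl).mem_nhds (by simp)
    filter_upwards [nhdsWithin_le_nhds h1, self_mem_nhdsWithin] with z h2 h3 h4
    exact h2 ⟨h4, h3⟩
  have hexcc : ∀ᶠ z in 𝓝[≠] (s₀ : ℂ), conj z ∉ excSet q₀ β :=
    (tendsto_conj_punctured hcs).eventually hexc
  have hY0 : ∀ᶠ z in 𝓝[≠] (s₀ : ℂ), rhY q₀ p d pp pm x z ≠ 0 := by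
    refine eventually_glue (P := fun z => z ≠ 0) (fun z hz => (map_ne_zero _).mpr hz)
      (tendsto_conj_punctured hcs) (hF.eventually_ne hF0) ?_
    have h2 : ∀ᶠ z in l, conj z ∉ excSet q₀ β := (inf_le_left : l ≤ _) hexcc
    filter_upwards [hN.eventually_ne hN0, h2, hlow] with z h1 h2 h3
    exact div_ne_zero h1 (h.atil_ne_zero h3 h2)
  have hd : ∀ᶠ z in 𝓝[≠] (s₀ : ℂ), DifferentiableAt ℂ (fun z => (rhY q₀ p d pp pm x z)⁻¹) z := by
    filter_upwards [hexc, hY0] with z h1 h2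
    exact (h.differentiableAt_rhY x h1).inv h2
  have hb1 : Tendsto (fun z => (z - s₀) * (jcore q₀ p d pp z x 0)⁻¹) l
      (𝓝 ((s₀ - s₀) * (jcore q₀ p d pp s₀ x 0)⁻¹)) := (hid.sub_const _).mul (hF.inv₀ hF0)
  have hb2 : Tendsto (fun z => jostW q₀ p d pp pm z * z ^ 2 / (z + s₀) / lcore q₀ p d pm z x 1) l
      (𝓝 (jostW q₀ p d pp pm s₀ * s₀ ^ 2 / (s₀ + s₀) / lcore q₀ p d pm s₀ x 1)) := by
    refine (((hW.mul (hid.pow 2)).div (hid.add_const _) ?_)).div hN hN0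
    rw [← two_mul]; exact mul_ne_zero two_ne_zero hsc
  set C := max (‖((s₀ : ℂ) - s₀) * (jcore q₀ p d pp s₀ x 0)⁻¹‖ + 1)
    (‖jostW q₀ p d pp pm s₀ * s₀ ^ 2 / (s₀ + s₀) / lcore q₀ p d pm s₀ x 1‖ + 1) with hC
  -- Above the axis 1/Y is the conjugate of ã/m, and ã has at worst order 1/(ζ − s₀). No case
  -- distinction on whether W vanishes at s₀ is needed.
  have hbd : ∀ᶠ z in 𝓝[≠] (s₀ : ℂ), ‖(z - s₀) * (rhY q₀ p d pp pm x z)⁻¹‖ ≤ C := by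
    have e : ∀ z, (z - s₀) * (rhY q₀ p d pp pm x z)⁻¹ =
        glue (fun z => (z - s₀) * (jcore q₀ p d pp z x 0)⁻¹)
          (fun z => (z - s₀) * (lcore q₀ p d pm z x 1 / atil q₀ p d pp pm z)⁻¹) z := fun z => by
      rw [← mul_glue hcs, rhY, inv_glue]
    simp only [e]
    refine eventually_glue (P := fun z => ‖z‖ ≤ C) (fun z hz => by rwa [RCLike.norm_conj])
      (tendsto_conj_punctured hcs) ?_ ?_
    · filter_upwards [hb1.norm.eventually_lt_const (lt_add_one _)] with z hz
      exact hz.le.trans (le_max_left _ _)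
    · have hne : ∀ᶠ z in l, z ≠ (s₀ : ℂ) ∧ z ≠ 0 ∧ z + s₀ ≠ 0 := by
        have h3 : ∀ᶠ z in l, z + s₀ ≠ (0 : ℂ) := (hid.add_const _).eventually_ne (by
          rw [← two_mul]; exact mul_ne_zero two_ne_zero hsc)
        have h1 : ∀ᶠ z in l, z ≠ (s₀ : ℂ) := (inf_le_left : l ≤ _) self_mem_nhdsWithin
        filter_upwards [h1, hid.eventually_ne hsc, h3] with z a b c using ⟨a, b, c⟩
      filter_upwards [hb2.norm.eventually_lt_const (lt_add_one _), hne] with z hz hn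
      refine le_trans (le_of_eq ?_) (hz.le.trans (le_max_right _ _))
      congr 1
      rw [inv_div, atil, ← mul_div_assoc]
      congr 1
      have h5 : z - s₀ ≠ 0 := sub_ne_zero.mpr hn.1
      have h6 : z ^ 2 - (q₀ : ℂ) ^ 2 = (z - s₀) * (z + s₀) := by rw [← hsqc]; ring
      have h7 : 1 - (q₀ : ℂ) ^ 2 / z ^ 2 = (z - s₀) * (z + s₀) / z ^ 2 := by
        rw [← h6]; field_simp [hn.2.1]
      rw [h7]
      have := hn.2.1
      have := hn.2.2
      field_simp
  have key := (tendsto_punctured_of_bounded (l := l) inf_le_left hd hbd hH).inv₀ (inv_ne_zero hF0)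
  simp only [inv_inv] at key
  have h0 : Tendsto (fun z : ℂ => z - s₀) (𝓝[≠] (s₀ : ℂ)) (𝓝 (s₀ - s₀)) :=
    (tendsto_id.sub_const _).mono_left nhdsWithin_le_nhds
  have := h0.mul key
  rwa [sub_self, zero_mul] at this

/-- The decay factor of the norming constants. -/
lemma norming_residue (h : PureSoliton q₀ p d pp pm β ct) (j : Fin N) (x : ℝ) :
    Tendsto (fun z => (z - eigen q₀ (β j)) * rhY q₀ p d pp pm x z) (𝓝[≠] (eigen q₀ (β j)))
      (𝓝 (conj (ct j) * Real.exp (-2 * (q₀ * Real.sin (β j)) * x) *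
        (-Complex.I * pp / eigen q₀ (β j)) * jcore q₀ p d pp (conj (eigen q₀ (β j))) x 0)) := by
  have hq := h.line.right.pos
  set ζ := eigen q₀ (β j) with hζ
  have him : 0 < ζ.im := eigen_im_pos hq (h.mem j)
  have hcim : (conj ζ).im < 0 := by rw [Complex.conj_im]; linarith
  have hn : ‖conj ζ‖ = q₀ := by rw [RCLike.norm_conj, norm_eigen hq]
  obtain ⟨bt, hb, hct⟩ := h.norming j
  obtain ⟨hbt, J, hJ, hder⟩ := exists_pos_hasDerivAt_atil h.line hn hcim hb
  have hder0 : deriv (atil q₀ p d pp pm) (conj ζ) ≠ 0 := by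
    rw [hder.deriv]
    refine neg_ne_zero.mpr (mul_ne_zero (mul_ne_zero hbt (div_ne_zero ?_ ?_)) ?_)
    · exact (map_ne_zero _).mpr h.line.right.inf_ne
    · exact ne_zero_of_im_neg hcim
    · exact_mod_cast hJ.ne'
  have ha0 : atil q₀ p d pp pm (conj ζ) = 0 := by
    rw [atil, jostW, hb 0]
    simp [wronskian]
    left; ring
  have hs := (hasDerivAt_iff_tendsto_slope.mp hder.differentiableAt.hasDerivAt)
  have hc : Tendsto (fun w => lcore q₀ p d pm w x 1) (𝓝[≠] (conj ζ)) (𝓝 (lcore q₀ p d pm (conj ζ) x 1)) :=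
    (((differentiableOn_lcore_one h.line x).differentiableAt
      (isOpen_im_neg.mem_nhds hcim)).continuousAt.tendsto).mono_left nhdsWithin_le_nhds
  have h1 := hc.div hs hder0
  have hmap : Tendsto (conj : ℂ → ℂ) (𝓝[≠] ζ) (𝓝[≠] (conj ζ)) := by
    refine tendsto_nhdsWithin_iff.mpr ⟨(Complex.continuous_conj.tendsto ζ).mono_left nhdsWithin_le_nhds, ?_⟩
    filter_upwards [self_mem_nhdsWithin] with z hz h0
    exact hz (star_injective h0)
  have h2 := (Complex.continuous_conj.tendsto _).comp (h1.comp hmap)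
  -- Proportionality replaces φ_{-,2} by φ_{+,1}, and the circle relation expresses the conjugate of
  -- its second component through its first. The residue thus involves only the value of Y at conj
  -- ζ_j, which closes the linear system.
  have hval : conj (lcore q₀ p d pm (conj ζ) x 1 / deriv (atil q₀ p d pp pm) (conj ζ)) =
      conj (ct j) * Real.exp (-2 * (q₀ * Real.sin (β j)) * x) *
        (-Complex.I * pp / ζ) * jcore q₀ p d pp (conj ζ) x 0 := by
    rw [lcore_eq_smul_ljost, hb x, jcore_eq_smul_rjost, hct]
    simp only [Pi.smul_apply, smul_eq_mul]
    rw [circle_mul_eq h.line.right hn hcim.le x]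
    simp only [map_div₀, map_mul, Complex.conj_conj, Complex.conj_I, ← Complex.exp_conj]
    rw [hζ, lam_conj_eigen hq]
    have e1 : Complex.exp (conj (-(Complex.I * -(Complex.I * ((q₀ * Real.sin (β j) : ℝ) : ℂ)) * x))) =
        Real.exp (-2 * (q₀ * Real.sin (β j)) * x) *
          Complex.exp (Complex.I * -(Complex.I * ((q₀ * Real.sin (β j) : ℝ) : ℂ)) * x) := by
      rw [Complex.ofReal_exp, ← Complex.exp_add]
      congr 1
      have hI := Complex.I_sq
      simp only [map_neg, map_mul, Complex.conj_I, Complex.conj_ofReal]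
      push_cast
      linear_combination (2 * q₀ * Complex.sin (β j) * x : ℂ) * hI
    rw [e1]
    ring
  rw [hval] at h2
  refine h2.congr' ?_
  filter_upwards [nhdsWithin_le_nhds (isOpen_im_pos.mem_nhds him), self_mem_nhdsWithin] with z hz hzne
  have hz' : ¬ z.im ≤ 0 := not_le.mpr hz
  have hzc : conj z - conj ζ ≠ 0 := by
    rw [← map_sub]; exact (map_ne_zero _).mpr (sub_ne_zero.mpr hzne)
  simp only [Function.comp_apply, Pi.div_apply, slope_def_field, ha0, sub_zero, rhY, glue, hz', if_false]
  simp only [map_div₀, map_sub, Complex.conj_conj]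
  rw [div_div_eq_mul_div, mul_comm, mul_div_assoc]

/-- The solution of the Riemann-Hilbert problem in partial fractions. -/
lemma jcore_eq_sum (h : PureSoliton q₀ p d pp pm β ct) (x : ℝ) {z : ℂ} (him : z.im ≤ 0)
    (h0 : z ≠ 0) (h1 : z ≠ q₀) (h2 : z ≠ -q₀) :
    jcore q₀ p d pp z x 0 = Complex.exp (Complex.I * tailD d x) +
      ∑ j, (conj (ct j) * Real.exp (-2 * (q₀ * Real.sin (β j)) * x) *
        (-Complex.I * pp / eigen q₀ (β j)) * jcore q₀ p d pp (conj (eigen q₀ (β j))) x 0) /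
          (z - eigen q₀ (β j)) := by
  have hq := h.line.right.pos
  set r : Fin N → ℂ := fun j => conj (ct j) * Real.exp (-2 * (q₀ * Real.sin (β j)) * x) *
        (-Complex.I * pp / eigen q₀ (β j)) * jcore q₀ p d pp (conj (eigen q₀ (β j))) x 0 with hr
  -- Residues as a function of the pole. It vanishes at 0 and ±q₀, which are not in the upper
  -- half-plane; distinctness of the angles makes it r j at ζ_j.
  set R : ℂ → ℂ := fun w => ∑ j, if eigen q₀ (β j) = w then r j else 0 with hR
  have hRreal : ∀ w : ℂ, w.im = 0 → R w = 0 := fun w hw => Finset.sum_eq_zero fun j _ => by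
    refine if_neg fun h0 => ?_
    have := eigen_im_pos hq (h.mem j)
    rw [h0, hw] at this
    exact lt_irrefl _ this
  have hReig : ∀ j, R (eigen q₀ (β j)) = r j := fun j => by
    rw [hR]
    simp only
    rw [Finset.sum_eq_single j (fun i _ hij => if_neg fun h0 => hij
      (h.inj (eigen_injOn hq (h.mem i) (h.mem j) h0))) (fun hj => absurd (Finset.mem_univ j) hj)]
    simp
  have hz : z ∉ excSet q₀ β := by
    rw [mem_excSet]; push Not
    refine ⟨⟨h0, h1, h2⟩, fun j hj => ?_⟩
    have := eigen_im_pos hq (h.mem j)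
    rw [← hj] at this; linarith
  have key := eq_add_sum_principal_parts (s := excSet q₀ β) (R := R)
    (fun w hw => h.differentiableAt_rhY x hw) (fun w hw => by
      rw [mem_excSet] at hw
      rcases hw with (rfl | rfl | rfl) | ⟨j, rfl⟩
      · rw [hRreal 0 (by simp)]; exact h.tendsto_mul_rhY_zero x
      · rw [hRreal _ (by simp)]; exact h.tendsto_mul_rhY_branch x (Or.inl rfl)
      · rw [hRreal _ (by simp)]
        have := h.tendsto_mul_rhY_branch x (s₀ := -q₀) (Or.inr rfl)
        rwa [Complex.ofReal_neg] at this
      · rw [hReig]; exact h.norming_residue j x) (h.tendsto_rhY x) hz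
  have hY : rhY q₀ p d pp pm x z = jcore q₀ p d pp z x 0 := by simp [rhY, glue, him]
  rw [← hY, key]
  congr 1
  have : ∀ w ∈ excSet q₀ β, R w / (z - w) =
      ∑ j, if eigen q₀ (β j) = w then r j / (z - eigen q₀ (β j)) else 0 := fun w _ => by
    rw [hR, Finset.sum_div]
    refine Finset.sum_congr rfl fun j _ => ?_
    split_ifs with h
    · rw [h]
    · rw [zero_div]
  rw [Finset.sum_congr rfl this, Finset.sum_comm]
  refine Finset.sum_congr rfl fun j _ => ?_
  rw [Finset.sum_ite_eq, if_pos (mem_excSet.mpr (Or.inr ⟨j, rfl⟩))]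

/-- Reconstruction of the potential. -/
lemma potential_eq (h : PureSoliton q₀ p d pp pm β ct) (x : ℝ) :
    p x * conj (Complex.exp (Complex.I * tailD d x)) / pp = Complex.exp (Complex.I * tailD d x) +
      ∑ j, (conj (ct j) * Real.exp (-2 * (q₀ * Real.sin (β j)) * x) *
        (-Complex.I * pp / eigen q₀ (β j)) * jcore q₀ p d pp (conj (eigen q₀ (β j))) x 0) /
          (0 - eigen q₀ (β j)) := by
  have hq := h.line.right.pos
  have h1 := tendsto_jcore_zero_at_zero h.line.right x
  have hz : Tendsto (fun η : ℝ => -Complex.I * ((q₀ ^ 2 / η : ℝ) : ℂ)) atTop (𝓝 0) := by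
    have h2 : Tendsto (fun η : ℝ => q₀ ^ 2 / η) atTop (𝓝 0) := tendsto_const_nhds.div_atTop tendsto_id
    have h3 := ((Complex.continuous_ofReal.tendsto 0).comp h2).const_mul (-Complex.I)
    simpa only [Complex.ofReal_zero, mul_zero, Function.comp_apply] using h3
  refine tendsto_nhds_unique h1 (Tendsto.congr' ?_ ((tendsto_finsetSum _ fun j _ =>
    tendsto_const_nhds.div (hz.sub_const (eigen q₀ (β j))) ?_).const_add _))
  · filter_upwards [eventually_gt_atTop 0] with η hη
    have hp : 0 < q₀ ^ 2 / η := by positivity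
    have him : (-Complex.I * ((q₀ ^ 2 / η : ℝ) : ℂ)).im = -(q₀ ^ 2 / η) := by
      rw [Complex.im_mul_ofReal]; simp
    have hne : (-Complex.I * ((q₀ ^ 2 / η : ℝ) : ℂ)).im ≠ 0 := by rw [him]; linarith
    refine (h.jcore_eq_sum x (by rw [him]; linarith) ?_ ?_ ?_).symm <;>
    · intro h0
      refine hne ?_
      rw [h0]; simp
  · simpa using eigen_ne_zero hq (β j)

end PureSoliton

end Soliton

/-! ### Determinants -/

/-- The coefficient of X^r in det(1 + XM) is the sum of the principal minors of size r; evaluation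
at X = 1 gives the expansion. -/
lemma det_one_add_eq_sum_minors {N : ℕ} (M : Matrix (Fin N) (Fin N) ℂ) :
    (1 + M).det = 1 + ∑ r ∈ Finset.Icc 1 N, ∑ S ∈ Finset.powersetCard r Finset.univ,
      principalMinor M S := by
  set P : Polynomial ℂ := (1 + (Polynomial.X : Polynomial ℂ) • M.map Polynomial.C).det with hP
  have hdeg : P.natDegree < N + 1 := by
    have := Polynomial.natDegree_det_X_add_C_le M (1 : Matrix (Fin N) (Fin N) ℂ)
    rw [Fintype.card_fin, Matrix.map_one _ (map_zero _) (map_one _), add_comm] at this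
    exact Nat.lt_succ_of_le this
  have heval : P.eval 1 = (1 + M).det := by
    rw [hP, ← Polynomial.coe_evalRingHom, RingHom.map_det]
    congr 1
    ext i j
    simp [Matrix.one_apply, apply_ite (Polynomial.eval (1 : ℂ))]
  rw [← heval, Polynomial.eval_eq_sum_range' hdeg]
  simp only [one_pow, mul_one]
  rw [Finset.sum_range_succ', add_comm]
  congr 1
  · rw [hP, Matrix.coeff_det_one_add_X_smul_eq_sum_minors]
    simp
  · rw [Finset.range_eq_Ico, Finset.sum_Ico_add' (fun k => P.coeff k) 0 N 1, zero_add]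
    refine Finset.sum_congr rfl fun r _ => ?_
    rw [hP, Matrix.coeff_det_one_add_X_smul_eq_sum_minors]
    rfl

/-- The Cauchy determinant. -/
lemma det_cauchy {ι : Type*} [LinearOrder ι] (x y : ι → ℂ) (hxy : ∀ i j, x i ≠ y j) (S : Finset ι) :
    (Matrix.of fun i j : {j // j ∈ S} => (x i - y j)⁻¹).det =
      (∏ j ∈ S, (x j - y j)⁻¹) * ∏ j ∈ S, ∏ k ∈ S with j < k,
        ((x j - x k) * (y k - y j) / ((x j - y k) * (x k - y j))) := by
  have hne : ∀ i j, x i - y j ≠ 0 := fun i j => sub_ne_zero.mpr (hxy i j)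
  induction S using Finset.induction_on_max with
  | empty => simp
  | insert a S ha ih =>
    have haS : a ∉ S := fun h => lt_irrefl _ (ha a h)
    set e := (Finset.subtypeInsertEquivOption haS).trans (Equiv.optionEquivSumPUnit.{0} _) with he
    set A : Matrix {j // j ∈ S} {j // j ∈ S} ℂ := Matrix.of fun i j => (x i - y j)⁻¹ with hA
    set D : Matrix Unit Unit ℂ := Matrix.of fun _ _ => (x a - y a)⁻¹ with hD
    set B : Matrix {j // j ∈ S} Unit ℂ := Matrix.of fun i _ => (x i - y a)⁻¹ with hB
    set C : Matrix Unit {j // j ∈ S} ℂ := Matrix.of fun _ j => (x a - y j)⁻¹ with hC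
    have h1 : (Matrix.of fun i j : {j // j ∈ insert a S} => (x i - y j)⁻¹) =
        (Matrix.fromBlocks A B C D).submatrix e e := by
      have hsymm : ∀ i : {j // j ∈ S}, e.symm (Sum.inl i) = ⟨i, Finset.mem_insert_of_mem i.2⟩ :=
        fun i => rfl
      have hsymm' : ∀ i : Unit, e.symm (Sum.inr i) = ⟨a, Finset.mem_insert_self a S⟩ := fun i => rfl
      have h2 : (Matrix.of fun i j : {j // j ∈ insert a S} => (x i - y j)⁻¹).submatrix e.symm e.symm =
          Matrix.fromBlocks A B C D := by
        ext (i | i) (j | j) <;> simp [hsymm, hsymm', hA, hB, hC, hD]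
      rw [← h2, Matrix.submatrix_submatrix]
      simp
    have hDdet : D.det = (x a - y a)⁻¹ := by rw [Matrix.det_unique]; rfl
    have : Invertible D := Matrix.invertibleOfIsUnitDet _ (by
      rw [hDdet]; exact (inv_ne_zero (hne a a)).isUnit)
    have hDinv : ⅟D = Matrix.of fun _ _ => (x a - y a) := by
      rw [Matrix.invOf_eq_nonsing_inv]
      refine Matrix.inv_eq_left_inv ?_
      ext i j
      simp [hD, Matrix.mul_apply, hne a a]
    -- The Schur complement of the last entry is again a Cauchy matrix up to diagonal factors,
    -- because (x_i − y_a)(x_a − y_j) − (x_a − y_a)(x_i − y_j) = (x_i − x_a)(y_a − y_j).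
    have hS : A - B * ⅟D * C = Matrix.diagonal (fun i : {j // j ∈ S} => (x i - x a) / (x i - y a)) * A *
        Matrix.diagonal (fun j : {j // j ∈ S} => (y a - y j) / (x a - y j)) := by
      ext i j
      rw [Matrix.mul_diagonal, Matrix.diagonal_mul, hDinv]
      simp only [Matrix.sub_apply, hA, hB, hC, Matrix.mul_apply, Matrix.of_apply, Finset.univ_unique,
        Finset.sum_singleton]
      have := hne i j
      have := hne i a
      have := hne a j
      field_simp
      ring
    rw [h1, Matrix.det_submatrix_equiv_self, Matrix.det_fromBlocks₂₂, hS, hDdet, Matrix.det_mul,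
      Matrix.det_mul, Matrix.det_diagonal, Matrix.det_diagonal, ih]
    have h3 : ∀ f : ι → ℂ, ∏ i : {j // j ∈ S}, f i = ∏ i ∈ S, f i := fun f =>
      Finset.prod_coe_sort S f
    rw [h3 (fun i => (x i - x a) / (x i - y a)), h3 (fun j => (y a - y j) / (x a - y j)),
      Finset.prod_insert haS, Finset.prod_insert haS]
    have h4 : (insert a S).filter (fun k => a < k) = ∅ := by
      refine Finset.filter_false_of_mem fun k hk hak => ?_
      rcases Finset.mem_insert.mp hk with rfl | hk
      · exact lt_irrefl _ hak
      · exact lt_asymm hak (ha k hk)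
    have h5 : ∀ j ∈ S, ∏ k ∈ insert a S with j < k,
        ((x j - x k) * (y k - y j) / ((x j - y k) * (x k - y j))) =
        ((x j - x a) / (x j - y a)) * ((y a - y j) / (x a - y j)) * ∏ k ∈ S with j < k,
        ((x j - x k) * (y k - y j) / ((x j - y k) * (x k - y j))) := fun j hj => by
      rw [Finset.filter_insert, if_pos (ha j hj), Finset.prod_insert (by simp [haS])]
      congr 1
      rw [mul_div_mul_comm]
    rw [h4, Finset.prod_empty, one_mul, Finset.prod_congr rfl h5, Finset.prod_mul_distrib,
      Finset.prod_mul_distrib]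
    ring

/-- A rank one update along a solution of a linear system. -/
lemma det_sub_vecMulVec {n : Type*} [Fintype n] [DecidableEq n] (G : Matrix n n ℂ) (v w : n → ℂ) :
    (G - Matrix.vecMulVec (G.mulVec v) w).det = G.det * (1 - ∑ j, w j * v j) := by
  have h1 : G - Matrix.vecMulVec (G.mulVec v) w = G * (1 + Matrix.replicateCol Unit (-v) *
      Matrix.replicateRow Unit w) := by
    rw [Matrix.mul_add, Matrix.mul_one, sub_eq_add_neg]
    congr 1
    ext i j
    simp [Matrix.vecMulVec, Matrix.mul_apply, Matrix.mulVec, dotProduct, Finset.sum_mul, mul_assoc]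
  rw [h1, Matrix.det_mul, Matrix.det_one_add_replicateCol_mul_replicateRow]
  simp [dotProduct, sub_eq_add_neg]

/-- The algebra behind the soliton formula: `g` are the coefficients, `X`, `Z` the nodes. -/
lemma det_soliton {N : ℕ} (X Z g y : Fin N → ℂ) (hXZ : ∀ i j, X i ≠ Z j) (hZ : ∀ i, Z i ≠ 0)
    (hy : ∀ k, y k = 1 - ∑ j, g j * y j / (X k - Z j)) :
    (1 + Matrix.of fun j k => g j * (X j / Z j) / (X j - Z k)).det =
      (1 + Matrix.of fun j k => g j / (X j - Z k)).det * (1 + ∑ j, g j * y j / Z j) := by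
  set G : Matrix (Fin N) (Fin N) ℂ := 1 + Matrix.of fun j k => g j / (X j - Z k) with hG
  -- The system for y, multiplied by g: the vector −g·y is the solution of G v = −g.
  have hv : G.mulVec (fun j => -(g j * y j)) = fun j => -g j := by
    ext j
    rw [hG, Matrix.add_mulVec, Matrix.one_mulVec]
    simp only [Pi.add_apply, Matrix.mulVec, dotProduct, Matrix.of_apply]
    have h1 : ∑ k, g j / (X j - Z k) * -(g k * y k) = -(g j * ∑ k, g k * y k / (X j - Z k)) := by
      rw [Finset.mul_sum, ← Finset.sum_neg_distrib]
      exact Finset.sum_congr rfl fun k _ => by ring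
    rw [h1]
    linear_combination (-(g j)) * hy j
  have h2 := det_sub_vecMulVec G (fun j => -(g j * y j)) (fun j => (Z j)⁻¹)
  -- Writing X_j = (X_j − Z_k) + Z_k after conjugation by the diagonal of Z splits off g_j/Z_k, a
  -- rank one term whose column is g = −G v.
  have h3 : Matrix.diagonal Z * (1 + Matrix.of fun j k => g j * (X j / Z j) / (X j - Z k)) *
      Matrix.diagonal (fun j => (Z j)⁻¹) =
      G - Matrix.vecMulVec (G.mulVec fun j => -(g j * y j)) (fun j => (Z j)⁻¹) := by
    ext j k
    rw [Matrix.mul_diagonal, Matrix.diagonal_mul, hv, hG]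
    simp only [Matrix.add_apply, Matrix.sub_apply, Matrix.of_apply, Matrix.vecMulVec_apply]
    have a1 := sub_ne_zero.mpr (hXZ j k)
    have a2 := hZ j
    have a3 := hZ k
    rcases eq_or_ne j k with rfl | hjk
    · simp only [Matrix.one_apply_eq]; field_simp; ring
    · rw [Matrix.one_apply_ne hjk]; field_simp; ring
  have h4 := congrArg Matrix.det h3
  rw [Matrix.det_mul, Matrix.det_mul, Matrix.det_diagonal, Matrix.det_diagonal, h2] at h4
  have h5 : (∏ j, Z j) * ∏ j, (Z j)⁻¹ = 1 := by
    rw [← Finset.prod_mul_distrib]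
    exact Finset.prod_eq_one fun j _ => mul_inv_cancel₀ (hZ j)
  have h6 : ∑ j, (Z j)⁻¹ * -(g j * y j) = -∑ j, g j * y j / Z j := by
    rw [← Finset.sum_neg_distrib]
    exact Finset.sum_congr rfl fun j _ => by ring
  rw [h6, sub_neg_eq_add] at h4
  rw [← h4]
  linear_combination (-(1 + Matrix.of fun j k => g j * (X j / Z j) / (X j - Z k)).det) * h5

/-- Conjugation by a diagonal matrix. -/
lemma det_one_add_conj {N : ℕ} (f c : Fin N → ℂ) (K : Matrix (Fin N) (Fin N) ℂ) :
    (1 + Matrix.of fun j k => f j * c j * f k * K j k).det =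
      (1 + Matrix.of fun j k => f j ^ 2 * c j * K j k).det := by
  have h1 : (Matrix.of fun j k => f j * c j * f k * K j k) =
      (Matrix.diagonal (fun j => f j * c j) * K) * Matrix.diagonal f := by
    ext j k; rw [Matrix.mul_diagonal, Matrix.diagonal_mul, Matrix.of_apply]; ring
  have h2 : (Matrix.of fun j k => f j ^ 2 * c j * K j k) =
      Matrix.diagonal f * (Matrix.diagonal (fun j => f j * c j) * K) := by
    ext j k; rw [Matrix.diagonal_mul, Matrix.diagonal_mul, Matrix.of_apply]; ring
  rw [h1, h2, Matrix.det_one_add_mul_comm]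

/-- The principal minors of a weighted Cauchy matrix. -/
lemma principalMinor_cauchy {N : ℕ} (f c x y : Fin N → ℂ) (hxy : ∀ i j, x i ≠ y j)
    (S : Finset (Fin N)) :
    principalMinor (Matrix.of fun j k => f j * c j * f k / (x j - y k)) S =
      (∏ j ∈ S, f j ^ 2 * c j * (x j - y j)⁻¹) * ∏ j ∈ S, ∏ k ∈ S with j < k,
        ((x j - x k) * (y k - y j) / ((x j - y k) * (x k - y j))) := by
  have h1 : (Matrix.submatrix (Matrix.of fun j k => f j * c j * f k / (x j - y k))
      (Subtype.val : {j // j ∈ S} → Fin N) Subtype.val) =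
      Matrix.diagonal (fun j : {j // j ∈ S} => f j * c j) *
        (Matrix.of fun i j : {j // j ∈ S} => (x i - y j)⁻¹) *
          Matrix.diagonal (fun j : {j // j ∈ S} => f j) := by
    ext j k
    rw [Matrix.mul_diagonal, Matrix.diagonal_mul, Matrix.of_apply, Matrix.submatrix_apply, Matrix.of_apply]
    ring
  rw [principalMinor, h1, Matrix.det_mul, Matrix.det_mul, Matrix.det_diagonal, Matrix.det_diagonal,
    det_cauchy x y hxy, Finset.prod_coe_sort S (fun j => f j * c j), Finset.prod_coe_sort S f]
  have h2 : (∏ j ∈ S, f j ^ 2 * c j * (x j - y j)⁻¹) =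
      (∏ j ∈ S, f j * c j) * (∏ j ∈ S, f j) * ∏ j ∈ S, (x j - y j)⁻¹ := by
    rw [← Finset.prod_mul_distrib, ← Finset.prod_mul_distrib]
    exact Finset.prod_congr rfl fun j _ => by ring
  rw [h2]; ring

/-- The interaction factor for conjugate nodes. -/
lemma cauchy_factor_conj (z w : ℂ) :
    (conj z - conj w) * (w - z) / ((conj z - w) * (conj w - z)) =
      (‖(-z + w) / (-conj z + w)‖ : ℂ) ^ 2 := by
  rw [← Complex.mul_conj']
  simp only [map_div₀, map_add, map_neg, Complex.conj_conj]
  rw [div_mul_div_comm]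
  have h1 : (conj z - conj w) * (w - z) = -((-z + w) * (-conj z + conj w)) := by ring
  have h2 : (conj z - w) * (conj w - z) = -((-conj z + w) * (-z + conj w)) := by ring
  rw [h1, h2, neg_div_neg_eq]

/-- The chord between q₀e^{is} and q₀e^{ic} has length 2q₀|sin((s − c)/2)|; numerator and
denominator are the cases s = b and s = −b. -/
lemma norm_eigen_factor {q₀ : ℝ} (hq : 0 < q₀) (b c : ℝ) :
    (‖(-eigen q₀ b + eigen q₀ c) / (-conj (eigen q₀ b) + eigen q₀ c)‖ : ℂ) ^ 2 =
      ((Real.sin ((b - c) / 2) ^ 2 / Real.sin ((b + c) / 2) ^ 2 : ℝ) : ℂ) := by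
  have key : ∀ s : ℝ, ‖-eigen q₀ s + eigen q₀ c‖ ^ 2 = 4 * q₀ ^ 2 * Real.sin ((s - c) / 2) ^ 2 :=
      fun s => by
    rw [← Complex.normSq_eq_norm_sq, Complex.normSq_apply]
    simp only [Complex.add_re, Complex.add_im, Complex.neg_re, Complex.neg_im, eigen_re, eigen_im]
    have h1 : Real.cos (s - c) = 1 - 2 * Real.sin ((s - c) / 2) ^ 2 := by
      have := Real.cos_two_mul ((s - c) / 2)
      rw [mul_div_cancel₀ _ two_ne_zero] at this
      rw [this, Real.cos_sq']; ring
    rw [Real.cos_sub] at h1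
    linear_combination (-2 * q₀ ^ 2) * h1 + q₀ ^ 2 * Real.sin_sq_add_cos_sq s +
      q₀ ^ 2 * Real.sin_sq_add_cos_sq c
  have hc : conj (eigen q₀ b) = eigen q₀ (-b) := by
    apply Complex.ext <;> simp [eigen_re, eigen_im]
  have h3 : ‖(-eigen q₀ b + eigen q₀ c) / (-conj (eigen q₀ b) + eigen q₀ c)‖ ^ 2 =
      Real.sin ((b - c) / 2) ^ 2 / Real.sin ((b + c) / 2) ^ 2 := by
    rw [norm_div, div_pow, key, hc, key, mul_div_mul_left _ _ (by positivity)]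
    congr 1
    rw [show (-b - c) / 2 = -((b + c) / 2) by ring, Real.sin_neg, neg_sq]
  exact_mod_cast h3

/-! ### Compatible linear systems -/

section Compat

variable {E : Type*} [NormedAddCommGroup E] [NormedSpace ℝ E]

lemma gronwallBound_le {δ K ε x : ℝ} (hK : 0 < K) (hε : 0 ≤ ε) :
    gronwallBound δ K ε x ≤ (δ + ε / K) * Real.exp (K * x) := by
  rw [gronwallBound_of_K_ne_0 hK.ne']
  have : 0 ≤ ε / K := by positivity
  nlinarith

/-- The first order expansion in the parameter is uniform on compact sets. -/
lemma exists_uniform_deriv {F F' : ℝ → ℝ → E} (hF : ∀ x t, HasDerivAt (F x) (F' x t) t)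
    (hc : Continuous fun p : ℝ × ℝ => F' p.1 p.2) (R t : ℝ) {ε : ℝ} (hε : 0 < ε) :
    ∃ η > 0, ∀ h, |h| ≤ η → ∀ x, |x| ≤ R → ‖F x (t + h) - F x t - h • F' x t‖ ≤ ε * |h| := by
  have hK : IsCompact (Set.Icc (-R) R ×ˢ Set.Icc (t - 1) (t + 1)) := isCompact_Icc.prod isCompact_Icc
  have hu := Metric.uniformContinuousOn_iff.mp (hK.uniformContinuousOn_of_continuous hc.continuousOn) ε hε
  obtain ⟨δ, hδ, hu⟩ := hu
  refine ⟨min 1 (δ / 2), by positivity, fun h hh x hx => ?_⟩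
  have h1 : |h| ≤ 1 := hh.trans (min_le_left _ _)
  have h2 : |h| ≤ δ / 2 := hh.trans (min_le_right _ _)
  have hd : ∀ s ∈ Set.uIcc t (t + h), HasDerivWithinAt (fun s => F x s - (s - t) • F' x t)
      (F' x s - F' x t) (Set.uIcc t (t + h)) s := fun s _ => by
    have e := ((hasDerivAt_id s).sub_const t).smul_const (F' x t)
    rw [one_smul] at e
    exact ((hF x s).sub e).hasDerivWithinAt
  have hb : ∀ s ∈ Set.uIcc t (t + h), ‖F' x s - F' x t‖ ≤ ε := fun s hs => by
    have hs1 : |s - t| ≤ |h| := by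
      have := Set.abs_sub_left_of_mem_uIcc hs
      simpa using this
    have hx' := abs_le.mp hx
    have hs2 := abs_le.mp (hs1.trans h1)
    have := hu (x, s) ⟨⟨hx'.1, hx'.2⟩, ⟨by linarith [hs2.1], by linarith [hs2.2]⟩⟩ (x, t)
      ⟨⟨hx'.1, hx'.2⟩, ⟨by linarith, by linarith⟩⟩ (by
        rw [Prod.dist_eq, dist_self, Real.dist_eq]
        exact max_lt hδ (by linarith))
    rw [dist_eq_norm] at this
    exact this.le
  have := (convex_uIcc t (t + h)).norm_image_sub_le_of_norm_hasDerivWithin_le hd hb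
    Set.left_mem_uIcc Set.right_mem_uIcc
  simpa [sub_right_comm] using this

/-- If the system in `x` and the system in `t` are compatible, a solution of the first that solves
the second on the line `x = 0` solves it everywhere. -/
lemma hasDerivAt_of_zeroCurvature {X V Xt Vx : ℝ → ℝ → E →L[ℝ] E} {ψ : ℝ → ℝ → E}
    (hX : Continuous fun p : ℝ × ℝ => X p.1 p.2) (hXt : ∀ x t, HasDerivAt (X x) (Xt x t) t)
    (hXtc : Continuous fun p : ℝ × ℝ => Xt p.1 p.2)
    (hVx : ∀ x t, HasDerivAt (fun y => V y t) (Vx x t) x)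
    (hzc : ∀ x t v, Xt x t v - Vx x t v + X x t (V x t v) - V x t (X x t v) = 0)
    (hψ : ∀ x t, HasDerivAt (fun y => ψ y t) (X x t (ψ x t)) x)
    (h0 : ∀ t, HasDerivAt (ψ 0) (V 0 t (ψ 0 t)) t) (x t : ℝ) :
    HasDerivAt (ψ x) (V x t (ψ x t)) t := by
  set R := |x| with hR
  obtain ⟨K, hK0, hK⟩ : ∃ K, 0 < K ∧ ∀ y h, |y| ≤ R → |h| ≤ 1 → ‖X y (t + h)‖ ≤ K := by
    have hcomp : IsCompact (Set.Icc (-R) R ×ˢ Set.Icc (-1 : ℝ) 1) := isCompact_Icc.prod isCompact_Icc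
    obtain ⟨K, hK⟩ := hcomp.exists_bound_of_continuousOn
      (f := fun p : ℝ × ℝ => X p.1 (t + p.2)) (by fun_prop)
    refine ⟨max K 1, by positivity, fun y h hy hh => ?_⟩
    exact (hK (y, h) ⟨abs_le.mp hy, abs_le.mp hh⟩).trans (le_max_left _ _)
  have hχc : Continuous fun y => ψ y t :=
    continuous_iff_continuousAt.mpr fun y => (hψ y t).continuousAt
  have hVc : Continuous fun y => V y t :=
    continuous_iff_continuousAt.mpr fun y => (hVx y t).continuousAt
  obtain ⟨M, hM0, hM⟩ := exists_norm_le_of_continuous hχc R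
  obtain ⟨M', hM'0, hM'⟩ := exists_norm_le_of_continuous (hVc.clm_apply hχc) R
  have hXtx : Continuous fun y => Xt y t := hXtc.comp (continuous_id.prodMk continuous_const)
  obtain ⟨L, hL0, hL⟩ := exists_norm_le_of_continuous hXtx R
  -- the remainder in the first order expansion
  set D := fun (h y : ℝ) => ψ y (t + h) - ψ y t - h • V y t (ψ y t) with hD
  have hDd : ∀ h y, HasDerivAt (D h) (X y (t + h) (D h y) + (h • (X y (t + h) - X y t) (V y t (ψ y t))
      + (X y (t + h) - X y t - h • Xt y t) (ψ y t))) y := fun h y => by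
    have e1 := (hψ y (t + h)).sub (hψ y t)
    have e2 := ((hVx y t).clm_apply (hψ y t)).const_smul h
    refine (e1.sub e2).congr_deriv ?_
    have e3 := hzc y t (ψ y t)
    -- Zero curvature replaces the derivative of Vψ by X_tψ + XVψ, so the remainder D solves the
    -- x-equation up to a source that is o(h). Only X_t and V_x occur, which is all that a twice
    -- differentiable field provides.
    have e4 : Vx y t (ψ y t) + V y t (X y t (ψ y t)) = Xt y t (ψ y t) + X y t (V y t (ψ y t)) := by
      rw [← sub_eq_zero, ← neg_eq_zero, ← e3]; abel
    rw [e4]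
    simp only [hD, map_sub, map_smul, sub_apply, smul_apply,
      smul_add, smul_sub]
    abel
  rw [hasDerivAt_iff_isLittleO_nhds_zero, Asymptotics.isLittleO_iff]
  intro c hc
  set B := Real.exp (K * R) with hB
  have hBpos : 0 < B := Real.exp_pos _
  obtain ⟨ε, hε0, hε⟩ : ∃ ε > 0, (ε + (ε * M' + ε * M) / K) * B ≤ c := by
    refine ⟨c / ((1 + (M' + M) / K) * B), by positivity, le_of_eq ?_⟩
    have : 0 < 1 + (M' + M) / K := by positivity
    field_simp
  obtain ⟨η, hη, hηx⟩ := exists_uniform_deriv hXt hXtc R t hε0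
  have hz := (hasDerivAt_iff_isLittleO_nhds_zero.mp (h0 t))
  rw [Asymptotics.isLittleO_iff] at hz
  have hsmall : ∀ᶠ h : ℝ in 𝓝 0, |h| ≤ min (min η 1) (ε / (ε + L)) := by
    have : (0:ℝ) < min (min η 1) (ε / (ε + L)) := by positivity
    filter_upwards [Metric.closedBall_mem_nhds (0:ℝ) this] with h hh
    simpa using hh
  filter_upwards [hz hε0, hsmall] with h hz0 hs
  have hs1 : |h| ≤ η := hs.trans ((min_le_left _ _).trans (min_le_left _ _))
  have hs2 : |h| ≤ 1 := hs.trans ((min_le_left _ _).trans (min_le_right _ _))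
  have hs3 : |h| ≤ ε / (ε + L) := hs.trans (min_le_right _ _)
  have hbound : ∀ y, |y| ≤ R → ‖X y (t + h) (D h y) + (h • (X y (t + h) - X y t) (V y t (ψ y t))
      + (X y (t + h) - X y t - h • Xt y t) (ψ y t))‖ ≤ K * ‖D h y‖ + (ε * M' + ε * M) * |h| :=
      fun y hy => by
    have a1 := hηx h hs1 y hy
    have a2 : ‖X y (t + h) - X y t‖ ≤ ε := by
      have b1 : ‖X y (t + h) - X y t‖ ≤ ε * |h| + |h| * L := by
        have b2 := norm_add_le (X y (t + h) - X y t - h • Xt y t) (h • Xt y t)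
        rw [sub_add_cancel, norm_smul, Real.norm_eq_abs] at b2
        exact b2.trans (add_le_add a1 (mul_le_mul_of_nonneg_left (hL y hy) (abs_nonneg h)))
      have b3 := (le_div_iff₀ (by positivity : 0 < ε + L)).mp hs3
      linarith
    have c1 : ‖X y (t + h) (D h y)‖ ≤ K * ‖D h y‖ :=
      (ContinuousLinearMap.le_opNorm _ _).trans (mul_le_mul_of_nonneg_right (hK y h hy hs2) (norm_nonneg _))
    have c2 : ‖h • (X y (t + h) - X y t) (V y t (ψ y t))‖ ≤ |h| * (ε * M') := by
      rw [norm_smul, Real.norm_eq_abs]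
      refine mul_le_mul_of_nonneg_left ?_ (abs_nonneg h)
      exact (ContinuousLinearMap.le_opNorm _ _).trans (mul_le_mul a2 (hM' y hy) (norm_nonneg _) hε0.le)
    have c3 : ‖(X y (t + h) - X y t - h • Xt y t) (ψ y t)‖ ≤ ε * |h| * M :=
      (ContinuousLinearMap.le_opNorm _ _).trans (mul_le_mul a1 (hM y hy) (norm_nonneg _) (by positivity))
    refine (norm_add_le _ _).trans ((add_le_add c1 ((norm_add_le _ _).trans (add_le_add c2 c3))).trans
      (le_of_eq ?_))
    ring
  -- Grönwall's inequality in x, started on the line x = 0, where the remainder is o(h) by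
  -- hypothesis.
  have hfin := norm_le_gronwallBound_abs (h := D h) (δ := ε * |h|) (R := R) (fun y _ => hDd h y)
    (by simpa [hD] using hz0) hbound x le_rfl
  refine hfin.trans ((gronwallBound_le hK0 (by positivity)).trans ?_)
  calc (ε * |h| + (ε * M' + ε * M) * |h| / K) * Real.exp (K * |x|)
      = ((ε + (ε * M' + ε * M) / K) * B) * |h| := by rw [hB, hR]; ring
    _ ≤ c * ‖h‖ := by rw [Real.norm_eq_abs]; gcongr

/-- Solutions of a system whose coefficients converge locally uniformly converge. -/
lemma tendsto_of_tendsto_coeff {V : ℝ → ℝ → E →L[ℝ] E} {Vinf : E →L[ℝ] E} {l : Filter ℝ}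
    (hV : ∀ t₀, Tendsto (fun p : ℝ × ℝ => V p.1 p.2) (l ×ˢ 𝓝 t₀) (𝓝 Vinf)) {m : ℝ → ℝ → E}
    (hm : ∀ x t, HasDerivAt (m x) (V x t (m x t)) t) {e : ℝ → E}
    (he : ∀ t, HasDerivAt e (Vinf (e t)) t) (h0 : Tendsto (fun x => m x 0) l (𝓝 (e 0))) (t : ℝ) :
    Tendsto (fun x => m x t) l (𝓝 (e t)) := by
  have hec : Continuous e := continuous_iff_continuousAt.mpr fun s => (he s).continuousAt
  obtain ⟨C, hC0, hC⟩ := exists_norm_le_of_continuous hec |t|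
  set K := ‖Vinf‖ + 1 with hK
  have hKpos : 0 < K := by positivity
  rw [Metric.tendsto_nhds]
  intro ε hε
  set B := Real.exp (K * |t|) with hB
  have hBpos : 0 < B := Real.exp_pos _
  obtain ⟨ε', hε'0, hε'⟩ : ∃ ε' > 0, (ε' + ε' * C / K) * B < ε := by
    refine ⟨ε / 2 / ((1 + C / K) * B), by positivity, ?_⟩
    have : 0 < 1 + C / K := by positivity
    have e1 : (ε / 2 / ((1 + C / K) * B) + ε / 2 / ((1 + C / K) * B) * C / K) * B = ε / 2 := by
      field_simp
    rw [e1]; linarith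
  -- Compactness of the time interval turns convergence that is local in t into uniform convergence.
  have hunif : ∀ᶠ x in l, ∀ s, |s| ≤ |t| → ‖V x s - Vinf‖ ≤ min 1 ε' := by
    have h1 : {p : ℝ × ℝ | ‖V p.1 p.2 - Vinf‖ ≤ min 1 ε'} ∈ l ×ˢ 𝓝ˢ (Set.Icc (-|t|) |t|) := by
      refine isCompact_Icc.mem_prod_nhdsSet_of_forall fun s _ => ?_
      have hpos : (0:ℝ) < min 1 ε' := by positivity
      filter_upwards [(Metric.tendsto_nhds.mp (hV s)) _ hpos] with p hp
      rw [dist_eq_norm] at hp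
      exact hp.le
    obtain ⟨a, ha, b, hb, hab⟩ := mem_prod_iff.mp h1
    filter_upwards [ha] with x hx s hs
    have hsb : s ∈ b := subset_of_mem_nhdsSet hb (Set.mem_Icc.mpr (abs_le.mp hs))
    have hp : (x, s) ∈ a ×ˢ b := ⟨hx, hsb⟩
    have := hab hp
    rwa [Set.mem_ofPred_eq] at this
  have h0' : ∀ᶠ x in l, ‖m x 0 - e 0‖ ≤ ε' := by
    filter_upwards [(Metric.tendsto_nhds.mp h0) _ hε'0] with x hx
    rw [dist_eq_norm] at hx
    exact hx.le
  filter_upwards [hunif, h0'] with x hx hx0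
  rw [dist_eq_norm]
  have key := norm_le_gronwallBound_abs (h := fun s => m x s - e s) (δ := ε') (K := K) (ε := ε' * C)
    (R := |t|) (fun s _ => (hm x s).sub (he s)) hx0 (fun s hs => by
      have a1 := hx s hs
      have a2 : V x s (m x s) - Vinf (e s) = Vinf (m x s - e s) + (V x s - Vinf) (m x s - e s) +
          (V x s - Vinf) (e s) := by
        simp only [map_sub, sub_apply]; abel
      rw [a2]
      refine (norm_add_le _ _).trans (add_le_add ((norm_add_le _ _).trans ?_) ?_)
      · rw [hK, add_mul, one_mul]
        refine add_le_add (ContinuousLinearMap.le_opNorm _ _) ?_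
        refine (ContinuousLinearMap.le_opNorm _ _).trans ?_
        exact mul_le_of_le_one_left (norm_nonneg _) (a1.trans (min_le_left _ _))
      · exact (ContinuousLinearMap.le_opNorm _ _).trans (mul_le_mul (a1.trans (min_le_right _ _))
          (hC s hs) (norm_nonneg _) hε'0.le)) t le_rfl
  exact (key.trans (gronwallBound_le hKpos (by positivity))).trans_lt hε'

/-- Joint solutions of compatible systems. -/
lemma exists_joint_solution [CompleteSpace E] {X V Xt Vx : ℝ → ℝ → E →L[ℝ] E}
    (hX : Continuous fun p : ℝ × ℝ => X p.1 p.2) (hXt : ∀ x t, HasDerivAt (X x) (Xt x t) t)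
    (hXtc : Continuous fun p : ℝ × ℝ => Xt p.1 p.2)
    (hV : Continuous fun p : ℝ × ℝ => V p.1 p.2)
    (hVx : ∀ x t, HasDerivAt (fun y => V y t) (Vx x t) x)
    (hzc : ∀ x t v, Xt x t v - Vx x t v + X x t (V x t v) - V x t (X x t v) = 0)
    {φ : ℝ → E} (hφ : ∀ x, HasDerivAt φ (X x 0 (φ x)) x) :
    ∃ ψ : ℝ → ℝ → E, (∀ x, ψ x 0 = φ x) ∧ (∀ x t, HasDerivAt (fun y => ψ y t) (X x t (ψ x t)) x) ∧
      ∀ x t, HasDerivAt (ψ x) (V x t (ψ x t)) t := by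
  -- First the t-equation along x = 0, then the x-equation at each t with the value g t at the
  -- origin; compatibility supplies the t-equation at the other x.
  obtain ⟨g, hg0, hg⟩ := exists_linear_ode (A := fun t => V 0 t) (by fun_prop) (φ 0)
  have hXc : ∀ t, Continuous fun x => X x t := fun t => by fun_prop
  choose ψ hψ0 hψ using fun t => exists_linear_ode (hXc t) (g t)
  refine ⟨fun x t => ψ t x, fun x => ?_, fun x t => hψ t x, fun x t => ?_⟩
  · exact congrFun (linear_ode_unique (hXc 0) (hψ 0) hφ (x₀ := 0) (by rw [hψ0, hg0])) x
  · refine hasDerivAt_of_zeroCurvature (ψ := fun x t => ψ t x) hX hXt hXtc hVx hzc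
      (fun x t => hψ t x) (fun t => ?_) x t
    simp only [hψ0]
    exact hg t

end Compat

/-- Multiplication by a matrix as a real linear map. -/
noncomputable def mulR (a b c e : ℂ) : (Fin 2 → ℂ) →L[ℝ] (Fin 2 → ℂ) :=
  (mulCLM !![a, b; c, e]).restrictScalars ℝ

lemma mulR_apply (a b c e : ℂ) (v : Fin 2 → ℂ) :
    mulR a b c e v = ![a * v 0 + b * v 1, c * v 0 + e * v 1] := by
  ext i
  fin_cases i <;> simp [mulR, mulCLM_apply, Matrix.mulVec, dotProduct, Fin.sum_univ_two]

lemma mulR_eq (a b c e : ℂ) : mulR a b c e =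
    ContinuousLinearMap.restrictScalarsL ℂ (Fin 2 → ℂ) (Fin 2 → ℂ) ℝ ℝ
      (a • mulCLM !![1, 0; 0, 0] + b • mulCLM !![0, 1; 0, 0] + c • mulCLM !![0, 0; 1, 0] +
      e • mulCLM !![0, 0; 0, 1]) := by
  rw [← mulCLM_eq]; rfl

lemma hasDerivAt_mulR {a b c e : ℝ → ℂ} {a' b' c' e' : ℂ} {x : ℝ} (ha : HasDerivAt a a' x)
    (hb : HasDerivAt b b' x) (hc : HasDerivAt c c' x) (he : HasDerivAt e e' x) :
    HasDerivAt (fun y => mulR (a y) (b y) (c y) (e y)) (mulR a' b' c' e') x := by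
  simp only [mulR_eq]
  have h1 := ha.smul_const (mulCLM !![1, 0; 0, 0])
  have h2 := hb.smul_const (mulCLM !![0, 1; 0, 0])
  have h3 := hc.smul_const (mulCLM !![0, 0; 1, 0])
  have h4 := he.smul_const (mulCLM !![0, 0; 0, 1])
  exact (ContinuousLinearMap.hasFDerivAt _).comp_hasDerivAt x (((h1.add h2).add h3).add h4)

lemma continuous_mulR {ι : Type*} [TopologicalSpace ι] {a b c e : ι → ℂ} (ha : Continuous a)
    (hb : Continuous b) (hc : Continuous c) (he : Continuous e) :
    Continuous fun y => mulR (a y) (b y) (c y) (e y) := by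
  simp only [mulR_eq]
  fun_prop

lemma tendsto_mulR {ι : Type*} {l : Filter ι} {a b c e : ι → ℂ} {a' b' c' e' : ℂ}
    (ha : Tendsto a l (𝓝 a')) (hb : Tendsto b l (𝓝 b')) (hc : Tendsto c l (𝓝 c'))
    (he : Tendsto e l (𝓝 e')) :
    Tendsto (fun y => mulR (a y) (b y) (c y) (e y)) l (𝓝 (mulR a' b' c' e')) := by
  simp only [mulR_eq]
  exact ((ContinuousLinearMap.continuous _).tendsto _).comp ((((ha.smul_const _).add
    (hb.smul_const _)).add (hc.smul_const _)).add (he.smul_const _))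

/-! ### The Lax pair and the evolution of the scattering data -/

lemma continuous_slice {X : Type*} [TopologicalSpace X] {F : ℝ → ℝ → X}
    (hF : Continuous fun p : ℝ × ℝ => F p.1 p.2) (x : ℝ) : Continuous fun s => F x s :=
  hF.comp (continuous_const.prodMk continuous_id)

/-- `q` solves the gauged equation, with derivatives `qx`, `qxx`, `qt` and boundary values `qp`, `qm`. -/
structure KEFlow (q₀ T α : ℝ) (qp qm : ℂ) (q qx qxx qt : ℝ → ℝ → ℂ) : Prop where
  hx : ∀ x t, HasDerivAt (fun y => q y t) (qx x t) x
  hxx : ∀ x t, HasDerivAt (fun y => qx y t) (qxx x t) x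
  ht : ∀ x t, HasDerivAt (q x) (qt x t) t
  cq : Continuous fun p : ℝ × ℝ => q p.1 p.2
  cqx : Continuous fun p : ℝ × ℝ => qx p.1 p.2
  cqt : Continuous fun p : ℝ × ℝ => qt p.1 p.2
  pde : ∀ x t, qt x t = Complex.I * qxx x t - 2 * α * qx x t -
    2 * Complex.I * (conj (q x t) * q x t - (q₀ : ℂ) ^ 2) * q x t +
    4 * Complex.I * (T : ℂ) ^ 2 * (conj (q x t) * q x t - (q₀ : ℂ) ^ 2) *
      (conj (q x t) * q x t + (q₀ : ℂ) ^ 2) * q x t -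
    4 * T * (conj (qx x t) * q x t + conj (q x t) * qx x t) * q x t
  right : ∀ t, Tendsto (fun p : ℝ × ℝ => q p.1 p.2) (atTop ×ˢ 𝓝 t) (𝓝 qp)
  left : ∀ t, Tendsto (fun p : ℝ × ℝ => q p.1 p.2) (atBot ×ˢ 𝓝 t) (𝓝 qm)
  rightx : ∀ t, Tendsto (fun p : ℝ × ℝ => qx p.1 p.2) (atTop ×ˢ 𝓝 t) (𝓝 0)
  leftx : ∀ t, Tendsto (fun p : ℝ × ℝ => qx p.1 p.2) (atBot ×ˢ 𝓝 t) (𝓝 0)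
  line : ∀ t, LinePotential q₀ (fun x => q x t) (kePert q₀ T fun x => q x t) qp qm

/-- The velocity shift in the time part of the Lax pair. -/
noncomputable def laxC (q₀ T α : ℝ) : ℂ := 2 * (α + 2 * T * (q₀ : ℂ) ^ 2)

section Entries

variable (q₀ T α : ℝ) (k a b a' b' : ℂ)

/-- The diagonal entry of the `x`-part, in terms of `a = q` and `b = conj q`. -/
noncomputable def laxD : ℂ := -Complex.I * (k + T * (b * a - (q₀ : ℂ) ^ 2))

/-- The scalar term of the `t`-part, in terms of `a = q`, `b = conj q`, `a' = q_x`, `b' = conj q_x`. -/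
noncomputable def laxOmega : ℂ :=
  T * (-2 * (-(Complex.I / 2) * (b * a' - a * b') + 2 * T * (b * a - (q₀ : ℂ) ^ 2) * (b * a)) -
    laxC q₀ T α * (b * a - (q₀ : ℂ) ^ 2))

/-- The diagonal entry of the `t`-part. -/
noncomputable def laxV1 : ℂ :=
  -Complex.I * (k * (2 * k - laxC q₀ T α) + (b * a - (q₀ : ℂ) ^ 2) + laxOmega q₀ T α a b a' b')

/-- The upper off-diagonal entry of the `t`-part. -/
noncomputable def laxV2 : ℂ :=
  (2 * k - laxC q₀ T α) * a + Complex.I * (a' + 2 * Complex.I * T * (b * a - (q₀ : ℂ) ^ 2) * a)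

/-- The lower off-diagonal entry of the `t`-part. -/
noncomputable def laxV3 : ℂ :=
  (2 * k - laxC q₀ T α) * b - Complex.I * (b' - 2 * Complex.I * T * (b * a - (q₀ : ℂ) ^ 2) * b)

end Entries

/-- The `x`-part of the Lax pair. -/
noncomputable def fX (q₀ T : ℝ) (q : ℝ → ℝ → ℂ) (k : ℂ) (x t : ℝ) : (Fin 2 → ℂ) →L[ℝ] (Fin 2 → ℂ) :=
  mulR (laxD q₀ T k (q x t) (conj (q x t))) (q x t) (conj (q x t))
    (-laxD q₀ T k (q x t) (conj (q x t)))

/-- The `t`-part of the Lax pair. -/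
noncomputable def fV (q₀ T α : ℝ) (q qx : ℝ → ℝ → ℂ) (k : ℂ) (x t : ℝ) :
    (Fin 2 → ℂ) →L[ℝ] (Fin 2 → ℂ) :=
  mulR (laxV1 q₀ T α k (q x t) (conj (q x t)) (qx x t) (conj (qx x t)))
    (laxV2 q₀ T α k (q x t) (conj (q x t)) (qx x t))
    (laxV3 q₀ T α k (q x t) (conj (q x t)) (conj (qx x t)))
    (-laxV1 q₀ T α k (q x t) (conj (q x t)) (qx x t) (conj (qx x t)))

lemma mulR_smul (a b c e s : ℂ) (v : Fin 2 → ℂ) : mulR a b c e (s • v) = s • mulR a b c e v := by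
  ext i; fin_cases i <;> simp [mulR_apply] <;> ring

lemma fV_smul {q₀ T α : ℝ} {q qx : ℝ → ℝ → ℂ} {k : ℂ} {x t : ℝ} (s : ℂ) (v : Fin 2 → ℂ) :
    fV q₀ T α q qx k x t (s • v) = s • fV q₀ T α q qx k x t v :=
  mulR_smul _ _ _ _ _ _

lemma isZSSol_iff_fX {q₀ T : ℝ} {q : ℝ → ℝ → ℂ} {k : ℂ} {t : ℝ} {φ : ℝ → Fin 2 → ℂ} :
    IsZSSol (fun x => q x t) (kePert q₀ T fun x => q x t) k φ ↔
      ∀ x, HasDerivAt φ (fX q₀ T q k x t (φ x)) x := by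
  unfold IsZSSol
  refine forall_congr' fun x => ?_
  have h1 : (zsX (q x t) (kePert q₀ T (fun x => q x t) x) k) =
      !![laxD q₀ T k (q x t) (conj (q x t)), q x t; conj (q x t),
        -laxD q₀ T k (q x t) (conj (q x t))] := by
    simp only [zsX, kePert, laxD]
    push_cast
    rw [← Complex.conj_mul']
    congr! 3
    ring_nf
  rw [h1]
  rfl

/-- The condition a' = a1 at x makes the products of first derivatives cancel in the derivative of b
a' − a b'. -/
lemma hasDerivAt_laxOmega {q₀ T α : ℝ} {a a' : ℝ → ℂ} {a1 a2 : ℂ} {x : ℝ} (ha : HasDerivAt a a1 x)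
    (ha' : HasDerivAt a' a2 x) (h1 : a' x = a1) :
    HasDerivAt (fun y => laxOmega q₀ T α (a y) (conj (a y)) (a' y) (conj (a' y)))
      (T * (-2 * (-(Complex.I / 2) * (conj (a x) * a2 - a x * conj a2) +
        2 * T * ((conj a1 * a x + conj (a x) * a1) * (conj (a x) * a x) +
          (conj (a x) * a x - (q₀ : ℂ) ^ 2) * (conj a1 * a x + conj (a x) * a1))) -
        laxC q₀ T α * (conj a1 * a x + conj (a x) * a1))) x := by
  have hb := hasDerivAt_conj ha
  have hb' := hasDerivAt_conj ha'
  unfold laxOmega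
  refine (((((((hb.mul ha').sub (ha.mul hb')).const_mul (-(Complex.I / 2))).add
    ((((hb.mul ha).sub_const ((q₀ : ℂ) ^ 2)).const_mul (2 * T : ℂ)).mul (hb.mul ha))).const_mul
      (-2)).sub (((hb.mul ha).sub_const ((q₀ : ℂ) ^ 2)).const_mul (laxC q₀ T α))).const_mul
        (T : ℂ)).congr_deriv ?_
  simp only [Pi.mul_apply, h1]
  ring

namespace KEFlow

variable {q₀ T α : ℝ} {qp qm : ℂ} {q qx qxx qt : ℝ → ℝ → ℂ}

lemma continuous_fX (h : KEFlow q₀ T α qp qm q qx qxx qt) (k : ℂ) :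
    Continuous fun p : ℝ × ℝ => fX q₀ T q k p.1 p.2 := by
  have h1 := h.cq
  have h2 : Continuous fun p : ℝ × ℝ => conj (q p.1 p.2) := Complex.continuous_conj.comp h1
  have h3 : Continuous fun p : ℝ × ℝ => laxD q₀ T k (q p.1 p.2) (conj (q p.1 p.2)) := by
    unfold laxD; fun_prop
  exact continuous_mulR h3 h1 h2 h3.neg

lemma continuous_fV (h : KEFlow q₀ T α qp qm q qx qxx qt) (k : ℂ) :
    Continuous fun p : ℝ × ℝ => fV q₀ T α q qx k p.1 p.2 := by
  have h1 := h.cq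
  have h1x := h.cqx
  have h2 : Continuous fun p : ℝ × ℝ => conj (q p.1 p.2) := Complex.continuous_conj.comp h1
  have h2x : Continuous fun p : ℝ × ℝ => conj (qx p.1 p.2) := Complex.continuous_conj.comp h1x
  have h3 : Continuous fun p : ℝ × ℝ =>
      laxV1 q₀ T α k (q p.1 p.2) (conj (q p.1 p.2)) (qx p.1 p.2) (conj (qx p.1 p.2)) := by
    unfold laxV1 laxOmega; fun_prop
  refine continuous_mulR h3 ?_ ?_ h3.neg
  · unfold laxV2; fun_prop
  · unfold laxV3; fun_prop

/-- The derivative in time of the `x`-part. -/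
lemma hasDerivAt_fX (h : KEFlow q₀ T α qp qm q qx qxx qt) (k : ℂ) (x t : ℝ) :
    HasDerivAt (fX q₀ T q k x)
      (mulR (-Complex.I * (T * (conj (qt x t) * q x t + conj (q x t) * qt x t))) (qt x t)
        (conj (qt x t)) (Complex.I * (T * (conj (qt x t) * q x t + conj (q x t) * qt x t)))) t := by
  have h1 := h.ht x t
  have h2 := hasDerivAt_conj h1
  have h3 : HasDerivAt (fun s => laxD q₀ T k (q x s) (conj (q x s)))
      (-Complex.I * (T * (conj (qt x t) * q x t + conj (q x t) * qt x t))) t := by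
    unfold laxD
    exact ((((h2.mul h1).sub_const _).const_mul (T : ℂ)).const_add k).const_mul _
  refine hasDerivAt_mulR h3 h1 h2 (h3.neg.congr_deriv ?_)
  ring

/-- The derivative in space of the `t`-part. -/
lemma hasDerivAt_fV (h : KEFlow q₀ T α qp qm q qx qxx qt) (k : ℂ) (x t : ℝ) :
    HasDerivAt (fun y => fV q₀ T α q qx k y t)
      (mulR (-Complex.I * ((conj (qx x t) * q x t + conj (q x t) * qx x t) +
          (T * (-2 * (-(Complex.I / 2) * (conj (q x t) * qxx x t - q x t * conj (qxx x t)) +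
        2 * T * ((conj (qx x t) * q x t + conj (q x t) * qx x t) * (conj (q x t) * q x t) +
          (conj (q x t) * q x t - (q₀ : ℂ) ^ 2) * (conj (qx x t) * q x t + conj (q x t) * qx x t))) -
        laxC q₀ T α * (conj (qx x t) * q x t + conj (q x t) * qx x t)))))
        ((2 * k - laxC q₀ T α) * qx x t + Complex.I * (qxx x t + 2 * Complex.I * T *
          ((conj (qx x t) * q x t + conj (q x t) * qx x t) * q x t +
            (conj (q x t) * q x t - (q₀ : ℂ) ^ 2) * qx x t)))
        ((2 * k - laxC q₀ T α) * conj (qx x t) - Complex.I * (conj (qxx x t) - 2 * Complex.I * T *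
          ((conj (qx x t) * q x t + conj (q x t) * qx x t) * conj (q x t) +
            (conj (q x t) * q x t - (q₀ : ℂ) ^ 2) * conj (qx x t))))
        (Complex.I * ((conj (qx x t) * q x t + conj (q x t) * qx x t) +
          (T * (-2 * (-(Complex.I / 2) * (conj (q x t) * qxx x t - q x t * conj (qxx x t)) +
        2 * T * ((conj (qx x t) * q x t + conj (q x t) * qx x t) * (conj (q x t) * q x t) +
          (conj (q x t) * q x t - (q₀ : ℂ) ^ 2) * (conj (qx x t) * q x t + conj (q x t) * qx x t))) -
        laxC q₀ T α * (conj (qx x t) * q x t + conj (q x t) * qx x t)))))) x := by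
  have h1 := h.hx x t
  have h1x := h.hxx x t
  have h2 := hasDerivAt_conj h1
  have h2x := hasDerivAt_conj h1x
  have hδ := (h2.mul h1).sub_const ((q₀ : ℂ) ^ 2)
  have hΩ := hasDerivAt_laxOmega (q₀ := q₀) (T := T) (α := α) h1 h1x rfl
  have h3 := ((hδ.const_add (k * (2 * k - laxC q₀ T α))).add hΩ).const_mul (-Complex.I)
  refine hasDerivAt_mulR h3 ?_ ?_ (h3.neg.congr_deriv ?_)
  · unfold laxV2
    refine ((h1.const_mul _).add ((h1x.add ((hδ.const_mul (2 * Complex.I * T)).mul h1)).const_mul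
      _)).congr_deriv ?_
    simp only [Pi.mul_apply]; ring
  · unfold laxV3
    refine ((h2.const_mul _).sub ((h2x.sub ((hδ.const_mul (2 * Complex.I * T)).mul h2)).const_mul
      _)).congr_deriv ?_
    simp only [Pi.mul_apply]; ring
  · ring

lemma conj_pde (h : KEFlow q₀ T α qp qm q qx qxx qt) (x t : ℝ) :
    conj (qt x t) = -Complex.I * conj (qxx x t) - 2 * α * conj (qx x t) +
    2 * Complex.I * (conj (q x t) * q x t - (q₀ : ℂ) ^ 2) * conj (q x t) -
    4 * Complex.I * (T : ℂ) ^ 2 * (conj (q x t) * q x t - (q₀ : ℂ) ^ 2) *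
      (conj (q x t) * q x t + (q₀ : ℂ) ^ 2) * conj (q x t) -
    4 * T * (conj (qx x t) * q x t + conj (q x t) * qx x t) * conj (q x t) := by
  rw [h.pde x t]
  simp only [map_sub, map_add, map_mul, map_pow, Complex.conj_I, Complex.conj_ofReal, Complex.conj_conj,
    Complex.conj_ofNat]
  ring

/-- The zero curvature equation. -/
lemma zeroCurvature (h : KEFlow q₀ T α qp qm q qx qxx qt) (k : ℂ) (x t : ℝ) (v : Fin 2 → ℂ) :
    mulR (-Complex.I * (T * (conj (qt x t) * q x t + conj (q x t) * qt x t))) (qt x t)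
        (conj (qt x t)) (Complex.I * (T * (conj (qt x t) * q x t + conj (q x t) * qt x t))) v -
      mulR (-Complex.I * ((conj (qx x t) * q x t + conj (q x t) * qx x t) +
          (T * (-2 * (-(Complex.I / 2) * (conj (q x t) * qxx x t - q x t * conj (qxx x t)) +
        2 * T * ((conj (qx x t) * q x t + conj (q x t) * qx x t) * (conj (q x t) * q x t) +
          (conj (q x t) * q x t - (q₀ : ℂ) ^ 2) * (conj (qx x t) * q x t + conj (q x t) * qx x t))) -
        laxC q₀ T α * (conj (qx x t) * q x t + conj (q x t) * qx x t)))))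
        ((2 * k - laxC q₀ T α) * qx x t + Complex.I * (qxx x t + 2 * Complex.I * T *
          ((conj (qx x t) * q x t + conj (q x t) * qx x t) * q x t +
            (conj (q x t) * q x t - (q₀ : ℂ) ^ 2) * qx x t)))
        ((2 * k - laxC q₀ T α) * conj (qx x t) - Complex.I * (conj (qxx x t) - 2 * Complex.I * T *
          ((conj (qx x t) * q x t + conj (q x t) * qx x t) * conj (q x t) +
            (conj (q x t) * q x t - (q₀ : ℂ) ^ 2) * conj (qx x t))))
        (Complex.I * ((conj (qx x t) * q x t + conj (q x t) * qx x t) +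
          (T * (-2 * (-(Complex.I / 2) * (conj (q x t) * qxx x t - q x t * conj (qxx x t)) +
        2 * T * ((conj (qx x t) * q x t + conj (q x t) * qx x t) * (conj (q x t) * q x t) +
          (conj (q x t) * q x t - (q₀ : ℂ) ^ 2) * (conj (qx x t) * q x t + conj (q x t) * qx x t))) -
        laxC q₀ T α * (conj (qx x t) * q x t + conj (q x t) * qx x t))))) v +
      fX q₀ T q k x t (fV q₀ T α q qx k x t v) - fV q₀ T α q qx k x t (fX q₀ T q k x t v) = 0 := by
  have e1 := h.pde x t
  have e2 := h.conj_pde x t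
  simp only [fX, fV, mulR_apply]
  -- The field and its conjugate are treated as independent variables. After elimination of the time
  -- derivatives by the equation and its conjugate, a polynomial identity remains.
  generalize conj (qt x t) = bt at e2 ⊢
  generalize qt x t = at' at e1 ⊢
  generalize conj (qxx x t) = bxx at e2 ⊢
  generalize qxx x t = axx at e1 ⊢
  generalize conj (qx x t) = bx at e1 e2 ⊢
  generalize qx x t = ax at e1 e2 ⊢
  generalize conj (q x t) = b at e1 e2 ⊢
  generalize q x t = a at e1 e2 ⊢
  subst e1 e2
  have hI := Complex.I_sq
  have hI3 : Complex.I ^ 3 = -Complex.I := Complex.I_pow_three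
  ext i
  fin_cases i
  · simp [laxD, laxV1, laxV2, laxV3, laxOmega, laxC]
    ring_nf
    simp only [hI, hI3]
    ring
  · simp [laxD, laxV1, laxV2, laxV3, laxOmega, laxC]
    ring_nf
    simp only [hI, hI3]
    ring

lemma exists_joint (h : KEFlow q₀ T α qp qm q qx qxx qt) (k : ℂ) {φ : ℝ → Fin 2 → ℂ}
    (hφ : IsZSSol (fun x => q x 0) (kePert q₀ T fun x => q x 0) k φ) :
    ∃ ψ : ℝ → ℝ → Fin 2 → ℂ, (∀ x, ψ x 0 = φ x) ∧
      (∀ t, IsZSSol (fun x => q x t) (kePert q₀ T fun x => q x t) k fun x => ψ x t) ∧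
      ∀ x t, HasDerivAt (ψ x) (fV q₀ T α q qx k x t (ψ x t)) t := by
  have hc : Continuous fun p : ℝ × ℝ => conj (qt p.1 p.2) := Complex.continuous_conj.comp h.cqt
  have hcq : Continuous fun p : ℝ × ℝ => conj (q p.1 p.2) := Complex.continuous_conj.comp h.cq
  have h1 := h.cq
  have h2 := h.cqt
  obtain ⟨ψ, a, b, c⟩ := exists_joint_solution (h.continuous_fX k) (h.hasDerivAt_fX k)
    (continuous_mulR (by fun_prop) h.cqt hc (by fun_prop)) (h.continuous_fV k) (h.hasDerivAt_fV k)
    (h.zeroCurvature k) (isZSSol_iff_fX.mp hφ)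
  exact ⟨ψ, a, fun t => isZSSol_iff_fX.mpr fun x => b x t, c⟩

/-- With |q|² = q₀² and q_x = 0 every correction term vanishes and V becomes (2κ − C) times the
limit of X. The asymptotic vectors are therefore eigenvectors of the time part as well. -/
lemma tendsto_fV {l : Filter ℝ} {qinf : ℂ} {t : ℝ} (hinf : ‖qinf‖ = q₀)
    (h1 : Tendsto (fun p : ℝ × ℝ => q p.1 p.2) (l ×ˢ 𝓝 t) (𝓝 qinf))
    (h2 : Tendsto (fun p : ℝ × ℝ => qx p.1 p.2) (l ×ˢ 𝓝 t) (𝓝 0)) (k : ℂ) :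
    Tendsto (fun p : ℝ × ℝ => fV q₀ T α q qx k p.1 p.2) (l ×ˢ 𝓝 t)
      (𝓝 (mulR (-Complex.I * (k * (2 * k - laxC q₀ T α))) ((2 * k - laxC q₀ T α) * qinf)
        ((2 * k - laxC q₀ T α) * conj qinf) (Complex.I * (k * (2 * k - laxC q₀ T α))))) := by
  have h3 : Tendsto (fun p : ℝ × ℝ => ((q p.1 p.2, conj (q p.1 p.2)), (qx p.1 p.2, conj (qx p.1 p.2))))
      (l ×ˢ 𝓝 t) (𝓝 ((qinf, conj qinf), (0, 0))) := by
    have e1 := (Complex.continuous_conj.tendsto _).comp h1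
    have e2 := (Complex.continuous_conj.tendsto _).comp h2
    rw [map_zero] at e2
    exact (h1.prodMk_nhds e1).prodMk_nhds (h2.prodMk_nhds e2)
  have hm : conj qinf * qinf = (q₀ : ℂ) ^ 2 := by rw [Complex.conj_mul', hinf]
  have c1 : Continuous fun w : (ℂ × ℂ) × (ℂ × ℂ) => laxV1 q₀ T α k w.1.1 w.1.2 w.2.1 w.2.2 := by
    unfold laxV1 laxOmega; fun_prop
  have c2 : Continuous fun w : (ℂ × ℂ) × (ℂ × ℂ) => laxV2 q₀ T α k w.1.1 w.1.2 w.2.1 := by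
    unfold laxV2; fun_prop
  have c3 : Continuous fun w : (ℂ × ℂ) × (ℂ × ℂ) => laxV3 q₀ T α k w.1.1 w.1.2 w.2.2 := by
    unfold laxV3; fun_prop
  have t1 := (c1.tendsto _).comp h3
  have t2 := (c2.tendsto _).comp h3
  have t3 := (c3.tendsto _).comp h3
  have v1 : laxV1 q₀ T α k qinf (conj qinf) 0 0 = -Complex.I * (k * (2 * k - laxC q₀ T α)) := by
    simp only [laxV1, laxOmega, hm]; ring
  have v2 : laxV2 q₀ T α k qinf (conj qinf) 0 = (2 * k - laxC q₀ T α) * qinf := by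
    simp only [laxV2, hm]; ring
  have v3 : laxV3 q₀ T α k qinf (conj qinf) 0 = (2 * k - laxC q₀ T α) * conj qinf := by
    simp only [laxV3, hm]; ring
  have t4 := t1.neg
  simp only [v1] at t1 t4
  simp only [v2] at t2
  simp only [v3] at t3
  have v4 : -(-Complex.I * (k * (2 * k - laxC q₀ T α))) = Complex.I * (k * (2 * k - laxC q₀ T α)) := by
    ring
  rw [v4] at t4
  exact tendsto_mulR t1 t2 t3 t4

/-- Evolution of the normalization at infinity. -/
lemma tendsto_normalization {l : Filter ℝ} {qinf k μ : ℂ} (hinf : ‖qinf‖ = q₀)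
    (h1 : ∀ t, Tendsto (fun p : ℝ × ℝ => q p.1 p.2) (l ×ˢ 𝓝 t) (𝓝 qinf))
    (h2 : ∀ t, Tendsto (fun p : ℝ × ℝ => qx p.1 p.2) (l ×ˢ 𝓝 t) (𝓝 0))
    {ψ : ℝ → ℝ → Fin 2 → ℂ} (hψ : ∀ x t, HasDerivAt (ψ x) (fV q₀ T α q qx k x t (ψ x t)) t)
    {c : ℝ → ℂ} {g : Fin 2 → ℂ}
    (hg : mulR (-Complex.I * (k * (2 * k - laxC q₀ T α))) ((2 * k - laxC q₀ T α) * qinf)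
        ((2 * k - laxC q₀ T α) * conj qinf) (Complex.I * (k * (2 * k - laxC q₀ T α))) g = -μ • g)
    (h0 : Tendsto (fun x => c x • ψ x 0) l (𝓝 g)) (t : ℝ) :
    Tendsto (fun x => c x • (Complex.exp (μ * t) • ψ x t)) l (𝓝 g) := by
  have key := tendsto_of_tendsto_coeff (fun t₀ => tendsto_fV hinf (h1 t₀) (h2 t₀) k)
    (m := fun x t => c x • ψ x t) (e := fun t => Complex.exp (-μ * t) • g)
    (fun x t => by
      refine ((hψ x t).const_smul (c x)).congr_deriv ?_
      rw [fV, mulR_smul])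
    (fun t => by
      refine ((hasDerivAt_exp_mul (-μ) t).smul_const g).congr_deriv ?_
      rw [mulR_smul, hg, smul_smul, mul_comm])
    (by simpa using h0) t
  have := key.const_smul (Complex.exp (μ * t))
  rw [smul_smul, ← Complex.exp_add] at this
  simp only [neg_mul, add_neg_cancel, Complex.exp_zero, one_smul] at this
  refine this.congr fun x => ?_
  rw [smul_comm]

/-- Evolution of `φ_{+,1}`. -/
lemma exists_evolution_right (h : KEFlow q₀ T α qp qm q qx qxx qt) {ζ : ℂ} (hζ : ζ ≠ 0)
    (him : ζ.im ≤ 0) : ∃ ψ : ℝ → ℝ → Fin 2 → ℂ,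
      (∀ x t, HasDerivAt (ψ x) (fV q₀ T α q qx (kappa q₀ ζ) x t (ψ x t)) t) ∧
      ∀ t x, rjost q₀ (fun x => q x t) (kePert q₀ T fun x => q x t) qp ζ x =
        Complex.exp (Complex.I * lam q₀ ζ * (2 * kappa q₀ ζ - laxC q₀ T α) * t) • ψ x t := by
  obtain ⟨a, b⟩ := isRightJost_rjost (h.line 0).right hζ him
  obtain ⟨ψ, h0, hx, ht⟩ := h.exists_joint (kappa q₀ ζ) a
  refine ⟨ψ, ht, fun t x => ?_⟩
  have hr := (h.line 0).right
  have key := tendsto_normalization (q₀ := q₀) (c := fun x => Complex.exp (Complex.I * lam q₀ ζ * x))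
    (μ := Complex.I * lam q₀ ζ * (2 * kappa q₀ ζ - laxC q₀ T α)) hr.norm_inf h.right h.rightx ht
    (g := asymV qp ζ) (by
      have h1 := hr.conj_mul_inf
      ext i
      fin_cases i
      · simp [mulR_apply, asymV]
        have h2 : qp * (Complex.I * conj qp / ζ) = Complex.I * (kappa q₀ ζ - lam q₀ ζ) := by
          rw [kappa_sub_lam, ← h1]; ring
        linear_combination (2 * kappa q₀ ζ - laxC q₀ T α) * h2
      · simp [mulR_apply, asymV]
        have h2 : conj qp = (kappa q₀ ζ + lam q₀ ζ) * (conj qp / ζ) := by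
          rw [kappa_add_lam]; field_simp
        linear_combination (2 * kappa q₀ ζ - laxC q₀ T α) * h2 +
          (conj qp / ζ * (2 * kappa q₀ ζ - laxC q₀ T α) * (kappa q₀ ζ + lam q₀ ζ)) * Complex.I_sq)
    (by simpa only [h0] using b) t
  have hj : IsRightJost q₀ (fun x => q x t) (kePert q₀ T fun x => q x t) qp ζ
      (fun x => Complex.exp (Complex.I * lam q₀ ζ * (2 * kappa q₀ ζ - laxC q₀ T α) * t) • ψ x t) :=
    ⟨(hx t).smul _, key⟩
  exact (congrFun (hj.eq_rjost (h.line t).right hζ him) x).symm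

/-- Evolution of `φ_{-,2}`. -/
lemma exists_evolution_left (h : KEFlow q₀ T α qp qm q qx qxx qt) {ζ : ℂ} (hζ : ζ ≠ 0)
    (him : ζ.im ≤ 0) : ∃ ψ : ℝ → ℝ → Fin 2 → ℂ,
      (∀ x t, HasDerivAt (ψ x) (fV q₀ T α q qx (kappa q₀ ζ) x t (ψ x t)) t) ∧
      ∀ t x, ljost q₀ (fun x => q x t) (kePert q₀ T fun x => q x t) qm ζ x =
        Complex.exp (-(Complex.I * lam q₀ ζ * (2 * kappa q₀ ζ - laxC q₀ T α)) * t) • ψ x t := by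
  have hr := (h.line 0).left
  obtain ⟨-, b⟩ := isJost_ljost (α := α) hr hζ him
  obtain ⟨ψ, h0, hx, ht⟩ := h.exists_joint (kappa q₀ ζ) ((h.line 0).isZSSol_ljost hζ him)
  refine ⟨ψ, ht, fun t x => ?_⟩
  have hn : ‖qm‖ = q₀ := by have := hr.norm_inf; rwa [norm_neg, RCLike.norm_conj] at this
  have hm : conj qm * qm = (q₀ : ℂ) ^ 2 := by rw [Complex.conj_mul', hn]
  have key := tendsto_normalization (q₀ := q₀)
    (c := fun x => Complex.exp (Complex.I * sgn3 1 * lam q₀ ζ * x))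
    (μ := -(Complex.I * lam q₀ ζ * (2 * kappa q₀ ζ - laxC q₀ T α))) hn h.left h.leftx ht
    (g := fun i => asymE qm ζ i 1) (by
      ext i
      fin_cases i
      · simp [mulR_apply, asymE]
        have h2 : qm = (kappa q₀ ζ + lam q₀ ζ) * (qm / ζ) := by
          rw [kappa_add_lam]; field_simp
        linear_combination (2 * kappa q₀ ζ - laxC q₀ T α) * h2 +
          (qm / ζ * (2 * kappa q₀ ζ - laxC q₀ T α) * (kappa q₀ ζ + lam q₀ ζ)) * Complex.I_sq
      · simp [mulR_apply, asymE]
        have h2 : conj qm * (Complex.I * qm / ζ) = Complex.I * (kappa q₀ ζ - lam q₀ ζ) := by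
          rw [kappa_sub_lam, ← hm]; ring
        linear_combination (-(2 * kappa q₀ ζ - laxC q₀ T α)) * h2)
    (by simpa only [h0] using b) t
  have hj : IsJost q₀ T α (fun x => q x t) atBot qm 1 ζ
      (fun x => Complex.exp (-(Complex.I * lam q₀ ζ * (2 * kappa q₀ ζ - laxC q₀ T α)) * t) • ψ x t) :=
    ⟨by simp only [laxX_eq]; exact (hx t).smul _, key⟩
  exact (congrFun (eq_ljost (h.line t).left hζ him hj) x).symm

lemma wronskian_const_time {k : ℂ} {x : ℝ} {ψ χ : ℝ → Fin 2 → ℂ}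
    (hψ : ∀ t, HasDerivAt ψ (fV q₀ T α q qx k x t (ψ t)) t)
    (hχ : ∀ t, HasDerivAt χ (fV q₀ T α q qx k x t (χ t)) t) (t s : ℝ) :
    wronskian (ψ t) (χ t) = wronskian (ψ s) (χ s) := by
  have hd : ∀ t, HasDerivAt (fun t => wronskian (ψ t) (χ t)) 0 t := fun t => by
    have a := hasDerivAt_pi.mp (hψ t)
    have b := hasDerivAt_pi.mp (hχ t)
    refine (((a 0).mul (b 1)).sub ((a 1).mul (b 0))).congr_deriv ?_
    simp only [fV, mulR_apply, Matrix.cons_val_zero, Matrix.cons_val_one, Matrix.cons_val_fin_one]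
    ring
  exact is_const_of_deriv_eq_zero (fun t => (hd t).differentiableAt) (fun t => (hd t).deriv) t s

lemma hasDerivAt_sconj_time {k : ℂ} {x : ℝ} {ψ : ℝ → Fin 2 → ℂ}
    (hψ : ∀ t, HasDerivAt ψ (fV q₀ T α q qx k x t (ψ t)) t) (t : ℝ) :
    HasDerivAt (fun t => sconj (ψ t)) (fV q₀ T α q qx (conj k) x t (sconj (ψ t))) t := by
  have a := hasDerivAt_pi.mp (hψ t)
  rw [hasDerivAt_pi, Fin.forall_fin_two]
  have hC : conj (laxC q₀ T α) = laxC q₀ T α := by simp [laxC, Complex.conj_ofNat]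
  refine ⟨(hasDerivAt_conj (a 1)).congr_deriv ?_, (hasDerivAt_conj (a 0)).congr_deriv ?_⟩
  · simp [fV, mulR_apply, sconj, laxV1, laxV2, laxV3, laxOmega, hC, Complex.conj_ofNat]
    ring
  · simp [fV, mulR_apply, sconj, laxV1, laxV2, laxV3, laxOmega, hC, Complex.conj_ofNat]
    ring

/-- The time exponentials of the two columns are inverse to each other, and joint solutions have a
constant Wronskian because V is traceless. -/
lemma jostW_const (h : KEFlow q₀ T α qp qm q qx qxx qt) {ζ : ℂ} (hζ : ζ ≠ 0) (him : ζ.im ≤ 0) (t : ℝ) :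
    jostW q₀ (fun x => q x t) (kePert q₀ T fun x => q x t) qp qm ζ =
      jostW q₀ (fun x => q x 0) (kePert q₀ T fun x => q x 0) qp qm ζ := by
  obtain ⟨ψ, a1, a2⟩ := h.exists_evolution_right hζ him
  obtain ⟨χ, b1, b2⟩ := h.exists_evolution_left hζ him
  have key := wronskian_const_time (a1 0) (b1 0) t 0
  have e : ∀ t, jostW q₀ (fun x => q x t) (kePert q₀ T fun x => q x t) qp qm ζ =
      wronskian (ψ 0 t) (χ 0 t) := fun t => by
    rw [jostW, a2, b2, wronskian_smul_smul, ← Complex.exp_add]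
    ring_nf
    simp
  rw [e, e, key]

/-- The scattering data evolve linearly. -/
lemma pureSoliton (h : KEFlow q₀ T α qp qm q qx qxx qt) {N : ℕ} {β : Fin N → ℝ} {ct : Fin N → ℂ}
    (hs : PureSoliton q₀ (fun x => q x 0) (kePert q₀ T fun x => q x 0) qp qm β ct) (t : ℝ) :
    PureSoliton q₀ (fun x => q x t) (kePert q₀ T fun x => q x t) qp qm β fun j =>
      ct j * Complex.exp (-2 * Complex.I * lam q₀ (conj (eigen q₀ (β j))) *
        (2 * kappa q₀ (conj (eigen q₀ (β j))) - laxC q₀ T α) * t) := by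
  have hq := hs.line.right.pos
  have hat : ∀ ζ : ℂ, ζ.im < 0 → atil q₀ (fun x => q x t) (kePert q₀ T fun x => q x t) qp qm ζ =
      atil q₀ (fun x => q x 0) (kePert q₀ T fun x => q x 0) qp qm ζ := fun ζ hζ => by
    rw [atil, atil, h.jostW_const (ne_zero_of_im_neg hζ) hζ.le]
  refine ⟨h.line t, fun s hs0 hs1 hs2 => ?_, hs.mem, hs.inj, fun ζ hζ h0 => ?_, fun j => ?_⟩
  · have hsc : (s : ℂ) ≠ 0 := by exact_mod_cast hs0
    have him : (s : ℂ).im ≤ 0 := by simp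
    obtain ⟨ψ, a1, a2⟩ := h.exists_evolution_right hsc him
    obtain ⟨χ, b1, b2⟩ := h.exists_evolution_left hsc him
    have b3 := hasDerivAt_sconj_time (b1 0)
    rw [conj_kappa, Complex.conj_ofReal] at b3
    have key := wronskian_const_time (a1 0) b3 t 0
    have h0 := hs.refl s hs0 hs1 hs2
    rw [a2, b2, sconj_smul, wronskian_smul_smul] at h0 ⊢
    rw [key]
    rcases mul_eq_zero.mp h0 with h1 | h1
    · exact absurd h1 (mul_ne_zero (Complex.exp_ne_zero _) ((map_ne_zero _).mpr (Complex.exp_ne_zero _)))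
    · rw [h1, mul_zero]
  · exact hs.zeros ζ hζ (by rw [← hat ζ hζ, h0])
  · have him : (conj (eigen q₀ (β j))).im < 0 := by
      have := eigen_im_pos hq (hs.mem j)
      rw [Complex.conj_im]; linarith
    obtain ⟨bt, hb, hct⟩ := hs.norming j
    set w := conj (eigen q₀ (β j)) with hw
    have hwne := ne_zero_of_im_neg him
    obtain ⟨ψ, a1, a2⟩ := h.exists_evolution_right hwne him.le
    obtain ⟨χ, b1, b2⟩ := h.exists_evolution_left hwne him.le
    -- Proportionality at time 0 propagates at each x by uniqueness for the t-equation. The factor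
    -- bt changes only through the quotient of the two normalizing exponentials.
    have hprop : ∀ x, χ x t = bt • ψ x t := fun x => by
      have hV : Continuous fun s => fV q₀ T α q qx (kappa q₀ w) x s :=
        continuous_slice (h.continuous_fV (kappa q₀ w)) x
      have e1 : ∀ s, HasDerivAt (fun s => bt • ψ x s) (fV q₀ T α q qx (kappa q₀ w) x s (bt • ψ x s)) s :=
        fun s => by
          have e := (a1 x s).const_smul bt
          rwa [← fV_smul] at e
      have e2 : χ x 0 = bt • ψ x 0 := by
        have := hb x
        rw [a2, b2] at this
        simpa using this
      exact congrFun (linear_ode_unique hV (b1 x) e1 e2) t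
    refine ⟨bt * Complex.exp (-2 * Complex.I * lam q₀ w * (2 * kappa q₀ w - laxC q₀ T α) * t),
      fun x => ?_, ?_⟩
    · rw [a2, b2, hprop, smul_smul, smul_smul, mul_assoc bt, ← Complex.exp_add, mul_comm bt]
      congr 3
      ring
    · have : deriv (atil q₀ (fun x => q x t) (kePert q₀ T fun x => q x t) qp qm) w =
          deriv (atil q₀ (fun x => q x 0) (kePert q₀ T fun x => q x 0) qp qm) w := by
        refine Filter.EventuallyEq.deriv_eq ?_
        filter_upwards [isOpen_im_neg.mem_nhds him] with ζ hζ using hat ζ hζ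
      rw [this, hct]
      ring

end KEFlow

/-! ### Solutions of the equation as flows of potentials -/

section Partial

variable {F : ℝ × ℝ → ℂ}

lemma hasDerivAt_fst (hF : Differentiable ℝ F) (x t : ℝ) :
    HasDerivAt (fun y => F (y, t)) (fderiv ℝ F (x, t) (1, 0)) x :=
  (hF (x, t)).hasFDerivAt.comp_hasDerivAt x ((hasDerivAt_id x).prodMk (hasDerivAt_const x t))

lemma hasDerivAt_snd (hF : Differentiable ℝ F) (x t : ℝ) :
    HasDerivAt (fun s => F (x, s)) (fderiv ℝ F (x, t) (0, 1)) t :=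
  (hF (x, t)).hasFDerivAt.comp_hasDerivAt t ((hasDerivAt_const t x).prodMk (hasDerivAt_id t))

end Partial

section Gauge

variable {q₀ T α θp θm : ℝ} {u : ℝ → ℝ → ℂ}

lemma gaugeField_mul_exp (q₀ T α : ℝ) (u : ℝ → ℝ → ℂ) (x t : ℝ) :
    gaugeField q₀ T α u x t * Complex.exp (Complex.I * (Upsilon q₀ T α x t : ℂ)) = u x t := by
  rw [gaugeField, mul_assoc, ← Complex.exp_add, neg_add_cancel, Complex.exp_zero, mul_one]

lemma norm_gaugeField (q₀ T α : ℝ) (u : ℝ → ℝ → ℂ) (x t : ℝ) : ‖gaugeField q₀ T α u x t‖ = ‖u x t‖ := by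
  rw [gaugeField, norm_mul, ← mul_neg, ← Complex.ofReal_neg, mul_comm Complex.I,
    Complex.norm_exp_ofReal_mul_I, mul_one]

lemma norm_sub_gauge (q₀ T α : ℝ) (u : ℝ → ℝ → ℂ) (c : ℂ) (x t : ℝ) :
    ‖u x t - Complex.exp (Complex.I * (Upsilon q₀ T α x t : ℂ)) * c‖ = ‖gaugeField q₀ T α u x t - c‖ := by
  rw [← gaugeField_mul_exp q₀ T α u x t, mul_comm (gaugeField _ _ _ _ _ _), ← mul_sub, norm_mul,
    mul_comm Complex.I, Complex.norm_exp_ofReal_mul_I, one_mul]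

lemma norm_bdry (hq : 0 < q₀) (θ : ℝ) : ‖bdry q₀ θ‖ = q₀ := norm_eigen hq θ

lemma contDiff_gaugeField (hu : ContDiff ℝ 2 fun p : ℝ × ℝ => u p.1 p.2) :
    ContDiff ℝ 2 fun p : ℝ × ℝ => gaugeField q₀ T α u p.1 p.2 := by
  have h1 : ContDiff ℝ 2 fun p : ℝ × ℝ => Upsilon q₀ T α p.1 p.2 := by
    unfold Upsilon; fun_prop
  exact hu.mul ((contDiff_const.mul (Complex.ofRealCLM.contDiff.comp h1)).neg.cexp)

lemma hasDerivAt_exp_Upsilon_fst (q₀ T α x t : ℝ) :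
    HasDerivAt (fun y => Complex.exp (Complex.I * (Upsilon q₀ T α y t : ℂ)))
      (Complex.I * α * Complex.exp (Complex.I * (Upsilon q₀ T α x t : ℂ))) x := by
  have h : HasDerivAt (fun y => Upsilon q₀ T α y t) α x := by
    simpa [Upsilon] using ((hasDerivAt_id x).const_mul α).add_const
      (2 * (-q₀ ^ 2 + 2 * T ^ 2 * q₀ ^ 4 - α ^ 2 / 2) * t)
  exact (h.ofReal_comp.const_mul Complex.I).cexp.congr_deriv (by ring)

lemma hasDerivAt_exp_Upsilon_snd (q₀ T α x t : ℝ) :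
    HasDerivAt (fun s => Complex.exp (Complex.I * (Upsilon q₀ T α x s : ℂ)))
      (Complex.I * (2 * (-q₀ ^ 2 + 2 * T ^ 2 * q₀ ^ 4 - α ^ 2 / 2) : ℝ) *
        Complex.exp (Complex.I * (Upsilon q₀ T α x t : ℂ))) t := by
  have h : HasDerivAt (fun s => Upsilon q₀ T α x s) (2 * (-q₀ ^ 2 + 2 * T ^ 2 * q₀ ^ 4 - α ^ 2 / 2)) t := by
    simpa [Upsilon] using ((hasDerivAt_id t).const_mul
      (2 * (-q₀ ^ 2 + 2 * T ^ 2 * q₀ ^ 4 - α ^ 2 / 2))).const_add (α * x)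
  exact (h.ofReal_comp.const_mul Complex.I).cexp.congr_deriv (by ring)

/-- The phase Υ is the one of the plane wave: removing it replaces |q|² by |q|² − q₀² in the cubic
term and |q|⁴ by |q|⁴ − q₀⁴ in the quintic one, and α leaves only the drift −2α q_x. -/
lemma SolvesKE.gauge (h : SolvesKE T u) {q qx qxx qt : ℝ → ℝ → ℂ} (hq : q = gaugeField q₀ T α u)
    (hx : ∀ x t, HasDerivAt (fun y => q y t) (qx x t) x)
    (hxx : ∀ x t, HasDerivAt (fun y => qx y t) (qxx x t) x)
    (ht : ∀ x t, HasDerivAt (q x) (qt x t) t) (x t : ℝ) :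
    qt x t = Complex.I * qxx x t - 2 * α * qx x t -
      2 * Complex.I * (conj (q x t) * q x t - (q₀ : ℂ) ^ 2) * q x t +
      4 * Complex.I * (T : ℂ) ^ 2 * (conj (q x t) * q x t - (q₀ : ℂ) ^ 2) *
        (conj (q x t) * q x t + (q₀ : ℂ) ^ 2) * q x t -
      4 * T * (conj (qx x t) * q x t + conj (q x t) * qx x t) * q x t := by
  have hu : u = fun x t => q x t * Complex.exp (Complex.I * (Upsilon q₀ T α x t : ℂ)) := by
    ext x t; rw [hq, gaugeField_mul_exp]
  have hn : ∀ x t, ‖u x t‖ = ‖q x t‖ := fun x t => by rw [hq, norm_gaugeField]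
  have e := hasDerivAt_exp_Upsilon_fst q₀ T α
  have h1 : ∀ y, deriv (fun w => u w t) y =
      (qx y t + Complex.I * α * q y t) * Complex.exp (Complex.I * (Upsilon q₀ T α y t : ℂ)) := fun y => by
    rw [hu]
    exact ((hx y t).mul (e y t)).deriv.trans (by ring)
  have h2 : deriv (fun y => deriv (fun w => u w t) y) x =
      (qxx x t + 2 * Complex.I * α * qx x t - (α : ℂ) ^ 2 * q x t) *
        Complex.exp (Complex.I * (Upsilon q₀ T α x t : ℂ)) := by
    rw [funext h1]
    refine (((hxx x t).add ((hx x t).const_mul (Complex.I * α))).mul (e x t)).deriv.trans ?_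
    simp only [Pi.add_apply]
    linear_combination (α : ℂ) ^ 2 * q x t * Complex.exp (Complex.I * (Upsilon q₀ T α x t : ℂ)) * Complex.I_sq
  have h3 : deriv (fun s => u x s) t = (qt x t +
      Complex.I * (2 * (-q₀ ^ 2 + 2 * T ^ 2 * q₀ ^ 4 - α ^ 2 / 2) : ℝ) * q x t) *
        Complex.exp (Complex.I * (Upsilon q₀ T α x t : ℂ)) := by
    rw [hu]
    exact ((ht x t).mul (hasDerivAt_exp_Upsilon_snd q₀ T α x t)).deriv.trans (by ring)
  have h4 : ((deriv (fun y => ‖u y t‖ ^ 2) x : ℝ) : ℂ) =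
      conj (qx x t) * q x t + conj (q x t) * qx x t := by
    have a : HasDerivAt (fun y => conj (q y t) * q y t)
      (conj (qx x t) * q x t + conj (q x t) * qx x t) x := (hasDerivAt_conj (hx x t)).mul (hx x t)
    have b : HasDerivAt (fun y => ‖u y t‖ ^ 2) (conj (qx x t) * q x t + conj (q x t) * qx x t).re x := by
      have a' := Complex.reCLM.hasFDerivAt.comp_hasDerivAt x a
      refine a'.congr_of_eventuallyEq (Eventually.of_forall fun y => ?_)
      simp only [Function.comp_apply, Complex.reCLM_apply, Complex.conj_mul', hn, ← Complex.ofReal_pow,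
        Complex.ofReal_re]
    rw [b.deriv]
    refine Complex.conj_eq_iff_re.mp ?_
    simp only [map_add, map_mul, Complex.conj_conj]
    ring
  have key := h x t
  rw [h2, h3, h4] at key
  have h5 : (‖u x t‖ : ℂ) ^ 2 = conj (q x t) * q x t := by rw [hn, Complex.conj_mul']
  have h6 : (‖u x t‖ : ℂ) ^ 4 = (conj (q x t) * q x t) ^ 2 := by rw [← h5]; ring
  rw [h5, h6, hu] at key
  have hE := Complex.exp_ne_zero (Complex.I * (Upsilon q₀ T α x t : ℂ))
  push_cast at key
  refine mul_right_cancel₀ hE ?_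
  linear_combination (-Complex.I) * key + Complex.exp (Complex.I * (Upsilon q₀ T α x t : ℂ)) *
    (qt x t + 2 * α * qx x t + 4 * T * (conj (qx x t) * q x t + conj (q x t) * qx x t) * q x t +
      Complex.I * (-(α : ℂ) ^ 2 - 2 * (q₀ : ℂ) ^ 2 + 4 * (q₀ : ℂ) ^ 4 * (T : ℂ) ^ 2) * q x t) * Complex.I_sq

/-- Since |q|² − q₀² = (|q| + q₀)(|q| − q₀) and q is bounded on the half-line, d is dominated by a
multiple of |q − q_∞| and inherits its first moment. -/
lemma rightPotential_kePert {p : ℝ → ℂ} {pinf : ℂ} (hq : 0 < q₀) (hn : ‖pinf‖ = q₀) (hp : ContDiff ℝ 1 p)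
    (hint : IntegrableOn (fun x => (1 + |x|) ^ 2 * ‖p x - pinf‖) (Set.Ioi 0))
    (hlim : Tendsto p atTop (𝓝 pinf)) : RightPotential q₀ p (kePert q₀ T p) pinf := by
  have hm : FirstMoment fun y => p y - pinf := by
    have hc := hp.continuous
    refine ⟨by fun_prop, hint.mono' (by fun_prop) (Eventually.of_forall fun y => ?_)⟩
    rw [Real.norm_of_nonneg (by positivity)]
    gcongr
    nlinarith [abs_nonneg y]
  obtain ⟨M, hM⟩ : ∃ M, ∀ y, 0 < y → ‖p y‖ ≤ M := by
    obtain ⟨R, hR⟩ := eventually_atTop.mp (hlim.norm.eventually_le_const (lt_add_one _))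
    obtain ⟨C, hC⟩ := (isCompact_Icc (a := (0 : ℝ)) (b := R)).exists_bound_of_continuousOn
      hp.continuous.continuousOn
    refine ⟨max C (‖pinf‖ + 1), fun y hy => ?_⟩
    rcases le_total y R with h | h
    · exact (hC y ⟨hy.le, h⟩).trans (le_max_left _ _)
    · exact (hR y h).trans (le_max_right _ _)
  refine ⟨hq, hn, hp, hm, hm.of_bound (C := |T| * (M + q₀)) ?_ fun y hy => ?_⟩
  · have hc := hp.continuous
    unfold kePert
    fun_prop
  · have h1 : |‖p y‖ - q₀| ≤ ‖p y - pinf‖ := by rw [← hn]; exact abs_norm_sub_norm_le _ _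
    rw [kePert, Real.norm_eq_abs, abs_mul, mul_assoc, show ‖p y‖ ^ 2 - q₀ ^ 2 = (‖p y‖ + q₀) * (‖p y‖ - q₀) by ring,
      abs_mul, abs_of_nonneg (add_nonneg (norm_nonneg _) hq.le)]
    have := hM y hy
    have h2 : 0 ≤ M + q₀ := by linarith [norm_nonneg (p y)]
    gcongr

lemma linePotential_of_isKESolution (hq : 0 < q₀) (hu : IsKESolution q₀ T α θp θm u) (t : ℝ) :
    LinePotential q₀ (fun x => gaugeField q₀ T α u x t)
      (kePert q₀ T fun x => gaugeField q₀ T α u x t) (bdry q₀ θp) (bdry q₀ θm) := by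
  have hp : ContDiff ℝ 1 fun x => gaugeField q₀ T α u x t :=
    ((contDiff_gaugeField hu.smooth).comp (contDiff_id.prodMk contDiff_const)).of_le one_le_two
  have hnorm : ∀ (c : ℂ) (x : ℝ), ‖(((1 + |x|) ^ 2 : ℝ) : ℂ) *
      (u x t - Complex.exp (Complex.I * (Upsilon q₀ T α x t : ℂ)) * c)‖ =
        (1 + |x|) ^ 2 * ‖gaugeField q₀ T α u x t - c‖ := fun c x => by
    rw [norm_mul, norm_sub_gauge, Complex.norm_real, Real.norm_of_nonneg (by positivity)]
  have hc : ∀ l : Filter ℝ, Tendsto (fun x : ℝ => (x, t)) l (l ×ˢ 𝓝 t) := fun l =>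
    tendsto_id.prodMk tendsto_const_nhds
  refine ⟨rightPotential_kePert hq (norm_bdry hq _) hp ?_ ((hu.right_limit t).comp (hc _)), ?_⟩
  · exact ((hu.right_integrable t).mono_set Set.Ioi_subset_Ici_self).norm.congr
      (Eventually.of_forall fun x => hnorm _ x)
  · rw [← kePert_reflP]
    refine rightPotential_kePert hq (by rw [norm_neg, RCLike.norm_conj, norm_bdry hq]) ?_ ?_ ?_
    · exact (Complex.conjCLE.contDiff.comp (hp.comp contDiff_neg)).neg
    · have h1 := (hu.left_integrable t).norm
      have h2 : IntegrableOn (fun x : ℝ => (1 + |x|) ^ 2 * ‖gaugeField q₀ T α u x t - bdry q₀ θm‖)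
          (Set.Iic 0) := h1.congr (Eventually.of_forall fun x => hnorm _ x)
      have h3 := ((Measure.measurePreserving_neg (volume : Measure ℝ)).integrableOn_comp_preimage
        (Homeomorph.neg ℝ).measurableEmbedding).mpr h2
      refine (h3.mono_set fun x (hx : 0 < x) => ?_).congr (Eventually.of_forall fun x => ?_)
      · simpa using hx.le
      simp only [Function.comp_apply, reflP, abs_neg, ← neg_sub', norm_neg, ← map_sub, RCLike.norm_conj]
    · exact ((Complex.continuous_conj.tendsto _).comp
        (((hu.left_limit t).comp (hc _)).comp tendsto_neg_atTop_atBot)).neg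

lemma exists_keFlow (hq : 0 < q₀) (hu : IsKESolution q₀ T α θp θm u) :
    ∃ qx qxx qt, KEFlow q₀ T α (bdry q₀ θp) (bdry q₀ θm) (gaugeField q₀ T α u) qx qxx qt := by
  set F : ℝ × ℝ → ℂ := fun p => gaugeField q₀ T α u p.1 p.2 with hF
  have cF : ContDiff ℝ 2 F := contDiff_gaugeField hu.smooth
  have dF : Differentiable ℝ F := cF.differentiable two_ne_zero
  have cG : ContDiff ℝ 1 fun p => fderiv ℝ F p (1, 0) :=
    (cF.fderiv_right (m := 1) (by norm_num)).clm_apply contDiff_const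
  have cFt : Continuous fun p => fderiv ℝ F p (0, 1) :=
    ((cF.fderiv_right (m := 1) (by norm_num)).clm_apply contDiff_const).continuous
  have hx := hasDerivAt_fst dF
  have hxx := hasDerivAt_fst (cG.differentiable one_ne_zero)
  have ht := hasDerivAt_snd dF
  have hd : ∀ p : ℝ × ℝ, deriv (fun y => gaugeField q₀ T α u y p.2) p.1 = fderiv ℝ F p (1, 0) :=
    fun p => (hx p.1 p.2).deriv
  refine ⟨fun x t => fderiv ℝ F (x, t) (1, 0),
    fun x t => fderiv ℝ (fun p => fderiv ℝ F p (1, 0)) (x, t) (1, 0),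
    fun x t => fderiv ℝ F (x, t) (0, 1), hx, hxx, ht, cF.continuous, cG.continuous, cFt,
    hu.equation.gauge rfl hx hxx ht, hu.right_limit, hu.left_limit, ?_, ?_,
    linePotential_of_isKESolution hq hu⟩
  · simpa only [hd] using hu.right_deriv
  · simpa only [hd] using hu.left_deriv

end Gauge

/-! ### The scattering data of the statement -/

section Data

variable {q₀ T α : ℝ} {q : ℝ → ℂ} {qp qm : ℂ}

lemma scatATilde_eq (h : LinePotential q₀ q (kePert q₀ T q) qp qm) {ζ : ℂ} (hζ : ζ ≠ 0) (him : ζ.im ≤ 0) :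
    scatATilde q₀ T α qp qm q ζ = atil q₀ q (kePert q₀ T q) qp qm ζ := by
  rw [scatATilde, jost_zero_atTop h.right hζ him, jost_one_atBot h.left hζ him, atil, jostW]

lemma scatA_eq (h : LinePotential q₀ q (kePert q₀ T q) qp qm) {ζ : ℂ} (hζ : ζ ≠ 0) (him : 0 ≤ ζ.im) :
    scatA q₀ T α qp qm q ζ = conj (atil q₀ q (kePert q₀ T q) qp qm (conj ζ)) := by
  rw [scatA, jost_one_atTop h.right hζ him, jost_zero_atBot h.left hζ him, wronskian_sconj,
    wronskian_comm, map_neg, neg_neg, atil, jostW]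
  simp

lemma scatB_eq (h : LinePotential q₀ q (kePert q₀ T q) qp qm) {s : ℝ} (hs : s ≠ 0) :
    scatB q₀ T α qp qm q (s : ℂ) =
      wronskian (rjost q₀ q (kePert q₀ T q) qp (s : ℂ) 0) (sconj (ljost q₀ q (kePert q₀ T q) qm (s : ℂ) 0)) /
        (1 - (q₀ : ℂ) ^ 2 / (s : ℂ) ^ 2) := by
  have hsc : (s : ℂ) ≠ 0 := by exact_mod_cast hs
  rw [scatB, jost_zero_atTop h.right hsc (by simp), jost_zero_atBot h.left hsc (by simp),
    Complex.conj_ofReal]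

lemma IsReflectionlessData.pureSoliton (h : LinePotential q₀ q (kePert q₀ T q) qp qm) {N : ℕ}
    {β : Fin N → ℝ} {ct : Fin N → ℂ} (hd : IsReflectionlessData q₀ T α qp qm q β ct) :
    PureSoliton q₀ q (kePert q₀ T q) qp qm β ct := by
  refine ⟨h, fun s h0 h1 h2 => ?_, hd.angle_mem, hd.angle_inj, fun ζ him h0 => ?_, fun j => ?_⟩
  · have hsc : (s : ℂ) ≠ 0 := by exact_mod_cast h0
    have key := hd.reflectionless s h0 h1 h2
    rw [reflection, scatA_eq h hsc (by simp), Complex.conj_ofReal, scatB_eq h h0] at key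
    -- A quotient with zero denominator is 0 in Lean, so r = 0 gives b = 0 only after zeros of a on
    -- the real axis are excluded; the same holds for the denominator inside b.
    rcases div_eq_zero_iff.mp key with h3 | h3
    · exact (div_eq_zero_iff.mp h3).resolve_right
        (one_sub_ne_zero hsc (by exact_mod_cast h1) (by exact_mod_cast h2))
    · exact absurd ((map_eq_zero _).mp h3) (atil_real_ne_zero h h0 h1 h2)
  · have hζ := ne_zero_of_im_neg him
    have hm : conj ζ ∈ {ζ : ℂ | 0 < ζ.im ∧ scatA q₀ T α qp qm q ζ = 0} := by
      have hi : 0 < (conj ζ).im := by simpa using him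
      refine ⟨hi, ?_⟩
      rw [scatA_eq h ((map_ne_zero _).mpr hζ) hi.le, Complex.conj_conj, h0, map_zero]
    rw [hd.zeros] at hm
    obtain ⟨j, hj⟩ := hm
    exact ⟨j, by rw [show eigen q₀ (β j) = conj ζ from hj, Complex.conj_conj]⟩
  · have him : (conj (eigen q₀ (β j))).im < 0 := by
      have := eigen_im_pos h.right.pos (hd.angle_mem j)
      rw [Complex.conj_im]; linarith
    have hne := ne_zero_of_im_neg him
    obtain ⟨bt, hb, hc⟩ := hd.norming j
    refine ⟨bt, ?_, ?_⟩
    · rwa [jost_zero_atTop h.right hne him.le, jost_one_atBot h.left hne him.le] at hb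
    · rw [hc]
      congr 1
      refine Filter.EventuallyEq.deriv_eq ?_
      filter_upwards [isOpen_im_neg.mem_nhds him] with ζ hζ
        using scatATilde_eq h (ne_zero_of_im_neg hζ) (le_of_lt hζ)

end Data

/-! ### The determinant formula -/

lemma conj_div_mul_div {q₀ : ℝ} (hq : 0 < q₀) {a b : ℂ} (ha : ‖a‖ = q₀) (hb : ‖b‖ = q₀) :
    conj (a / b) * (a / b) = 1 := by
  rw [Complex.conj_mul', norm_div, ha, hb, div_self hq.ne']
  simp

lemma conj_eigen_sub_eigen (q₀ β : ℝ) :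
    conj (eigen q₀ β) - eigen q₀ β = -(2 * Complex.I * (q₀ * Real.sin β : ℝ)) := by
  rw [← neg_sub, Complex.sub_conj, eigen_im]
  push_cast
  ring

lemma conj_eigen_ne_eigen {q₀ : ℝ} (hq : 0 < q₀) {N : ℕ} {β : Fin N → ℝ}
    (hβ : ∀ j, β j ∈ Set.Ioo 0 Real.pi) (i j : Fin N) : conj (eigen q₀ (β i)) ≠ eigen q₀ (β j) := fun h => by
  have h1 := congrArg Complex.im h
  rw [Complex.conj_im] at h1
  linarith [eigen_im_pos hq (hβ i), eigen_im_pos hq (hβ j)]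

/-- The Cauchy-type matrix of the soliton formula in terms of positive weights. -/
noncomputable def cauchyMat (q₀ : ℝ) {N : ℕ} (β w : Fin N → ℝ) : Matrix (Fin N) (Fin N) ℂ :=
  Matrix.of fun j k => -Complex.I * w j / (conj (eigen q₀ (β j)) - eigen q₀ (β k))

/-- By Cauchy's determinant with conjugate nodes each principal minor is a product of numbers
w_j/(2q₀ sin β_j) and squared moduli, hence nonnegative. The determinant is 1 plus their sum. -/
lemma det_one_add_cauchyMat_ne_zero {q₀ : ℝ} (hq : 0 < q₀) {N : ℕ} {β w : Fin N → ℝ}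
    (hβ : ∀ j, β j ∈ Set.Ioo 0 Real.pi) (hw : ∀ j, 0 < w j) : (1 + cauchyMat q₀ β w).det ≠ 0 := by
  have hminor : ∀ S, ∃ r : ℝ, 0 ≤ r ∧ principalMinor (cauchyMat q₀ β w) S = r := fun S => by
    have h1 : cauchyMat q₀ β w = Matrix.of fun j k => (1 : ℂ) * (-Complex.I * w j) * 1 /
        (conj (eigen q₀ (β j)) - eigen q₀ (β k)) := by
      ext j k; simp [cauchyMat]
    refine ⟨(∏ j ∈ S, w j / (2 * (q₀ * Real.sin (β j)))) * ∏ j ∈ S, ∏ k ∈ S with j < k,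
      ‖(-eigen q₀ (β j) + eigen q₀ (β k)) / (-conj (eigen q₀ (β j)) + eigen q₀ (β k))‖ ^ 2, ?_, ?_⟩
    · refine mul_nonneg (Finset.prod_nonneg fun j _ => ?_)
        (Finset.prod_nonneg fun j _ => Finset.prod_nonneg fun k _ => by positivity)
      have := Real.sin_pos_of_mem_Ioo (hβ j)
      have := hw j
      positivity
    · rw [h1, principalMinor_cauchy (fun _ => 1) (fun j => -Complex.I * w j)
        (fun j => conj (eigen q₀ (β j))) (fun j => eigen q₀ (β j)) (conj_eigen_ne_eigen hq hβ)]
      push_cast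
      congr 1
      · refine Finset.prod_congr rfl fun j _ => ?_
        have hs : ((q₀ * Real.sin (β j) : ℝ) : ℂ) ≠ 0 :=
          Complex.ofReal_ne_zero.mpr (mul_pos hq (Real.sin_pos_of_mem_Ioo (hβ j))).ne'
        rw [conj_eigen_sub_eigen, ← Complex.ofReal_sin, ← Complex.ofReal_mul]
        field_simp
      · refine Finset.prod_congr rfl fun j _ => Finset.prod_congr rfl fun k _ => ?_
        rw [cauchy_factor_conj]
  choose r hr hm using hminor
  intro h0
  rw [det_one_add_eq_sum_minors] at h0
  simp only [hm] at h0
  have h1 : (1 : ℝ) + ∑ k ∈ Finset.Icc 1 N, ∑ S ∈ Finset.powersetCard k Finset.univ, r S = 0 := by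
    exact_mod_cast h0
  have h2 : 0 ≤ ∑ k ∈ Finset.Icc 1 N, ∑ S ∈ Finset.powersetCard k Finset.univ, r S :=
    Finset.sum_nonneg fun _ _ => Finset.sum_nonneg fun S _ => hr S
  linarith

section Soliton

variable {q₀ : ℝ} {p : ℝ → ℂ} {d : ℝ → ℝ} {pp pm : ℂ} {N : ℕ} {β : Fin N → ℝ} {ct : Fin N → ℂ}

/-- The derivative of ã contains the same b̃, which cancels. As q₊/ζ_j is unimodular, the inverse of
its conjugate is itself, and m is the reciprocal of the positive integral J. -/
lemma PureSoliton.exists_norming (h : PureSoliton q₀ p d pp pm β ct) (j : Fin N) :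
    ∃ m : ℝ, 0 < m ∧ ct j = -(m * (pp / eigen q₀ (β j))) := by
  have hq := h.line.right.pos
  have hn := norm_eigen hq (β j)
  have him : (conj (eigen q₀ (β j))).im < 0 := by
    have := eigen_im_pos hq (h.mem j)
    rw [Complex.conj_im]; linarith
  obtain ⟨bt, hb, hc⟩ := h.norming j
  obtain ⟨hbt, J, hJ, hd⟩ := exists_pos_hasDerivAt_atil h.line (by rwa [RCLike.norm_conj]) him hb
  refine ⟨J⁻¹, inv_pos.mpr hJ, ?_⟩
  have e1 := conj_div_mul_div hq h.line.right.norm_inf hn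
  have hJ' : (J : ℂ) ≠ 0 := by exact_mod_cast hJ.ne'
  have hne : conj (pp / eigen q₀ (β j)) ≠ 0 := fun h0 => by rw [h0, zero_mul] at e1; exact zero_ne_one e1
  rw [hc, hd.deriv, ← map_div₀, Complex.ofReal_inv]
  rw [div_eq_iff (neg_ne_zero.mpr (mul_ne_zero (mul_ne_zero hbt hne) hJ'))]
  field_simp
  linear_combination -e1

/-- Divided by ε = e^{i tailD}, the partial fractions at the points conj ζ_k have the form required
by `det_soliton` with g_j = −i w_j, since the phases of c̃_j and of the residue cancel. The limit at
0 reads p conj ε/q₊ = ε · (quotient of determinants), so the phase is ε². -/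
lemma PureSoliton.potential_eq_det (h : PureSoliton q₀ p d pp pm β ct) {m : Fin N → ℝ} (hm : ∀ j, 0 < m j)
    (hct : ∀ j, ct j = -(m j * (pp / eigen q₀ (β j)))) (x : ℝ) {w : Fin N → ℝ}
    (hw : ∀ j, w j = m j * Real.exp (-2 * (q₀ * Real.sin (β j)) * x)) :
    p x = Complex.exp (2 * Complex.I * tailD d x) * (pp *
      ((1 + Matrix.of fun j k => -Complex.I * w j * (conj (eigen q₀ (β j)) / eigen q₀ (β j)) /
        (conj (eigen q₀ (β j)) - eigen q₀ (β k))).det / (1 + cauchyMat q₀ β w).det)) := by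
  have hq := h.line.right.pos
  have hpp : pp ≠ 0 := by rw [← norm_pos_iff, h.line.right.norm_inf]; exact hq
  have hD := det_one_add_cauchyMat_ne_zero hq h.mem fun j => (by rw [hw]; have := hm j; positivity : 0 < w j)
  set ε := Complex.exp (Complex.I * tailD d x) with hε
  have hε0 : ε ≠ 0 := Complex.exp_ne_zero _
  have hεc : conj ε * ε = 1 := by
    rw [Complex.conj_mul', hε, mul_comm Complex.I, Complex.norm_exp_ofReal_mul_I]; simp
  have hcoef : ∀ j, conj (ct j) * Real.exp (-2 * (q₀ * Real.sin (β j)) * x) *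
      (-Complex.I * pp / eigen q₀ (β j)) = Complex.I * w j := fun j => by
    have e1 := conj_div_mul_div hq h.line.right.norm_inf (norm_eigen hq (β j))
    rw [hct, hw, map_neg, map_mul, Complex.conj_ofReal]
    push_cast
    rw [mul_div_assoc]
    linear_combination (Complex.I * m j * Complex.exp (-2 * (q₀ * Complex.sin (β j)) * x)) * e1
  set y : Fin N → ℂ := fun k => jcore q₀ p d pp (conj (eigen q₀ (β k))) x 0 / ε with hy
  have hj : ∀ k, jcore q₀ p d pp (conj (eigen q₀ (β k))) x 0 = y k * ε := fun k =>
    (div_mul_cancel₀ _ hε0).symm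
  have hyk : ∀ k, y k = 1 - ∑ j, -Complex.I * w j * y j / (conj (eigen q₀ (β k)) - eigen q₀ (β j)) := fun k => by
    have him := eigen_im_pos hq (h.mem k)
    have hi : (conj (eigen q₀ (β k))).im < 0 := by rw [Complex.conj_im]; linarith
    have key := h.jcore_eq_sum x hi.le (ne_zero_of_im_neg hi) (fun h0 => by simp [h0] at hi)
      (fun h0 => by simp [h0] at hi)
    simp only [hcoef, hj] at key
    refine mul_right_cancel₀ hε0 (key.trans ?_)
    rw [sub_mul, one_mul, sub_eq_add_neg, Finset.sum_mul, ← Finset.sum_neg_distrib]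
    congr 1
    exact Finset.sum_congr rfl fun j _ => by ring
  have hp := h.potential_eq x
  simp only [hcoef, hj] at hp
  have hs : p x * conj ε / pp = ε * (1 + ∑ j, -Complex.I * w j * y j / eigen q₀ (β j)) := by
    rw [hp, mul_add, mul_one, Finset.mul_sum]
    congr 1
    refine Finset.sum_congr rfl fun j _ => ?_
    rw [zero_sub, div_neg]
    ring
  have hdet := det_soliton (fun j => conj (eigen q₀ (β j))) (fun j => eigen q₀ (β j))
    (fun j => -Complex.I * w j) y (conj_eigen_ne_eigen hq h.mem) (fun i => eigen_ne_zero hq _) hyk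
  rw [hdet]
  rw [cauchyMat] at hD ⊢
  rw [mul_div_cancel_left₀ _ hD]
  have h2 : Complex.exp (2 * Complex.I * tailD d x) = ε * ε := by rw [hε, ← Complex.exp_add]; ring_nf
  rw [h2]
  rw [div_eq_iff hpp] at hs
  linear_combination ε * hs - p x * hεc

end Soliton

section Weights

variable {q₀ T α θp : ℝ} {N : ℕ} {β : Fin N → ℝ} {ct : Fin N → ℂ}

/-- Only the squares of the f_j enter determinants and principal minors, so the choice of the square
root is immaterial. -/
lemma fcoef_sq (q₀ T α : ℝ) (β : Fin N → ℝ) (ct : Fin N → ℂ) (x t : ℝ) (j : Fin N) :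
    fcoef q₀ T α β ct x t j ^ 2 =
      ct j * Complex.exp (-2 * Complex.I * Theta q₀ T α x t (conj (eigen q₀ (β j)))) := by
  rw [fcoef, mul_pow, ← Complex.exp_nat_mul, one_div]
  have : (ct j ^ ((2 : ℂ)⁻¹)) ^ 2 = ct j := Complex.cpow_nat_inv_pow _ two_ne_zero
  rw [this]
  congr 2
  push_cast
  ring

lemma Theta_eq (q₀ T α x t : ℝ) (ζ : ℂ) :
    Theta q₀ T α x t ζ = lam q₀ ζ * x + lam q₀ ζ * (2 * kappa q₀ ζ - laxC q₀ T α) * t := by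
  rw [Theta, specZ, laxC]; ring

/-- `2iΘ` at a conjugate eigenvalue is the real number `-Δ`. -/
lemma Theta_conj_eigen (hq : 0 < q₀) (T α b x t : ℝ) :
    -2 * Complex.I * Theta q₀ T α x t (conj (eigen q₀ b)) = (Delta q₀ T α b x t : ℂ) := by
  have hk : kappa q₀ (conj (eigen q₀ b)) = (q₀ * Real.cos b : ℝ) := by
    have h1 : (q₀ : ℂ) ^ 2 / conj (eigen q₀ b) = eigen q₀ b := by
      rw [← eigen_mul_conj hq b, mul_div_cancel_right₀ _ ((map_ne_zero _).mpr (eigen_ne_zero hq b))]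
    rw [kappa, h1, add_comm, Complex.add_conj, eigen_re]
    push_cast; ring
  rw [Theta_eq, lam_conj_eigen hq, hk, laxC, Delta]
  push_cast
  linear_combination (2 * q₀ * Complex.sin b * (x + (2 * q₀ * Complex.cos b - 4 * T * q₀ ^ 2 - 2 * α) * t)) * Complex.I_sq

lemma matB_eq (x t : ℝ) : (1 + matB q₀ T α θp β ct x t).det = (1 + Matrix.of fun j k =>
    fcoef q₀ T α β ct x t j ^ 2 * (Complex.I * eigen q₀ (β j) * (bdry q₀ θp)⁻¹) /
      (conj (eigen q₀ (β j)) - eigen q₀ (β k))).det := by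
  simp only [div_eq_mul_inv]
  exact det_one_add_conj _ _ fun j k => (conj (eigen q₀ (β j)) - eigen q₀ (β k))⁻¹

lemma matB'_eq (x t : ℝ) : (1 + matB' q₀ T α θp β ct x t).det = (1 + Matrix.of fun j k =>
    fcoef q₀ T α β ct x t j ^ 2 * (Complex.I * conj (eigen q₀ (β j)) * (bdry q₀ θp)⁻¹) /
      (conj (eigen q₀ (β j)) - eigen q₀ (β k))).det := by
  simp only [div_eq_mul_inv]
  exact det_one_add_conj _ _ fun j k => (conj (eigen q₀ (β j)) - eigen q₀ (β k))⁻¹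

/-- The parameter b allows both ζ_j and its conjugate, b = ±β_j. From conj ζ_j − ζ_j = −2iq₀ sin β_j
come the sign and a q₀ that cancels the modulus of s; the remaining q₀⁻¹ belongs to q₊⁻¹. -/
lemma minor_factor (hq : 0 < q₀) (x t : ℝ) (j : Fin N) {s : ℂ} {b : ℝ} (hs : s = q₀ * Complex.exp (Complex.I * b)) :
    Complex.I * (fcoef q₀ T α β ct x t j ^ 2 * s * (bdry q₀ θp)⁻¹ *
      (conj (eigen q₀ (β j)) - eigen q₀ (β j))⁻¹) =
    -1 * (q₀ : ℂ)⁻¹ * Complex.exp (-Complex.I * θp) * Complex.exp (Complex.I * b) *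
      Complex.exp (-2 * Complex.I * Theta q₀ T α x t (conj (eigen q₀ (β j)))) *
      (ct j / (2 * (Real.sin (β j) : ℂ))) := by
  have hq' : (q₀ : ℂ) ≠ 0 := by exact_mod_cast hq.ne'
  have hb : (bdry q₀ θp)⁻¹ = (q₀ : ℂ)⁻¹ * Complex.exp (-Complex.I * θp) := by
    rw [bdry, mul_inv, ← Complex.exp_neg, neg_mul]
  rw [conj_eigen_sub_eigen, fcoef_sq, hb, hs, inv_neg, mul_inv, mul_inv, Complex.ofReal_mul, mul_inv,
    div_eq_mul_inv, mul_inv]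
  have e1 : (q₀ : ℂ) * (q₀ : ℂ)⁻¹ = 1 := mul_inv_cancel₀ hq'
  have e2 : Complex.I * Complex.I⁻¹ = 1 := mul_inv_cancel₀ Complex.I_ne_zero
  generalize Complex.I⁻¹ = J at *
  generalize (q₀ : ℂ)⁻¹ = Q at *
  generalize ((Real.sin (β j) : ℝ) : ℂ)⁻¹ = R
  generalize Complex.exp (-Complex.I * θp) = A
  generalize Complex.exp (Complex.I * b) = B
  generalize Complex.exp (-2 * Complex.I * Theta q₀ T α x t (conj (eigen q₀ (β j)))) = E
  linear_combination (-(ct j * E * B * Q * A * 2⁻¹ * R)) * (e2 + Complex.I * J * e1)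

end Weights

/-! ### Reconstruction of the solution -/

section Solution

variable {q₀ T α θp θm : ℝ} {u : ℝ → ℝ → ℂ} {N : ℕ} {β : Fin N → ℝ} {ct : Fin N → ℂ}

lemma integrableOn_sub_norm_sq (hq : 0 < q₀) (hu : IsKESolution q₀ T α θp θm u) (x t : ℝ) :
    IntegrableOn (fun y => q₀ ^ 2 - ‖u y t‖ ^ 2) (Set.Ioi x) := by
  have hl := linePotential_of_isKESolution hq hu t
  -- The perturbation is taken with coefficient 1 instead of T, since T may vanish and would then
  -- say nothing about |u|² − q₀².
  have h1 : RightPotential q₀ (fun y => gaugeField q₀ T α u y t)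
      (kePert q₀ 1 fun y => gaugeField q₀ T α u y t) (bdry q₀ θp) :=
    rightPotential_kePert hq (norm_bdry hq _) hl.right.contDiff
      (((hu.right_integrable t).mono_set Set.Ioi_subset_Ici_self).norm.congr
        (Eventually.of_forall fun y => by
          simp only [norm_mul, norm_sub_gauge, Complex.norm_real]
          rw [Real.norm_of_nonneg (by positivity)]))
      ((hu.right_limit t).comp (tendsto_id.prodMk tendsto_const_nhds))
  refine (h1.momd.integrableOn' x).neg.congr (Eventually.of_forall fun y => ?_)
  simp only [Pi.neg_apply, kePert, norm_gaugeField]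
  ring

lemma tailD_kePert (x t : ℝ) :
    tailD (kePert q₀ T fun y => gaugeField q₀ T α u y t) x = -omegaPlus q₀ T u x t := by
  rw [tailD, omegaPlus, ← integral_const_mul, ← integral_neg]
  refine integral_congr_ae (Eventually.of_forall fun y => ?_)
  simp only [kePert, norm_gaugeField]
  ring

lemma exists_norming (hq : 0 < q₀) (hu : IsKESolution q₀ T α θp θm u)
    (hdata : IsReflectionlessData q₀ T α (bdry q₀ θp) (bdry q₀ θm)
      (fun x => gaugeField q₀ T α u x 0) β ct) (j : Fin N) :
    ∃ m : ℝ, 0 < m ∧ ct j = -(m * (bdry q₀ θp / eigen q₀ (β j))) :=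
  (hdata.pureSoliton (linePotential_of_isKESolution hq hu 0)).exists_norming j

/-- The phase q₊/ζ_j of c̃_j cancels the factor ζ_j/q₊ of the matrix, and 2iΘ is real at conjugate
eigenvalues, so positive weights m_j e^{Δ_j} remain. -/
lemma det_matB (hq : 0 < q₀) {m : Fin N → ℝ}
    (hct : ∀ j, ct j = -(m j * (bdry q₀ θp / eigen q₀ (β j)))) (x t : ℝ) :
    (1 + matB q₀ T α θp β ct x t).det =
      (1 + cauchyMat q₀ β fun j => m j * Real.exp (Delta q₀ T α (β j) x t)).det := by
  have hp : bdry q₀ θp ≠ 0 := eigen_ne_zero hq θp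
  rw [matB_eq, cauchyMat]
  congr 3
  ext j k
  have h0 := eigen_ne_zero hq (β j)
  rw [fcoef_sq, Theta_conj_eigen hq, hct]
  congr 1
  push_cast
  field_simp

lemma det_matB' (hq : 0 < q₀) {m : Fin N → ℝ}
    (hct : ∀ j, ct j = -(m j * (bdry q₀ θp / eigen q₀ (β j)))) (x t : ℝ) :
    (1 + matB' q₀ T α θp β ct x t).det = (1 + Matrix.of fun j k =>
      -Complex.I * (m j * Real.exp (Delta q₀ T α (β j) x t) : ℝ) *
        (conj (eigen q₀ (β j)) / eigen q₀ (β j)) / (conj (eigen q₀ (β j)) - eigen q₀ (β k))).det := by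
  have hp : bdry q₀ θp ≠ 0 := eigen_ne_zero hq θp
  rw [matB'_eq]
  congr 3
  ext j k
  have h0 := eigen_ne_zero hq (β j)
  rw [fcoef_sq, Theta_conj_eigen hq, hct]
  congr 1
  push_cast
  field_simp

/-- The fixed-time formula is applied to the profile at time t. The evolved norming constants give
the weights m_j e^{Δ_j(0,t)}, and the factor e^{−2q₀ sin β_j x} completes them to m_j e^{Δ_j(x,t)};
the phase is e^{2i tailD} with tailD = −ω₊. -/
lemma soliton_solution (hq : 0 < q₀) (hu : IsKESolution q₀ T α θp θm u)
    (hdata : IsReflectionlessData q₀ T α (bdry q₀ θp) (bdry q₀ θm)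
      (fun x => gaugeField q₀ T α u x 0) β ct) (x t : ℝ) :
    (1 + matB q₀ T α θp β ct x t).det ≠ 0 ∧
      u x t = Complex.exp (Complex.I *
          ((Upsilon q₀ T α x t - 2 * omegaPlus q₀ T u x t : ℝ) : ℂ)) *
        (bdry q₀ θp * ((1 + matB' q₀ T α θp β ct x t).det /
          (1 + matB q₀ T α θp β ct x t).det)) := by
  choose m hm hct using exists_norming hq hu hdata
  obtain ⟨qx, qxx, qt, hf⟩ := exists_keFlow hq hu
  have hs := hf.pureSoliton (hdata.pureSoliton (hf.line 0)) t
  rw [det_matB hq hct, det_matB' hq hct]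
  refine ⟨det_one_add_cauchyMat_ne_zero hq hs.mem fun j => mul_pos (hm j) (Real.exp_pos _), ?_⟩
  have key := hs.potential_eq_det (m := fun j => m j * Real.exp (Delta q₀ T α (β j) 0 t))
    (fun j => mul_pos (hm j) (Real.exp_pos _)) (fun j => ?_) x
    (w := fun j => m j * Real.exp (Delta q₀ T α (β j) x t)) fun j => ?_
  · rw [tailD_kePert] at key
    rw [← gaugeField_mul_exp q₀ T α u x t, key, mul_right_comm, ← Complex.exp_add]
    congr 2
    push_cast
    ring
  · have h1 := Theta_conj_eigen hq T α (β j) 0 t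
    rw [Theta_eq, Complex.ofReal_zero, mul_zero, zero_add] at h1
    rw [hct, Complex.ofReal_mul, Complex.ofReal_exp, ← h1]
    ring_nf
  · rw [mul_assoc, ← Real.exp_add]
    congr 2
    rw [Delta, Delta]
    ring

end Solution

/-! ### One soliton -/

lemma tanh_half (s : ℝ) : Real.tanh (s / 2) = (Real.exp s - 1) / (Real.exp s + 1) := by
  have h1 : Real.exp s = Real.exp (s / 2) * Real.exp (s / 2) := by rw [← Real.exp_add, add_halves]
  have h2 := Real.exp_pos (s / 2)
  rw [Real.tanh_eq, h1, Real.exp_neg]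
  field_simp

lemma tendsto_tanh_atTop : Tendsto Real.tanh atTop (𝓝 1) := by
  have h1 : ∀ s, Real.tanh s = (1 - Real.exp (-(2 * s))) / (1 + Real.exp (-(2 * s))) := fun s => by
    have h2 := Real.exp_pos (2 * s)
    rw [show s = 2 * s / 2 by ring, tanh_half, Real.exp_neg, mul_div_cancel₀ _ two_ne_zero]
    field_simp
  have h2 : Tendsto (fun s : ℝ => Real.exp (-(2 * s))) atTop (𝓝 0) :=
    Real.tendsto_exp_neg_atTop_nhds_zero.comp (tendsto_id.const_mul_atTop two_pos)
  have h3 := (tendsto_const_nhds (x := (1 : ℝ)).sub h2).div (tendsto_const_nhds (x := (1 : ℝ)).add h2)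
    (by norm_num)
  rw [add_zero, sub_zero, div_one] at h3
  exact h3.congr fun s => (h1 s).symm

lemma hasDerivAt_tanh (s : ℝ) : HasDerivAt Real.tanh ((1 / Real.cosh s) ^ 2) s := by
  have h1 := (Real.hasDerivAt_sinh s).div (Real.hasDerivAt_cosh s) (Real.cosh_pos s).ne'
  refine (h1.congr_deriv ?_).congr_of_eventuallyEq
    (Eventually.of_forall fun y => Real.tanh_eq_sinh_div_cosh y)
  rw [div_pow, one_pow]
  congr 1
  linarith [Real.cosh_sq s]

lemma one_sub_tanh_sq (s : ℝ) : 1 - Real.tanh s ^ 2 = (1 / Real.cosh s) ^ 2 := by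
  have h := (Real.cosh_pos s).ne'
  rw [Real.tanh_eq_sinh_div_cosh]
  field_simp
  linarith [Real.cosh_sq s]

lemma kappa_eigen {q₀ : ℝ} (hq : 0 < q₀) (b : ℝ) : kappa q₀ (eigen q₀ b) = (q₀ * Real.cos b : ℝ) := by
  rw [kappa, ← eigen_mul_conj hq b, mul_div_cancel_left₀ _ (eigen_ne_zero hq b), Complex.add_conj, eigen_re]
  push_cast; ring

lemma lam_eigen {q₀ : ℝ} (hq : 0 < q₀) (b : ℝ) :
    lam q₀ (eigen q₀ b) = Complex.I * (q₀ * Real.sin b : ℝ) := by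
  rw [lam, ← eigen_mul_conj hq b, mul_div_cancel_left₀ _ (eigen_ne_zero hq b), Complex.sub_conj, eigen_im]
  push_cast; ring

lemma conj_eigen (q₀ b : ℝ) : conj (eigen q₀ b) = q₀ * Complex.exp (Complex.I * (-b : ℝ)) := by
  rw [eigen, map_mul, Complex.conj_ofReal, ← Complex.exp_conj, map_mul, Complex.conj_I, Complex.conj_ofReal]
  push_cast
  ring_nf

section OneSoliton

variable {q₀ T α θp : ℝ} {u : ℝ → ℝ → ℂ} {β : Fin 1 → ℝ} {ct : Fin 1 → ℂ}

/-- The determinant is 1 plus its only entry. The factor on the right clears the denominators and is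
the same for B', so it drops out of the quotient. -/
lemma det_matB_one (hq : 0 < q₀) (hβ : β 0 ∈ Set.Ioo 0 Real.pi) (x t : ℝ) :
    ct 0 * Complex.exp (Complex.I * (2 * β 0)) -
        2 * q₀ * Real.sin (β 0) * Real.exp (-Delta q₀ T α (β 0) x t) * Complex.exp (Complex.I * (β 0 + θp)) =
      (1 + matB q₀ T α θp β ct x t).det *
        -(2 * q₀ * Real.sin (β 0) * Real.exp (-Delta q₀ T α (β 0) x t) *
          Complex.exp (Complex.I * (β 0 + θp))) := by
  have hs : (Real.sin (β 0) : ℂ) ≠ 0 := by exact_mod_cast (Real.sin_pos_of_mem_Ioo hβ).ne'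
  have hq' : (q₀ : ℂ) ≠ 0 := by exact_mod_cast hq.ne'
  have h1 := minor_factor (T := T) (α := α) (θp := θp) (β := β) (ct := ct) hq x t 0
    (s := eigen q₀ (β 0)) (b := β 0) rfl
  have h2 : (1 + matB q₀ T α θp β ct x t).det = 1 + Complex.I * (fcoef q₀ T α β ct x t 0 ^ 2 *
      eigen q₀ (β 0) * (bdry q₀ θp)⁻¹ * (conj (eigen q₀ (β 0)) - eigen q₀ (β 0))⁻¹) := by
    rw [Matrix.det_fin_one]
    simp only [Matrix.add_apply, Matrix.one_apply_eq, matB]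
    ring
  rw [h2, h1, Theta_conj_eigen hq]
  have e1 : Complex.exp (-Complex.I * θp) * Complex.exp (Complex.I * β 0) *
      Complex.exp (Complex.I * (β 0 + θp)) = Complex.exp (Complex.I * (2 * β 0)) := by
    rw [← Complex.exp_add, ← Complex.exp_add]; ring_nf
  have e2 : Complex.exp (Delta q₀ T α (β 0) x t) * (Real.exp (-Delta q₀ T α (β 0) x t) : ℂ) = 1 := by
    rw [Complex.ofReal_exp, ← Complex.exp_add]; simp
  rw [← e1]
  generalize Complex.exp (-Complex.I * θp) = A
  generalize Complex.exp (Complex.I * β 0) = B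
  generalize Complex.exp (Complex.I * (β 0 + θp)) = C
  field_simp
  linear_combination (-(ct 0 * A * B * C)) * e2

lemma det_matB'_one (hq : 0 < q₀) (hβ : β 0 ∈ Set.Ioo 0 Real.pi) (x t : ℝ) :
    ct 0 - 2 * q₀ * Real.sin (β 0) * Real.exp (-Delta q₀ T α (β 0) x t) * Complex.exp (Complex.I * (β 0 + θp)) =
      (1 + matB' q₀ T α θp β ct x t).det *
        -(2 * q₀ * Real.sin (β 0) * Real.exp (-Delta q₀ T α (β 0) x t) *
          Complex.exp (Complex.I * (β 0 + θp))) := by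
  have hs : (Real.sin (β 0) : ℂ) ≠ 0 := by exact_mod_cast (Real.sin_pos_of_mem_Ioo hβ).ne'
  have hq' : (q₀ : ℂ) ≠ 0 := by exact_mod_cast hq.ne'
  have h1 := minor_factor (T := T) (α := α) (θp := θp) (β := β) (ct := ct) hq x t 0
    (s := conj (eigen q₀ (β 0))) (b := -β 0) (conj_eigen q₀ (β 0))
  have h2 : (1 + matB' q₀ T α θp β ct x t).det = 1 + Complex.I * (fcoef q₀ T α β ct x t 0 ^ 2 *
      conj (eigen q₀ (β 0)) * (bdry q₀ θp)⁻¹ * (conj (eigen q₀ (β 0)) - eigen q₀ (β 0))⁻¹) := by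
    rw [Matrix.det_fin_one]
    simp only [Matrix.add_apply, Matrix.one_apply_eq, matB']
    ring
  rw [h2, h1, Theta_conj_eigen hq]
  have e1 : Complex.exp (-Complex.I * θp) * Complex.exp (Complex.I * (-β 0 : ℝ)) *
      Complex.exp (Complex.I * (β 0 + θp)) = 1 := by
    rw [← Complex.exp_add, ← Complex.exp_add]; push_cast; ring_nf; simp
  have e2 : Complex.exp (Delta q₀ T α (β 0) x t) * (Real.exp (-Delta q₀ T α (β 0) x t) : ℂ) = 1 := by
    rw [Complex.ofReal_exp, ← Complex.exp_add]; simp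
  generalize Complex.exp (-Complex.I * θp) = A at *
  generalize Complex.exp (Complex.I * (-β 0 : ℝ)) = B at *
  generalize Complex.exp (Complex.I * (β 0 + θp)) = C at *
  field_simp
  linear_combination (-ct 0) * e1 - (ct 0 * A * B * C) * e2

end OneSoliton

/-! ### Closed forms of the principal minors -/

section Minors

variable {q₀ T α θp : ℝ} {N : ℕ} {β : Fin N → ℝ} {ct : Fin N → ℂ}

lemma principalMinor_eq_prod (hq : 0 < q₀) (hβ : ∀ j, β j ∈ Set.Ioo 0 Real.pi) (f s : Fin N → ℂ) (c : ℂ)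
    (S : Finset (Fin N)) :
    principalMinor (Matrix.of fun j k => f j * (Complex.I * s j * c) * f k /
      (conj (eigen q₀ (β j)) - eigen q₀ (β k))) S =
      Complex.I ^ S.card * (∏ j ∈ S, f j ^ 2 * s j * c * (conj (eigen q₀ (β j)) - eigen q₀ (β j))⁻¹) *
        ∏ j ∈ S, ∏ k ∈ S with j < k, (‖(-eigen q₀ (β j) + eigen q₀ (β k)) /
          (-conj (eigen q₀ (β j)) + eigen q₀ (β k))‖ : ℂ) ^ 2 := by
  rw [principalMinor_cauchy f (fun j => Complex.I * s j * c) (fun j => conj (eigen q₀ (β j)))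
    (fun j => eigen q₀ (β j)) (conj_eigen_ne_eigen hq hβ)]
  congr 1
  · rw [← Finset.prod_const, ← Finset.prod_mul_distrib]
    exact Finset.prod_congr rfl fun j _ => by ring
  · exact Finset.prod_congr rfl fun j _ => Finset.prod_congr rfl fun k _ => cauchy_factor_conj _ _

lemma prod_minor_factor (hq : 0 < q₀) (x t : ℝ) {s : Fin N → ℂ} {b : Fin N → ℝ}
    (hs : ∀ j, s j = q₀ * Complex.exp (Complex.I * b j)) (S : Finset (Fin N)) :
    Complex.I ^ S.card * (∏ j ∈ S, fcoef q₀ T α β ct x t j ^ 2 * s j * (bdry q₀ θp)⁻¹ *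
        (conj (eigen q₀ (β j)) - eigen q₀ (β j))⁻¹) *
      ∏ j ∈ S, ∏ k ∈ S with j < k, (‖(-eigen q₀ (β j) + eigen q₀ (β k)) /
          (-conj (eigen q₀ (β j)) + eigen q₀ (β k))‖ : ℂ) ^ 2 =
    (-1) ^ S.card * ((q₀ : ℂ)⁻¹) ^ S.card *
      Complex.exp (-Complex.I * ∑ _j ∈ S, (θp : ℂ)) *
      Complex.exp (Complex.I * ∑ j ∈ S, (b j : ℂ)) *
      Complex.exp (-2 * Complex.I * ∑ j ∈ S, Theta q₀ T α x t (conj (eigen q₀ (β j)))) *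
      (∏ j ∈ S, ct j / (2 * (Real.sin (β j) : ℂ))) *
      ∏ j ∈ S, ∏ k ∈ S with j < k,
        ((Real.sin ((β j - β k) / 2) ^ 2 / Real.sin ((β j + β k) / 2) ^ 2 : ℝ) : ℂ) := by
  simp only [norm_eigen_factor hq]
  congr 1
  rw [← Finset.prod_const, ← Finset.prod_mul_distrib,
    Finset.prod_congr rfl fun j _ => minor_factor hq x t j (hs j)]
  simp only [Finset.prod_mul_distrib, Finset.prod_const, Finset.mul_sum, Complex.exp_sum]

lemma principalMinor_matB (hq : 0 < q₀) (hβ : ∀ j, β j ∈ Set.Ioo 0 Real.pi) (x t : ℝ)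
    (S : Finset (Fin N)) :
    principalMinor (matB q₀ T α θp β ct x t) S =
      Complex.I ^ S.card *
        (∏ j ∈ S, fcoef q₀ T α β ct x t j ^ 2 * eigen q₀ (β j) * (bdry q₀ θp)⁻¹ *
          (conj (eigen q₀ (β j)) - eigen q₀ (β j))⁻¹) *
        ∏ j ∈ S, ∏ k ∈ S with j < k, (‖(-eigen q₀ (β j) + eigen q₀ (β k)) /
          (-conj (eigen q₀ (β j)) + eigen q₀ (β k))‖ : ℂ) ^ 2 :=
  principalMinor_eq_prod hq hβ _ _ _ S

lemma principalMinor_matB' (hq : 0 < q₀) (hβ : ∀ j, β j ∈ Set.Ioo 0 Real.pi) (x t : ℝ)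
    (S : Finset (Fin N)) :
    principalMinor (matB' q₀ T α θp β ct x t) S =
      Complex.I ^ S.card *
        (∏ j ∈ S, fcoef q₀ T α β ct x t j ^ 2 * conj (eigen q₀ (β j)) * (bdry q₀ θp)⁻¹ *
          (conj (eigen q₀ (β j)) - eigen q₀ (β j))⁻¹) *
        ∏ j ∈ S, ∏ k ∈ S with j < k, (‖(-eigen q₀ (β j) + eigen q₀ (β k)) /
          (-conj (eigen q₀ (β j)) + eigen q₀ (β k))‖ : ℂ) ^ 2 :=
  principalMinor_eq_prod hq hβ _ _ _ S

end Minors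

/-! ### The dark one-soliton -/

section OneSoliton

variable {q₀ T α θp θm : ℝ} {u : ℝ → ℝ → ℂ} {β : Fin 1 → ℝ} {ct : Fin 1 → ℂ}

lemma one_soliton (hq : 0 < q₀) (hu : IsKESolution q₀ T α θp θm u)
    (hdata : IsReflectionlessData q₀ T α (bdry q₀ θp) (bdry q₀ θm)
      (fun x => gaugeField q₀ T α u x 0) β ct) (x t : ℝ) :
    ct 0 * Complex.exp (Complex.I * (2 * β 0)) -
        2 * q₀ * Real.sin (β 0) * Real.exp (-Delta q₀ T α (β 0) x t) *
          Complex.exp (Complex.I * (β 0 + θp)) ≠ 0 ∧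
    u x t = Complex.exp (Complex.I * ((Upsilon q₀ T α x t - 2 * omegaPlus q₀ T u x t : ℝ) : ℂ)) *
      (q₀ * Complex.exp (Complex.I * θp) *
        ((ct 0 - 2 * q₀ * Real.sin (β 0) * Real.exp (-Delta q₀ T α (β 0) x t) *
            Complex.exp (Complex.I * (β 0 + θp))) /
          (ct 0 * Complex.exp (Complex.I * (2 * β 0)) -
            2 * q₀ * Real.sin (β 0) * Real.exp (-Delta q₀ T α (β 0) x t) *
              Complex.exp (Complex.I * (β 0 + θp))))) := by
  obtain ⟨h1, h2⟩ := soliton_solution hq hu hdata x t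
  have hβ := hdata.angle_mem 0
  have h3 : -(2 * q₀ * Real.sin (β 0) * Real.exp (-Delta q₀ T α (β 0) x t) *
      Complex.exp (Complex.I * (β 0 + θp)) : ℂ) ≠ 0 := by
    have hr : (2 * q₀ * Real.sin (β 0) * Real.exp (-Delta q₀ T α (β 0) x t) : ℝ) ≠ 0 := by
      have := Real.sin_pos_of_mem_Ioo hβ
      positivity
    exact neg_ne_zero.mpr (mul_ne_zero (by exact_mod_cast hr) (Complex.exp_ne_zero _))
  rw [det_matB_one hq hβ, det_matB'_one hq hβ, mul_div_mul_right _ _ h3]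
  exact ⟨mul_ne_zero h1 h3, h2⟩

/-- The one-soliton as a dark soliton profile. -/
lemma one_soliton_tanh (hq : 0 < q₀) (hu : IsKESolution q₀ T α θp θm u)
    (hdata : IsReflectionlessData q₀ T α (bdry q₀ θp) (bdry q₀ θm)
      (fun x => gaugeField q₀ T α u x 0) β ct)
    (hct : ct 0 = -((eigen q₀ (β 0) - conj (eigen q₀ (β 0))) /
      (Complex.I * eigen q₀ (β 0) * (bdry q₀ θp)⁻¹))) (x t : ℝ) :
    u x t = Complex.exp (Complex.I * ((Upsilon q₀ T α x t - 2 * omegaPlus q₀ T u x t : ℝ) : ℂ)) *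
      (Complex.exp (Complex.I * (θp - β 0)) *
        (kappa q₀ (eigen q₀ (β 0)) + lam q₀ (eigen q₀ (β 0)) *
          (Real.tanh (-Delta q₀ T α (β 0) x t / 2) : ℂ))) := by
  have hs := Real.sin_pos_of_mem_Ioo (hdata.angle_mem 0)
  have hq' : (q₀ : ℂ) ≠ 0 := by exact_mod_cast hq.ne'
  rw [(one_soliton hq hu hdata x t).2]
  congr 1
  -- The special norming constant is −2q₀ sin β e^{i(θ₊−β)}. With it the denominator becomes a
  -- monomial times e^{−Δ} + 1, which `tanh_half` recognizes.
  have hc : ct 0 = -(2 * q₀ * Real.sin (β 0) * Complex.exp (Complex.I * (θp - β 0))) := by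
    have h1 : Complex.exp (Complex.I * (θp - β 0)) * eigen q₀ (β 0) = bdry q₀ θp := by
      rw [eigen, bdry, mul_left_comm, ← Complex.exp_add]; ring_nf
    have h2 := eigen_ne_zero hq (β 0)
    have h3 : bdry q₀ θp ≠ 0 := eigen_ne_zero hq θp
    rw [hct, ← neg_sub, conj_eigen_sub_eigen, ← h1]
    have h4 := Complex.exp_ne_zero (Complex.I * (θp - β 0))
    push_cast
    field_simp
  set E := Real.exp (-Delta q₀ T α (β 0) x t) with hE
  have hEpos : 0 < E := Real.exp_pos _
  have hE1 : (E : ℂ) + 1 ≠ 0 := by exact_mod_cast (by positivity : E + 1 ≠ 0)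
  set b : ℂ := Complex.exp (Complex.I * β 0) with hb
  have hb0 : b ≠ 0 := Complex.exp_ne_zero _
  set a : ℂ := Complex.exp (Complex.I * θp) with ha
  have ha0 : a ≠ 0 := Complex.exp_ne_zero _
  have e1 : Complex.exp (Complex.I * (θp - β 0)) = a * b⁻¹ := by
    rw [ha, hb, ← Complex.exp_neg, ← Complex.exp_add]; ring_nf
  have e2 : Complex.exp (Complex.I * (β 0 + θp)) = a * b := by
    rw [ha, hb, ← Complex.exp_add]; ring_nf
  have e3 : Complex.exp (Complex.I * (2 * β 0)) = b * b := by
    rw [hb, ← Complex.exp_add]; ring_nf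
  have e4 : (q₀ * Real.cos (β 0) : ℝ) = q₀ * ((b + b⁻¹) / 2) := by
    rw [hb, ← Complex.exp_neg]
    push_cast
    rw [Complex.cos]; ring_nf
  have e5 : Complex.I * (q₀ * Real.sin (β 0) : ℝ) = q₀ * ((b - b⁻¹) / 2) := by
    rw [hb, ← Complex.exp_neg]
    push_cast
    rw [Complex.sin]
    ring_nf
    rw [Complex.I_sq]
    ring
  have hsc : (Real.sin (β 0) : ℂ) ≠ 0 := by exact_mod_cast hs.ne'
  rw [hc, kappa_eigen hq, lam_eigen hq, tanh_half, ← hE, e1, e2, e3, e4, e5]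
  push_cast
  have hden : -(2 * q₀ * Complex.sin (β 0) * (a * b⁻¹)) * (b * b) -
      2 * q₀ * Complex.sin (β 0) * E * (a * b) = -(2 * q₀ * Complex.sin (β 0) * a * b * (E + 1)) := by
    field_simp
    ring
  rw [hden]
  rw [Complex.ofReal_sin] at hsc
  field_simp
  ring

/-- At an eigenvalue κ = q₀ cos β is real and λ = iq₀ sin β imaginary, so the squared modulus is
q₀²cos²β + q₀²sin²β tanh². -/
lemma norm_sq_one_soliton (hq : 0 < q₀) (hu : IsKESolution q₀ T α θp θm u)
    (hdata : IsReflectionlessData q₀ T α (bdry q₀ θp) (bdry q₀ θm)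
      (fun x => gaugeField q₀ T α u x 0) β ct)
    (hct : ct 0 = -((eigen q₀ (β 0) - conj (eigen q₀ (β 0))) /
      (Complex.I * eigen q₀ (β 0) * (bdry q₀ θp)⁻¹))) (x t : ℝ) :
    ‖u x t‖ ^ 2 = q₀ ^ 2 - (q₀ * Real.sin (β 0)) ^ 2 *
      (1 / Real.cosh (-Delta q₀ T α (β 0) x t / 2)) ^ 2 := by
  rw [one_soliton_tanh hq hu hdata hct x t, norm_mul, norm_mul, ← Complex.ofReal_sub, mul_comm Complex.I,
    mul_comm Complex.I, Complex.norm_exp_ofReal_mul_I, Complex.norm_exp_ofReal_mul_I, one_mul, one_mul,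
    kappa_eigen hq, lam_eigen hq, mul_comm Complex.I, mul_right_comm, ← Complex.ofReal_mul,
    ← Complex.normSq_eq_norm_sq, Complex.normSq_add_mul_I, ← one_sub_tanh_sq]
  linear_combination q₀ ^ 2 * Real.sin_sq_add_cos_sq (β 0)

/-- With ν = q₀ sin β the integrand ν² sech²(ν(y + c)) is the derivative of ν tanh(ν(y + c)), which
tends to ν at infinity. -/
lemma omegaPlus_one_soliton (hq : 0 < q₀) (hu : IsKESolution q₀ T α θp θm u)
    (hdata : IsReflectionlessData q₀ T α (bdry q₀ θp) (bdry q₀ θm)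
      (fun x => gaugeField q₀ T α u x 0) β ct)
    (hct : ct 0 = -((eigen q₀ (β 0) - conj (eigen q₀ (β 0))) /
      (Complex.I * eigen q₀ (β 0) * (bdry q₀ θp)⁻¹))) (x t : ℝ) :
    omegaPlus q₀ T u x t =
      -T * q₀ * Real.sin (β 0) * (-1 + Real.tanh (-Delta q₀ T α (β 0) x t / 2)) := by
  have hs := Real.sin_pos_of_mem_Ioo (hdata.angle_mem 0)
  set ν := q₀ * Real.sin (β 0) with hν
  have hνpos : 0 < ν := mul_pos hq hs
  have hi := integrableOn_sub_norm_sq hq hu x t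
  set c := (2 * q₀ * Real.cos (β 0) - 4 * T * q₀ ^ 2 - 2 * α) * t with hc
  have hΔ : ∀ y, -Delta q₀ T α (β 0) y t / 2 = ν * (y + c) := fun y => by rw [Delta, hν, hc]; ring
  have hu' : ∀ y, q₀ ^ 2 - ‖u y t‖ ^ 2 = ν * ((1 / Real.cosh (ν * (y + c))) ^ 2 * ν) := fun y => by
    rw [norm_sq_one_soliton hq hu hdata hct, hΔ]; ring
  have hd : ∀ y, HasDerivAt (fun y => ν * Real.tanh (ν * (y + c))) (q₀ ^ 2 - ‖u y t‖ ^ 2) y := fun y => by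
    rw [hu']
    have h1 : HasDerivAt (fun y => ν * (y + c)) ν y := by
      simpa using ((hasDerivAt_id y).add_const c).const_mul ν
    exact ((hasDerivAt_tanh _).comp y h1).const_mul ν
  have hl : Tendsto (fun y => ν * Real.tanh (ν * (y + c))) atTop (𝓝 (ν * 1)) :=
    (tendsto_tanh_atTop.comp ((tendsto_atTop_add_const_right _ c tendsto_id).const_mul_atTop
      hνpos)).const_mul ν
  rw [omegaPlus, integral_Ioi_of_hasDerivAt_of_tendsto' (fun y _ => hd y) hi hl, hΔ]
  ring

end OneSoliton

end KunduEckhaus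

theorem mainTheorem6 (q₀ T α θp θm : ℝ) (hq₀ : 0 < q₀) (u : ℝ → ℝ → ℂ)
    (hu : IsKESolution q₀ T α θp θm u) (N : ℕ) (β : Fin N → ℝ) (ct : Fin N → ℂ)
    (hdata : IsReflectionlessData q₀ T α (bdry q₀ θp) (bdry q₀ θm)
      (fun x => gaugeField q₀ T α u x 0) β ct) :
    -- the phase integral converges, and the N-soliton formula holds
    (∀ x t : ℝ, IntegrableOn (fun y => q₀ ^ 2 - ‖u y t‖ ^ 2) (Set.Ioi x)) ∧
    (∀ x t : ℝ, (1 + matB q₀ T α θp β ct x t).det ≠ 0 ∧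
      u x t = Complex.exp (Complex.I *
          ((Upsilon q₀ T α x t - 2 * omegaPlus q₀ T u x t : ℝ) : ℂ)) *
        (bdry q₀ θp * ((1 + matB' q₀ T α θp β ct x t).det /
          (1 + matB q₀ T α θp β ct x t).det))) ∧
    -- expansion of the determinants in principal minors
    (∀ x t : ℝ,
      (1 + matB' q₀ T α θp β ct x t).det =
        1 + ∑ r ∈ Finset.Icc 1 N, ∑ S ∈ Finset.powersetCard r Finset.univ,
          principalMinor (matB' q₀ T α θp β ct x t) S ∧
      (1 + matB q₀ T α θp β ct x t).det =
        1 + ∑ r ∈ Finset.Icc 1 N, ∑ S ∈ Finset.powersetCard r Finset.univ,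
          principalMinor (matB q₀ T α θp β ct x t) S) ∧
    -- the principal minors of B'
    (∀ (x t : ℝ) (S : Finset (Fin N)),
      principalMinor (matB' q₀ T α θp β ct x t) S =
        Complex.I ^ S.card *
          (∏ j ∈ S, fcoef q₀ T α β ct x t j ^ 2 * conj (eigen q₀ (β j)) * (bdry q₀ θp)⁻¹ *
            (conj (eigen q₀ (β j)) - eigen q₀ (β j))⁻¹) *
          ∏ j ∈ S, ∏ k ∈ S with j < k,
            (‖(-eigen q₀ (β j) + eigen q₀ (β k)) /
              (-conj (eigen q₀ (β j)) + eigen q₀ (β k))‖ : ℂ) ^ 2 ∧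
      principalMinor (matB' q₀ T α θp β ct x t) S =
        (-1) ^ S.card * ((q₀ : ℂ)⁻¹) ^ S.card *
          Complex.exp (-Complex.I * ∑ _j ∈ S, (θp : ℂ)) *
          Complex.exp (-Complex.I * ∑ j ∈ S, (β j : ℂ)) *
          Complex.exp (-2 * Complex.I *
            ∑ j ∈ S, Theta q₀ T α x t (conj (eigen q₀ (β j)))) *
          (∏ j ∈ S, ct j / (2 * (Real.sin (β j) : ℂ))) *
          ∏ j ∈ S, ∏ k ∈ S with j < k,
            ((Real.sin ((β j - β k) / 2) ^ 2 / Real.sin ((β j + β k) / 2) ^ 2 : ℝ) : ℂ)) ∧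
    -- the principal minors of B
    (∀ (x t : ℝ) (S : Finset (Fin N)),
      principalMinor (matB q₀ T α θp β ct x t) S =
        Complex.I ^ S.card *
          (∏ j ∈ S, fcoef q₀ T α β ct x t j ^ 2 * eigen q₀ (β j) * (bdry q₀ θp)⁻¹ *
            (conj (eigen q₀ (β j)) - eigen q₀ (β j))⁻¹) *
          ∏ j ∈ S, ∏ k ∈ S with j < k,
            (‖(-eigen q₀ (β j) + eigen q₀ (β k)) /
              (-conj (eigen q₀ (β j)) + eigen q₀ (β k))‖ : ℂ) ^ 2 ∧
      principalMinor (matB q₀ T α θp β ct x t) S =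
        (-1) ^ S.card * ((q₀ : ℂ)⁻¹) ^ S.card *
          Complex.exp (-Complex.I * ∑ _j ∈ S, (θp : ℂ)) *
          Complex.exp (Complex.I * ∑ j ∈ S, (β j : ℂ)) *
          Complex.exp (-2 * Complex.I *
            ∑ j ∈ S, Theta q₀ T α x t (conj (eigen q₀ (β j)))) *
          (∏ j ∈ S, ct j / (2 * (Real.sin (β j) : ℂ))) *
          ∏ j ∈ S, ∏ k ∈ S with j < k,
            ((Real.sin ((β j - β k) / 2) ^ 2 / Real.sin ((β j + β k) / 2) ^ 2 : ℝ) : ℂ)) ∧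
    -- the one-soliton, j being the only index
    (N = 1 → ∀ j : Fin N,
      (∀ x t : ℝ,
        ct j * Complex.exp (Complex.I * (2 * β j)) -
            2 * q₀ * Real.sin (β j) * Real.exp (-Delta q₀ T α (β j) x t) *
              Complex.exp (Complex.I * (β j + θp)) ≠ 0 ∧
        u x t = Complex.exp (Complex.I *
            ((Upsilon q₀ T α x t - 2 * omegaPlus q₀ T u x t : ℝ) : ℂ)) *
          (q₀ * Complex.exp (Complex.I * θp) *
            ((ct j - 2 * q₀ * Real.sin (β j) * Real.exp (-Delta q₀ T α (β j) x t) *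
                Complex.exp (Complex.I * (β j + θp))) /
              (ct j * Complex.exp (Complex.I * (2 * β j)) -
                2 * q₀ * Real.sin (β j) * Real.exp (-Delta q₀ T α (β j) x t) *
                  Complex.exp (Complex.I * (β j + θp)))))) ∧
      -- its tanh form
      (ct j = -((eigen q₀ (β j) - conj (eigen q₀ (β j))) /
          (Complex.I * eigen q₀ (β j) * (bdry q₀ θp)⁻¹)) →
        ∀ x t : ℝ,
          u x t = Complex.exp (Complex.I *
              ((Upsilon q₀ T α x t - 2 * omegaPlus q₀ T u x t : ℝ) : ℂ)) *
            (Complex.exp (Complex.I * (θp - β j)) *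
              (kappa q₀ (eigen q₀ (β j)) + lam q₀ (eigen q₀ (β j)) *
                (Real.tanh (-Delta q₀ T α (β j) x t / 2) : ℂ))) ∧
          omegaPlus q₀ T u x t =
            -T * q₀ * Real.sin (β j) * (-1 + Real.tanh (-Delta q₀ T α (β j) x t / 2)) ∧
          ‖u x t‖ ^ 2 = q₀ ^ 2 -
            ‖lam q₀ (eigen q₀ (β j))‖ ^ 2 *
              (1 / Real.cosh (Delta q₀ T α (β j) x t / 2)) ^ 2)) := by
  have hβ := hdata.angle_mem
  refine ⟨integrableOn_sub_norm_sq hq₀ hu, soliton_solution hq₀ hu hdata,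
    fun x t => ⟨det_one_add_eq_sum_minors _, det_one_add_eq_sum_minors _⟩,
    fun x t S => ⟨principalMinor_matB' hq₀ hβ x t S, ?_⟩,
    fun x t S => ⟨principalMinor_matB hq₀ hβ x t S, ?_⟩, ?_⟩
  -- The conjugate eigenvalue is q₀e^{−iβ_j}, so the minors of B' come from the same evaluation with
  -- the angles negated in the numerator only.
  · rw [principalMinor_matB' hq₀ hβ, prod_minor_factor hq₀ x t (b := fun j => -β j) fun j => conj_eigen _ _]
    simp only [Complex.ofReal_neg, Finset.sum_neg_distrib, mul_neg, neg_mul]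
  · rw [principalMinor_matB hq₀ hβ, prod_minor_factor hq₀ x t (s := fun j => eigen q₀ (β j)) (b := β) fun j => rfl]
  · rintro rfl j
    obtain rfl : j = 0 := Subsingleton.elim _ _
    refine ⟨one_soliton hq₀ hu hdata, fun hct x t => ⟨one_soliton_tanh hq₀ hu hdata hct x t,
      omegaPlus_one_soliton hq₀ hu hdata hct x t, ?_⟩⟩
    rw [norm_sq_one_soliton hq₀ hu hdata hct, lam_eigen hq₀, norm_mul, Complex.norm_I, one_mul,
      Complex.norm_real, Real.norm_eq_abs, sq_abs, neg_div, Real.cosh_neg]
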